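/- **Setting.** For $n\ge 1$ and $d\ge 0$ consider matrices $A_1,A_2,A_3,E\in\mathbb{Q}^{n\times d}$, $X_1,X_2,Y\in\mathbb{Q}^{d\times d}$ and $W_{-(n-1)},\dots,W_{n-1}\in\mathbb{Q}^{d\times d}$. For $\mathsf X\in\mathbb{R}^{d^2\times d^2}$, with rows and columns indexed by pairs in $[d]\times[d]$, and its vectorization $x\in\mathbb{R}^{d^4}$, let $$A(x)_{i,j}=\exp\Big(\frac1d\sum_{a,b,k,l\in[d]}(A_1)_{i,a}(A_2)_{j,b}\,(W_{i-j})_{k,l}\,\mathsf X_{(a,b),(k,l)}\Big)\quad(i,j\in[n]),\qquad D(x)=\mathrm{diag}(A(x)\mathbf 1_n),$$ (that is, $\mathrm{vec}(A(x))=\exp((\mathsf A\oslash\mathsf W)x/d)$ with $\mathsf A=A_1\otimes A_2$, with $\mathsf W$ the $n^2\times d^2$ matrix whose row $(i,j)$ is $\mathrm{vec}(W_{i-j})$, and with $\oslash$ the row-wise Kronecker product), and let the RoPE attention loss be $$L(x)=\tfrac12\,\|D(x)^{-1}A(x)A_3Y-E\|_F^2 .$$ For $B\in\mathbb{R}$ and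 $K,b\in\mathbb{N}$ call the data *admissible* for $(B,K,b)$ if there is $S\subseteq[d]\times[d]$ with $|S|\le Kd$ containing the supports of all $W_t$; all entries of $A_1X_1$, $A_2X_2$, $A_3Y$ are at most $B$ in absolute value; all entries of all $W_t$ are at most $1$ in absolute value; and every entry of $A_1,A_2,A_3,E,X_1,X_2,Y$ and the $W_t$ is a rational number whose numerator and denominator (in lowest terms) have at most $b$ binary digits. **Theorem.** Let $d,b:\mathbb{N}\to\mathbb{N}$ and $B:\mathbb{N}\to\mathbb{R}$ satisfy $d(n)=O(\log n)$, $b(n)=O(\log n)$ and $B(n)=o(\sqrt{\log n})$, and let $K,p\in\mathbb{N}$ be constants. Then there is an algorithm (a random access machine program with integer registers and memory cells, with time measured in the logarithmic cost model in which multiplication and division of integers of lengths $\ell,\ell'$ cost $\ell\ell'$) with running time $T(n)=O(n^{1+o(1)})$ such that for every $n\ge1$ and all data with $d=d(n)$ that are admissible for $(B(n),K,b(n))$, given as input together with $n$ and $d$, the loss $L$ is differentiable at $x=\mathrm{vec}(X_1\otimes X_2)$ and the algorithm halts within time $T(n)$ with output a rational vector $\widetilde g\in\mathbb{R}^{d^4}$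 such that $$\Big\|\widetilde g-\frac{\mathrm dL}{\mathrm dx}(x)\Big\|_\infty\le\frac1{n^{p}} .$$ -/

import Mathlib

open Filter Topology Asymptotics
open scoped Kronecker

namespace RAM

/-- The number of bits charged for handling the integer `z` (at least one). -/
def bits (z : ℤ) : ℕ := z.natAbs.size + 1

/-- Memory of a random access machine: integer registers `reg x`, and memory banks `mem a`
whose cells are addressed by integers and hold integers. A program names finitely many registers
and banks; the addresses inside a bank are computed. -/
structure State where
  reg : ℕ → ℤ
  mem : ℕ → ℤ → ℤ

/-- Expressions: constants, registers, indirect reads and integer arithmetic. -/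
inductive Expr where
  | const (z : ℤ)
  | reg (x : ℕ)
  | get (a : ℕ) (i : Expr)
  | add (e f : Expr)
  | sub (e f : Expr)
  | mul (e f : Expr)
  | div (e f : Expr)

/-- Value of an expression; `div` is integer division with remainder (and `z / 0 = 0`). -/
def Expr.eval (s : State) : Expr → ℤ
  | .const z => z
  | .reg x => s.reg x
  | .get a i => s.mem a (i.eval s)
  | .add e f => e.eval s + f.eval s
  | .sub e f => e.eval s - f.eval s
  | .mul e f => e.eval s * f.eval s
  | .div e f => e.eval s / f.eval s

/-- Logarithmic (bit) cost of evaluating an expression: an access costs the length of the address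
and of the datum, an addition or subtraction the sum of the lengths of the operands, and a
multiplication or division the product of these lengths. -/
def Expr.cost (s : State) : Expr → ℕ
  | .const z => bits z
  | .reg x => bits (s.reg x)
  | .get a i => i.cost s + bits (i.eval s) + bits (s.mem a (i.eval s))
  | .add e f => e.cost s + f.cost s + bits (e.eval s) + bits (f.eval s)
  | .sub e f => e.cost s + f.cost s + bits (e.eval s) + bits (f.eval s)
  | .mul e f => e.cost s + f.cost s + bits (e.eval s) * bits (f.eval s)
  | .div e f => e.cost s + f.cost s + bits (e.eval s) * bits (f.eval s)

/-- Programs. Branches and loops test whether an expression is positive. -/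
inductive Program where
  | skip
  | assign (x : ℕ) (e : Expr)
  | store (a : ℕ) (i e : Expr)
  | seq (P Q : Program)
  | ite (e : Expr) (P Q : Program)
  | loop (e : Expr) (P : Program)

def State.setReg (s : State) (x : ℕ) (v : ℤ) : State :=
  { s with reg := Function.update s.reg x v }

def State.setMem (s : State) (a : ℕ) (i v : ℤ) : State :=
  { s with mem := Function.update s.mem a (Function.update (s.mem a) i v) }

/-- `Runs P s c s'`: started in the state `s`, the (deterministic) program `P` halts in the state
`s'` after time exactly `c`, in the logarithmic cost measure. -/
inductive Runs : Program → State → ℕ → State → Prop where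
  | skip (s : State) : Runs .skip s 1 s
  | assign (s : State) (x : ℕ) (e : Expr) :
      Runs (.assign x e) s (e.cost s + bits (e.eval s)) (s.setReg x (e.eval s))
  | store (s : State) (a : ℕ) (i e : Expr) :
      Runs (.store a i e) s (i.cost s + e.cost s + bits (i.eval s) + bits (e.eval s))
        (s.setMem a (i.eval s) (e.eval s))
  | seq {P Q : Program} {s t u : State} {c c' : ℕ} :
      Runs P s c t → Runs Q t c' u → Runs (.seq P Q) s (c + c') u
  | ite_pos {e : Expr} {P Q : Program} {s t : State} {c : ℕ} :
      0 < e.eval s → Runs P s c t → Runs (.ite e P Q) s (e.cost s + bits (e.eval s) + c) t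
  | ite_neg {e : Expr} {P Q : Program} {s t : State} {c : ℕ} :
      e.eval s ≤ 0 → Runs Q s c t → Runs (.ite e P Q) s (e.cost s + bits (e.eval s) + c) t
  | loop_step {e : Expr} {P : Program} {s t u : State} {c c' : ℕ} :
      0 < e.eval s → Runs P s c t → Runs (.loop e P) t c' u →
        Runs (.loop e P) s (e.cost s + bits (e.eval s) + c + c') u
  | loop_exit {e : Expr} {P : Program} {s : State} :
      e.eval s ≤ 0 → Runs (.loop e P) s (e.cost s + bits (e.eval s)) s

/-- The bank contents that hold the datum `f i` at the address `addr i` (for injective `addr`), and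
`0` at all other addresses. -/
def layout {ι : Type*} [Fintype ι] (addr : ι → ℤ) (f : ι → ℤ) : ℤ → ℤ :=
  fun z => ∑ i, if addr i = z then f i else 0

/-- A running time that is `O(n ^ (1 + o(1)))`. -/
def AlmostLinear (T : ℕ → ℕ) : Prop :=
  ∃ e : ℕ → ℝ, Tendsto e atTop (𝓝 0) ∧
    (fun n => (T n : ℝ)) =O[atTop] fun n => (n : ℝ) ^ (1 + e n)

end RAM

noncomputable section

namespace RoPE

/-- Row and column indices of `𝖷 ∈ ℝ^{d² × d²}` are pairs, so the coordinates of its vectorization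
`x ∈ ℝ^{d⁴}` are pairs of pairs. -/
abbrev Idx (d : ℕ) : Type := (Fin d × Fin d) × (Fin d × Fin d)

/-- Row-wise Kronecker product `M ⊘ N`. -/
def rowKron {ι α β : Type*} (M : Matrix ι α ℝ) (N : Matrix ι β ℝ) : Matrix ι (α × β) ℝ :=
  Matrix.of fun i q => M i q.1 * N i q.2

/-- Vectorization of a `d² × d²` matrix. -/
def vect {d : ℕ} (X : Matrix (Fin d × Fin d) (Fin d × Fin d) ℝ) : EuclideanSpace ℝ (Idx d) :=
  WithLp.toLp 2 fun q => X q.1 q.2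

/-- Frobenius norm. -/
def frobenius {m k : ℕ} (M : Matrix (Fin m) (Fin k) ℝ) : ℝ :=
  √(∑ i, ∑ j, M i j ^ 2)

section Loss

variable {n d : ℕ}

/-- The `n² × d²` matrix `𝖶` whose row `(i, j)` is the vectorization of `W_{i-j}`. -/
def posMatrix (n : ℕ) (W : ℤ → Matrix (Fin d) (Fin d) ℝ) :
    Matrix (Fin n × Fin n) (Fin d × Fin d) ℝ :=
  Matrix.of fun p q => W ((p.1 : ℤ) - (p.2 : ℤ)) q.1 q.2

/-- The attention matrix `A(𝖷)`, the matrix form of `exp((𝖠 ⊘ 𝖶) x / d)` with `𝖠 = A₁ ⊗ A₂`. -/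
def attention (A₁ A₂ : Matrix (Fin n) (Fin d) ℝ) (W : ℤ → Matrix (Fin d) (Fin d) ℝ)
    (x : EuclideanSpace ℝ (Idx d)) : Matrix (Fin n) (Fin n) ℝ :=
  Matrix.of fun i j =>
    Real.exp ((rowKron (A₁ ⊗ₖ A₂) (posMatrix n W)).mulVec (fun q => x q / (d : ℝ)) (i, j))

/-- The diagonal matrix `D(𝖷)` of the row sums of `A(𝖷)`. -/
def normalizer (A₁ A₂ : Matrix (Fin n) (Fin d) ℝ) (W : ℤ → Matrix (Fin d) (Fin d) ℝ)
    (x : EuclideanSpace ℝ (Idx d)) : Matrix (Fin n) (Fin n) ℝ :=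
  Matrix.diagonal ((attention A₁ A₂ W x).mulVec 1)

/-- The loss `L(𝖷) = 0.5 ‖D(𝖷)⁻¹ A(𝖷) A₃ Y - E‖_F²` as a function of `x = vec(𝖷) ∈ ℝ^{d⁴}`. -/
def loss (A₁ A₂ A₃ E : Matrix (Fin n) (Fin d) ℝ) (Y : Matrix (Fin d) (Fin d) ℝ)
    (W : ℤ → Matrix (Fin d) (Fin d) ℝ) (x : EuclideanSpace ℝ (Idx d)) : ℝ :=
  1 / 2 * frobenius ((normalizer A₁ A₂ W x)⁻¹ * attention A₁ A₂ W x * A₃ * Y - E) ^ 2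

end Loss

/-- Entrywise inclusion of rational into real matrices. -/
def toReal {m k : ℕ} (M : Matrix (Fin m) (Fin k) ℚ) : Matrix (Fin m) (Fin k) ℝ :=
  M.map fun r => (r : ℝ)

/-- The maximum of `|M i j|` is at most `B`. -/
def MaxNormLE {m k : ℕ} (M : Matrix (Fin m) (Fin k) ℚ) (B : ℝ) : Prop :=
  ∀ i j, |toReal M i j| ≤ B

/-- Numerator and denominator of every entry have at most `b` binary digits. -/
def BitsLE {m k : ℕ} (M : Matrix (Fin m) (Fin k) ℚ) (b : ℕ) : Prop :=
  ∀ i j, (M i j).num.natAbs.size ≤ b ∧ (M i j).den.size ≤ b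

/-- The data of an instance; only the matrices `W t` with `-(n-1) ≤ t ≤ n-1` are ever used. -/
structure Instance (n d : ℕ) where
  A₁ : Matrix (Fin n) (Fin d) ℚ
  A₂ : Matrix (Fin n) (Fin d) ℚ
  A₃ : Matrix (Fin n) (Fin d) ℚ
  E : Matrix (Fin n) (Fin d) ℚ
  X₁ : Matrix (Fin d) (Fin d) ℚ
  X₂ : Matrix (Fin d) (Fin d) ℚ
  Y : Matrix (Fin d) (Fin d) ℚ
  W : ℤ → Matrix (Fin d) (Fin d) ℚ

namespace Instance

variable {n d : ℕ}

/-- The constraints on an instance: a common support `S` of the `W t` with `|S| ≤ K d`, the entry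
bound `B` on `A₁ X₁`, `A₂ X₂`, `A₃ Y`, the bound `1` on the `W t`, and `b`-bit entries. -/
structure Admissible (I : Instance n d) (B : ℝ) (K b : ℕ) : Prop where
  support : ∃ S : Finset (Fin d × Fin d), S.card ≤ K * d ∧
    ∀ t : ℤ, -(n : ℤ) < t → t < n → ∀ k l, I.W t k l ≠ 0 → (k, l) ∈ S
  query : MaxNormLE (I.A₁ * I.X₁) B
  key : MaxNormLE (I.A₂ * I.X₂) B
  value : MaxNormLE (I.A₃ * I.Y) B
  weight : ∀ t : ℤ, -(n : ℤ) < t → t < n → MaxNormLE (I.W t) 1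
  bits_A₁ : BitsLE I.A₁ b
  bits_A₂ : BitsLE I.A₂ b
  bits_A₃ : BitsLE I.A₃ b
  bits_E : BitsLE I.E b
  bits_X₁ : BitsLE I.X₁ b
  bits_X₂ : BitsLE I.X₂ b
  bits_Y : BitsLE I.Y b
  bits_W : ∀ t : ℤ, -(n : ℤ) < t → t < n → BitsLE (I.W t) b

/-- The loss of the instance, as a function on `ℝ^{d⁴}`. -/
def lossFn (I : Instance n d) : EuclideanSpace ℝ (Idx d) → ℝ :=
  loss (toReal I.A₁) (toReal I.A₂) (toReal I.A₃) (toReal I.E) (toReal I.Y)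
    (fun t => toReal (I.W t))

/-- The point `x = vec(X₁ ⊗ X₂)`. -/
def point (I : Instance n d) : EuclideanSpace ℝ (Idx d) :=
  vect (toReal I.X₁ ⊗ₖ toReal I.X₂)

/-- Row-major storage of `f (M i k)` over the entries of `M`. -/
def storeMatrix {m k : ℕ} (f : ℚ → ℤ) (M : Matrix (Fin m) (Fin k) ℚ) : ℤ → ℤ :=
  RAM.layout (fun q : Fin m × Fin k => (q.1 : ℤ) * k + q.2) fun q => f (M q.1 q.2)

/-- Row-major storage of `W_{-(n-1)}, …, W_{n-1}` one after the other. -/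
def storeWeights (f : ℚ → ℤ) (I : Instance n d) : ℤ → ℤ :=
  RAM.layout (fun q : Fin (2 * n - 1) × Fin d × Fin d => ((q.1 : ℤ) * d + q.2.1) * d + q.2.2)
    fun q => f (I.W ((q.1 : ℤ) - ((n : ℤ) - 1)) q.2.1 q.2.2)

/-- The initial state of the machine: `n` and `d` in registers `0` and `1`, the numerators of the
matrices in banks `0, …, 7`, their denominators in banks `8, …, 15`, and zeros elsewhere. -/
def input (I : Instance n d) : RAM.State where
  reg := fun x => match x with
    | 0 => (n : ℤ)
    | 1 => (d : ℤ)
    | _ => 0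
  mem := fun a => match a with
    | 0 => storeMatrix Rat.num I.A₁
    | 1 => storeMatrix Rat.num I.A₂
    | 2 => storeMatrix Rat.num I.A₃
    | 3 => storeMatrix Rat.num I.E
    | 4 => storeMatrix Rat.num I.X₁
    | 5 => storeMatrix Rat.num I.X₂
    | 6 => storeMatrix Rat.num I.Y
    | 7 => I.storeWeights Rat.num
    | 8 => storeMatrix (fun r => (r.den : ℤ)) I.A₁
    | 9 => storeMatrix (fun r => (r.den : ℤ)) I.A₂
    | 10 => storeMatrix (fun r => (r.den : ℤ)) I.A₃
    | 11 => storeMatrix (fun r => (r.den : ℤ)) I.E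
    | 12 => storeMatrix (fun r => (r.den : ℤ)) I.X₁
    | 13 => storeMatrix (fun r => (r.den : ℤ)) I.X₂
    | 14 => storeMatrix (fun r => (r.den : ℤ)) I.Y
    | 15 => I.storeWeights (fun r => (r.den : ℤ))
    | _ => fun _ => 0

end Instance

/-- Position of the coordinate `((a, b), (k, l))` in the output vector of length `d⁴`. -/
def outAddr {d : ℕ} (q : Idx d) : ℤ :=
  ((((q.1.1 : ℤ) * d + q.1.2) * d + q.2.1) * d + q.2.2)

/-- The final state holds a vector of rationals, with numerators in bank `16` and positive
denominators in bank `17`, whose `ℓ∞` distance from `g` is at most `ε`. -/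
def Outputs {d : ℕ} (s : RAM.State) (g : EuclideanSpace ℝ (Idx d)) (ε : ℝ) : Prop :=
  ∀ q : Idx d, 0 < s.mem 17 (outAddr q) ∧
    |(s.mem 16 (outAddr q) : ℝ) / (s.mem 17 (outAddr q) : ℝ) - g q| ≤ ε

end RoPE

end

namespace RAM

/-- Binary integer operations of the formula language. -/
inductive BinOp where
  | add | sub | mul | div | mod

def BinOp.eval : BinOp → ℤ → ℤ → ℤ
  | .add, x, y => x + y
  | .sub, x, y => x - y
  | .mul, x, y => x * y
  | .div, x, y => x / y
  | .mod, x, y => x % y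

/-- Formulas for the entries of tables. `self i` reads an earlier cell of the table that is being
filled (the index of the current cell is held by the variable `100`), `pos c p q` is
`p` if `0 < c`, else `q`, `sum x v e` is the sum of `e` over `0 ≤ v < x`. -/
inductive Fml where
  | const (z : ℤ)
  | var (x : ℕ)
  | get (b : ℕ) (i : Fml)
  | self (i : Fml)
  | op (o : BinOp) (e f : Fml)
  | pos (c p q : Fml)
  | sum (x v : ℕ) (e : Fml)
  | bind (v : ℕ) (e f : Fml)

namespace Fml

instance : Add Fml := ⟨op .add⟩
instance : Sub Fml := ⟨op .sub⟩
instance : Mul Fml := ⟨op .mul⟩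
instance : Div Fml := ⟨op .div⟩
instance : Mod Fml := ⟨op .mod⟩
instance (n : ℕ) : OfNat Fml n := ⟨const n⟩

/-- Value of a formula for the bank `a`, in the memory `M` and the environment `ρ`. -/
def eval (a : ℕ) (M : ℕ → ℤ → ℤ) : Fml → (ℕ → ℤ) → ℤ
  | const z, _ => z
  | var x, ρ => ρ x
  | get b i, ρ => M b (i.eval a M ρ)
  | self i, ρ => if 0 ≤ i.eval a M ρ ∧ i.eval a M ρ < ρ 100 then M a (i.eval a M ρ) else 0
  | op o e f, ρ => o.eval (e.eval a M ρ) (f.eval a M ρ)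
  | pos c p q, ρ => if 0 < c.eval a M ρ then p.eval a M ρ else q.eval a M ρ
  | sum x v e, ρ => ∑ y ∈ Finset.range (ρ x).toNat, e.eval a M (Function.update ρ v (y : ℤ))
  | bind v e f, ρ => f.eval a M (Function.update ρ v (e.eval a M ρ))

/-- The formula reads only the registers `Dr` and the variables `L`, and only the banks `Db`. -/
def wf (Dr Db : List ℕ) : List ℕ → Fml → Bool
  | _, const _ => true
  | L, var x => decide (x ∈ Dr ∨ x ∈ L)
  | L, get b i => decide (b ∈ Db) && wf Dr Db L i
  | L, self i => decide (100 ∈ L) && wf Dr Db L i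
  | L, op _ e f => wf Dr Db L e && wf Dr Db L f
  | L, pos c p q => wf Dr Db L c && wf Dr Db L p && wf Dr Db L q
  | L, sum x v e => decide (x ∈ Dr ∧ 100 < v ∧ v < 200 ∧ v ∉ L) && wf Dr Db (v :: L) e
  | L, bind v e f => decide (100 < v ∧ v < 200 ∧ v ∉ L) && wf Dr Db L e && wf Dr Db (v :: L) f

/-- Growth rate of the length of the values. -/
def weight : Fml → ℕ
  | const z => z.natAbs.size + 1
  | var _ => 1
  | get _ i => i.weight
  | self i => i.weight + 1
  | op _ e f => e.weight + f.weight
  | pos c p q => c.weight + p.weight + q.weight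
  | sum _ _ e => e.weight + 2
  | bind _ e f => e.weight * f.weight

/-- Number of elementary steps of the evaluation. -/
def steps (ρ : ℕ → ℤ) : Fml → ℕ
  | const _ => 1
  | var _ => 1
  | get _ i => i.steps ρ + 1
  | self i => i.steps ρ + 3
  | op _ e f => e.steps ρ + f.steps ρ + 1
  | pos c p q => c.steps ρ + p.steps ρ + q.steps ρ + 1
  | sum x _ e => (ρ x).toNat * (e.steps ρ + 3) + 3
  | bind _ e f => e.steps ρ + f.steps ρ + 1

def _root_.RAM.BinOp.expr (t : ℕ) : BinOp → Expr
  | .add => .add (.reg t) (.reg (t + 1))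
  | .sub => .sub (.reg t) (.reg (t + 1))
  | .mul => .mul (.reg t) (.reg (t + 1))
  | .div => .div (.reg t) (.reg (t + 1))
  | .mod => .sub (.reg t) (.mul (.div (.reg t) (.reg (t + 1))) (.reg (t + 1)))

/-- Program that evaluates a formula into the register `t`, with temporaries from `t` on. -/
def comp (a : ℕ) : Fml → ℕ → Program
  | const z, t => .assign t (.const z)
  | var x, t => .assign t (.reg x)
  | get b i, t => .seq (i.comp a t) (.assign t (.get b (.reg t)))
  | self i, t => .seq (i.comp a t)
      (.ite (.sub (.reg 100) (.reg t))
        (.ite (.add (.reg t) (.const 1)) (.assign t (.get a (.reg t))) (.assign t (.const 0)))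
        (.assign t (.const 0)))
  | op o e f, t => .seq (e.comp a t) (.seq (f.comp a (t + 1)) (.assign t (o.expr t)))
  | pos c p q, t => .seq (c.comp a t) (.ite (.reg t) (p.comp a t) (q.comp a t))
  | sum x v e, t => .seq (.assign t (.const 0)) (.seq (.assign v (.const 0))
      (.loop (.sub (.reg x) (.reg v)) (.seq (e.comp a (t + 1))
        (.seq (.assign t (.add (.reg t) (.reg (t + 1))))
          (.assign v (.add (.reg v) (.const 1)))))))
  | bind v e f, t => .seq (e.comp a t) (.seq (.assign v (.reg t)) (f.comp a t))

theorem weight_pos (e : Fml) : 1 ≤ e.weight := by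
  induction e with
  | bind v e f he hf => exact Nat.mul_pos he hf
  | _ => simp only [weight]; omega

theorem update_agree {Dr L : List ℕ} {v : ℕ} {ρ ρ' : ℕ → ℤ} {y y' : ℤ}
    (hρ : ∀ x, x ∈ Dr ∨ x ∈ L → ρ x = ρ' x) (hy : y = y') (x : ℕ) (hx : x ∈ Dr ∨ x ∈ v :: L) :
    Function.update ρ v y x = Function.update ρ' v y' x := by
  by_cases h : x = v
  · subst h; simpa using hy
  · rw [Function.update_of_ne h, Function.update_of_ne h]
    exact hρ x (hx.imp_right fun h' => (List.mem_cons.1 h').resolve_left h)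

theorem eval_congr {Dr Db : List ℕ} {a : ℕ} {M M' : ℕ → ℤ → ℤ} {e : Fml} {L : List ℕ}
    (hw : wf Dr Db L e = true)
    (hM : ∀ b ∈ Db, M b = M' b) {ρ ρ' : ℕ → ℤ}
    (hs : 100 ∈ L → ∀ z, 0 ≤ z → z < ρ 100 → M a z = M' a z)
    (hρ : ∀ x, x ∈ Dr ∨ x ∈ L → ρ x = ρ' x) :
    e.eval a M ρ = e.eval a M' ρ' := by
  induction e generalizing L ρ ρ' with
  | const z => rfl
  | var x =>
    simp only [wf, decide_eq_true_eq] at hw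
    exact hρ x hw
  | get b i ih =>
    simp only [wf, Bool.and_eq_true, decide_eq_true_eq] at hw
    simp only [eval, ih hw.2 hs hρ, hM b hw.1]
  | self i ih =>
    simp only [wf, Bool.and_eq_true, decide_eq_true_eq] at hw
    simp only [eval, ih hw.2 hs hρ]
    have h100 := hρ 100 (Or.inr hw.1)
    rw [← h100]
    split_ifs with h
    · exact hs hw.1 _ h.1 h.2
    · rfl
  | op o e f he hf =>
    simp only [wf, Bool.and_eq_true] at hw
    simp only [eval, he hw.1 hs hρ, hf hw.2 hs hρ]
  | pos c p q hc hp hq =>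
    simp only [wf, Bool.and_eq_true] at hw
    simp only [eval, hc hw.1.1 hs hρ, hp hw.1.2 hs hρ, hq hw.2 hs hρ]
  | sum x v e ih =>
    simp only [wf, Bool.and_eq_true, decide_eq_true_eq] at hw
    simp only [eval, hρ x (Or.inl hw.1.1)]
    refine Finset.sum_congr rfl fun y _ => ih hw.2 ?_ ?_
    · intro h z h0 h1
      rw [Function.update_of_ne (by omega)] at h1
      exact hs ((List.mem_cons.1 h).resolve_left (by omega)) z h0 h1
    · exact update_agree hρ rfl
  | bind v e f he hf =>
    simp only [wf, Bool.and_eq_true, decide_eq_true_eq] at hw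
    refine hf hw.2 ?_ (update_agree hρ (he hw.1.2 hs hρ))
    intro h z h0 h1
    rw [Function.update_of_ne (by omega)] at h1
    exact hs ((List.mem_cons.1 h).resolve_left (by omega)) z h0 h1

theorem steps_congr {Dr Db : List ℕ} {e : Fml} {L : List ℕ} (hw : wf Dr Db L e = true)
    {ρ ρ' : ℕ → ℤ} (hρ : ∀ x ∈ Dr, ρ x = ρ' x) : e.steps ρ = e.steps ρ' := by
  induction e generalizing L with
  | const z => rfl
  | var x => rfl
  | get b i ih =>
    simp only [wf, Bool.and_eq_true] at hw
    simp only [steps, ih hw.2]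
  | self i ih =>
    simp only [wf, Bool.and_eq_true] at hw
    simp only [steps, ih hw.2]
  | op o e f he hf =>
    simp only [wf, Bool.and_eq_true] at hw
    simp only [steps, he hw.1, hf hw.2]
  | pos c p q hc hp hq =>
    simp only [wf, Bool.and_eq_true] at hw
    simp only [steps, hc hw.1.1, hp hw.1.2, hq hw.2]
  | sum x v e ih =>
    simp only [wf, Bool.and_eq_true, decide_eq_true_eq] at hw
    simp only [steps, ih hw.2, hρ x hw.1.1]
  | bind v e f he hf =>
    simp only [wf, Bool.and_eq_true] at hw
    simp only [steps, he hw.1.2, hf hw.2]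

theorem two_pow_add_le {a b : ℕ} (ha : 1 ≤ a) (hb : 1 ≤ b) :
    (2 : ℤ) ^ a + 2 ^ b ≤ 2 ^ (a + b) := by
  have h1 : (2 : ℤ) ≤ 2 ^ a := by
    simpa using pow_le_pow_right₀ (by norm_num : (1 : ℤ) ≤ 2) ha
  have h2 : (2 : ℤ) ≤ 2 ^ b := by
    simpa using pow_le_pow_right₀ (by norm_num : (1 : ℤ) ≤ 2) hb
  rw [pow_add]
  nlinarith

theorem _root_.RAM.BinOp.abs_eval_le (o : BinOp) {x y : ℤ} {a b : ℕ} (ha : 1 ≤ a) (hb : 1 ≤ b)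
    (hx : |x| ≤ 2 ^ a) (hy : |y| ≤ 2 ^ b) : |o.eval x y| ≤ 2 ^ (a + b) := by
  have h := two_pow_add_le ha hb
  have h1 : (2 : ℤ) ^ a ≤ 2 ^ (a + b) := pow_le_pow_right₀ (by norm_num) (by omega)
  cases o with
  | add => exact (abs_add_le x y).trans (by linarith)
  | sub => exact (abs_sub x y).trans (by linarith)
  | mul =>
    simp only [BinOp.eval, abs_mul, pow_add]
    exact mul_le_mul hx hy (abs_nonneg _) (by positivity)
  | div =>
    exact ((Int.abs_ediv_le_abs x y).trans hx).trans h1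
  | mod =>
    have h0 := Int.emod_add_mul_ediv x y
    simp only [BinOp.eval]
    by_cases hy0 : y = 0
    · subst hy0; simpa using hx.trans h1
    · rw [abs_of_nonneg (Int.emod_nonneg x hy0)]
      have := Int.emod_lt_abs x hy0
      have : (0:ℤ) ≤ 2 ^ a := by positivity
      linarith

theorem abs_eval_le {a : ℕ} {M : ℕ → ℤ → ℤ} {Dr Db : List ℕ} {e : Fml} {L : List ℕ}
    (hw : wf Dr Db L e = true) {m : ℕ} (hm : 1 ≤ m) (hM : ∀ b z, |M b z| ≤ 2 ^ m) {ρ : ℕ → ℤ}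
    (hρ : ∀ x, x ∈ Dr ∨ x ∈ L → |ρ x| ≤ 2 ^ m) : |e.eval a M ρ| ≤ 2 ^ (e.weight * m) := by
  have mono : ∀ {i j : ℕ}, i ≤ j → (2 : ℤ) ^ i ≤ 2 ^ j := fun h =>
    pow_le_pow_right₀ (by norm_num) h
  induction e generalizing L ρ m with
  | const z =>
    simp only [eval, weight]
    have h : (z.natAbs : ℤ) < 2 ^ z.natAbs.size := by exact_mod_cast Nat.lt_size_self z.natAbs
    rw [Int.abs_eq_natAbs]
    exact h.le.trans (mono (by nlinarith))
  | var x =>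
    simp only [wf, decide_eq_true_eq] at hw
    simpa [weight, eval] using hρ x hw
  | get b i ih =>
    simp only [eval, weight]
    exact (hM _ _).trans (mono (Nat.le_mul_of_pos_left m i.weight_pos))
  | self i ih =>
    simp only [eval, weight]
    split_ifs
    · exact (hM _ _).trans (mono (Nat.le_mul_of_pos_left m (by omega)))
    · simp
  | op o e f he hf =>
    simp only [wf, Bool.and_eq_true] at hw
    simp only [eval, weight, add_mul]
    exact o.abs_eval_le (Nat.mul_pos e.weight_pos hm) (Nat.mul_pos f.weight_pos hm)
      (he hw.1 hm hM hρ) (hf hw.2 hm hM hρ)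
  | pos c p q hc hp hq =>
    simp only [wf, Bool.and_eq_true] at hw
    simp only [eval, weight]
    split_ifs
    · exact (hp hw.1.2 hm hM hρ).trans (mono (Nat.mul_le_mul_right _ (by omega)))
    · exact (hq hw.2 hm hM hρ).trans (mono (Nat.mul_le_mul_right _ (by omega)))
  | sum x v e ih =>
    simp only [wf, Bool.and_eq_true, decide_eq_true_eq] at hw
    have hx : ρ x ≤ 2 ^ m := (le_abs_self _).trans (hρ x (Or.inl hw.1.1))
    simp only [eval, weight]
    refine (Finset.abs_sum_le_sum_abs _ _).trans ?_
    refine (Finset.sum_le_card_nsmul _ _ (2 ^ (e.weight * m)) fun y hy => ?_).trans ?_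
    · refine ih hw.2 hm hM fun z hz => ?_
      by_cases h : z = v
      · subst h
        rw [Finset.mem_range] at hy
        rw [Function.update_self, Nat.abs_cast]
        omega
      · rw [Function.update_of_ne h]
        exact hρ z (hz.imp_right fun h' => (List.mem_cons.1 h').resolve_left h)
    · rw [Finset.card_range, nsmul_eq_mul]
      calc ((ρ x).toNat : ℤ) * 2 ^ (e.weight * m) ≤ 2 ^ m * 2 ^ (e.weight * m) := by
            gcongr
            have : (0 : ℤ) ≤ 2 ^ m := by positivity
            omega
        _ ≤ _ := by rw [← pow_add]; exact mono (by nlinarith)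
  | bind v e f he hf =>
    simp only [wf, Bool.and_eq_true, decide_eq_true_eq] at hw
    simp only [eval, weight]
    have hv := he hw.1.2 hm hM hρ
    have hle : m ≤ e.weight * m := Nat.le_mul_of_pos_left m e.weight_pos
    have := hf hw.2 (hm.trans hle) (fun b z => (hM b z).trans (mono hle))
      (ρ := Function.update ρ v (e.eval a M ρ)) ?_
    · refine this.trans (mono (le_of_eq (by ring)))
    · intro z hz
      by_cases h : z = v
      · subst h; simpa using hv
      · rw [Function.update_of_ne h]
        exact (hρ z (hz.imp_right fun h' => (List.mem_cons.1 h').resolve_left h)).trans (mono hle)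

end Fml

end RAM

namespace RAM

theorem bits_le {z : ℤ} {j : ℕ} (hj : 1 ≤ j) (hz : |z| ≤ 2 ^ j) : bits z ≤ 3 * j := by
  have h : z.natAbs.size ≤ j + 1 := by
    rw [Nat.size_le]
    have h1 : (z.natAbs : ℤ) ≤ 2 ^ j := by rwa [← Int.abs_eq_natAbs]
    have h2 : z.natAbs ≤ 2 ^ j := by exact_mod_cast h1
    rw [pow_succ]
    have : 0 < 2 ^ j := by positivity
    omega
  unfold bits
  omega

@[simp] theorem State.setReg_mem (s : State) (x : ℕ) (v : ℤ) : (s.setReg x v).mem = s.mem := rfl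

@[simp] theorem State.setReg_reg (s : State) (x : ℕ) (v : ℤ) :
    (s.setReg x v).reg = Function.update s.reg x v := rfl

@[simp] theorem State.setMem_reg (s : State) (a : ℕ) (i v : ℤ) : (s.setMem a i v).reg = s.reg := rfl

@[simp] theorem State.setMem_mem (s : State) (a : ℕ) (i v : ℤ) :
    (s.setMem a i v).mem = Function.update s.mem a (Function.update (s.mem a) i v) := rfl

theorem BinOp.eval_expr (o : BinOp) (s : State) (t : ℕ) :
    (o.expr t).eval s = o.eval (s.reg t) (s.reg (t + 1)) := by
  cases o <;> simp only [BinOp.expr, Expr.eval, BinOp.eval]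
  rw [Int.emod_def, mul_comm]

theorem BinOp.cost_expr_le (o : BinOp) (s : State) (t : ℕ) {a b : ℕ} (ha : 1 ≤ a) (hb : 1 ≤ b)
    (hx : |s.reg t| ≤ 2 ^ a) (hy : |s.reg (t + 1)| ≤ 2 ^ b) :
    (o.expr t).cost s + bits ((o.expr t).eval s) ≤ 100 * (a + b) ^ 2 := by
  have h1 := bits_le ha hx
  have h2 := bits_le hb hy
  have h3 := bits_le (by omega) (o.abs_eval_le ha hb hx hy)
  rw [o.eval_expr]
  have h4 : bits (s.reg t) * bits (s.reg (t + 1)) ≤ (3 * a) * (3 * b) := Nat.mul_le_mul h1 h2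
  cases o with
  | mod =>
    have h5 := bits_le ha ((Int.abs_ediv_le_abs _ (s.reg (t + 1))).trans hx)
    have h6 : bits (s.reg t / s.reg (t + 1)) * bits (s.reg (t + 1)) ≤ (3 * a) * (3 * b) :=
      Nat.mul_le_mul h5 h2
    have h7 : bits (s.reg t / s.reg (t + 1) * s.reg (t + 1)) ≤ 3 * (a + b) :=
      bits_le (by omega) (BinOp.abs_eval_le .mul ha hb
        ((Int.abs_ediv_le_abs _ (s.reg (t + 1))).trans hx) hy)
    simp only [BinOp.expr, Expr.cost, Expr.eval] at *
    nlinarith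
  | _ =>
    simp only [BinOp.expr, Expr.cost] at *
    simp only [Expr.eval] at *
    nlinarith

namespace Fml

/-- Registers that the evaluation of a formula into the register `t` does not change. -/
def Keep (Dr L : List ℕ) (t : ℕ) (s s' : State) : Prop :=
  ∀ x, (x ∈ Dr ∨ x ∈ L ∨ (200 ≤ x ∧ x < t)) → s'.reg x = s.reg x

set_option maxHeartbeats 1000000 in
theorem comp_run (a : ℕ) {Dr Db : List ℕ} (hDr : ∀ x ∈ Dr, x < 100) (e : Fml) :
    ∀ {L : List ℕ}, wf Dr Db L e = true → (∀ x ∈ L, 100 ≤ x ∧ x < 200) →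
    ∀ {m : ℕ}, 1 ≤ m → ∀ {ρ : ℕ → ℤ}, (∀ x, x ∈ Dr ∨ x ∈ L → |ρ x| ≤ 2 ^ m) →
    ∀ {t : ℕ}, 200 ≤ t → ∀ s : State, (∀ b z, |s.mem b z| ≤ 2 ^ m) →
    (∀ x, x ∈ Dr ∨ x ∈ L → s.reg x = ρ x) →
    ∃ c s', Runs (e.comp a t) s c s' ∧ s'.reg t = e.eval a s.mem ρ ∧ s'.mem = s.mem ∧
      Keep Dr L t s s' ∧ c ≤ e.steps ρ * (100 * (e.weight * m) ^ 2) := by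
  have keep_set : ∀ {L : List ℕ}, (∀ x ∈ L, 100 ≤ x ∧ x < 200) → ∀ {t : ℕ}, 200 ≤ t →
      ∀ {s s' : State} {v : ℤ}, Keep Dr L t s s' → Keep Dr L t s (s'.setReg t v) := by
    intro L hL t ht s s' v h x hx
    rw [State.setReg_reg, Function.update_of_ne, h x hx]
    rintro rfl
    rcases hx with hx | hx | hx
    · have := hDr _ hx; omega
    · have := hL _ hx; omega
    · omega
  have keep_le : ∀ {L : List ℕ} {t t' : ℕ} {s s' : State}, t ≤ t' → Keep Dr L t' s s' →
      Keep Dr L t s s' := fun h hk x hx =>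
    hk x (hx.imp_right fun h' => h'.imp_right fun h'' => ⟨h''.1, h''.2.trans_le h⟩)
  have keep_trans : ∀ {L : List ℕ} {t : ℕ} {s s' s'' : State}, Keep Dr L t s s' →
      Keep Dr L t s' s'' → Keep Dr L t s s'' := fun h h' x hx => (h' x hx).trans (h x hx)
  have keep_agree : ∀ {L : List ℕ} {t : ℕ} {s s' : State} {ρ : ℕ → ℤ}, Keep Dr L t s s' →
      (∀ x, x ∈ Dr ∨ x ∈ L → s.reg x = ρ x) → ∀ x, x ∈ Dr ∨ x ∈ L → s'.reg x = ρ x :=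
    fun h h' x hx => (h x (hx.imp_right Or.inl)).trans (h' x hx)
  have unit_le : ∀ {w w' m : ℕ}, w ≤ w' → 100 * (w * m) ^ 2 ≤ 100 * (w' * m) ^ 2 := by
    intro w w' m h; gcongr
  have unit_mono : ∀ {w w' m c k : ℕ}, w ≤ w' → c ≤ k * (100 * (w * m) ^ 2) →
      c ≤ k * (100 * (w' * m) ^ 2) := fun h h' => h'.trans (Nat.mul_le_mul_left _ (unit_le h))
  induction e with
  | const z =>
    intro L hw hL m hm ρ hρ t ht s hM hs
    refine ⟨_, _, Runs.assign s t _, by simp [Expr.eval, eval], rfl,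
      keep_set hL ht fun _ _ => rfl, ?_⟩
    have hz : bits z ≤ 3 * (weight (const z) * m) :=
      bits_le (Nat.mul_pos (weight_pos _) hm) (abs_eval_le (a := a) hw hm hM hρ)
    have : 1 ≤ weight (const z) * m := Nat.mul_pos (weight_pos _) hm
    simp only [Expr.cost, Expr.eval, steps]
    nlinarith
  | var x =>
    intro L hw hL m hm ρ hρ t ht s hM hs
    have hx : s.reg x = ρ x := by
      simp only [wf, decide_eq_true_eq] at hw
      exact hs x hw
    refine ⟨_, _, Runs.assign s t _, by simp [Expr.eval, eval, hx], rfl,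
      keep_set hL ht fun _ _ => rfl, ?_⟩
    have hz : bits (ρ x) ≤ 3 * (weight (var x) * m) :=
      bits_le (Nat.mul_pos (weight_pos _) hm) (abs_eval_le (a := a) hw hm hM hρ)
    have : 1 ≤ weight (var x) * m := Nat.mul_pos (weight_pos _) hm
    simp only [Expr.cost, Expr.eval, steps, hx]
    nlinarith
  | get b i ih =>
    intro L hw hL m hm ρ hρ t ht s hM hs
    simp only [wf, Bool.and_eq_true] at hw
    obtain ⟨c, s', hr, hv, hm', hk, hc⟩ := ih hw.2 hL hm hρ ht s hM hs
    refine ⟨_, _, hr.seq (Runs.assign s' t _), by simp [Expr.eval, eval, hv, hm'], hm',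
      keep_set hL ht hk, ?_⟩
    have h1 : bits (i.eval a s.mem ρ) ≤ 3 * (weight i * m) :=
      bits_le (Nat.mul_pos (weight_pos _) hm) (abs_eval_le (a := a) hw.2 hm hM hρ)
    have h2 : bits (s.mem b (i.eval a s.mem ρ)) ≤ 3 * m := bits_le hm (hM _ _)
    have h3 : m ≤ weight i * m := Nat.le_mul_of_pos_left m i.weight_pos
    simp only [Expr.cost, Expr.eval, steps, hv, hm', weight]
    nlinarith
  | self i ih =>
    intro L hw hL m hm ρ hρ t ht s hM hs
    simp only [wf, Bool.and_eq_true, decide_eq_true_eq] at hw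
    obtain ⟨c, s', hr, hv, hm', hk, hc⟩ := ih hw.2 hL hm hρ ht s hM hs
    have h1 := abs_eval_le (a := a) hw.2 hm hM hρ
    have h1' : bits (i.eval a s.mem ρ) ≤ 3 * (weight i * m) :=
      bits_le (Nat.mul_pos (weight_pos _) hm) h1
    have h2 : bits (s.mem a (i.eval a s.mem ρ)) ≤ 3 * m := bits_le hm (hM _ _)
    have h3 : m ≤ weight i * m := Nat.le_mul_of_pos_left m i.weight_pos
    have h100 : s'.reg 100 = ρ 100 := keep_agree hk hs 100 (Or.inr hw.1)
    have h4 := hρ 100 (Or.inr hw.1)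
    have h4' := bits_le hm h4
    have h5 : bits (ρ 100 - i.eval a s.mem ρ) ≤ 3 * (m + weight i * m) :=
      bits_le (by omega) (BinOp.abs_eval_le .sub hm (by omega) h4 h1)
    have h6 : bits (i.eval a s.mem ρ + 1) ≤ 3 * (weight i * m + 1) :=
      bits_le (by omega) (BinOp.abs_eval_le .add (by omega) le_rfl h1 (by norm_num))
    have b0 : bits 0 = 1 := by simp [bits]
    have b1 : bits 1 = 2 := by simp [bits]
    have hc' := unit_mono (show i.weight ≤ (self i).weight by simp [weight]) hc
    have fin : ∀ c' : ℕ, c' ≤ 30 * (weight i * m) + 30 * m + 40 →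
        c + c' ≤ (self i).steps ρ * (100 * ((self i).weight * m) ^ 2) := by
      intro c' hc''
      rw [steps, add_mul]
      refine Nat.add_le_add hc' (hc''.trans ?_)
      have : m + 1 ≤ (self i).weight * m := by simp only [weight]; nlinarith
      have : weight i * m ≤ (self i).weight * m := by simp only [weight]; nlinarith
      nlinarith
    by_cases hlt : i.eval a s.mem ρ < ρ 100
    · by_cases h0 : 0 ≤ i.eval a s.mem ρ
      · refine ⟨_, _, hr.seq (Runs.ite_pos (by simp only [Expr.eval, h100, hv]; omega)
          (Runs.ite_pos (by simp only [Expr.eval, hv]; omega) (Runs.assign s' t _))), ?_, hm',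
          keep_set hL ht hk, fin _ ?_⟩
        · simp [Expr.eval, eval, hv, hm', hlt, h0]
        · simp only [Expr.cost, Expr.eval, hv, hm', h100, b1]
          omega
      · refine ⟨_, _, hr.seq (Runs.ite_pos (by simp only [Expr.eval, h100, hv]; omega)
          (Runs.ite_neg (by simp only [Expr.eval, hv]; omega) (Runs.assign s' t _))), ?_, hm',
          keep_set hL ht hk, fin _ ?_⟩
        · simp [Expr.eval, eval, h0]
        · simp only [Expr.cost, Expr.eval, hv, h100, b1, b0]
          omega
    · refine ⟨_, _, hr.seq (Runs.ite_neg (by simp only [Expr.eval, h100, hv]; omega)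
          (Runs.assign s' t _)), ?_, hm', keep_set hL ht hk, fin _ ?_⟩
      · simp [Expr.eval, eval, hlt]
      · simp only [Expr.cost, Expr.eval, hv, h100, b0]
        omega
  | op o e f he hf =>
    intro L hw hL m hm ρ hρ t ht s hM hs
    simp only [wf, Bool.and_eq_true] at hw
    obtain ⟨c, s', hr, hv, hm', hk, hc⟩ := he hw.1 hL hm hρ ht s hM hs
    obtain ⟨c', s'', hr', hv', hm'', hk', hc'⟩ := hf hw.2 hL hm hρ (t := t + 1) (by omega) s'
      (by rwa [hm']) (keep_agree hk hs)
    have ht' : s''.reg t = e.eval a s.mem ρ := by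
      rw [hk' t (Or.inr (Or.inr ⟨ht, by omega⟩)), hv]
    rw [hm'] at hv'
    refine ⟨_, _, hr.seq (hr'.seq (Runs.assign s'' t _)), ?_, hm''.trans hm',
      keep_set hL ht (keep_trans hk (keep_le (by omega) hk')), ?_⟩
    · simp [BinOp.eval_expr, eval, ht', hv']
    · have h := o.cost_expr_le s'' t (Nat.mul_pos e.weight_pos hm) (Nat.mul_pos f.weight_pos hm)
        (by rw [ht']; exact abs_eval_le (a := a) hw.1 hm hM hρ)
        (by rw [hv']; exact abs_eval_le (a := a) hw.2 hm hM hρ)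
      rw [← add_mul] at h
      have h1 := unit_mono (Nat.le_add_right e.weight f.weight) hc
      have h2 := unit_mono (Nat.le_add_left f.weight e.weight) hc'
      simp only [steps, weight, add_mul (e.steps ρ + f.steps ρ), add_mul (e.steps ρ), one_mul]
      omega
  | pos c p q hc hp hq =>
    intro L hw hL m hm ρ hρ t ht s hM hs
    simp only [wf, Bool.and_eq_true] at hw
    obtain ⟨k, s', hr, hv, hm', hk, hk1⟩ := hc hw.1.1 hL hm hρ ht s hM hs
    have hb := bits_le (Nat.mul_pos c.weight_pos hm) (abs_eval_le (a := a) hw.1.1 hm hM hρ)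
    have hw0 : c.weight ≤ (pos c p q).weight := by simp only [weight]; omega
    have hwp : p.weight ≤ (pos c p q).weight := by simp only [weight]; omega
    have hwq : q.weight ≤ (pos c p q).weight := by simp only [weight]; omega
    have hb1 : bits (s'.reg t) + bits (s'.reg t) ≤ 100 * ((pos c p q).weight * m) ^ 2 := by
      refine le_trans ?_ (unit_le hw0)
      have : 1 ≤ c.weight * m := Nat.mul_pos c.weight_pos hm
      rw [hv]
      nlinarith
    have hk2 := unit_mono hw0 hk1
    by_cases h : 0 < c.eval a s.mem ρ
    · obtain ⟨k', s'', hr', hv', hm'', hk', hc'⟩ := hp hw.1.2 hL hm hρ ht s'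
        (by rwa [hm']) (keep_agree hk hs)
      refine ⟨_, _, hr.seq (Runs.ite_pos (by simpa only [Expr.eval, hv]) hr'), ?_, hm''.trans hm',
        keep_trans hk hk', ?_⟩
      · simp [eval, hv', hm', h]
      · have := unit_mono hwp hc'
        generalize 100 * ((pos c p q).weight * m) ^ 2 = U at *
        simp only [steps, Expr.cost, Expr.eval]
        nlinarith
    · obtain ⟨k', s'', hr', hv', hm'', hk', hc'⟩ := hq hw.2 hL hm hρ ht s'
        (by rwa [hm']) (keep_agree hk hs)
      refine ⟨_, _, hr.seq (Runs.ite_neg (by simpa only [Expr.eval, hv, not_lt] using h) hr'), ?_,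
        hm''.trans hm', keep_trans hk hk', ?_⟩
      · simp [eval, hv', hm', h]
      · have := unit_mono hwq hc'
        generalize 100 * ((pos c p q).weight * m) ^ 2 = U at *
        simp only [steps, Expr.cost, Expr.eval]
        nlinarith
  | sum x v e ih =>
    intro L hw hL m hm ρ hρ t ht s hM hs
    simp only [wf, Bool.and_eq_true, decide_eq_true_eq] at hw
    obtain ⟨⟨hxD, hv1, hv2, hvL⟩, hw⟩ := hw
    have hx100 := hDr x hxD
    have hxm := hρ x (Or.inl hxD)
    have hxm' : ρ x ≤ 2 ^ m := (le_abs_self _).trans hxm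
    set φ : ℕ → ℤ := fun y => e.eval a s.mem (Function.update ρ v (y : ℤ)) with hφ
    have hρv : ∀ y < (ρ x).toNat, ∀ z, z ∈ Dr ∨ z ∈ v :: L →
        |Function.update ρ v (y : ℤ) z| ≤ 2 ^ m := by
      intro y hy z hz
      by_cases h : z = v
      · subst h
        rw [Function.update_self, Nat.abs_cast]
        omega
      · rw [Function.update_of_ne h]
        exact hρ z (hz.imp_right fun h' => (List.mem_cons.1 h').resolve_left h)
    have hφb : ∀ y < (ρ x).toNat, |φ y| ≤ 2 ^ (e.weight * m) := fun y hy =>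
      abs_eval_le (a := a) hw hm hM (hρv y hy)
    have hpart : ∀ y ≤ (ρ x).toNat, |∑ j ∈ Finset.range y, φ j| ≤ 2 ^ ((e.weight + 1) * m) := by
      intro y hy
      refine (Finset.abs_sum_le_sum_abs _ _).trans ?_
      refine (Finset.sum_le_card_nsmul _ _ (2 ^ (e.weight * m)) fun j hj =>
        hφb j ((Finset.mem_range.1 hj).trans_le hy)).trans ?_
      rw [Finset.card_range, nsmul_eq_mul, add_mul, one_mul, pow_add, mul_comm]
      gcongr
      have : (0 : ℤ) ≤ 2 ^ m := by positivity
      omega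
    have hwm : 1 ≤ e.weight * m := Nat.mul_pos e.weight_pos hm
    set U := 100 * ((sum x v e).weight * m) ^ 2 with hU
    have hU1 : 100 * (e.weight * m + 2 * m) ≤ U := by
      have : e.weight * m + 2 * m = (sum x v e).weight * m := by simp only [weight]; ring
      rw [hU, this]
      have : 1 ≤ (sum x v e).weight * m := Nat.mul_pos (weight_pos _) hm
      nlinarith
    have hst : ∀ y : ℕ, e.steps (Function.update ρ v (y : ℤ)) = e.steps ρ := fun y =>
      steps_congr hw fun z hz => Function.update_of_ne (by have := hDr _ hz; omega) _ _
    have hL' : ∀ y ∈ v :: L, 100 ≤ y ∧ y < 200 := by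
      intro y hy
      rcases List.mem_cons.1 hy with rfl | hy
      · omega
      · exact hL y hy
    have htest : ∀ s' : State, ∀ y : ℕ, y ≤ (ρ x).toNat → s'.reg x = ρ x → s'.reg v = y →
        (Expr.sub (.reg x) (.reg v)).cost s' + bits ((Expr.sub (.reg x) (.reg v)).eval s') ≤ U := by
      intro s' y hy h1 h2
      have hyb : |(y : ℤ)| ≤ 2 ^ m := by
        rw [Nat.abs_cast]
        have : (0 : ℤ) ≤ 2 ^ m := by positivity
        omega
      have b1 := bits_le hm hxm
      have b2 := bits_le hm hyb
      have b3 : bits (ρ x - y) ≤ 3 * (m + m) :=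
        bits_le (by omega) (BinOp.abs_eval_le .sub hm hm hxm hyb)
      simp only [Expr.cost, Expr.eval, h1, h2]
      omega
    have hloop : ∀ k y : ℕ, y + k = (ρ x).toNat → ∀ s' : State, s'.reg v = y →
        s'.reg t = ∑ j ∈ Finset.range y, φ j → s'.mem = s.mem → Keep Dr L t s s' →
        ∃ c s'', Runs (.loop (.sub (.reg x) (.reg v)) (.seq (e.comp a (t + 1))
          (.seq (.assign t (.add (.reg t) (.reg (t + 1))))
          (.assign v (.add (.reg v) (.const 1)))))) s' c s'' ∧
          s''.reg t = ∑ j ∈ Finset.range (ρ x).toNat, φ j ∧ s''.mem = s.mem ∧ Keep Dr L t s s'' ∧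
          c ≤ k * ((e.steps ρ + 3) * U) + U := by
      intro k
      induction k with
      | zero =>
        intro y hy s' h1 h2 h3 h4
        have hxs : s'.reg x = ρ x := keep_agree h4 hs x (Or.inl hxD)
        refine ⟨_, _, Runs.loop_exit ?_, ?_, h3, h4, ?_⟩
        · simp only [Expr.eval, hxs, h1]; omega
        · rw [h2]; congr 2
        · have := htest s' y (by omega) hxs h1
          omega
      | succ k ihk =>
        intro y hy s' h1 h2 h3 h4
        have hxs : s'.reg x = ρ x := keep_agree h4 hs x (Or.inl hxD)
        have hagree : ∀ z, z ∈ Dr ∨ z ∈ v :: L → s'.reg z = Function.update ρ v (y : ℤ) z := by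
          intro z hz
          by_cases h : z = v
          · subst h; simpa using h1
          · rw [Function.update_of_ne h]
            exact keep_agree h4 hs z (hz.imp_right fun h' => (List.mem_cons.1 h').resolve_left h)
        obtain ⟨c, s₁, hr, hv, hm', hk, hc⟩ := ih hw hL' hm (hρv y (by omega)) (t := t + 1)
          (by omega) s' (by rwa [h3]) hagree
        rw [hst, h3] at *
        have hvt : v ≠ t := by omega
        have hv1' : s₁.reg v = y := (hk v (Or.inr (Or.inl List.mem_cons_self))).trans h1
        have ht1 : s₁.reg t = ∑ j ∈ Finset.range y, φ j :=
          (hk t (Or.inr (Or.inr ⟨ht, by omega⟩))).trans h2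
        set s₂ := s₁.setReg t (s₁.reg t + s₁.reg (t + 1)) with hs₂
        set s₃ := s₂.setReg v (s₂.reg v + 1) with hs₃
        have h2v : s₂.reg v = y := by
          rw [hs₂, State.setReg_reg, Function.update_of_ne hvt, hv1']
        have k1 : Keep Dr L t s s₁ := keep_trans h4 (keep_le (by omega)
          fun z hz => hk z (hz.imp_right fun h => h.imp_left (List.mem_cons_of_mem v)))
        have k3 : Keep Dr L t s s₃ := by
          intro z hz
          have hne : z ≠ v := by
            rintro rfl
            rcases hz with hz | hz | hz
            · have := hDr _ hz; omega
            · exact hvL hz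
            · omega
          rw [hs₃, State.setReg_reg, Function.update_of_ne hne]
          exact keep_set hL ht k1 z hz
        obtain ⟨c', s₄, hr', hv', hm'', hk', hc'⟩ := ihk (y + 1) (by omega) s₃
          (by rw [hs₃, State.setReg_reg, Function.update_self, h2v]; push_cast; rfl)
          (by
            rw [hs₃, State.setReg_reg, Function.update_of_ne hvt.symm, hs₂, State.setReg_reg,
              Function.update_self, ht1, hv, Finset.sum_range_succ])
          hm' k3
        refine ⟨_, _, Runs.loop_step ?_ (hr.seq ((Runs.assign s₁ t _).seq (Runs.assign s₂ v _)))
          hr', hv', hm'', hk', ?_⟩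
        · simp only [Expr.eval, hxs, h1]; omega
        · have c1 := htest s' y (by omega) hxs h1
          have c2 := unit_mono (show e.weight ≤ (sum x v e).weight by simp [weight]) hc
          rw [← hU] at c2
          have hp := hpart y (by omega)
          have hp' := hφb y (by omega)
          have b1 := bits_le (by nlinarith) hp
          have b2 := bits_le hwm hp'
          have b3 : bits (∑ j ∈ Finset.range y, φ j + φ y) ≤ 3 * ((e.weight + 1) * m) := by
            rw [← Finset.sum_range_succ]
            exact bits_le (by nlinarith) (hpart (y + 1) (by omega))
          have hyb : |(y : ℤ)| ≤ 2 ^ m := by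
            rw [Nat.abs_cast]
            omega
          have b4 := bits_le hm hyb
          have b5 : bits ((y : ℤ) + 1) ≤ 3 * (m + 1) :=
            bits_le (by omega) (BinOp.abs_eval_le .add hm le_rfl hyb (by norm_num))
          have b6 : bits 1 = 2 := by simp [bits]
          rw [add_mul, one_mul] at b1 b3
          have c3 : (Expr.add (.reg t) (.reg (t + 1))).cost s₁ +
              bits ((Expr.add (.reg t) (.reg (t + 1))).eval s₁) ≤ U := by
            have hvφ : s₁.reg (t + 1) = φ y := hv
            simp only [Expr.cost, Expr.eval, ht1, hvφ]
            omega
          have c4 : (Expr.add (.reg v) (.const 1)).cost s₂ +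
              bits ((Expr.add (.reg v) (.const 1)).eval s₂) ≤ U := by
            simp only [Expr.cost, Expr.eval, h2v, b6]
            omega
          have c5 : (k + 1) * ((e.steps ρ + 3) * U) =
              k * ((e.steps ρ + 3) * U) + (e.steps ρ * U + 3 * U) := by ring
          rw [c5]
          omega
    have hks : Keep Dr L t s ((s.setReg t 0).setReg v 0) := by
      intro z hz
      have hne : z ≠ v := by
        rintro rfl
        rcases hz with hz | hz | hz
        · have := hDr _ hz; omega
        · exact hvL hz
        · omega
      rw [State.setReg_reg, Function.update_of_ne hne]
      exact keep_set hL ht (fun _ _ => rfl) z hz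
    obtain ⟨c, s', hr, hv, hm', hk, hc⟩ := hloop (ρ x).toNat 0 (by omega)
      ((s.setReg t 0).setReg v 0) (by simp)
      (by simp [Function.update_of_ne (show t ≠ v by omega)]) rfl hks
    refine ⟨_, _, (Runs.assign s t (.const 0)).seq ((Runs.assign _ v (.const 0)).seq hr), hv, hm',
      hk, ?_⟩
    have b0 : bits 0 = 1 := by simp [bits]
    have c5 : (sum x v e).steps ρ * U = (ρ x).toNat * ((e.steps ρ + 3) * U) + 3 * U := by
      simp only [steps]; ring
    rw [c5]
    simp only [Expr.cost, Expr.eval, b0]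
    omega
  | bind v e f he hf =>
    intro L hw hL m hm ρ hρ t ht s hM hs
    simp only [wf, Bool.and_eq_true, decide_eq_true_eq] at hw
    obtain ⟨c, s', hr, hv, hm', hk, hc⟩ := he hw.1.2 hL hm hρ ht s hM hs
    have hle : m ≤ e.weight * m := Nat.le_mul_of_pos_left m e.weight_pos
    have mono : (2 : ℤ) ^ m ≤ 2 ^ (e.weight * m) := pow_le_pow_right₀ (by norm_num) hle
    have hev := abs_eval_le (a := a) hw.1.2 hm hM hρ
    have hkv : Keep Dr L t s' (s'.setReg v (s'.reg t)) := by
      intro y hy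
      rw [State.setReg_reg, Function.update_of_ne]
      rintro rfl
      rcases hy with hy | hy | hy
      · have := hDr _ hy; omega
      · exact hw.1.1.2.2 hy
      · omega
    obtain ⟨c', s'', hr', hv', hm'', hk', hc'⟩ := hf (L := v :: L) hw.2
      (by
        intro y hy
        rcases List.mem_cons.1 hy with rfl | hy
        · omega
        · exact hL y hy) (m := e.weight * m) (hm.trans hle)
      (ρ := Function.update ρ v (e.eval a s.mem ρ))
      (by
        intro z hz
        by_cases h : z = v
        · subst h; simpa using hev
        · rw [Function.update_of_ne h]
          exact (hρ z (hz.imp_right fun h' => (List.mem_cons.1 h').resolve_left h)).trans mono)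
      ht (s'.setReg v (s'.reg t)) (by
        intro b z
        rw [State.setReg_mem, hm']
        exact (hM b z).trans mono) (by
        rw [State.setReg_reg]
        exact update_agree (keep_agree hk hs) hv)
    rw [State.setReg_mem, hm'] at hv' hm''
    refine ⟨_, _, hr.seq ((Runs.assign s' v _).seq hr'), hv', hm'', ?_, ?_⟩
    · intro y hy
      rw [hk' y (hy.imp_right fun h => h.imp_left (List.mem_cons_of_mem v)), hkv y hy, hk y hy]
    · have hst : f.steps (Function.update ρ v (e.eval a s.mem ρ)) = f.steps ρ :=
        steps_congr hw.2 fun y hy => Function.update_of_ne (by have := hDr _ hy; omega) _ _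
      rw [hst] at hc'
      have hb := bits_le (Nat.mul_pos e.weight_pos hm) hev
      have hwe : e.weight ≤ (bind v e f).weight := Nat.le_mul_of_pos_right _ f.weight_pos
      have h1 := unit_mono hwe hc
      have h2 : (100 : ℕ) * (f.weight * (e.weight * m)) ^ 2 =
          100 * ((bind v e f).weight * m) ^ 2 := by simp only [weight]; ring
      rw [h2] at hc'
      have h3 : bits (s'.reg t) + bits (s'.reg t) ≤ 100 * ((bind v e f).weight * m) ^ 2 := by
        refine le_trans ?_ (unit_le hwe)
        have : 1 ≤ e.weight * m := Nat.mul_pos e.weight_pos hm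
        rw [hv]
        nlinarith
      generalize 100 * ((bind v e f).weight * m) ^ 2 = U at *
      simp only [steps, Expr.cost, Expr.eval]
      linarith

end Fml

end RAM

namespace RAM

/-- Statements of the table language: compute a parameter, or fill a table of given length. -/
inductive Stmt where
  | param (x : ℕ) (e : Fml)
  | fill (a x : ℕ) (e : Fml)

namespace Stmt

def regs : Stmt → List ℕ
  | param x _ => [x]
  | fill _ _ _ => []

def banks : Stmt → List ℕ
  | param _ _ => []
  | fill a _ _ => [a]

def fml : Stmt → Fml
  | param _ e => e
  | fill _ _ e => e

def wf (Dr Db : List ℕ) : Stmt → Bool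
  | param x e => decide (x ∉ Dr ∧ x < 100) && e.wf Dr Db []
  | fill a x e => decide (a ∉ Db ∧ x ∈ Dr) && e.wf Dr Db [100]

/-- The equations that a statement imposes on the final registers and memory. -/
def Holds (ρ : ℕ → ℤ) (M : ℕ → ℤ → ℤ) : Stmt → Prop
  | param x e => ρ x = e.eval 0 M ρ
  | fill a x e => (∀ z : ℕ, (z : ℤ) < ρ x → M a z = e.eval a M (Function.update ρ 100 (z : ℤ))) ∧
      ∀ z : ℤ, z < 0 ∨ ρ x ≤ z → M a z = 0

def comp : Stmt → Program
  | param x e => .seq (e.comp 0 200) (.assign x (.reg 200))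
  | fill a x e => .seq (.assign 100 (.const 0)) (.loop (.sub (.reg x) (.reg 100))
      (.seq (e.comp a 200) (.seq (.store a (.reg 100) (.reg 200))
        (.assign 100 (.add (.reg 100) (.const 1))))))

/-- Number of elementary steps. -/
def steps (ρ : ℕ → ℤ) : Stmt → ℕ
  | param _ e => e.steps ρ + 1
  | fill _ x e => (ρ x).toNat * (e.steps ρ + 3) + 2

/-- The first `z` entries of a table. -/
def table (a : ℕ) (M : ℕ → ℤ → ℤ) (ρ : ℕ → ℤ) (e : Fml) : ℕ → ℤ → ℤ
  | 0 => 0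
  | z + 1 => Function.update (table a M ρ e z) z
      (e.eval a (Function.update M a (table a M ρ e z)) (Function.update ρ 100 (z : ℤ)))

theorem table_of_lt (a : ℕ) (M : ℕ → ℤ → ℤ) (ρ : ℕ → ℤ) (e : Fml) {y z : ℕ} (h : z < y) :
    table a M ρ e y z = table a M ρ e (z + 1) z := by
  induction y with
  | zero => omega
  | succ y ih =>
    rcases Nat.lt_succ_iff_lt_or_eq.1 h with h | rfl
    · rw [← ih h, table, Function.update_of_ne]
      exact_mod_cast h.ne
    · rfl

theorem table_of_not (a : ℕ) (M : ℕ → ℤ → ℤ) (ρ : ℕ → ℤ) (e : Fml) {y : ℕ} {z : ℤ}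
    (h : z < 0 ∨ (y : ℤ) ≤ z) : table a M ρ e y z = 0 := by
  induction y with
  | zero => rfl
  | succ y ih =>
    rw [table, Function.update_of_ne (by omega), ih (by omega)]

theorem table_abs_le (a : ℕ) (M : ℕ → ℤ → ℤ) (ρ : ℕ → ℤ) (e : Fml) {y T : ℕ} (h : y ≤ T) {b : ℤ}
    (hb : ∀ z, |table a M ρ e T z| ≤ b) (z : ℤ) : |table a M ρ e y z| ≤ b := by
  by_cases hz : z < 0 ∨ (y : ℤ) ≤ z
  · rw [table_of_not _ _ _ _ hz]
    simpa using (abs_nonneg _).trans (hb z)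
  · push Not at hz
    obtain ⟨w, rfl⟩ := Int.eq_ofNat_of_zero_le hz.1
    have hw : w < y := by exact_mod_cast hz.2
    have := hb w
    rwa [table_of_lt _ _ _ _ (hw.trans_le h), ← table_of_lt _ _ _ _ hw] at this

theorem table_eq {Dr Db : List ℕ} {a : ℕ} {e : Fml} (ha : a ∉ Db)
    (hw : e.wf Dr Db [100] = true) (M : ℕ → ℤ → ℤ) (ρ : ℕ → ℤ)
    {T z : ℕ} (hz : z < T) :
    table a M ρ e T z = e.eval a (Function.update M a (table a M ρ e T))
      (Function.update ρ 100 (z : ℤ)) := by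
  rw [table_of_lt _ _ _ _ hz, table, Function.update_self]
  refine Fml.eval_congr hw ?_ ?_ fun _ _ => rfl
  · intro b hb
    have : b ≠ a := fun h => ha (h ▸ hb)
    rw [Function.update_of_ne this, Function.update_of_ne this]
  · intro _ w h0 h1
    obtain ⟨w, rfl⟩ := Int.eq_ofNat_of_zero_le h0
    rw [Function.update_self] at h1
    have h1 : w < z := by exact_mod_cast h1
    simp only [Function.update_self]
    change table a M ρ e z w = table a M ρ e T w
    rw [table_of_lt _ _ _ _ h1, table_of_lt _ _ _ _ (h1.trans hz)]

theorem param_run {Dr Db : List ℕ} {x : ℕ} {e : Fml} (hDr : ∀ y ∈ Dr, y < 100) (hx : x ∉ Dr)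
    (hw : e.wf Dr Db [] = true) {m : ℕ} (hm : 1 ≤ m) {ρ : ℕ → ℤ} (hρ : ∀ y ∈ Dr, |ρ y| ≤ 2 ^ m)
    (s : State) (hM : ∀ b z, |s.mem b z| ≤ 2 ^ m) (hs : ∀ y ∈ Dr, s.reg y = ρ y) :
    ∃ c s', Runs (param x e).comp s c s' ∧ s'.mem = s.mem ∧
      (∀ y ∈ Dr, s'.reg y = ρ y) ∧ s'.reg x = e.eval 0 s.mem ρ ∧
      c ≤ (param x e).steps ρ * (100 * (e.weight * m) ^ 2) := by
  obtain ⟨c, s', hr, hv, hm', hk, hc⟩ := Fml.comp_run 0 hDr e hw (by simp) hm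
    (ρ := ρ) (by simpa using hρ) le_rfl s hM (by simpa using hs)
  refine ⟨_, _, hr.seq (Runs.assign s' x _), hm', ?_, ?_, ?_⟩
  · intro y hy
    rw [State.setReg_reg, Function.update_of_ne (ne_of_mem_of_not_mem hy hx), hk y (Or.inl hy), hs y hy]
  · simp [Expr.eval, hv]
  · have h1 : bits (e.eval 0 s.mem ρ) ≤ 3 * (e.weight * m) :=
      bits_le (Nat.mul_pos e.weight_pos hm) (Fml.abs_eval_le hw hm hM (by simpa using hρ))
    have : 1 ≤ e.weight * m := Nat.mul_pos e.weight_pos hm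
    simp only [Expr.cost, Expr.eval, hv, steps]
    nlinarith

theorem fill_run {Dr Db : List ℕ} {a x : ℕ} {e : Fml} (hDr : ∀ y ∈ Dr, y < 100) (ha : a ∉ Db)
    (hx : x ∈ Dr) (hw : e.wf Dr Db [100] = true) {m : ℕ} (hm : 1 ≤ m) {ρ : ℕ → ℤ}
    (hρ : ∀ y ∈ Dr, |ρ y| ≤ 2 ^ m) (s : State) (h0 : s.mem a = 0)
    (hM : ∀ b z, |Function.update s.mem a (table a s.mem ρ e (ρ x).toNat) b z| ≤ 2 ^ m)
    (hs : ∀ y ∈ Dr, s.reg y = ρ y) :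
    ∃ c s', Runs (fill a x e).comp s c s' ∧
      s'.mem = Function.update s.mem a (table a s.mem ρ e (ρ x).toNat) ∧
      (∀ y ∈ Dr, s'.reg y = ρ y) ∧
      c ≤ (fill a x e).steps ρ * (100 * ((e.weight + 2) * m) ^ 2) := by
  set T := (ρ x).toNat with hT
  set U := 100 * ((e.weight + 2) * m) ^ 2 with hU
  have hwm : 1 ≤ e.weight * m := Nat.mul_pos e.weight_pos hm
  have hU1 : 100 * (e.weight * m + 2 * m) ≤ U := by
    rw [hU, add_mul]
    nlinarith
  have hxm := hρ x hx
  have hxm' : ρ x ≤ 2 ^ m := (le_abs_self _).trans hxm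
  have hx100 := hDr x hx
  have h2m : (0 : ℤ) ≤ 2 ^ m := by positivity
  have hMt : ∀ y ≤ T, ∀ b z, |Function.update s.mem a (table a s.mem ρ e y) b z| ≤ 2 ^ m := by
    intro y hy b z
    by_cases hb : b = a
    · subst hb
      simp only [Function.update_self] at hM ⊢
      refine table_abs_le _ _ _ _ hy (fun z => ?_) z
      simpa using hM b z
    · have := hM b z
      rw [Function.update_of_ne hb] at this ⊢
      exact this
  have hyb : ∀ y : ℕ, y ≤ T → |(y : ℤ)| ≤ 2 ^ m := by
    intro y hy
    rw [Nat.abs_cast]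
    omega
  have hρz : ∀ y ≤ T, ∀ z, z ∈ Dr ∨ z ∈ [100] → |Function.update ρ 100 (y : ℤ) z| ≤ 2 ^ m := by
    intro y hy z hz
    by_cases h : z = 100
    · subst h
      simpa using hyb y hy
    · rw [Function.update_of_ne h]
      exact hρ z (hz.resolve_right (by simpa using h))
  have hst : ∀ y : ℕ, e.steps (Function.update ρ 100 (y : ℤ)) = e.steps ρ := fun y =>
    Fml.steps_congr hw fun z hz => Function.update_of_ne (by have := hDr _ hz; omega) _ _
  have htest : ∀ s' : State, ∀ y : ℕ, y ≤ T → s'.reg x = ρ x → s'.reg 100 = y →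
      (Expr.sub (.reg x) (.reg 100)).cost s' +
        bits ((Expr.sub (.reg x) (.reg 100)).eval s') ≤ U := by
    intro s' y hy h1 h2
    have b1 := bits_le hm hxm
    have b2 := bits_le hm (hyb y hy)
    have b3 : bits (ρ x - y) ≤ 3 * (m + m) :=
      bits_le (by omega) (BinOp.abs_eval_le .sub hm hm hxm (hyb y hy))
    simp only [Expr.cost, Expr.eval, h1, h2]
    omega
  have hloop : ∀ k y : ℕ, y + k = T → ∀ s' : State, s'.reg 100 = y →
      s'.mem = Function.update s.mem a (table a s.mem ρ e y) → (∀ y ∈ Dr, s'.reg y = ρ y) →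
      ∃ c s'', Runs (.loop (.sub (.reg x) (.reg 100))
        (.seq (e.comp a 200) (.seq (.store a (.reg 100) (.reg 200))
          (.assign 100 (.add (.reg 100) (.const 1)))))) s' c s'' ∧
        s''.mem = Function.update s.mem a (table a s.mem ρ e T) ∧ (∀ y ∈ Dr, s''.reg y = ρ y) ∧
        c ≤ k * ((e.steps ρ + 3) * U) + U := by
    intro k
    induction k with
    | zero =>
      intro y hy s' h1 h2 h3
      refine ⟨_, _, Runs.loop_exit ?_, ?_, h3, ?_⟩
      · simp only [Expr.eval, h3 x hx, h1]; omega
      · rw [h2, ← hy, add_zero]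
      · have := htest s' y (by omega) (h3 x hx) h1
        omega
    | succ k ihk =>
      intro y hy s' h1 h2 h3
      obtain ⟨c, s₁, hr, hv, hm', hk, hc⟩ := Fml.comp_run a hDr e hw (by simp) hm
        (hρz y (by omega)) le_rfl s' (by rw [h2]; exact hMt y (by omega)) (by
          intro z hz
          by_cases h : z = 100
          · subst h; simpa using h1
          · rw [Function.update_of_ne h]
            exact h3 z (hz.resolve_right (by simpa using h)))
      have hev := Fml.abs_eval_le (a := a) hw hm (hMt y (by omega)) (hρz y (by omega))
      rw [hst] at hc
      rw [h2] at hv hm'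
      have h100 : s₁.reg 100 = y := (hk 100 (Or.inr (Or.inl (by simp)))).trans h1
      set s₂ := s₁.setMem a (s₁.reg 100) (s₁.reg 200) with hs₂
      set s₃ := s₂.setReg 100 (s₂.reg 100 + 1) with hs₃
      have h2v : s₂.reg 100 = y := h100
      obtain ⟨c', s₄, hr', hm'', hk', hc'⟩ := ihk (y + 1) (by omega) s₃
        (by rw [hs₃, State.setReg_reg, Function.update_self, h2v]; push_cast; rfl)
        (by
          rw [hs₃, State.setReg_mem, hs₂, State.setMem_mem, hm', h100, hv]
          simp [table])
        (by
          intro z hz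
          have := hDr z hz
          rw [hs₃, State.setReg_reg, Function.update_of_ne (by omega), hs₂, State.setMem_reg,
            hk z (Or.inl hz), h3 z hz])
      refine ⟨_, _, Runs.loop_step ?_ (hr.seq ((Runs.store s₁ a _ _).seq (Runs.assign s₂ 100 _)))
          hr', hm'', hk', ?_⟩
      · simp only [Expr.eval, h3 x hx, h1]; omega
      · have c1 := htest s' y (by omega) (h3 x hx) h1
        have c2 : c ≤ e.steps ρ * U := hc.trans (Nat.mul_le_mul_left _ (by rw [hU]; gcongr; omega))
        have b2 := bits_le hwm hev
        have b4 := bits_le hm (hyb y (by omega))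
        have b5 : bits ((y : ℤ) + 1) ≤ 3 * (m + 1) :=
          bits_le (by omega) (BinOp.abs_eval_le .add hm le_rfl (hyb y (by omega)) (by norm_num))
        have b6 : bits 1 = 2 := by simp [bits]
        have c3 : (Expr.reg 100).cost s₁ + (Expr.reg 200).cost s₁ + bits ((Expr.reg 100).eval s₁) +
            bits ((Expr.reg 200).eval s₁) ≤ U := by
          simp only [Expr.cost, Expr.eval, h100, hv]
          omega
        have c4 : (Expr.add (.reg 100) (.const 1)).cost s₂ +
            bits ((Expr.add (.reg 100) (.const 1)).eval s₂) ≤ U := by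
          simp only [Expr.cost, Expr.eval, h2v, b6]
          omega
        have c5 : (k + 1) * ((e.steps ρ + 3) * U) =
            k * ((e.steps ρ + 3) * U) + (e.steps ρ * U + 3 * U) := by ring
        rw [c5]
        omega
  obtain ⟨c, s', hr, hm', hk, hc⟩ := hloop T 0 (by omega) (s.setReg 100 0) (by simp)
    (by rw [State.setReg_mem, table, ← h0, Function.update_eq_self]) (by
      intro z hz
      have := hDr z hz
      rw [State.setReg_reg, Function.update_of_ne (by omega), hs z hz])
  refine ⟨_, _, (Runs.assign s 100 (.const 0)).seq hr, hm', hk, ?_⟩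
  have b0 : bits 0 = 1 := by simp [bits]
  have c5 : (fill a x e).steps ρ * U = T * ((e.steps ρ + 3) * U) + 2 * U := by
    simp only [steps]; ring
  rw [c5]
  simp only [Expr.cost, Expr.eval, b0]
  omega

/-- Every statement reads only what is defined before, and defines something new. -/
def wfList : List ℕ → List ℕ → List Stmt → Bool
  | _, _, [] => true
  | Dr, Db, st :: l => st.wf Dr Db && wfList (st.regs ++ Dr) (st.banks ++ Db) l

def compList : List Stmt → Program
  | [] => .skip
  | st :: l => .seq st.comp (compList l)

/-- Bound for the running time when all values have absolute value at most `2 ^ m`. -/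
def costList (ρ : ℕ → ℤ) (m : ℕ) : List Stmt → ℕ
  | [] => 1
  | st :: l => st.steps ρ * (100 * ((st.fml.weight + 2) * m) ^ 2) + costList ρ m l

/-- A well-formed table program reaches a state in which the equations of all its statements
hold, within the time given by `costList`. -/
theorem run_list (l : List Stmt) : ∀ {Dr Db : List ℕ}, wfList Dr Db l = true →
    (∀ x ∈ Dr, x < 100) → ∀ (ρ : ℕ → ℤ) (M : ℕ → ℤ → ℤ), (∀ b, b ∉ Db → M b = 0) →
    ∃ (ρ' : ℕ → ℤ) (M' : ℕ → ℤ → ℤ), (∀ x, (x ∈ Dr ∨ ∀ st ∈ l, x ∉ st.regs) → ρ' x = ρ x) ∧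
      (∀ b, (b ∈ Db ∨ ∀ st ∈ l, b ∉ st.banks) → M' b = M b) ∧ (∀ st ∈ l, st.Holds ρ' M') ∧
      ∀ m, 1 ≤ m → (∀ x, |ρ' x| ≤ 2 ^ m) → (∀ b z, |M' b z| ≤ 2 ^ m) →
        ∀ s : State, s.mem = M → (∀ x ∈ Dr, s.reg x = ρ x) →
        ∃ c s', Runs (compList l) s c s' ∧ s'.mem = M' ∧ c ≤ costList ρ' m l := by
  induction l with
  | nil =>
    intro Dr Db _ _ ρ M _
    refine ⟨ρ, M, fun _ _ => rfl, fun _ _ => rfl, by simp, fun m _ _ _ s hs _ => ?_⟩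
    exact ⟨_, _, Runs.skip s, hs, le_rfl⟩
  | cons st l ih =>
    intro Dr Db hw hDr ρ M hM0
    rw [wfList, Bool.and_eq_true] at hw
    obtain ⟨hst, hl⟩ := hw
    cases st with
    | param x e =>
      simp only [wf, Bool.and_eq_true, decide_eq_true_eq] at hst
      obtain ⟨⟨hx, hx100⟩, he⟩ := hst
      obtain ⟨ρ', M', h1, h2, h3, h4⟩ := ih hl (by
        intro y hy
        simp only [regs, List.singleton_append, List.mem_cons] at hy
        rcases hy with rfl | hy
        · exact hx100
        · exact hDr y hy) (Function.update ρ x (e.eval 0 M ρ)) M hM0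
      have hρ' : ∀ y ∈ Dr, ρ' y = ρ y := fun y hy => by
        rw [h1 y (Or.inl (by simp [regs, hy])), Function.update_of_ne (ne_of_mem_of_not_mem hy hx)]
      have hM' : ∀ b ∈ Db, M' b = M b := fun b hb => h2 b (Or.inl (by simp [banks, hb]))
      have hρx : ρ' x = e.eval 0 M ρ := by
        rw [h1 x (Or.inl (by simp [regs])), Function.update_self]
      have hval : e.eval 0 M ρ = e.eval 0 M' ρ' :=
        Fml.eval_congr he (fun b hb => (hM' b hb).symm) (by simp)
          (by simpa using fun y hy => (hρ' y hy).symm)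
      refine ⟨ρ', M', ?_, ?_, ?_, ?_⟩
      · rintro y (hy | hy)
        · exact hρ' y hy
        · have hyx : y ≠ x := by
            have := hy (param x e) List.mem_cons_self
            simpa [regs] using this
          rw [h1 y (Or.inr fun st hst => hy st (List.mem_cons_of_mem _ hst)),
            Function.update_of_ne hyx]
      · rintro b (hb | hb)
        · exact hM' b hb
        · exact h2 b (Or.inr fun st hst => hb st (List.mem_cons_of_mem _ hst))
      · intro st hst
        rcases List.mem_cons.1 hst with rfl | hst
        · exact hρx.trans hval
        · exact h3 st hst
      · intro m hm hρb hMb s hs hsr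
        have hMb' : ∀ b z, |s.mem b z| ≤ 2 ^ m := by
          intro b z
          rw [hs]
          by_cases hb : b ∈ Db
          · rw [← hM' b hb]; exact hMb b z
          · rw [hM0 b hb]; simp
        obtain ⟨c, s', r1, r2, r3, r4, r5⟩ := param_run (x := x) hDr hx he hm (ρ := ρ)
          (fun y hy => by rw [← hρ' y hy]; exact hρb y) s hMb' hsr
        obtain ⟨c', s'', r1', r2', r3'⟩ := h4 m hm hρb hMb s' (r2.trans hs) (by
          intro y hy
          simp only [regs, List.singleton_append, List.mem_cons] at hy
          by_cases h : y = x
          · subst h; rw [r4, hs, Function.update_self]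
          · rw [Function.update_of_ne h]; exact r3 y (hy.resolve_left h))
        refine ⟨_, _, r1.seq r1', r2', ?_⟩
        have hs1 : (param x e).steps ρ = (param x e).steps ρ' := by
          simp only [steps, Fml.steps_congr he fun y hy => (hρ' y hy).symm]
        rw [hs1] at r5
        refine Nat.add_le_add (r5.trans (Nat.mul_le_mul_left _ ?_)) r3'
        simp only [fml]
        gcongr
        omega
    | fill a x e =>
      simp only [wf, Bool.and_eq_true, decide_eq_true_eq] at hst
      obtain ⟨⟨ha, hx⟩, he⟩ := hst
      set T := (ρ x).toNat with hT
      obtain ⟨ρ', M', h1, h2, h3, h4⟩ := ih hl (by simpa [regs] using hDr) ρ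
        (Function.update M a (table a M ρ e T)) (by
          intro b hb
          simp only [banks, List.singleton_append, List.mem_cons, not_or] at hb
          rw [Function.update_of_ne hb.1, hM0 b hb.2])
      have hρ' : ∀ y ∈ Dr, ρ' y = ρ y := fun y hy => h1 y (Or.inl (by simp [regs, hy]))
      have hM' : ∀ b ∈ Db, M' b = M b := fun b hb => by
        rw [h2 b (Or.inl (by simp [banks, hb])), Function.update_of_ne (ne_of_mem_of_not_mem hb ha)]
      have hMa : M' a = table a M ρ e T := by
        rw [h2 a (Or.inl (by simp [banks])), Function.update_self]
      refine ⟨ρ', M', ?_, ?_, ?_, ?_⟩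
      · rintro y (hy | hy)
        · exact hρ' y hy
        · exact h1 y (Or.inr fun st hst => hy st (List.mem_cons_of_mem _ hst))
      · rintro b (hb | hb)
        · exact hM' b hb
        · have hba : b ≠ a := by
            have := hb (fill a x e) List.mem_cons_self
            simpa [banks] using this
          rw [h2 b (Or.inr fun st hst => hb st (List.mem_cons_of_mem _ hst)),
            Function.update_of_ne hba]
      · intro st hst
        rcases List.mem_cons.1 hst with rfl | hst
        · constructor
          · intro z hz
            rw [hρ' x hx] at hz
            rw [hMa, table_eq ha he M ρ (show z < T by omega)]
            refine Fml.eval_congr he ?_ ?_ ?_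
            · intro b hb
              rw [hM' b hb, Function.update_of_ne (ne_of_mem_of_not_mem hb ha)]
            · intro _ w _ _
              rw [Function.update_self, hMa]
            · intro y hy
              by_cases h : y = 100
              · subst h; simp
              · rw [Function.update_of_ne h, Function.update_of_ne h]
                exact (hρ' y (hy.resolve_right (by simpa using h))).symm
          · intro z hz
            rw [hρ' x hx] at hz
            rw [hMa, table_of_not]
            omega
        · exact h3 st hst
      · intro m hm hρb hMb s hs hsr
        obtain ⟨c, s', r1, r2, r3, r5⟩ := fill_run (x := x) hDr ha hx he hm (ρ := ρ)
          (fun y hy => by rw [← hρ' y hy]; exact hρb y) s (by rw [hs, hM0 a ha]) (by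
            intro b z
            rw [hs]
            by_cases hba : b = a
            · subst hba; rw [Function.update_self, ← hMa]; exact hMb b z
            · rw [Function.update_of_ne hba]
              by_cases hb : b ∈ Db
              · rw [← hM' b hb]; exact hMb b z
              · rw [hM0 b hb]; simp) hsr
        rw [hs] at r2
        obtain ⟨c', s'', r1', r2', r3'⟩ := h4 m hm hρb hMb s' r2 (by simpa [regs] using r3)
        refine ⟨_, _, r1.seq r1', r2', ?_⟩
        have hs1 : (fill a x e).steps ρ = (fill a x e).steps ρ' := by
          simp only [steps, Fml.steps_congr he fun y hy => (hρ' y hy).symm, hρ' x hx]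
        rw [hs1] at r5
        exact Nat.add_le_add r5 r3'

end Stmt

end RAM

namespace RAM.Fml

/-- Evaluation rules. -/
theorem eval_rules (a : ℕ) (M : ℕ → ℤ → ℤ) (ρ : ℕ → ℤ) :
    (∀ e f : Fml, (e + f).eval a M ρ = e.eval a M ρ + f.eval a M ρ) ∧
    (∀ e f : Fml, (e - f).eval a M ρ = e.eval a M ρ - f.eval a M ρ) ∧
    (∀ e f : Fml, (e * f).eval a M ρ = e.eval a M ρ * f.eval a M ρ) ∧
    (∀ e f : Fml, (e / f).eval a M ρ = e.eval a M ρ / f.eval a M ρ) ∧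
    (∀ e f : Fml, (e % f).eval a M ρ = e.eval a M ρ % f.eval a M ρ) ∧
    (∀ z, (const z).eval a M ρ = z) ∧ (0 : Fml).eval a M ρ = 0 ∧ (1 : Fml).eval a M ρ = 1 ∧
    (2 : Fml).eval a M ρ = 2 ∧ (3 : Fml).eval a M ρ = 3 ∧ (∀ x, (var x).eval a M ρ = ρ x) ∧
    (∀ b i, (get b i).eval a M ρ = M b (i.eval a M ρ)) ∧
    (∀ i, (self i).eval a M ρ =
      if 0 ≤ i.eval a M ρ ∧ i.eval a M ρ < ρ 100 then M a (i.eval a M ρ) else 0) ∧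
    (∀ c p q, (pos c p q).eval a M ρ =
      if 0 < c.eval a M ρ then p.eval a M ρ else q.eval a M ρ) ∧
    (∀ x v e, (sum x v e).eval a M ρ =
      ∑ y ∈ Finset.range (ρ x).toNat, e.eval a M (Function.update ρ v (y : ℤ))) ∧
    (∀ v e f, (bind v e f).eval a M ρ = f.eval a M (Function.update ρ v (e.eval a M ρ))) :=
  ⟨fun _ _ => rfl, fun _ _ => rfl, fun _ _ => rfl, fun _ _ => rfl, fun _ _ => rfl, fun _ => rfl,
    rfl, rfl, rfl, rfl, fun _ => rfl, fun _ _ => rfl, fun _ => rfl, fun _ _ _ => rfl,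
    fun _ _ _ => rfl, fun _ _ _ => rfl⟩

end RAM.Fml

namespace RoPE.Alg

open RAM RAM.Fml

/-- The index of the current cell. -/
abbrev z : Fml := var 100

/-- Binary length. -/
def fSize : Fml := pos z (1 + self (z / 2)) 0

/-- Powers of `c`. -/
def fPow (c : Fml) : Fml := pos z (c * self (z - 1)) 1

def fFact : Fml := pos z (z * self (z - 1)) 1

/-- Number of `y < x` with `y ^ 2 < x`. -/
def fRoot : Fml := sum 2 101 (pos (var 2 - var 101 * var 101) 1 0)

/-- Scaled and rounded entries of the product of the matrices in the banks `a` and `x`. -/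
def fProj (a x : ℕ) : Fml :=
  bind 101 (z / var 1) (bind 102 (z % var 1) (sum 1 103
    ((var 13 * get a (var 101 * var 1 + var 103) * get x (var 103 * var 1 + var 102)) /
      (get (a + 8) (var 101 * var 1 + var 103) * get (x + 8) (var 103 * var 1 + var 102)))))

/-- Running maximum of absolute values. -/
def fMax (b : ℕ) : Fml :=
  bind 101 (get b z) (bind 102 (pos (var 101) (var 101) (0 - var 101))
    (pos (var 102 - self (z - 1)) (var 102) (self (z - 1))))

def fRadius (K : ℕ) : Fml :=
  const K * (get 28 (var 15 - 1) / var 13 + 1) * (get 29 (var 15 - 1) / var 13 + 1) + 1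

/-- Degree of the Taylor polynomial. -/
def fDegree : Fml := sum 17 101 (pos (get 31 (var 101) * var 13 - get 30 (var 101)) 1 0)

def fNonzero : Fml := self (z - var 14) + pos (get 7 z * get 7 z) 1 0

def fFlag : Fml := pos (get 32 (var 23 + z)) 1 0

/-- Numbers of monomials of given degree in the first few variables. -/
def fCount : Fml :=
  bind 101 (z / var 20) (bind 102 (z % var 20)
    (pos (var 101) (self (z - var 20) + get 33 (var 101 - 1) * pos (var 102) (self (z - 1)) 0)
      (pos (var 102) 0 1)))

/-- How a monomial arises: `0` unused cell, `1` monomial in fewer variables, `2` multiple of the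
last variable, `3` the constant monomial. -/
def fKind : Fml :=
  bind 101 (z / var 26) (bind 102 ((z % var 26) / var 25) (bind 103 (z % var 25)
    (pos (var 101)
      (pos (get 34 ((var 101 - 1) * var 20 + var 102) - var 103) 1
        (pos (get 34 (var 101 * var 20 + var 102) - var 103) 2 0))
      (pos (get 34 (var 102) - var 103) 3 0))))

/-- The monomial from which a monomial arises. -/
def fSource : Fml :=
  bind 101 (z / var 26) (bind 102 ((z % var 26) / var 25)
    (pos (get 35 z - 1) (z - var 25 - get 34 ((var 101 - 1) * var 20 + var 102)) (z - var 26)))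

def byKind (P k₀ k₁ k₂ k₃ : Fml) : Fml :=
  pos (get 35 P) (pos (get 35 P - 1) (pos (get 35 P - 2) k₃ k₂) k₁) k₀

/-- Exponent of the last variable. -/
def fMult : Fml := byKind z 0 0 (self (get 36 z) + 1) 0

def fChoose (g m : Fml) : Fml := get 30 g / (get 30 m * get 30 (g - m))

def fBase : Fml :=
  bind 102 ((z % var 26) / var 25) (bind 104 (get 36 z) (bind 105 (get 37 (var 104))
    (byKind z 0 (self (var 104) * fChoose (var 102) (var 105)) (self (var 104)) 1)))

/-- Values of the monomials, modulo `F`. -/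
def fFeature (len : ℕ) (c : Fml) : Fml :=
  bind 101 (z / var len) (bind 102 (z % var len) (bind 103 (get 36 (var 101))
    (bind 104 (var 101 / var 26) (byKind (var 101) 0 (self (var 103 * var len + var 102))
      ((self (var 103 * var len + var 102) * c) % var 12) 1))))

def fWeight : Fml := (var 13 * get 7 z) / get 15 z

def fWeightExt : Fml :=
  bind 101 (z / var 21) (bind 102 (z % var 21)
    (pos (var 14 - var 101) (get 41 (var 102 * var 14 + var 101)) (var 13)))

def fValueExt : Fml :=
  bind 101 (z / var 0) (bind 102 (z % var 0) (bind 103 (var 101 / (var 1 + 1))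
    (bind 104 (var 101 % (var 1 + 1))
      (pos (var 1 - var 103) ((var 13 * get 1 (var 102 * var 1 + var 103)) /
          get 9 (var 102 * var 1 + var 103)) (var 13) *
        pos (var 1 - var 104) (get 27 (var 102 * var 1 + var 104)) (var 13)))))

/-- Position in `{0, …, n-1}` of a group element, or `-1`. -/
def fPosition : Fml :=
  pos (sum 3 101 (pos ((z / get 23 (var 101)) % var 6 - var 5 + 1) 1 0)) (0 - 1)
    (sum 3 101 (((z / get 23 (var 101)) % var 6) * get 22 (var 101)))

/-- Difference of positions that a group element stands for. -/
def fOffset : Fml :=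
  sum 3 101 (bind 102 ((z / get 23 (var 101)) % var 6)
    (pos (var 5 - var 102) (var 102) (var 102 - var 6) * get 22 (var 101)))

/-- Group element of a position. -/
def fEmbed : Fml := sum 3 101 (((z / get 22 (var 101)) % var 5) * get 23 (var 101))

/-- Fourier transform, one digit after the other. -/
def fFourier (σ : ℤ) (base : Fml) : Fml :=
  bind 101 (z % var 8) (bind 102 ((z / var 8) % var 7) (pos (var 102)
    (bind 103 (get 23 (var 102 - 1)) (bind 104 ((var 101 / var 103) % var 6)
      ((sum 6 105 (get 48 ((const σ * var 104 * var 105) % var 6) *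
        self (z - var 8 + (var 105 - var 104) * var 103))) % var 12)))
    base))

def fWeightInput : Fml :=
  bind 106 (z / var 34) (bind 107 (var 106 / (var 14 + 1)) (bind 108 (var 106 % (var 14 + 1))
    (bind 109 (get 46 (var 101)) (pos (var 109 + var 0) (pos (var 0 - var 109)
      ((get 43 ((var 14 * var 26 + var 107) * var 21 + (var 109 + var 0 - 1)) *
        get 42 (var 108 * var 21 + (var 109 + var 0 - 1))) % var 12) 0) 0))))

def fValueInput : Fml :=
  bind 106 (z / var 34) (bind 107 (var 106 / var 31) (bind 108 (var 106 % var 31)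
    (bind 109 (get 45 (var 101)) (pos (var 109 + 1) (pos (var 0 - var 109)
      ((get 40 ((var 14 * var 26 + var 107) * var 0 + var 109) *
        get 44 (var 108 * var 0 + var 109)) % var 12) 0) 0))))

def fProductInput : Fml :=
  bind 106 (z / var 34) (bind 107 (var 106 / var 38) (bind 108 (var 106 % var 38)
    ((get 49 (((var 107 * (var 14 + 1) + var 108 / var 31) * var 7 + var 3) * var 8 + var 101) *
      get 50 (((var 107 * var 31 + var 108 % var 31) * var 7 + var 3) * var 8 + var 101)) %
        var 12)))

/-- The sums `∑ j, P(z i j) w (i - j) v j`, scaled to integers. -/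
def fSums : Fml :=
  bind 101 (z / var 0) (bind 102 (z % var 0) (bind 103 (get 47 (var 102))
    (bind 104 ((sum 26 105 (bind 106 (var 14 * var 26 + var 105) (bind 107 (var 105 / var 25)
      ((get 30 (var 19) / get 30 (var 107)) *
        (get 38 (var 106) * fChoose (var 107) (get 37 (var 106))) * get 52 (var 19 - var 107) *
        get 39 (var 106 * var 0 + var 102) *
        get 51 (((var 105 * var 38 + var 101) * var 7 + var 3) * var 8 + var 103)))) *
          var 41) % var 12)
      (pos (2 * var 104 - var 12) (var 104 - var 12) (var 104)))))

def fSumAt (κ b c i : Fml) : Fml := get 53 ((κ * var 31 + b * (var 1 + 1) + c) * var 0 + i)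

/-- Partial sums of the entries of the gradient. -/
def fGradient : Fml :=
  bind 101 (z / var 42) (bind 102 (z % var 42) (bind 103 (var 102 / (var 1 * var 14))
    (bind 104 ((var 102 / var 14) % var 1) (bind 105 (var 102 % var 14)
    (bind 106 (fSumAt (var 14) (var 1) (var 1) (var 101))
    (bind 107 (fSumAt (var 105) (var 104) (var 1) (var 101))
    (self (z - var 42) + sum 1 108
      (bind 109 (fSumAt (var 14) (var 1) (var 108) (var 101))
      (bind 110 (fSumAt (var 105) (var 104) (var 108) (var 101))
        ((var 13 * get 0 (var 101 * var 1 + var 103) *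
          (var 109 * get 11 (var 101 * var 1 + var 108) -
            get 3 (var 101 * var 1 + var 108) * var 106) *
          (var 110 * var 106 - var 109 * var 107)) /
        (get 8 (var 101 * var 1 + var 103) * get 11 (var 101 * var 1 + var 108) *
          var 106 * var 106 * var 106 * var 1)))))))))))

open Stmt in
/-- The algorithm. -/
def prog (K C₁ C₂ C₃ : ℕ) : List Stmt :=
  [fill 20 0 fSize, param 2 (1 + get 20 (var 0 / 2)), param 3 fRoot, param 4 (var 2 + 1),
   fill 21 4 (fPow 2), param 5 (get 21 (var 3)), param 6 (2 * var 5), param 7 (var 3 + 1),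
   fill 22 7 (fPow (var 5)), fill 23 7 (fPow (var 6)), param 8 (get 23 (var 3)),
   param 9 (const C₁ * var 2), param 33 (const C₃ * var 2 * var 2), param 10 (var 5 * var 33),
   param 11 (2 * var 10 + 1), fill 24 11 (fPow 2), param 12 (get 24 (var 10) + 1),
   param 13 (get 24 (var 9)), param 14 (var 1 * var 1), param 15 (var 0 * var 1),
   fill 25 15 (fProj 0 4), fill 26 15 (fProj 1 5), fill 27 15 (fProj 2 6),
   fill 28 15 (fMax 25), fill 29 15 (fMax 26), param 16 (fRadius K),
   param 17 (const C₂ * var 2), param 18 (var 17 + 1), fill 30 18 fFact,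
   fill 31 18 (fPow (var 16)), param 19 fDegree, param 20 (var 19 + 1),
   param 21 (2 * var 0 - 1), param 22 (var 21 * var 14), fill 32 22 fNonzero,
   param 23 ((var 21 - 1) * var 14), fill 33 14 fFlag, param 24 ((var 14 + 1) * var 20),
   fill 34 24 fCount, param 25 (sum 20 101 (get 34 (var 14 * var 20 + var 101))),
   param 26 (var 20 * var 25), param 27 ((var 14 + 1) * var 26), fill 35 27 fKind,
   fill 36 27 fSource, fill 37 27 fMult, fill 38 27 fBase, param 28 (var 27 * var 0),
   fill 39 28 (fFeature 0 (get 25 (var 102 * var 1 + (var 104 - 1) / var 1))),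
   fill 40 28 (fFeature 0 (get 26 (var 102 * var 1 + (var 104 - 1) % var 1))),
   fill 41 22 fWeight, param 29 ((var 14 + 1) * var 21), fill 42 29 fWeightExt,
   param 30 (var 27 * var 21),
   fill 43 30 (fFeature 21 (get 42 ((var 104 - 1) * var 21 + var 102))),
   param 31 ((var 1 + 1) * (var 1 + 1)), param 32 (var 31 * var 0), fill 44 32 fValueExt,
   fill 45 8 fPosition, fill 46 8 fOffset, fill 47 0 fEmbed,
   fill 48 6 (get 24 (var 33 * z) % var 12), param 34 (var 7 * var 8),
   param 35 (var 26 * (var 14 + 1) * var 34), fill 49 35 (fFourier 1 fWeightInput),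
   param 36 (var 26 * var 31 * var 34), fill 50 36 (fFourier 1 fValueInput),
   param 38 ((var 14 + 1) * var 31), param 37 (var 26 * var 38 * var 34),
   fill 51 37 (fFourier (-1) fProductInput), param 39 (var 38 * var 0),
   param 40 (var 1 * var 13 * var 13 * var 13), fill 52 20 (fPow (var 40)),
   param 41 (get 24 (2 * var 10 - var 3 * var 7)), fill 53 39 fSums,
   param 42 (var 14 * var 14), param 43 (var 0 * var 42), fill 54 43 fGradient,
   fill 16 42 (get 54 (var 43 - var 42 + z)), fill 17 42 (var 13)]

def inputBanks : List ℕ := [0, 1, 2, 3, 4, 5, 6, 7, 8, 9, 10, 11, 12, 13, 14, 15]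

theorem prog_wf (K C₁ C₂ C₃ : ℕ) :
    Stmt.wfList [0, 1] inputBanks (prog K C₁ C₂ C₃) = true := by
  rfl

end RoPE.Alg

namespace RoPE.Alg

open RAM RAM.Fml

/-- The least `s` with `l ≤ s ^ 2`. -/
def root (l : ℕ) : ℕ := ((Finset.range l).filter fun x => x * x < l).card

theorem root_le (l : ℕ) : root l ≤ l := by
  simpa [root] using Finset.card_filter_le (Finset.range l) fun x => x * x < l

theorem filter_root (l : ℕ) : (Finset.range l).filter (fun x => x * x < l) =
    Finset.range (root l) := by
  have key : ∃ t, (Finset.range l).filter (fun x => x * x < l) = Finset.range t := by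
    have hex : ∃ t, l ≤ t * t := ⟨l, by nlinarith⟩
    refine ⟨Nat.find hex, ?_⟩
    ext x
    simp only [Finset.mem_filter, Finset.mem_range]
    constructor
    · rintro ⟨_, h⟩
      by_contra h'
      have h1 := Nat.find_spec hex
      have : Nat.find hex * Nat.find hex ≤ x * x := Nat.mul_self_le_mul_self (by omega)
      omega
    · intro h
      have h1 := Nat.find_min hex h
      exact ⟨by nlinarith, by omega⟩
  obtain ⟨t, ht⟩ := key
  rw [root, ht, Finset.card_range]

theorem le_root_sq (l : ℕ) : l ≤ root l * root l := by
  by_contra h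
  push Not at h
  have : root l ∈ (Finset.range l).filter fun x => x * x < l := by
    simp only [Finset.mem_filter, Finset.mem_range]
    exact ⟨by nlinarith, h⟩
  rw [filter_root] at this
  simp at this

theorem root_sq_le {l : ℕ} (hl : 1 ≤ l) : root l * root l + 2 ≤ l + 2 * root l := by
  have h0 : 0 ∈ (Finset.range l).filter fun x => x * x < l := by
    simp only [Finset.mem_filter, Finset.mem_range]; omega
  rw [filter_root, Finset.mem_range] at h0
  have : root l - 1 ∈ (Finset.range l).filter fun x => x * x < l := by
    rw [filter_root, Finset.mem_range]; omega
  simp only [Finset.mem_filter, Finset.mem_range] at this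
  obtain ⟨t, ht⟩ : ∃ t, root l = t + 1 := ⟨root l - 1, by omega⟩
  rw [ht] at this ⊢
  simp only [Nat.add_sub_cancel] at this
  nlinarith

/-- Number of digits. -/
abbrev dig (n : ℕ) : ℕ := root n.size
/-- Base of the digits of positions. -/
abbrev base (n : ℕ) : ℕ := 2 ^ dig n
/-- Order of the cyclic factors of the group. -/
abbrev ord (n : ℕ) : ℕ := 2 * base n
/-- Exponent of the root of unity. -/
abbrev rootExp (C₃ n : ℕ) : ℕ := C₃ * n.size * n.size
/-- Exponent of the modulus. -/
abbrev modExp (C₃ n : ℕ) : ℕ := base n * rootExp C₃ n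
/-- The modulus. -/
abbrev modulus (C₃ n : ℕ) : ℕ := 2 ^ modExp C₃ n + 1
/-- The precision. -/
abbrev prec (C₁ n : ℕ) : ℕ := C₁ * n.size

theorem idx_div {i k d : ℕ} (h : k < d) : ((i : ℤ) * d + k) / d = i := by
  rw [add_comm, Int.add_mul_ediv_right _ _ (by omega), Int.ediv_eq_zero_of_lt (by omega) (by omega),
    zero_add]

theorem idx_mod {i k d : ℕ} (h : k < d) : ((i : ℤ) * d + k) % d = k := by
  rw [add_comm, Int.add_mul_emod_self_right, Int.emod_eq_of_lt (by omega) (by omega)]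

theorem idx_lt {i k d n : ℕ} (hi : i < n) (hk : k < d) : i * d + k < n * d := by
  have : (i + 1) * d ≤ n * d := Nat.mul_le_mul_right _ hi
  nlinarith

theorem self_pred {f : ℤ → ℤ} {z : ℕ} (hz : 0 < z) :
    (if 0 ≤ (z : ℤ) - 1 ∧ (z : ℤ) - 1 < z then f ((z : ℤ) - 1) else 0) = f ((z - 1 : ℕ) : ℤ) := by
  rw [if_pos (by omega)]
  congr 1
  omega

/-- The equations of the algorithm. -/
structure Sys (K C₁ C₂ C₃ : ℕ) {n d : ℕ} (I : Instance n d) (ρ : ℕ → ℤ) (M : ℕ → ℤ → ℤ) :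
    Prop where
  holds : ∀ st ∈ prog K C₁ C₂ C₃, st.Holds ρ M
  input : ∀ b ∈ inputBanks, M b = I.input.mem b
  pos : 0 < n
  le : C₁ ≤ C₃
  r0 : ρ 0 = n
  r1 : ρ 1 = d

namespace Sys

variable {K C₁ C₂ C₃ n d : ℕ} {I : Instance n d} {ρ : ℕ → ℤ} {M : ℕ → ℤ → ℤ}

theorem fillEq (S : Sys K C₁ C₂ C₃ I ρ M) {a x : ℕ} {e : Fml}
    (h : Stmt.fill a x e ∈ prog K C₁ C₂ C₃) {T : ℕ} (hx : ρ x = T) {z : ℕ} (hz : z < T) :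
    M a z = e.eval a M (Function.update ρ 100 (z : ℤ)) :=
  (S.holds _ h).1 z (by rw [hx]; exact_mod_cast hz)

theorem paramEq (S : Sys K C₁ C₂ C₃ I ρ M) {x : ℕ} {e : Fml}
    (h : Stmt.param x e ∈ prog K C₁ C₂ C₃) : ρ x = e.eval 0 M ρ := S.holds _ h

theorem powEq (S : Sys K C₁ C₂ C₃ I ρ M) {a x : ℕ} {c : Fml} {C : ℤ}
    (h : Stmt.fill a x (fPow c) ∈ prog K C₁ C₂ C₃) (hc : ∀ z, c.eval a M (Function.update ρ 100 z) = C)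
    {T : ℕ} (hx : ρ x = T) : ∀ z : ℕ, z < T → M a z = C ^ z := by
  intro z
  induction z with
  | zero =>
    intro hz
    rw [S.fillEq h hx hz]
    simp [fPow, eval_rules]
  | succ z ih =>
    intro hz
    rw [S.fillEq h hx hz]
    simp only [fPow, eval_rules, Function.update_self, hc]
    rw [self_pred (by omega), if_pos (by omega), Nat.add_sub_cancel, ih (by omega), pow_succ]
    ring

theorem t20 (S : Sys K C₁ C₂ C₃ I ρ M) : ∀ z : ℕ, z < n → M 20 z = z.size := by
  intro z
  induction z using Nat.strong_induction_on with
  | _ z ih =>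
    intro hz
    rw [S.fillEq (a := 20) (e := fSize) (by simp [prog]) S.r0 hz]
    simp only [fSize, eval_rules, Function.update_self]
    by_cases h : z = 0
    · subst h; simp
    · have e1 : (z : ℤ) / 2 = ((z / 2 : ℕ) : ℤ) := by simp
      rw [if_pos (by omega), if_pos (by omega), e1, ih (z / 2) (by omega) (by omega)]
      obtain ⟨w, b, rfl⟩ : ∃ (w : ℕ) (b : Bool), z = Nat.bit b w :=
        ⟨z / 2, Nat.bodd z, by rw [← Nat.div2_val, Nat.bit_bodd_div2]⟩
      rw [Nat.size_bit h]
      have : Nat.bit b w / 2 = w := by rw [← Nat.div2_val, Nat.div2_bit]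
      rw [this]; push_cast; ring

theorem r2 (S : Sys K C₁ C₂ C₃ I ρ M) : ρ 2 = n.size := by
  rw [S.paramEq (x := 2) (e := 1 + get 20 (var 0 / 2)) (by simp [prog])]
  have hn := S.pos
  simp only [eval_rules, S.r0]
  have e1 : (n : ℤ) / 2 = ((n / 2 : ℕ) : ℤ) := by simp
  rw [e1, S.t20 _ (by omega)]
  obtain ⟨w, b, rfl⟩ : ∃ (w : ℕ) (b : Bool), n = Nat.bit b w :=
    ⟨n / 2, Nat.bodd n, by rw [← Nat.div2_val, Nat.bit_bodd_div2]⟩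
  rw [Nat.size_bit (by omega)]
  have : Nat.bit b w / 2 = w := by rw [← Nat.div2_val, Nat.div2_bit]
  rw [this]; push_cast; ring

theorem r3 (S : Sys K C₁ C₂ C₃ I ρ M) : ρ 3 = dig n := by
  rw [S.paramEq (x := 3) (e := fRoot) (by simp [prog])]
  simp only [fRoot, eval_rules, S.r2, Function.update_apply, reduceIte, Nat.reduceEqDiff,
    Int.toNat_natCast]
  rw [dig, root, Finset.card_filter]
  push_cast
  refine Finset.sum_congr rfl fun x _ => if_congr ?_ rfl rfl
  constructor
  · intro h; zify; omega
  · intro h; zify at h; omega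

theorem lg_pos (S : Sys K C₁ C₂ C₃ I ρ M) : 1 ≤ n.size := Nat.size_pos.2 S.pos

theorem r4 (S : Sys K C₁ C₂ C₃ I ρ M) : ρ 4 = (n.size + 1 : ℕ) := by
  rw [S.paramEq (x := 4) (e := var 2 + 1) (by simp [prog])]
  simp only [eval_rules, S.r2]; push_cast; rfl

theorem r5 (S : Sys K C₁ C₂ C₃ I ρ M) : ρ 5 = base n := by
  rw [S.paramEq (x := 5) (e := get 21 (var 3)) (by simp [prog])]
  simp only [eval_rules, S.r3]
  rw [S.powEq (a := 21) (c := 2) (C := 2) (by simp [prog]) (fun _ => rfl) S.r4]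
  · push_cast; rfl
  · exact Nat.lt_succ_of_le (root_le n.size)

theorem r6 (S : Sys K C₁ C₂ C₃ I ρ M) : ρ 6 = ord n := by
  rw [S.paramEq (x := 6) (e := 2 * var 5) (by simp [prog])]
  simp only [eval_rules, S.r5]; push_cast; rfl

theorem r7 (S : Sys K C₁ C₂ C₃ I ρ M) : ρ 7 = (dig n + 1 : ℕ) := by
  rw [S.paramEq (x := 7) (e := var 3 + 1) (by simp [prog])]
  simp only [eval_rules, S.r3]; push_cast; rfl

theorem t22 (S : Sys K C₁ C₂ C₃ I ρ M) : ∀ t : ℕ, t < dig n + 1 → M 22 t = (base n : ℤ) ^ t :=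
  S.powEq (a := 22) (c := var 5) (by simp [prog])
    (fun z => by simp only [eval_rules, Function.update_apply, reduceIte, Nat.reduceEqDiff, S.r5])
    S.r7

theorem t23 (S : Sys K C₁ C₂ C₃ I ρ M) : ∀ t : ℕ, t < dig n + 1 → M 23 t = (ord n : ℤ) ^ t :=
  S.powEq (a := 23) (c := var 6) (by simp [prog])
    (fun z => by simp only [eval_rules, Function.update_apply, reduceIte, Nat.reduceEqDiff, S.r6])
    S.r7

theorem r8 (S : Sys K C₁ C₂ C₃ I ρ M) : ρ 8 = (ord n ^ dig n : ℕ) := by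
  rw [S.paramEq (x := 8) (e := get 23 (var 3)) (by simp [prog])]
  simp only [eval_rules, S.r3]
  rw [S.t23 _ (by omega)]; push_cast; rfl

theorem r9 (S : Sys K C₁ C₂ C₃ I ρ M) : ρ 9 = prec C₁ n := by
  rw [S.paramEq (x := 9) (e := const C₁ * var 2) (by simp [prog])]
  simp only [eval_rules, S.r2]; push_cast; rfl

theorem r33 (S : Sys K C₁ C₂ C₃ I ρ M) : ρ 33 = rootExp C₃ n := by
  rw [S.paramEq (x := 33) (e := const C₃ * var 2 * var 2) (by simp [prog])]
  simp only [eval_rules, S.r2]; push_cast; rfl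

theorem r10 (S : Sys K C₁ C₂ C₃ I ρ M) : ρ 10 = modExp C₃ n := by
  rw [S.paramEq (x := 10) (e := var 5 * var 33) (by simp [prog])]
  simp only [eval_rules, S.r5, S.r33]; push_cast; rfl

theorem r11 (S : Sys K C₁ C₂ C₃ I ρ M) : ρ 11 = (2 * modExp C₃ n + 1 : ℕ) := by
  rw [S.paramEq (x := 11) (e := 2 * var 10 + 1) (by simp [prog])]
  simp only [eval_rules, S.r10]; push_cast; rfl

theorem t24 (S : Sys K C₁ C₂ C₃ I ρ M) : ∀ t : ℕ, t < 2 * modExp C₃ n + 1 → M 24 t = 2 ^ t :=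
  S.powEq (a := 24) (c := 2) (by simp [prog]) (fun _ => rfl) S.r11

theorem r12 (S : Sys K C₁ C₂ C₃ I ρ M) : ρ 12 = modulus C₃ n := by
  rw [S.paramEq (x := 12) (e := get 24 (var 10) + 1) (by simp [prog])]
  simp only [eval_rules, S.r10]
  rw [S.t24 _ (by omega)]; push_cast; rfl

theorem prec_le (S : Sys K C₁ C₂ C₃ I ρ M) : prec C₁ n ≤ modExp C₃ n := by
  have h1 := S.lg_pos
  have h2 : 1 ≤ base n := Nat.one_le_two_pow
  have h3 := S.le
  calc C₁ * n.size ≤ C₃ * n.size := by gcongr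
    _ ≤ C₃ * n.size * n.size := Nat.le_mul_of_pos_right _ h1
    _ ≤ _ := Nat.le_mul_of_pos_left _ h2

theorem r13 (S : Sys K C₁ C₂ C₃ I ρ M) : ρ 13 = 2 ^ prec C₁ n := by
  rw [S.paramEq (x := 13) (e := get 24 (var 9)) (by simp [prog])]
  simp only [eval_rules, S.r9]
  have := S.prec_le
  rw [S.t24 _ (by omega)]

theorem r14 (S : Sys K C₁ C₂ C₃ I ρ M) : ρ 14 = (d * d : ℕ) := by
  rw [S.paramEq (x := 14) (e := var 1 * var 1) (by simp [prog])]
  simp only [eval_rules, S.r1]; push_cast; rfl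

theorem r15 (S : Sys K C₁ C₂ C₃ I ρ M) : ρ 15 = (n * d : ℕ) := by
  rw [S.paramEq (x := 15) (e := var 0 * var 1) (by simp [prog])]
  simp only [eval_rules, S.r0, S.r1]; push_cast; rfl

theorem projEq (S : Sys K C₁ C₂ C₃ I ρ M) {c a x : ℕ}
    (h : Stmt.fill c 15 (fProj a x) ∈ prog K C₁ C₂ C₃) {i k : ℕ} (hi : i < n) (hk : k < d) :
    M c ((i : ℤ) * d + k) = ∑ j ∈ Finset.range d,
      (2 ^ prec C₁ n * M a ((i : ℤ) * d + j) * M x ((j : ℤ) * d + k)) /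
        (M (a + 8) ((i : ℤ) * d + j) * M (x + 8) ((j : ℤ) * d + k)) := by
  have := S.fillEq h S.r15 (idx_lt hi hk)
  push_cast at this
  rw [this]
  simp only [fProj, eval_rules, Function.update_apply, reduceIte, Nat.reduceEqDiff, S.r1, S.r13,
    Int.toNat_natCast, idx_div hk, idx_mod hk]

theorem maxEq (S : Sys K C₁ C₂ C₃ I ρ M) {c b : ℕ}
    (h : Stmt.fill c 15 (fMax b) ∈ prog K C₁ C₂ C₃) :
    0 ≤ M c ((n * d : ℕ) - 1) ∧ (∀ z < n * d, |M b (z : ℤ)| ≤ M c ((n * d : ℕ) - 1)) ∧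
      ∀ B : ℤ, 0 ≤ B → (∀ z < n * d, |M b (z : ℤ)| ≤ B) → M c ((n * d : ℕ) - 1) ≤ B := by
  have key : ∀ z : ℕ, z < n * d → 0 ≤ M c z ∧ (∀ y ≤ z, |M b (y : ℤ)| ≤ M c z) ∧
      ∃ y ≤ z, M c z = |M b (y : ℤ)| := by
    intro z
    induction z with
    | zero =>
      intro hz
      have := S.fillEq h S.r15 hz
      simp only [fMax, eval_rules, Function.update_apply, reduceIte, Nat.reduceEqDiff,
        Nat.cast_zero] at this
      have h0 : M c 0 = |M b 0| := by
        rw [this]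
        rcases le_or_gt (M b 0) 0 with h | h
        · rw [abs_of_nonpos h]; split_ifs <;> omega
        · rw [abs_of_pos h]; split_ifs <;> omega
      refine ⟨by simp [h0], fun y hy => ?_, 0, le_rfl, by simpa using h0⟩
      obtain rfl : y = 0 := by omega
      simp [h0]
    | succ z ih =>
      intro hz
      obtain ⟨h1, h2, y0, hy0, h3⟩ := ih (by omega)
      have := S.fillEq h S.r15 hz
      simp only [fMax, eval_rules, Function.update_apply, reduceIte, Nat.reduceEqDiff] at this
      rw [self_pred (by omega), Nat.add_sub_cancel] at this
      have h0 : M c (z + 1 : ℕ) = max |M b (z + 1 : ℕ)| (M c z) := by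
        rw [this]
        rcases le_or_gt (M b (z + 1 : ℕ)) 0 with h | h
        · rw [abs_of_nonpos h, max_def]; split_ifs <;> omega
        · rw [abs_of_pos h, max_def]; split_ifs <;> omega
      refine ⟨by rw [h0]; exact le_max_of_le_right h1, fun y hy => ?_, ?_⟩
      · rw [h0]
        rcases Nat.le_succ_iff.1 hy with hy | rfl
        · exact le_max_of_le_right (h2 y hy)
        · exact le_max_left _ _
      · rcases max_choice |M b (z + 1 : ℕ)| (M c z) with hm | hm
        · exact ⟨z + 1, le_rfl, by rw [h0, hm]⟩
        · exact ⟨y0, by omega, by rw [h0, hm, h3]⟩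
  rcases Nat.eq_zero_or_pos (n * d) with h0 | h0
  · have : M c ((n * d : ℕ) - 1) = 0 := (S.holds _ h).2 _ (Or.inl (by omega))
    rw [this, h0]
    exact ⟨le_rfl, by simp, fun B hB _ => hB⟩
  · have e1 : ((n * d : ℕ) : ℤ) - 1 = ((n * d - 1 : ℕ) : ℤ) := by omega
    rw [e1]
    obtain ⟨h1, h2, y0, hy0, h3⟩ := key (n * d - 1) (by omega)
    exact ⟨h1, fun y hy => h2 y (by omega), fun B _ hB => by rw [h3]; exact hB y0 (by omega)⟩

theorem r16 (S : Sys K C₁ C₂ C₃ I ρ M) : ρ 16 =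
    K * (M 28 ((n * d : ℕ) - 1) / 2 ^ prec C₁ n + 1) *
      (M 29 ((n * d : ℕ) - 1) / 2 ^ prec C₁ n + 1) + 1 := by
  rw [S.paramEq (x := 16) (e := fRadius K) (by simp [prog])]
  simp only [fRadius, eval_rules, S.r13, S.r15]

theorem r16_pos (S : Sys K C₁ C₂ C₃ I ρ M) : 0 < ρ 16 := by
  have h1 := (S.maxEq (c := 28) (b := 25) (by simp [prog])).1
  have h2 := (S.maxEq (c := 29) (b := 26) (by simp [prog])).1
  rw [S.r16]
  positivity

/-- The radius of the disc on which the exponential is approximated. -/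
theorem r16_nat (S : Sys K C₁ C₂ C₃ I ρ M) : ρ 16 = ((ρ 16).toNat : ℕ) := by
  have := S.r16_pos; omega

theorem r17 (S : Sys K C₁ C₂ C₃ I ρ M) : ρ 17 = (C₂ * n.size : ℕ) := by
  rw [S.paramEq (x := 17) (e := const C₂ * var 2) (by simp [prog])]
  simp only [eval_rules, S.r2]; push_cast; rfl

theorem r18 (S : Sys K C₁ C₂ C₃ I ρ M) : ρ 18 = (C₂ * n.size + 1 : ℕ) := by
  rw [S.paramEq (x := 18) (e := var 17 + 1) (by simp [prog])]
  simp only [eval_rules, S.r17]; push_cast; rfl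

theorem t30 (S : Sys K C₁ C₂ C₃ I ρ M) :
    ∀ g : ℕ, g < C₂ * n.size + 1 → M 30 g = (g.factorial : ℕ) := by
  intro g
  induction g with
  | zero =>
    intro hz
    rw [S.fillEq (a := 30) (e := fFact) (by simp [prog]) S.r18 hz]
    simp [fFact, eval_rules]
  | succ g ih =>
    intro hz
    rw [S.fillEq (a := 30) (e := fFact) (by simp [prog]) S.r18 hz]
    simp only [fFact, eval_rules, Function.update_self]
    rw [self_pred (by omega), if_pos (by omega), Nat.add_sub_cancel, ih (by omega),
      Nat.factorial_succ]
    push_cast; ring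

theorem t31 (S : Sys K C₁ C₂ C₃ I ρ M) :
    ∀ g : ℕ, g < C₂ * n.size + 1 → M 31 g = (((ρ 16).toNat : ℕ) : ℤ) ^ g :=
  S.powEq (a := 31) (c := var 16) (by simp [prog])
    (fun z => by
      simp only [eval_rules, Function.update_apply, reduceIte, Nat.reduceEqDiff]
      exact S.r16_nat)
    S.r18

end Sys

/-- Number of `g < Q` with `g! < R ^ g * 2 ^ P`. -/
def degree (R P Q : ℕ) : ℕ :=
  ((Finset.range Q).filter fun g => g.factorial < R ^ g * 2 ^ P).card

theorem degree_le (R P Q : ℕ) : degree R P Q ≤ Q := by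
  simpa [degree] using
    Finset.card_filter_le (Finset.range Q) fun g => g.factorial < R ^ g * 2 ^ P

namespace Sys

variable {K C₁ C₂ C₃ n d : ℕ} {I : Instance n d} {ρ : ℕ → ℤ} {M : ℕ → ℤ → ℤ}

theorem r19 (S : Sys K C₁ C₂ C₃ I ρ M) :
    ρ 19 = degree (ρ 16).toNat (prec C₁ n) (C₂ * n.size) := by
  rw [S.paramEq (x := 19) (e := fDegree) (by simp [prog])]
  simp only [fDegree, eval_rules, Function.update_apply, reduceIte, Nat.reduceEqDiff,
    S.r17, S.r13, Int.toNat_natCast]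
  rw [degree, Finset.card_filter]
  push_cast
  refine Finset.sum_congr rfl fun g hg => if_congr ?_ rfl rfl
  have hg := Finset.mem_range.1 hg
  rw [S.t30 _ (by omega), S.t31 _ (by omega), sub_pos]
  exact_mod_cast Iff.rfl

end Sys

end RoPE.Alg

namespace RoPE.Alg

open RAM RAM.Fml

open Classical in
/-- Whether the entry `e` of some weight matrix is nonzero. -/
def flag (n d : ℕ) (M : ℕ → ℤ → ℤ) (e : ℕ) : ℕ :=
  if ∃ t < 2 * n - 1, M 7 ((t : ℤ) * (d * d : ℕ) + e) ≠ 0 then 1 else 0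

theorem flag_le (n d : ℕ) (M : ℕ → ℤ → ℤ) (e : ℕ) : flag n d M e ≤ 1 := by
  unfold flag; split_ifs <;> omega

/-- Number of monomials of degree `g` in those of the variables `0, …, e - 1` that are flagged. -/
def cnt (fl : ℕ → ℕ) : ℕ → ℕ → ℕ
  | 0, 0 => 1
  | 0, _ + 1 => 0
  | e + 1, 0 => cnt fl e 0
  | e + 1, g + 1 => cnt fl e (g + 1) + fl e * cnt fl (e + 1) g

theorem cnt_zero_right (fl : ℕ → ℕ) (e : ℕ) : cnt fl e 0 = 1 := by
  induction e with
  | zero => simp [cnt]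
  | succ e ih => simpa [cnt] using ih

theorem cnt_le_succ (fl : ℕ → ℕ) (e g : ℕ) : cnt fl e g ≤ cnt fl (e + 1) g := by
  cases g with
  | zero => simp [cnt]
  | succ g => simp [cnt]

theorem cnt_mono (fl : ℕ → ℕ) (g : ℕ) : Monotone fun e => cnt fl e g :=
  monotone_nat_of_le_succ fun e => cnt_le_succ fl e g

theorem sum_cnt {fl : ℕ → ℕ} (hfl : ∀ e, fl e ≤ 1) (e q : ℕ) :
    ∑ g ∈ Finset.range (q + 1), cnt fl e g =
      (∑ i ∈ Finset.range e, fl i + q).choose q := by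
  induction e generalizing q with
  | zero =>
    rw [Finset.sum_range_succ']
    simp [cnt]
  | succ e ih =>
    rw [Finset.sum_range_succ (fun i => fl i)]
    rcases Nat.le_one_iff_eq_zero_or_eq_one.1 (hfl e) with h | h
    · rw [h, add_zero, ← ih]
      refine Finset.sum_congr rfl fun g _ => ?_
      cases g <;> simp [cnt, h]
    · induction q with
      | zero => simp [cnt_zero_right]
      | succ q ihq =>
        have : ∑ g ∈ Finset.range (q + 1 + 1), cnt fl (e + 1) g =
            ∑ g ∈ Finset.range (q + 1 + 1), cnt fl e g +
              ∑ g ∈ Finset.range (q + 1), cnt fl (e + 1) g := by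
          rw [Finset.sum_range_succ' _ (q + 1), Finset.sum_range_succ' _ (q + 1)]
          simp only [cnt, h, one_mul, Finset.sum_add_distrib]
          ring
        rw [this, ih, ihq, h]
        have e1 : ∑ i ∈ Finset.range e, fl i + 1 + (q + 1) =
          (∑ i ∈ Finset.range e, fl i + 1 + q) + 1 := by ring
        rw [e1, Nat.choose_succ_succ']
        have e2 : ∑ i ∈ Finset.range e, fl i + (q + 1) = ∑ i ∈ Finset.range e, fl i + 1 + q := by
          ring
        rw [e2]; ring

namespace Sys

variable {K C₁ C₂ C₃ n d : ℕ} {I : Instance n d} {ρ : ℕ → ℤ} {M : ℕ → ℤ → ℤ}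

theorem r20 (S : Sys K C₁ C₂ C₃ I ρ M) {q : ℕ} (hq : ρ 19 = q) : ρ 20 = (q + 1 : ℕ) := by
  rw [S.paramEq (x := 20) (e := var 19 + 1) (by simp [prog])]
  simp only [eval_rules, hq]; push_cast; rfl

theorem r21 (S : Sys K C₁ C₂ C₃ I ρ M) : ρ 21 = (2 * n - 1 : ℕ) := by
  rw [S.paramEq (x := 21) (e := 2 * var 0 - 1) (by simp [prog])]
  simp only [eval_rules, S.r0]
  have := S.pos
  omega

theorem r22 (S : Sys K C₁ C₂ C₃ I ρ M) : ρ 22 = ((2 * n - 1) * (d * d) : ℕ) := by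
  rw [S.paramEq (x := 22) (e := var 21 * var 14) (by simp [prog])]
  simp only [eval_rules, S.r21, S.r14]; push_cast; rfl

theorem t32 (S : Sys K C₁ C₂ C₃ I ρ M) {e : ℕ} (he : e < d * d) : ∀ t < 2 * n - 1,
    0 ≤ M 32 ((t : ℤ) * (d * d : ℕ) + e) ∧ M 32 ((t : ℤ) * (d * d : ℕ) + e) ≤ t + 1 ∧
    (0 < M 32 ((t : ℤ) * (d * d : ℕ) + e) ↔ ∃ t' ≤ t, M 7 ((t' : ℤ) * (d * d : ℕ) + e) ≠ 0) := by
  intro t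
  have hsq : ∀ x : ℤ, (0 < x * x ↔ x ≠ 0) := fun x => by
    constructor
    · rintro h rfl; simp at h
    · exact fun h => mul_self_pos.2 h
  induction t with
  | zero =>
    intro ht
    have := S.fillEq (a := 32) (e := fNonzero) (by simp [prog]) S.r22 (idx_lt ht he)
    push_cast at this ⊢
    rw [this]
    simp only [fNonzero, eval_rules, Function.update_apply, reduceIte, Nat.reduceEqDiff, S.r14,
      hsq]
    rw [if_neg (by push_cast; omega)]
    simp only [zero_mul, zero_add, Nat.le_zero, exists_eq_left, Nat.cast_zero]
    split_ifs <;> simp_all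
  | succ t ih =>
    intro ht
    have := S.fillEq (a := 32) (e := fNonzero) (by simp [prog]) S.r22 (idx_lt ht he)
    obtain ⟨h1, h2, h3⟩ := ih (by omega)
    push_cast at this h1 h2 h3 ⊢
    rw [this]
    simp only [fNonzero, eval_rules, Function.update_apply, reduceIte, Nat.reduceEqDiff, S.r14,
      hsq]
    push_cast
    have e1 : ((t : ℤ) + 1) * (d * d) + e - d * d = t * (d * d) + e := by ring
    have hdd : (0 : ℤ) < d * d := by exact_mod_cast (Nat.zero_le _).trans_lt he
    rw [e1, if_pos ⟨by positivity, by nlinarith⟩]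
    have h4 : (∃ t' ≤ t + 1, M 7 ((t' : ℤ) * (d * d) + e) ≠ 0) ↔
        (∃ t' ≤ t, M 7 ((t' : ℤ) * (d * d) + e) ≠ 0) ∨ M 7 (((t : ℤ) + 1) * (d * d) + e) ≠ 0 := by
      constructor
      · rintro ⟨t', h, h'⟩
        rcases Nat.le_succ_iff.1 h with h | rfl
        · exact Or.inl ⟨t', h, h'⟩
        · right; push_cast at h'; exact h'
      · rintro (⟨t', h, h'⟩ | h')
        · exact ⟨t', by omega, h'⟩
        · exact ⟨t + 1, le_rfl, by push_cast; exact h'⟩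
    rw [h4, ← h3]
    split_ifs with h
    · exact ⟨by omega, by omega, fun _ => Or.inr h, fun _ => by omega⟩
    · exact ⟨by omega, by omega, fun _ => Or.inl (by omega), fun h' => by
        have := h'.resolve_right h; omega⟩

theorem r23 (S : Sys K C₁ C₂ C₃ I ρ M) : ρ 23 = ((2 * n - 2) * (d * d) : ℕ) := by
  rw [S.paramEq (x := 23) (e := (var 21 - 1) * var 14) (by simp [prog])]
  simp only [eval_rules, S.r21, S.r14]
  have := S.pos
  have e1 : ((2 * n - 1 : ℕ) : ℤ) - 1 = (2 * n - 2 : ℕ) := by omega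
  rw [e1]; push_cast; rfl

theorem t33 (S : Sys K C₁ C₂ C₃ I ρ M) {e : ℕ} (he : e < d * d) : M 33 e = flag n d M e := by
  have hn := S.pos
  have h' : (∃ t' ≤ 2 * n - 2, M 7 ((t' : ℤ) * (d * d) + e) ≠ 0) ↔
      ∃ t < 2 * n - 1, M 7 ((t : ℤ) * (d * d) + e) ≠ 0 := by
    constructor
    · rintro ⟨t, h1, h2⟩; exact ⟨t, by omega, h2⟩
    · rintro ⟨t, h1, h2⟩; exact ⟨t, by omega, h2⟩
  rw [S.fillEq (a := 33) (e := fFlag) (by simp [prog]) S.r14 he]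
  simp only [fFlag, eval_rules, Function.update_apply, reduceIte, Nat.reduceEqDiff, S.r23]
  push_cast
  obtain ⟨_, _, h⟩ := S.t32 he (2 * n - 2) (by omega)
  push_cast at h
  rw [flag]
  push_cast
  rw [h'] at h
  split_ifs <;> simp_all

theorem r24 (S : Sys K C₁ C₂ C₃ I ρ M) {q : ℕ} (hq : ρ 19 = q) :
    ρ 24 = ((d * d + 1) * (q + 1) : ℕ) := by
  rw [S.paramEq (x := 24) (e := (var 14 + 1) * var 20) (by simp [prog])]
  simp only [eval_rules, S.r14, S.r20 hq]; push_cast; rfl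

theorem t34 (S : Sys K C₁ C₂ C₃ I ρ M) {q : ℕ} (hq : ρ 19 = q) : ∀ e ≤ d * d, ∀ g ≤ q,
    M 34 ((e : ℤ) * (q + 1 : ℕ) + g) = cnt (flag n d M) e g := by
  intro e
  induction e with
  | zero =>
    intro _ g hg
    have := S.fillEq (a := 34) (e := fCount) (by simp [prog]) (S.r24 hq)
      (idx_lt (i := 0) (k := g) (Nat.succ_pos _) (Nat.lt_succ_of_le hg))
    push_cast at this ⊢
    rw [this]
    simp only [fCount, eval_rules, Function.update_apply, reduceIte, Nat.reduceEqDiff, S.r20 hq]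
    have hd := idx_div (i := 0) (Nat.lt_succ_of_le hg)
    have hm := idx_mod (i := 0) (Nat.lt_succ_of_le hg)
    push_cast at hd hm ⊢
    rw [hd, hm, if_neg (by omega)]
    cases g with
    | zero => simp [cnt]
    | succ g => rw [if_pos (by omega)]; simp [cnt]
  | succ e ih =>
    intro he g
    have hidx : ∀ g : ℕ, (((e + 1 : ℕ) : ℤ) * (q + 1 : ℕ) + g) - (q + 1 : ℕ) =
      (e : ℤ) * (q + 1 : ℕ) + g := fun g => by push_cast; ring
    have key : ∀ g ≤ q, M 34 (((e + 1 : ℕ) : ℤ) * (q + 1 : ℕ) + g) =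
        cnt (flag n d M) e g + flag n d M e *
          (if 0 < g then M 34 (((e + 1 : ℕ) : ℤ) * (q + 1 : ℕ) + g - 1) else 0) := by
      intro g hg
      have := S.fillEq (a := 34) (e := fCount) (by simp [prog]) (S.r24 hq)
        (idx_lt (i := e + 1) (k := g) (Nat.lt_succ_of_le he) (Nat.lt_succ_of_le hg))
      rw [Nat.cast_add, Nat.cast_mul] at this
      rw [this]
      simp only [fCount, eval_rules, Function.update_apply, reduceIte, Nat.reduceEqDiff, S.r20 hq,
        idx_div (Nat.lt_succ_of_le hg), idx_mod (Nat.lt_succ_of_le hg), hidx]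
      rw [if_pos (by omega), if_pos ⟨by positivity, by push_cast; nlinarith⟩,
        show ((e + 1 : ℕ) : ℤ) - 1 = e by omega, S.t33 (by omega)]
      have := ih (by omega) g hg
      push_cast at this ⊢
      rw [this]
      congr 2
      by_cases h0 : 0 < g
      · have : (0 : ℤ) ≤ ((e : ℤ) + 1) * (q + 1) := by positivity
        rw [if_pos (by omega), if_pos h0, if_pos ⟨by omega, by omega⟩]
      · rw [if_neg (by omega), if_neg h0]
    induction g with
    | zero =>
      intro hg
      rw [key 0 hg]
      simp [cnt]
    | succ g ihg =>
      intro hg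
      rw [key _ hg, if_pos (by omega)]
      have e1 : (((e + 1 : ℕ) : ℤ) * (q + 1 : ℕ) + (g + 1 : ℕ)) - 1 =
        ((e + 1 : ℕ) : ℤ) * (q + 1 : ℕ) + g := by push_cast; ring
      rw [e1, ihg (by omega)]
      simp [cnt]

theorem r25 (S : Sys K C₁ C₂ C₃ I ρ M) {q : ℕ} (hq : ρ 19 = q) :
    ρ 25 = (∑ i ∈ Finset.range (d * d), flag n d M i + q).choose q := by
  rw [S.paramEq (x := 25) (e := sum 20 101 (get 34 (var 14 * var 20 + var 101))) (by simp [prog]),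
    ← sum_cnt (flag_le n d M)]
  simp only [eval_rules, Function.update_apply, reduceIte, Nat.reduceEqDiff, S.r20 hq, S.r14,
    Int.toNat_natCast]
  push_cast
  refine Finset.sum_congr rfl fun g hg => ?_
  have := S.t34 hq (d * d) le_rfl g (by simpa [Nat.lt_succ_iff] using hg)
  push_cast at this
  exact this

theorem cnt_le (S : Sys K C₁ C₂ C₃ I ρ M) {q : ℕ} (hq : ρ 19 = q) {c : ℕ} (hc : ρ 25 = c)
    {e g : ℕ} (he : e ≤ d * d) (hg : g ≤ q) : cnt (flag n d M) e g ≤ c := by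
  have h1 : c = ∑ g ∈ Finset.range (q + 1), cnt (flag n d M) (d * d) g := by
    have h2 := (S.r25 hq).symm.trans hc
    rw [← sum_cnt (flag_le n d M)] at h2
    exact_mod_cast h2.symm
  rw [h1]
  exact (cnt_mono (flag n d M) g he).trans
    (Finset.single_le_sum (f := fun g => cnt (flag n d M) (d * d) g) (fun _ _ => Nat.zero_le _)
      (by simpa [Nat.lt_succ_iff] using hg))

end Sys

end RoPE.Alg

namespace RoPE.Alg

open RAM RAM.Fml

/-- Place of the `j`-th monomial of degree `g` in the first `e` variables. -/
def place (q c e g j : ℕ) : ℕ := e * ((q + 1) * c) + (g * c + j)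

section place

variable {q c e g j : ℕ}

theorem place_div (hg : g ≤ q) (hj : j < c) :
    ((place q c e g j : ℕ) : ℤ) / ((q + 1) * c : ℕ) = e := by
  rw [place, Nat.cast_add, Nat.cast_mul]
  exact idx_div (idx_lt (Nat.lt_succ_of_le hg) hj)

theorem place_mod_div (hg : g ≤ q) (hj : j < c) :
    ((place q c e g j : ℕ) : ℤ) % ((q + 1) * c : ℕ) / c = g := by
  rw [place, Nat.cast_add, Nat.cast_mul, idx_mod (idx_lt (Nat.lt_succ_of_le hg) hj),
    Nat.cast_add, Nat.cast_mul, idx_div hj]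

theorem place_mod (hj : j < c) : ((place q c e g j : ℕ) : ℤ) % c = j := by
  have : ((place q c e g j : ℕ) : ℤ) = ((e * (q + 1) + g : ℕ) : ℤ) * c + j := by
    rw [place]; push_cast; ring
  rw [this, idx_mod hj]

theorem place_lt {m : ℕ} (he : e < m) (hg : g ≤ q) (hj : j < c) :
    place q c e g j < m * ((q + 1) * c) :=
  idx_lt he (idx_lt (Nat.lt_succ_of_le hg) hj)

end place

namespace Sys

variable {K C₁ C₂ C₃ n d : ℕ} {I : Instance n d} {ρ : ℕ → ℤ} {M : ℕ → ℤ → ℤ}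

theorem r26 (S : Sys K C₁ C₂ C₃ I ρ M) {q c : ℕ} (hq : ρ 19 = q) (hc : ρ 25 = c) :
    ρ 26 = ((q + 1) * c : ℕ) := by
  rw [S.paramEq (x := 26) (e := var 20 * var 25) (by simp [prog])]
  simp only [eval_rules, S.r20 hq, hc]; push_cast; rfl

theorem r27 (S : Sys K C₁ C₂ C₃ I ρ M) {q c : ℕ} (hq : ρ 19 = q) (hc : ρ 25 = c) :
    ρ 27 = ((d * d + 1) * ((q + 1) * c) : ℕ) := by
  rw [S.paramEq (x := 27) (e := (var 14 + 1) * var 26) (by simp [prog])]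
  simp only [eval_rules, S.r14, S.r26 hq hc]; push_cast; rfl

theorem kind_zero (S : Sys K C₁ C₂ C₃ I ρ M) {q c : ℕ} (hq : ρ 19 = q) (hc : ρ 25 = c)
    {g j : ℕ} (hg : g ≤ q) (hj : j < c) :
    M 35 (place q c 0 g j) = if j < cnt (flag n d M) 0 g then 3 else 0 := by
  rw [S.fillEq (a := 35) (e := fKind) (by simp [prog]) (S.r27 hq hc)
    (place_lt (Nat.succ_pos _) hg hj)]
  simp only [fKind, eval_rules, Function.update_apply, reduceIte, Nat.reduceEqDiff, S.r26 hq hc,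
    hc, place_div hg hj, place_mod_div hg hj, place_mod hj]
  have h := S.t34 hq 0 (Nat.zero_le _) g hg
  rw [Nat.cast_zero, zero_mul, zero_add] at h
  rw [h, if_neg (by simp)]
  exact if_congr (by omega) rfl rfl

theorem kind_succ (S : Sys K C₁ C₂ C₃ I ρ M) {q c : ℕ} (hq : ρ 19 = q) (hc : ρ 25 = c)
    {e g j : ℕ} (he : e < d * d) (hg : g ≤ q) (hj : j < c) :
    M 35 (place q c (e + 1) g j) = if j < cnt (flag n d M) e g then 1 else
      if j < cnt (flag n d M) (e + 1) g then 2 else 0 := by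
  rw [S.fillEq (a := 35) (e := fKind) (by simp [prog]) (S.r27 hq hc)
    (place_lt (by omega) hg hj)]
  simp only [fKind, eval_rules, Function.update_apply, reduceIte, Nat.reduceEqDiff, S.r26 hq hc,
    hc, place_div hg hj, place_mod_div hg hj, place_mod hj, S.r20 hq]
  rw [show ((e + 1 : ℕ) : ℤ) - 1 = e by omega, S.t34 hq e he.le g hg, S.t34 hq (e + 1) he g hg,
    if_pos (by omega)]
  exact if_congr (by omega) rfl (if_congr (by omega) rfl rfl)

theorem source_copy (S : Sys K C₁ C₂ C₃ I ρ M) {q c : ℕ} (hq : ρ 19 = q) (hc : ρ 25 = c)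
    {e g j : ℕ} (he : e < d * d) (hg : g ≤ q) (hj : j < cnt (flag n d M) e g) :
    M 36 (place q c (e + 1) g j) = place q c e g j := by
  have hjc : j < c := hj.trans_le (S.cnt_le hq hc he.le hg)
  rw [S.fillEq (a := 36) (e := fSource) (by simp [prog]) (S.r27 hq hc)
    (place_lt (by omega) hg hjc)]
  simp only [fSource, eval_rules, Function.update_apply, reduceIte, Nat.reduceEqDiff, S.r26 hq hc,
    S.kind_succ hq hc he hg hjc, if_pos hj, sub_self, lt_irrefl]
  simp only [place]; push_cast; ring

theorem kind_mul (S : Sys K C₁ C₂ C₃ I ρ M) {q c : ℕ} (hq : ρ 19 = q) (hc : ρ 25 = c)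
    {e g j : ℕ} (he : e < d * d) (hg : g + 1 ≤ q)
    (hj : cnt (flag n d M) e (g + 1) + j < cnt (flag n d M) (e + 1) (g + 1)) :
    M 35 (place q c (e + 1) (g + 1) (cnt (flag n d M) e (g + 1) + j)) = 2 := by
  rw [S.kind_succ hq hc he hg (hj.trans_le (S.cnt_le hq hc he hg)), if_neg (by omega), if_pos hj]

theorem source_mul (S : Sys K C₁ C₂ C₃ I ρ M) {q c : ℕ} (hq : ρ 19 = q) (hc : ρ 25 = c)
    {e g j : ℕ} (he : e < d * d) (hg : g + 1 ≤ q)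
    (hj : cnt (flag n d M) e (g + 1) + j < cnt (flag n d M) (e + 1) (g + 1)) :
    M 36 (place q c (e + 1) (g + 1) (cnt (flag n d M) e (g + 1) + j)) =
      place q c (e + 1) g j := by
  have hjc := hj.trans_le (S.cnt_le hq hc he hg)
  rw [S.fillEq (a := 36) (e := fSource) (by simp [prog]) (S.r27 hq hc)
    (place_lt (by omega) hg hjc)]
  simp only [fSource, eval_rules, Function.update_apply, reduceIte, Nat.reduceEqDiff, S.r26 hq hc,
    S.kind_mul hq hc he hg hj, place_div hg hjc, place_mod_div hg hjc, S.r20 hq, hc]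
  rw [show ((e + 1 : ℕ) : ℤ) - 1 = e by omega, S.t34 hq e he.le _ hg, if_pos (by norm_num)]
  simp only [place]; push_cast; ring

theorem kind_copy (S : Sys K C₁ C₂ C₃ I ρ M) {q c : ℕ} (hq : ρ 19 = q) (hc : ρ 25 = c)
    {e g j : ℕ} (he : e < d * d) (hg : g ≤ q) (hj : j < cnt (flag n d M) e g) :
    M 35 (place q c (e + 1) g j) = 1 := by
  rw [S.kind_succ hq hc he hg (hj.trans_le (S.cnt_le hq hc he.le hg)), if_pos hj]

theorem cnt_pos_left (S : Sys K C₁ C₂ C₃ I ρ M) {q c : ℕ} (hq : ρ 19 = q) (hc : ρ 25 = c) :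
    0 < c := by
  have := S.cnt_le hq hc (Nat.zero_le _) (Nat.zero_le _)
  rw [cnt_zero_right] at this
  exact this

theorem kind_one (S : Sys K C₁ C₂ C₃ I ρ M) {q c : ℕ} (hq : ρ 19 = q) (hc : ρ 25 = c) :
    M 35 (place q c 0 0 0) = 3 := by
  rw [S.kind_zero hq hc (Nat.zero_le _) (S.cnt_pos_left hq hc), cnt_zero_right, if_pos one_pos]

theorem place_copy_lt {q c e g j : ℕ} (hc : 0 < c) : place q c e g j < place q c (e + 1) g j := by
  simp only [place]; nlinarith [Nat.mul_pos (Nat.succ_pos q) hc]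

theorem place_mul_lt {q c e g j m : ℕ} (hc : 0 < c) :
    place q c e g j < place q c e (g + 1) (m + j) := by
  simp only [place]; nlinarith

theorem mult_copy (S : Sys K C₁ C₂ C₃ I ρ M) {q c : ℕ} (hq : ρ 19 = q) (hc : ρ 25 = c)
    {e g j : ℕ} (he : e < d * d) (hg : g ≤ q) (hj : j < cnt (flag n d M) e g) :
    M 37 (place q c (e + 1) g j) = 0 := by
  have hjc : j < c := hj.trans_le (S.cnt_le hq hc he.le hg)
  rw [S.fillEq (a := 37) (e := fMult) (by simp [prog]) (S.r27 hq hc)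
    (place_lt (by omega) hg hjc)]
  simp [fMult, byKind, eval_rules, S.kind_copy hq hc he hg hj]

theorem mult_mul (S : Sys K C₁ C₂ C₃ I ρ M) {q c : ℕ} (hq : ρ 19 = q) (hc : ρ 25 = c)
    {e g j : ℕ} (he : e < d * d) (hg : g + 1 ≤ q)
    (hj : cnt (flag n d M) e (g + 1) + j < cnt (flag n d M) (e + 1) (g + 1)) :
    M 37 (place q c (e + 1) (g + 1) (cnt (flag n d M) e (g + 1) + j)) =
      M 37 (place q c (e + 1) g j) + 1 := by
  rw [S.fillEq (a := 37) (e := fMult) (by simp [prog]) (S.r27 hq hc)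
    (place_lt (by omega) hg (hj.trans_le (S.cnt_le hq hc he hg)))]
  have := place_mul_lt (q := q) (e := e + 1) (g := g) (j := j) (m := cnt (flag n d M) e (g + 1))
    (S.cnt_pos_left hq hc)
  simp [fMult, byKind, eval_rules, S.kind_mul hq hc he hg hj, S.source_mul hq hc he hg hj, this]

theorem mult_one (S : Sys K C₁ C₂ C₃ I ρ M) {q c : ℕ} (hq : ρ 19 = q) (hc : ρ 25 = c) :
    M 37 (place q c 0 0 0) = 0 := by
  rw [S.fillEq (a := 37) (e := fMult) (by simp [prog]) (S.r27 hq hc)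
    (place_lt (by omega) (Nat.zero_le _) (S.cnt_pos_left hq hc))]
  simp [fMult, byKind, eval_rules, S.kind_one hq hc]

/-- The coefficient by which a monomial is multiplied, given by `fChoose`. -/
def chooseAt (M : ℕ → ℤ → ℤ) (g m : ℤ) : ℤ := M 30 g / (M 30 m * M 30 (g - m))

theorem base_copy (S : Sys K C₁ C₂ C₃ I ρ M) {q c : ℕ} (hq : ρ 19 = q) (hc : ρ 25 = c)
    {e g j : ℕ} (he : e < d * d) (hg : g ≤ q) (hj : j < cnt (flag n d M) e g) :
    M 38 (place q c (e + 1) g j) =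
      M 38 (place q c e g j) * chooseAt M g (M 37 (place q c e g j)) := by
  have hjc : j < c := hj.trans_le (S.cnt_le hq hc he.le hg)
  rw [S.fillEq (a := 38) (e := fBase) (by simp [prog]) (S.r27 hq hc)
    (place_lt (by omega) hg hjc)]
  have := place_copy_lt (q := q) (e := e) (g := g) (j := j) (S.cnt_pos_left hq hc)
  simp only [fBase, byKind, fChoose, eval_rules, Function.update_apply, reduceIte,
    Nat.reduceEqDiff, S.kind_copy hq hc he hg hj, S.source_copy hq hc he hg hj, S.r26 hq hc, hc,
    place_mod_div hg hjc, zero_lt_one, sub_self, lt_irrefl]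
  rw [if_pos ⟨by positivity, by exact_mod_cast this⟩, chooseAt]

theorem base_mul (S : Sys K C₁ C₂ C₃ I ρ M) {q c : ℕ} (hq : ρ 19 = q) (hc : ρ 25 = c)
    {e g j : ℕ} (he : e < d * d) (hg : g + 1 ≤ q)
    (hj : cnt (flag n d M) e (g + 1) + j < cnt (flag n d M) (e + 1) (g + 1)) :
    M 38 (place q c (e + 1) (g + 1) (cnt (flag n d M) e (g + 1) + j)) =
      M 38 (place q c (e + 1) g j) := by
  rw [S.fillEq (a := 38) (e := fBase) (by simp [prog]) (S.r27 hq hc)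
    (place_lt (by omega) hg (hj.trans_le (S.cnt_le hq hc he hg)))]
  have := place_mul_lt (q := q) (e := e + 1) (g := g) (j := j) (m := cnt (flag n d M) e (g + 1))
    (S.cnt_pos_left hq hc)
  simp [fBase, byKind, eval_rules, S.kind_mul hq hc he hg hj, S.source_mul hq hc he hg hj, this]

theorem base_one (S : Sys K C₁ C₂ C₃ I ρ M) {q c : ℕ} (hq : ρ 19 = q) (hc : ρ 25 = c) :
    M 38 (place q c 0 0 0) = 1 := by
  rw [S.fillEq (a := 38) (e := fBase) (by simp [prog]) (S.r27 hq hc)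
    (place_lt (by omega) (Nat.zero_le _) (S.cnt_pos_left hq hc))]
  simp [fBase, byKind, eval_rules, S.kind_one hq hc]

theorem base_unused (S : Sys K C₁ C₂ C₃ I ρ M) {q c : ℕ} (hq : ρ 19 = q) (hc : ρ 25 = c)
    {e g j : ℕ} (he : e ≤ d * d) (hg : g ≤ q) (hj : cnt (flag n d M) e g ≤ j) (hjc : j < c) :
    M 38 (place q c e g j) = 0 := by
  have hk : M 35 (place q c e g j) = 0 := by
    cases e with
    | zero => rw [S.kind_zero hq hc hg hjc, if_neg (by omega)]
    | succ e =>
      have := cnt_le_succ (flag n d M) e g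
      rw [S.kind_succ hq hc he hg hjc, if_neg (by omega), if_neg (by omega)]
  rw [S.fillEq (a := 38) (e := fBase) (by simp [prog]) (S.r27 hq hc)
    (place_lt (by omega) hg hjc)]
  simp [fBase, byKind, eval_rules, hk]

section feature

variable {a x len ℓ : ℕ} {f : Fml} {mul : ℕ → ℕ → ℤ}

theorem feature_copy (S : Sys K C₁ C₂ C₃ I ρ M) {q c : ℕ} (hq : ρ 19 = q) (hc : ρ 25 = c)
    (hmem : Stmt.fill a x (fFeature len f) ∈ prog K C₁ C₂ C₃)
    (hx : ρ x = ((d * d + 1) * ((q + 1) * c) * ℓ : ℕ)) (hlen : ρ len = ℓ) (hl100 : len < 100)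
    {e g j i : ℕ} (he : e < d * d) (hg : g ≤ q) (hj : j < cnt (flag n d M) e g) (hi : i < ℓ) :
    M a ((place q c (e + 1) g j : ℤ) * ℓ + i) = M a ((place q c e g j : ℤ) * ℓ + i) := by
  have hjc : j < c := hj.trans_le (S.cnt_le hq hc he.le hg)
  have h := S.fillEq hmem hx (idx_lt (place_lt (by omega) hg hjc : place q c (e + 1) g j < _) hi)
  rw [Nat.cast_add, Nat.cast_mul] at h
  rw [h]
  have := place_copy_lt (q := q) (e := e) (g := g) (j := j) (S.cnt_pos_left hq hc)
  have h1 : len ≠ 100 := by omega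
  have h2 : len ≠ 101 := by omega
  have h3 : len ≠ 102 := by omega
  have h4 : len ≠ 103 := by omega
  have h5 : len ≠ 104 := by omega
  simp only [fFeature, byKind, eval_rules, Function.update_apply, reduceIte, Nat.reduceEqDiff, h1,
    h2, h3, h4, h5, hlen, idx_div hi, idx_mod hi, S.kind_copy hq hc he hg hj,
    S.source_copy hq hc he hg hj, zero_lt_one, sub_self, lt_irrefl]
  refine if_pos ⟨by positivity, ?_⟩
  have hl : (0 : ℤ) < ℓ := by omega
  have : (place q c e g j : ℤ) < place q c (e + 1) g j := by exact_mod_cast this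
  nlinarith

theorem feature_mul (S : Sys K C₁ C₂ C₃ I ρ M) {q c : ℕ} (hq : ρ 19 = q) (hc : ρ 25 = c)
    (hmem : Stmt.fill a x (fFeature len f) ∈ prog K C₁ C₂ C₃)
    (hx : ρ x = ((d * d + 1) * ((q + 1) * c) * ℓ : ℕ)) (hlen : ρ len = ℓ) (hl100 : len < 100)
    (hf : ∀ (e i : ℕ) (ρ' : ℕ → ℤ), e < d * d → i < ℓ → ρ' 102 = i → ρ' 104 = (e + 1 : ℕ) →
      (∀ x < 100, ρ' x = ρ x) → f.eval a M ρ' = mul e i)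
    {e g j i : ℕ} (he : e < d * d) (hg : g + 1 ≤ q)
    (hj : cnt (flag n d M) e (g + 1) + j < cnt (flag n d M) (e + 1) (g + 1)) (hi : i < ℓ) :
    M a ((place q c (e + 1) (g + 1) (cnt (flag n d M) e (g + 1) + j) : ℤ) * ℓ + i) =
      (M a ((place q c (e + 1) g j : ℤ) * ℓ + i) * mul e i) % modulus C₃ n := by
  have hjc := hj.trans_le (S.cnt_le hq hc he hg)
  have h := S.fillEq hmem hx (idx_lt (place_lt (by omega) hg hjc :
    place q c (e + 1) (g + 1) (cnt (flag n d M) e (g + 1) + j) < _) hi)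
  rw [Nat.cast_add, Nat.cast_mul] at h
  rw [h]
  have := place_mul_lt (q := q) (e := e + 1) (g := g) (j := j) (m := cnt (flag n d M) e (g + 1))
    (S.cnt_pos_left hq hc)
  have h1 : len ≠ 100 := by omega
  have h2 : len ≠ 101 := by omega
  have h3 : len ≠ 102 := by omega
  have h4 : len ≠ 103 := by omega
  have h5 : len ≠ 104 := by omega
  simp only [fFeature, byKind, eval_rules, Function.update_apply, reduceIte, Nat.reduceEqDiff, h1,
    h2, h3, h4, h5, hlen, idx_div hi, idx_mod hi, S.kind_mul hq hc he hg hj,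
    S.source_mul hq hc he hg hj, S.r26 hq hc, place_div hg hjc, S.r12]
  have hlt : (place q c (e + 1) g j : ℤ) * ℓ + i <
      place q c (e + 1) (g + 1) (cnt (flag n d M) e (g + 1) + j) * ℓ + i := by
    have hl : (0 : ℤ) < ℓ := by omega
    have : (place q c (e + 1) g j : ℤ) <
      place q c (e + 1) (g + 1) (cnt (flag n d M) e (g + 1) + j) := by exact_mod_cast this
    nlinarith
  rw [if_pos (by norm_num), if_pos (by norm_num), if_neg (by norm_num),
    if_pos ⟨by positivity, hlt⟩, hf e i _ he hi (by simp) (by simp)]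
  intro y hy
  simp only [Function.update_apply]
  rw [if_neg (by omega), if_neg (by omega), if_neg (by omega), if_neg (by omega),
    if_neg (by omega)]

theorem feature_one (S : Sys K C₁ C₂ C₃ I ρ M) {q c : ℕ} (hq : ρ 19 = q) (hc : ρ 25 = c)
    (hmem : Stmt.fill a x (fFeature len f) ∈ prog K C₁ C₂ C₃)
    (hx : ρ x = ((d * d + 1) * ((q + 1) * c) * ℓ : ℕ)) (hlen : ρ len = ℓ) (hl100 : len < 100)
    {i : ℕ} (hi : i < ℓ) : M a ((place q c 0 0 0 : ℤ) * ℓ + i) = 1 := by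
  have h := S.fillEq hmem hx (idx_lt (place_lt (by omega) (Nat.zero_le _) (S.cnt_pos_left hq hc) :
    place q c 0 0 0 < _) hi)
  rw [Nat.cast_add, Nat.cast_mul] at h
  rw [h]
  have h1 : len ≠ 100 := by omega
  have h2 : len ≠ 101 := by omega
  simp only [fFeature, byKind, eval_rules, Function.update_apply, reduceIte, Nat.reduceEqDiff, h1,
    h2, hlen, idx_div hi, idx_mod hi, S.kind_one hq hc]
  norm_num

end feature

end Sys

end RoPE.Alg

namespace RoPE.Alg

/-- Enumeration of the monomials in `t 0, t 1, …`: `mt` is the exponent of the last variable,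
`cb e g j * choose g (mt e g j)` the multinomial coefficient and `Th` the value. -/
structure Monomials {A : Type*} [CommRing A] (fl : ℕ → ℕ) (m q : ℕ) (t : ℕ → A)
    (mt : ℕ → ℕ → ℕ → ℕ) (cb Th : ℕ → ℕ → ℕ → A) : Prop where
  le : ∀ e, fl e ≤ 1
  mt_copy : ∀ e < m, ∀ g ≤ q, ∀ j < cnt fl e g, mt (e + 1) g j = 0
  mt_mul : ∀ e < m, ∀ g < q, ∀ j, cnt fl e (g + 1) + j < cnt fl (e + 1) (g + 1) →
    mt (e + 1) (g + 1) (cnt fl e (g + 1) + j) = mt (e + 1) g j + 1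
  cb_copy : ∀ e < m, ∀ g ≤ q, ∀ j < cnt fl e g,
    cb (e + 1) g j = cb e g j * (g.choose (mt e g j) : ℕ)
  cb_mul : ∀ e < m, ∀ g < q, ∀ j, cnt fl e (g + 1) + j < cnt fl (e + 1) (g + 1) →
    cb (e + 1) (g + 1) (cnt fl e (g + 1) + j) = cb (e + 1) g j
  cb_one : cb 0 0 0 = 1
  Th_copy : ∀ e < m, ∀ g ≤ q, ∀ j < cnt fl e g, Th (e + 1) g j = Th e g j
  Th_mul : ∀ e < m, ∀ g < q, ∀ j, cnt fl e (g + 1) + j < cnt fl (e + 1) (g + 1) →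
    Th (e + 1) (g + 1) (cnt fl e (g + 1) + j) = Th (e + 1) g j * t e
  Th_one : Th 0 0 0 = 1
  mt_one : mt 0 0 0 = 0

namespace Monomials

variable {A : Type*} [CommRing A] {fl : ℕ → ℕ} {m q : ℕ} {t : ℕ → A} {mt : ℕ → ℕ → ℕ → ℕ}
  {cb Th : ℕ → ℕ → ℕ → A}

theorem sum_block (h : Monomials fl m q t mt cb Th) {e : ℕ} (he : e < m) : ∀ g ≤ q, ∀ ψ : ℕ → A,
    ∑ j ∈ Finset.range (cnt fl (e + 1) g), ψ (mt (e + 1) g j) * cb (e + 1) g j * Th (e + 1) g j =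
    ∑ a ∈ Finset.range (g + 1), ψ a * (fl e * t e) ^ a *
      ∑ j ∈ Finset.range (cnt fl e (g - a)),
        ((g - a).choose (mt e (g - a) j) : ℕ) * cb e (g - a) j * Th e (g - a) j := by
  have first : ∀ g ≤ q, ∀ ψ : ℕ → A, ∑ j ∈ Finset.range (cnt fl e g),
      ψ (mt (e + 1) g j) * cb (e + 1) g j * Th (e + 1) g j =
      ψ 0 * ∑ j ∈ Finset.range (cnt fl e g), (g.choose (mt e g j) : ℕ) * cb e g j * Th e g j := by
    intro g hg ψ
    rw [Finset.mul_sum]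
    refine Finset.sum_congr rfl fun j hj => ?_
    have hj := Finset.mem_range.1 hj
    rw [h.mt_copy e he g hg j hj, h.cb_copy e he g hg j hj, h.Th_copy e he g hg j hj]
    ring
  intro g
  induction g with
  | zero =>
    intro hg ψ
    have : cnt fl (e + 1) 0 = cnt fl e 0 := by simp [cnt]
    rw [this, first 0 hg ψ]
    simp
  | succ g ih =>
    intro hg ψ
    have hc : cnt fl (e + 1) (g + 1) = cnt fl e (g + 1) + fl e * cnt fl (e + 1) g := by simp [cnt]
    rw [Finset.sum_range_succ', hc, Finset.sum_range_add, first (g + 1) hg ψ, add_comm]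
    simp only [pow_zero, mul_one, Nat.sub_zero, Nat.add_sub_add_right]
    congr 1
    rcases Nat.le_one_iff_eq_zero_or_eq_one.1 (h.le e) with h0 | h1
    · simp [h0]
    · have key := ih (by omega) fun a => ψ (a + 1) * t e
      simp only [h1, one_mul, Nat.cast_one] at key ⊢
      have e1 : ∀ j ∈ Finset.range (cnt fl (e + 1) g),
          ψ (mt (e + 1) (g + 1) (cnt fl e (g + 1) + j)) *
          cb (e + 1) (g + 1) (cnt fl e (g + 1) + j) * Th (e + 1) (g + 1) (cnt fl e (g + 1) + j) =
          ψ (mt (e + 1) g j + 1) * t e * cb (e + 1) g j * Th (e + 1) g j := by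
        intro j hj
        have hj' : cnt fl e (g + 1) + j < cnt fl (e + 1) (g + 1) := by
          have := Finset.mem_range.1 hj
          rw [hc, h1]; omega
        rw [h.mt_mul e he g hg j hj', h.cb_mul e he g hg j hj', h.Th_mul e he g hg j hj']
        ring
      rw [Finset.sum_congr rfl e1, key]
      refine Finset.sum_congr rfl fun a _ => ?_
      rw [pow_succ]; ring

theorem sum_eq_pow (h : Monomials fl m q t mt cb Th) : ∀ e ≤ m, ∀ g ≤ q,
    ∑ j ∈ Finset.range (cnt fl e g), (g.choose (mt e g j) : ℕ) * cb e g j * Th e g j =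
      (∑ i ∈ Finset.range e, fl i * t i) ^ g := by
  intro e
  induction e with
  | zero =>
    intro _ g _
    cases g with
    | zero => simp [cnt, h.mt_one, h.cb_one, h.Th_one]
    | succ g => simp [cnt]
  | succ e ih =>
    intro he g hg
    rw [h.sum_block he g hg fun a => (g.choose a : ℕ), Finset.sum_range_succ _ e,
      add_comm _ (_ * _), add_pow]
    refine Finset.sum_congr rfl fun a ha => ?_
    rw [ih (by omega) (g - a) (by omega)]
    ring

end Monomials

namespace Sys

open RAM RAM.Fml

variable {K C₁ C₂ C₃ n d : ℕ} {I : Instance n d} {ρ : ℕ → ℤ} {M : ℕ → ℤ → ℤ}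

theorem chooseAt_eq (S : Sys K C₁ C₂ C₃ I ρ M) {g m : ℕ} (hg : g ≤ C₂ * n.size) (hm : m ≤ g) :
    chooseAt M g m = (g.choose m : ℕ) := by
  rw [chooseAt, ← Nat.cast_sub hm, S.t30 g (by omega), S.t30 m (by omega), S.t30 (g - m) (by omega),
    Nat.choose_eq_factorial_div_factorial hm]
  push_cast
  rfl

theorem q_le (S : Sys K C₁ C₂ C₃ I ρ M) {q : ℕ} (hq : ρ 19 = q) : q ≤ C₂ * n.size := by
  have h := S.r19.symm.trans hq
  have : degree (ρ 16).toNat (prec C₁ n) (C₂ * n.size) = q := by exact_mod_cast h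
  rw [← this]
  exact degree_le _ _ _

theorem mult_le (S : Sys K C₁ C₂ C₃ I ρ M) {q c : ℕ} (hq : ρ 19 = q) (hc : ρ 25 = c) :
    ∀ e ≤ d * d, ∀ g ≤ q, ∀ j < cnt (flag n d M) e g,
      0 ≤ M 37 (place q c e g j) ∧ M 37 (place q c e g j) ≤ g := by
  intro e
  cases e with
  | zero =>
    intro _ g _ j hj
    cases g with
    | zero =>
      have : j = 0 := by rw [cnt_zero_right] at hj; omega
      subst this
      rw [S.mult_one hq hc]; simp
    | succ g => simp [cnt] at hj
  | succ e =>
    intro he g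
    induction g with
    | zero =>
      intro hg j hj
      rw [S.mult_copy hq hc he hg (by simpa [cnt] using hj)]; simp
    | succ g ih =>
      intro hg j hj
      rcases lt_or_ge j (cnt (flag n d M) e (g + 1)) with h | h
      · rw [S.mult_copy hq hc he hg h]; exact ⟨le_rfl, by positivity⟩
      · obtain ⟨i, rfl⟩ := Nat.exists_eq_add_of_le h
        rw [S.mult_mul hq hc he hg hj]
        have hi : i < cnt (flag n d M) (e + 1) g := by
          have e1 : cnt (flag n d M) (e + 1) (g + 1) = cnt (flag n d M) e (g + 1) +
            flag n d M e * cnt (flag n d M) (e + 1) g := by simp [cnt]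
          have := Nat.mul_le_mul_right (cnt (flag n d M) (e + 1) g) (flag_le n d M e)
          omega
        have := ih (by omega) i hi
        push_cast
        omega

/-- The tables enumerate the monomials; the values are computed modulo `F`. -/
theorem monomials (S : Sys K C₁ C₂ C₃ I ρ M) {q c : ℕ} (hq : ρ 19 = q) (hc : ρ 25 = c)
    {A : Type*} [CommRing A] (t : ℕ → A) (Th : ℕ → ℕ → ℕ → A)
    (hcopy : ∀ e < d * d, ∀ g ≤ q, ∀ j < cnt (flag n d M) e g, Th (e + 1) g j = Th e g j)
    (hmul : ∀ e < d * d, ∀ g < q, ∀ j,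
      cnt (flag n d M) e (g + 1) + j < cnt (flag n d M) (e + 1) (g + 1) →
      Th (e + 1) (g + 1) (cnt (flag n d M) e (g + 1) + j) = Th (e + 1) g j * t e)
    (hone : Th 0 0 0 = 1) :
    Monomials (flag n d M) (d * d) q t (fun e g j => (M 37 (place q c e g j)).toNat)
      (fun e g j => (M 38 (place q c e g j) : A)) Th where
  le := flag_le n d M
  mt_copy e he g hg j hj := by rw [S.mult_copy hq hc he hg hj]; rfl
  mt_mul e he g hg j hj := by
    have hi : j < cnt (flag n d M) (e + 1) g := by
      have e1 : cnt (flag n d M) (e + 1) (g + 1) = cnt (flag n d M) e (g + 1) +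
        flag n d M e * cnt (flag n d M) (e + 1) g := by simp [cnt]
      have := Nat.mul_le_mul_right (cnt (flag n d M) (e + 1) g) (flag_le n d M e)
      omega
    have := S.mult_le hq hc (e + 1) he g hg.le j hi
    rw [S.mult_mul hq hc he hg hj]
    omega
  cb_copy e he g hg j hj := by
    obtain ⟨h1, h2⟩ := S.mult_le hq hc e he.le g hg j hj
    rw [S.base_copy hq hc he hg hj, ← Int.toNat_of_nonneg h1, S.chooseAt_eq, Int.toNat_natCast]
    · push_cast; rfl
    · exact hg.trans (S.q_le hq)
    · omega
  cb_mul e he g hg j hj := by rw [S.base_mul hq hc he hg hj]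
  cb_one := by rw [S.base_one hq hc]; simp
  Th_copy := hcopy
  Th_mul := hmul
  Th_one := hone
  mt_one := by rw [S.mult_one hq hc]; rfl

/-- Summation over the last block of monomials. -/
theorem sum_monomials (S : Sys K C₁ C₂ C₃ I ρ M) {q c : ℕ} (hq : ρ 19 = q) (hc : ρ 25 = c)
    {A : Type*} [CommRing A] (t : ℕ → A) (Th : ℕ → ℕ → ℕ → A)
    (hcopy : ∀ e < d * d, ∀ g ≤ q, ∀ j < cnt (flag n d M) e g, Th (e + 1) g j = Th e g j)
    (hmul : ∀ e < d * d, ∀ g < q, ∀ j,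
      cnt (flag n d M) e (g + 1) + j < cnt (flag n d M) (e + 1) (g + 1) →
      Th (e + 1) (g + 1) (cnt (flag n d M) e (g + 1) + j) = Th (e + 1) g j * t e)
    (hone : Th 0 0 0 = 1) {g : ℕ} (hg : g ≤ q) :
    ∑ j ∈ Finset.range c, ((M 38 (place q c (d * d) g j) *
      chooseAt M g (M 37 (place q c (d * d) g j)) : ℤ) : A) * Th (d * d) g j =
      (∑ e ∈ Finset.range (d * d), flag n d M e * t e) ^ g := by
  rw [← (S.monomials hq hc t Th hcopy hmul hone).sum_eq_pow (d * d) le_rfl g hg]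
  have hle := S.cnt_le hq hc (le_refl (d * d)) hg
  rw [← Finset.sum_subset (Finset.range_subset_range.2 hle)]
  · refine Finset.sum_congr rfl fun j hj => ?_
    obtain ⟨h1, h2⟩ := S.mult_le hq hc (d * d) le_rfl g hg j (Finset.mem_range.1 hj)
    rw [← Int.toNat_of_nonneg h1, S.chooseAt_eq (hg.trans (S.q_le hq)) (by omega),
      Int.toNat_natCast]
    push_cast; ring
  · intro j hj hj'
    rw [S.base_unused hq hc le_rfl hg (by simpa using hj') (Finset.mem_range.1 hj)]
    simp

end Sys

end RoPE.Alg

namespace RoPE.Alg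

/-- The digit of `x` at place `t` in base `B`. -/
abbrev digit (B x t : ℕ) : ℕ := x / B ^ t % B

/-- The number with given digits. -/
def ofDig (B s : ℕ) (f : ℕ → ℕ) : ℕ := ∑ t ∈ Finset.range s, f t * B ^ t

section digits

variable {B s : ℕ}

theorem digit_add_mul {t τ : ℕ} (ht : t < τ) (hB : 0 < B) (r w : ℕ) :
    digit B (r + B ^ τ * w) t = digit B r t := by
  obtain ⟨k, rfl⟩ := Nat.exists_eq_add_of_lt ht
  have e1 : r + B ^ (t + k + 1) * w = r + B ^ t * (B * (B ^ k * w)) := by ring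
  rw [digit, e1, Nat.add_mul_div_left _ _ (by positivity), Nat.add_mul_mod_self_left]

theorem digit_mod {t τ : ℕ} (ht : t < τ) (hB : 0 < B) (x : ℕ) :
    digit B (x % B ^ τ) t = digit B x t := by
  conv_rhs => rw [← Nat.mod_add_div x (B ^ τ)]
  rw [digit_add_mul ht hB]

theorem ofDig_lt {f : ℕ → ℕ} (hf : ∀ t < s, f t < B) : ofDig B s f < B ^ s := by
  induction s with
  | zero => simp [ofDig]
  | succ s ih =>
    have h1 := ih fun t ht => hf t (by omega)
    have h2 := hf s (by omega)
    rw [ofDig, Finset.sum_range_succ, pow_succ]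
    rw [ofDig] at h1
    have : (f s + 1) * B ^ s ≤ B * B ^ s := Nat.mul_le_mul_right _ h2
    nlinarith

theorem digit_ofDig {f : ℕ → ℕ} (hf : ∀ t < s, f t < B) {t : ℕ} (ht : t < s) :
    digit B (ofDig B s f) t = f t := by
  have hB : 0 < B := (Nat.zero_le _).trans_lt (hf t ht)
  induction s with
  | zero => omega
  | succ s ih =>
    rw [ofDig, Finset.sum_range_succ, mul_comm (f s)]
    rcases Nat.lt_succ_iff_lt_or_eq.1 ht with h | rfl
    · rw [digit_add_mul h hB]
      exact ih (fun t ht => hf t (by omega)) h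
    · have h1 : ofDig B t f < B ^ t := ofDig_lt fun u hu => hf u (by omega)
      rw [ofDig] at h1
      rw [digit, Nat.add_mul_div_left _ _ (by positivity), Nat.div_eq_of_lt h1, zero_add,
        Nat.mod_eq_of_lt (hf t ht)]

theorem ofDig_digit (x : ℕ) : ofDig B s (digit B x) = x % B ^ s := by
  induction s with
  | zero => simp [ofDig, Nat.mod_one]
  | succ s ih =>
    rw [ofDig, Finset.sum_range_succ, ← ofDig, ih, Nat.mod_pow_succ, mul_comm]

theorem sum_range_pow_succ {A : Type*} [AddCommMonoid A] (f : ℕ → A) :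
    ∑ y ∈ Finset.range (B ^ (s + 1)), f y =
      ∑ c ∈ Finset.range B, ∑ y ∈ Finset.range (B ^ s), f (y + B ^ s * c) := by
  rw [pow_succ]
  generalize B ^ s = m
  induction B with
  | zero => simp
  | succ B ih =>
    rw [Nat.mul_succ, Finset.sum_range_add, ih, Finset.sum_range_succ]
    congr 1
    exact Finset.sum_congr rfl fun y _ => by rw [add_comm]

theorem sum_prod_digit {A : Type*} [CommRing A] (hB : 0 < B) (f : ℕ → ℕ → A) :
    ∑ y ∈ Finset.range (B ^ s), ∏ t ∈ Finset.range s, f t (digit B y t) =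
      ∏ t ∈ Finset.range s, ∑ c ∈ Finset.range B, f t c := by
  induction s with
  | zero => simp
  | succ s ih =>
    rw [sum_range_pow_succ, Finset.prod_range_succ, ← ih, Finset.mul_sum]
    refine Finset.sum_congr rfl fun c hc => ?_
    rw [Finset.sum_mul]
    refine Finset.sum_congr rfl fun y hy => ?_
    rw [Finset.prod_range_succ]
    congr 1
    · refine Finset.prod_congr rfl fun t ht => ?_
      rw [digit_add_mul (Finset.mem_range.1 ht) hB]
    · rw [digit, Nat.add_mul_div_left _ _ (by positivity),
        Nat.div_eq_of_lt (Finset.mem_range.1 hy), zero_add,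
        Nat.mod_eq_of_lt (Finset.mem_range.1 hc)]

end digits

/-- Exponential functions of order `N` with the orthogonality relation. -/
structure IsChar {A : Type*} [CommRing A] (N : ℕ) (e : ℤ → A) : Prop where
  add : ∀ x y, e (x + y) = e x * e y
  zero : e 0 = 1
  sum : ∀ z, ∑ c ∈ Finset.range N, e (c * z) = if (N : ℤ) ∣ z then (N : A) else 0

/-- Pairing of the group `(ℤ / N) ^ s`. -/
def pairing (N s x y : ℕ) : ℤ := ∑ t ∈ Finset.range s, (digit N x t : ℤ) * digit N y t

/-- `x` with its digit at place `τ` replaced by `c`. -/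
def replaceDigit (N τ x c : ℕ) : ℕ := x % N ^ τ + N ^ τ * (c + N * (x / N ^ (τ + 1)))

theorem replaceDigit_lt {N s τ x c : ℕ} (hτ : τ < s) (hx : x < N ^ s) (hc : c < N) :
    replaceDigit N τ x c < N ^ s := by
  have hN : 0 < N := by omega
  have hpos : 0 < N ^ τ := by positivity
  have hmod : x % N ^ τ < N ^ τ := Nat.mod_lt _ hpos
  have h1 : x / N ^ (τ + 1) < N ^ (s - (τ + 1)) := by
    rw [Nat.div_lt_iff_lt_mul (by positivity), ← pow_add, Nat.sub_add_cancel hτ]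
    exact hx
  have h2 : N ^ s = N ^ τ * (N * N ^ (s - (τ + 1))) := by
    rw [← pow_succ', ← pow_add]; congr 1; omega
  have h3 : c + N * (x / N ^ (τ + 1)) + 1 ≤ N * N ^ (s - (τ + 1)) := by
    have : N * (x / N ^ (τ + 1) + 1) ≤ N * N ^ (s - (τ + 1)) := Nat.mul_le_mul_left _ h1
    rw [mul_add, mul_one] at this
    omega
  have h4 := Nat.mul_le_mul_left (N ^ τ) h3
  rw [h2, replaceDigit]
  rw [mul_add, mul_one] at h4
  omega

section fourier

variable {A : Type*} [CommRing A] {N : ℕ} {e : ℤ → A}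

theorem IsChar.map_sum (h : IsChar N e) (s : ℕ) (f : ℕ → ℤ) :
    e (∑ t ∈ Finset.range s, f t) = ∏ t ∈ Finset.range s, e (f t) := by
  induction s with
  | zero => simpa using h.zero
  | succ s ih => rw [Finset.sum_range_succ, h.add, ih, Finset.prod_range_succ]

theorem fourier_stage (h : IsChar N e) (hN : 0 < N) {s : ℕ} {σ : ℤ} {D : ℕ → ℕ → A}
    (hD : ∀ τ < s, ∀ x < N ^ s, D (τ + 1) x =
      ∑ c ∈ Finset.range N, e (σ * digit N x τ * c) * D τ (replaceDigit N τ x c)) :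
    ∀ τ ≤ s, ∀ x < N ^ s, D τ x = ∑ y ∈ Finset.range (N ^ τ),
      e (σ * pairing N τ x y) * D 0 (y + N ^ τ * (x / N ^ τ)) := by
  intro τ
  induction τ with
  | zero => intro _ x _; simp [pairing, h.zero]
  | succ τ ih =>
    intro hτ x hx
    rw [hD τ hτ x hx, sum_range_pow_succ]
    refine Finset.sum_congr rfl fun c hc => ?_
    have hc := Finset.mem_range.1 hc
    have hpos : 0 < N ^ τ := by positivity
    have hmod : x % N ^ τ < N ^ τ := Nat.mod_lt _ hpos
    have hdiv : replaceDigit N τ x c / N ^ τ = c + N * (x / N ^ (τ + 1)) := by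
      rw [replaceDigit, Nat.add_mul_div_left _ _ hpos, Nat.div_eq_of_lt hmod, zero_add]
    have hlt : replaceDigit N τ x c < N ^ s := replaceDigit_lt hτ hx hc
    rw [ih (by omega) _ hlt, Finset.mul_sum]
    refine Finset.sum_congr rfl fun y hy => ?_
    have hy := Finset.mem_range.1 hy
    have hp : σ * pairing N (τ + 1) x (y + N ^ τ * c) =
        σ * digit N x τ * c + σ * pairing N τ (replaceDigit N τ x c) y := by
      have h1 : digit N (y + N ^ τ * c) τ = c := by
        rw [digit, Nat.add_mul_div_left _ _ hpos, Nat.div_eq_of_lt hy, zero_add,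
          Nat.mod_eq_of_lt hc]
      have h2 : pairing N τ (replaceDigit N τ x c) y = pairing N τ x (y + N ^ τ * c) := by
        refine Finset.sum_congr rfl fun t ht => ?_
        have ht := Finset.mem_range.1 ht
        rw [replaceDigit, digit_add_mul ht hN, digit_mod ht hN, digit_add_mul ht hN]
      rw [h2]
      simp only [pairing]
      rw [Finset.sum_range_succ, h1]
      ring
    have e1 : y + N ^ τ * c + N ^ (τ + 1) * (x / N ^ (τ + 1)) =
        y + N ^ τ * (c + N * (x / N ^ (τ + 1))) := by rw [pow_succ]; ring
    rw [hp, h.add, hdiv, e1]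
    ring

theorem fourier_full (h : IsChar N e) (hN : 0 < N) {s : ℕ} {σ : ℤ} {D : ℕ → ℕ → A}
    (hD : ∀ τ < s, ∀ x < N ^ s, D (τ + 1) x =
      ∑ c ∈ Finset.range N, e (σ * digit N x τ * c) * D τ (replaceDigit N τ x c)) {x : ℕ}
    (hx : x < N ^ s) :
    D s x = ∑ y ∈ Finset.range (N ^ s), e (σ * pairing N s x y) * D 0 y := by
  rw [fourier_stage h hN hD s le_rfl x hx, Nat.div_eq_of_lt hx]
  simp

/-- Inverse transform of the product of two transforms. -/
theorem convolution (h : IsChar N e) (hN : 0 < N) (s : ℕ) (w v : ℕ → A) (x : ℕ) :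
    ∑ y ∈ Finset.range (N ^ s), e (-1 * pairing N s x y) *
      ((∑ a ∈ Finset.range (N ^ s), e (1 * pairing N s y a) * w a) *
        ∑ b ∈ Finset.range (N ^ s), e (1 * pairing N s y b) * v b) =
    (N : A) ^ s * ∑ b ∈ Finset.range (N ^ s), v b * ∑ a ∈ Finset.range (N ^ s),
      (∏ t ∈ Finset.range s,
        if (N : ℤ) ∣ (digit N a t : ℤ) + (digit N b t - digit N x t) then (1 : A) else 0) * w a := by
  have key : ∀ a b, ∑ y ∈ Finset.range (N ^ s), e (-1 * pairing N s x y) *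
      (e (1 * pairing N s y a) * e (1 * pairing N s y b)) = (N : A) ^ s *
      ∏ t ∈ Finset.range s,
        if (N : ℤ) ∣ (digit N a t : ℤ) + (digit N b t - digit N x t) then (1 : A) else 0 := by
    intro a b
    have h1 : ∀ y, e (-1 * pairing N s x y) *
        (e (1 * pairing N s y a) * e (1 * pairing N s y b)) =
        ∏ t ∈ Finset.range s,
          e ((digit N y t : ℤ) * (digit N a t + (digit N b t - digit N x t))) := by
      intro y
      rw [← h.map_sum, ← h.add, ← h.add]
      congr 1
      simp only [pairing, one_mul, neg_mul]
      rw [← Finset.sum_neg_distrib, ← Finset.sum_add_distrib, ← Finset.sum_add_distrib]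
      exact Finset.sum_congr rfl fun t _ => by ring
    simp only [h1]
    rw [sum_prod_digit hN
      fun t c => e ((c : ℤ) * ((digit N a t : ℤ) + (digit N b t - digit N x t)))]
    simp only [h.sum]
    rw [← Finset.card_range s, ← Finset.prod_const, Finset.card_range, ← Finset.prod_mul_distrib]
    exact Finset.prod_congr rfl fun t _ => by split_ifs <;> simp
  have h2 : ∀ y, e (-1 * pairing N s x y) *
      ((∑ a ∈ Finset.range (N ^ s), e (1 * pairing N s y a) * w a) *
        ∑ b ∈ Finset.range (N ^ s), e (1 * pairing N s y b) * v b) =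
      ∑ b ∈ Finset.range (N ^ s), ∑ a ∈ Finset.range (N ^ s), (v b * w a) *
        (e (-1 * pairing N s x y) * (e (1 * pairing N s y a) * e (1 * pairing N s y b))) := by
    intro y
    rw [Finset.sum_mul_sum, Finset.sum_comm, Finset.mul_sum]
    refine Finset.sum_congr rfl fun b _ => ?_
    rw [Finset.mul_sum]
    exact Finset.sum_congr rfl fun a _ => by ring
  simp only [h2]
  rw [Finset.sum_comm, Finset.mul_sum]
  refine Finset.sum_congr rfl fun b _ => ?_
  rw [Finset.sum_comm, Finset.mul_sum, Finset.mul_sum]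
  refine Finset.sum_congr rfl fun a _ => ?_
  rw [← Finset.mul_sum, key]
  ring

end fourier

/-- Group element of a position. -/
def embed (k s i : ℕ) : ℕ := ofDig (2 * k) s (digit k i)

/-- Difference of positions that a group element stands for. -/
def offset (k s a : ℕ) : ℤ := ∑ t ∈ Finset.range s,
  (if digit (2 * k) a t < k then (digit (2 * k) a t : ℤ) else digit (2 * k) a t - 2 * k) * k ^ t

/-- The convolution theorem for Toeplitz matrices. -/
theorem toeplitz_convolution {A : Type*} [CommRing A] {k s n : ℕ} {e : ℤ → A}
    (h : IsChar (2 * k) e) (hk : 0 < k) (hn : n ≤ k ^ s) {w v : ℕ → A} {W : ℤ → A} {V : ℕ → A}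
    (hw : ∀ a < (2 * k) ^ s, -(n : ℤ) < offset k s a → offset k s a < n → w a = W (offset k s a))
    (hv : ∀ j < n, v (embed k s j) = V j)
    (hv0 : ∀ b < (2 * k) ^ s, (∀ j < n, b ≠ embed k s j) → v b = 0) {i : ℕ} (hi : i < n) :
    ∑ y ∈ Finset.range ((2 * k) ^ s), e (-1 * pairing (2 * k) s (embed k s i) y) *
      ((∑ a ∈ Finset.range ((2 * k) ^ s), e (1 * pairing (2 * k) s y a) * w a) *
        ∑ b ∈ Finset.range ((2 * k) ^ s), e (1 * pairing (2 * k) s y b) * v b) =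
    ((2 * k : ℕ) : A) ^ s * ∑ j ∈ Finset.range n, W (i - j) * V j := by
  have hdk : ∀ j t, digit k j t < k := fun j t => Nat.mod_lt _ hk
  have hdl : ∀ j, ∀ t < s, digit k j t < 2 * k := fun j t _ => (hdk j t).trans (by omega)
  have hval : ∀ j < n, (∑ t ∈ Finset.range s, (digit k j t : ℤ) * k ^ t) = j := by
    intro j hj
    have := ofDig_digit (B := k) (s := s) j
    rw [Nat.mod_eq_of_lt (hj.trans_le hn)] at this
    exact_mod_cast this
  have hinj : Set.InjOn (embed k s) (Finset.range n : Set ℕ) := by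
    intro j hj j' hj' hjj
    simp only [Finset.coe_range, Set.mem_Iio] at hj hj'
    have : (j : ℤ) = j' := by
      rw [← hval j hj, ← hval j' hj']
      refine Finset.sum_congr rfl fun t ht => ?_
      have ht := Finset.mem_range.1 ht
      rw [← digit_ofDig (hdl j) ht, ← digit_ofDig (hdl j') ht]
      simp only [embed] at hjj
      rw [hjj]
    exact_mod_cast this
  rw [convolution h (by omega)]
  congr 1
  have hsub : (Finset.range n).image (embed k s) ⊆ Finset.range ((2 * k) ^ s) := by
    intro b hb
    obtain ⟨j, _, rfl⟩ := Finset.mem_image.1 hb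
    exact Finset.mem_range.2 (ofDig_lt (hdl j))
  rw [← Finset.sum_subset hsub, Finset.sum_image hinj]
  · refine Finset.sum_congr rfl fun j hj => ?_
    have hj := Finset.mem_range.1 hj
    have key : ∀ a ∈ Finset.range ((2 * k) ^ s), (∏ t ∈ Finset.range s,
        if ((2 * k : ℕ) : ℤ) ∣ (digit (2 * k) a t : ℤ) +
          (digit (2 * k) (embed k s j) t - digit (2 * k) (embed k s i) t) then (1 : A) else 0) *
          w a = (∏ t ∈ Finset.range s, if ((2 * k : ℕ) : ℤ) ∣ (digit (2 * k) a t : ℤ) +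
          ((digit k j t : ℤ) - digit k i t) then (1 : A) else 0) * W (i - j) := by
      intro a ha
      have e1 : ∀ t ∈ Finset.range s, (if ((2 * k : ℕ) : ℤ) ∣ (digit (2 * k) a t : ℤ) +
          (digit (2 * k) (embed k s j) t - digit (2 * k) (embed k s i) t) then (1 : A) else 0) =
          if ((2 * k : ℕ) : ℤ) ∣ (digit (2 * k) a t : ℤ) +
            ((digit k j t : ℤ) - digit k i t) then (1 : A) else 0 := by
        intro t ht
        have ht := Finset.mem_range.1 ht
        rw [embed, embed, digit_ofDig (hdl j) ht, digit_ofDig (hdl i) ht]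
      rw [Finset.prod_congr rfl e1]
      by_cases hall : ∀ t < s, ((2 * k : ℕ) : ℤ) ∣ (digit (2 * k) a t : ℤ) +
          ((digit k j t : ℤ) - digit k i t)
      · congr 1
        have hoff : offset k s a = i - j := by
          rw [← hval i hi, ← hval j hj, offset, ← Finset.sum_sub_distrib]
          refine Finset.sum_congr rfl fun t ht => ?_
          obtain ⟨c, hc⟩ := hall t (Finset.mem_range.1 ht)
          have h1 := hdk i t
          have h2 := hdk j t
          have h3 : digit (2 * k) a t < 2 * k := Nat.mod_lt _ (by omega)
          rw [← sub_mul]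
          congr 1
          generalize digit (2 * k) a t = x at *
          generalize digit k i t = y at *
          generalize digit k j t = z at *
          push_cast at hc
          have hc1 : -1 < c := by nlinarith
          have hc2 : c < 2 := by nlinarith
          obtain rfl | rfl : c = 0 ∨ c = 1 := by omega
          · split_ifs <;> omega
          · split_ifs <;> omega
        rw [hw a (Finset.mem_range.1 ha) (by omega) (by omega), hoff]
      · push Not at hall
        obtain ⟨t, ht, hnd⟩ := hall
        rw [Finset.prod_eq_zero (Finset.mem_range.2 ht) (if_neg hnd)]
        simp
    rw [Finset.sum_congr rfl key, ← Finset.sum_mul,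
      sum_prod_digit (by omega) fun t c => if ((2 * k : ℕ) : ℤ) ∣ (c : ℤ) +
        ((digit k j t : ℤ) - digit k i t) then (1 : A) else 0, Finset.prod_eq_one, one_mul, hv j hj,
      mul_comm]
    intro t _
    have h1 := hdk i t
    have h2 := hdk j t
    generalize digit k i t = y at *
    generalize digit k j t = z at *
    have hc0 : ∃ c < 2 * k, ((2 * k : ℕ) : ℤ) ∣ (c : ℤ) + ((z : ℤ) - y) := by
      rcases le_total z y with hzy | hzy
      · exact ⟨y - z, by omega, ⟨0, by push_cast [hzy]; ring⟩⟩
      · rcases eq_or_lt_of_le hzy with rfl | hlt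
        · exact ⟨0, by omega, ⟨0, by simp⟩⟩
        · exact ⟨2 * k - (z - y), by omega, ⟨1, by
            rw [Nat.cast_sub (by omega), Nat.cast_sub hzy]; ring⟩⟩
    obtain ⟨c₀, hc0, hd0⟩ := hc0
    rw [Finset.sum_eq_single c₀, if_pos hd0]
    · intro c hc hne
      rw [if_neg]
      intro hd
      have := dvd_sub hd hd0
      rw [add_sub_add_right_eq_sub] at this
      have hc := Finset.mem_range.1 hc
      have h3 : |(c : ℤ) - c₀| < (2 * k : ℕ) := by rw [abs_lt]; omega
      have := Int.eq_zero_of_abs_lt_dvd this h3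
      omega
    · intro h; exact absurd (Finset.mem_range.2 hc0) h
  · intro b hb hnb
    rw [hv0 b (Finset.mem_range.1 hb), zero_mul]
    rintro j hj rfl
    exact hnb (Finset.mem_image_of_mem _ (Finset.mem_range.2 hj))

end RoPE.Alg

namespace RoPE.Alg

open RAM RAM.Fml

theorem geom_sum_eq_zero {A : Type*} [CommRing A] {v : A} {m t : ℕ} (ht : t < m)
    (hv : v ^ 2 ^ t = -1) : ∑ c ∈ Finset.range (2 ^ m), v ^ c = 0 := by
  induction m with
  | zero => omega
  | succ m ih =>
    have e1 : ∑ c ∈ Finset.range (2 ^ (m + 1)), v ^ c =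
        (1 + v ^ 2 ^ m) * ∑ c ∈ Finset.range (2 ^ m), v ^ c := by
      rw [pow_succ, mul_two, Finset.sum_range_add, add_mul, one_mul, Finset.mul_sum]
      simp only [pow_add]
    rcases Nat.lt_succ_iff_lt_or_eq.1 ht with h | rfl
    · rw [e1, ih h, mul_zero]
    · rw [e1, hv]; ring

theorem exists_pow_eq_neg_one {A : Type*} [CommRing A] {s : ℕ} {u : Aˣ} (hu : u ^ 2 ^ s = -1)
    {z : ℤ} (hz : ¬ ((2 ^ (s + 1) : ℕ) : ℤ) ∣ z) : ∃ t < s + 1, (u ^ z) ^ 2 ^ t = -1 := by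
  induction s generalizing u z with
  | zero =>
    refine ⟨0, by omega, ?_⟩
    have hodd : Odd z := by
      rw [← Int.not_even_iff_odd, even_iff_two_dvd]; simpa using hz
    rw [pow_zero, pow_one] at hu ⊢
    rw [hu, hodd.neg_one_zpow]
  | succ s ih =>
    rcases Int.even_or_odd z with he | ho
    · obtain ⟨w, rfl⟩ := even_iff_two_dvd.1 he
      obtain ⟨t, ht, h⟩ := ih (u := u ^ 2) (by rw [← pow_mul, ← pow_succ']; exact hu) (z := w) (by
        intro hw
        apply hz
        rw [pow_succ', Nat.cast_mul]
        exact mul_dvd_mul_left _ hw)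
      refine ⟨t, by omega, ?_⟩
      rw [zpow_mul]
      exact h
    · refine ⟨s + 1, by omega, ?_⟩
      rw [← zpow_natCast, zpow_comm, zpow_natCast, hu, ho.neg_one_zpow]

/-- A root of `-1` of order a power of two gives an exponential function. -/
theorem isChar_of_pow {A : Type*} [CommRing A] {s : ℕ} {u : Aˣ} (hu : u ^ 2 ^ s = -1) :
    IsChar (2 * 2 ^ s) fun z : ℤ => ((u ^ z : Aˣ) : A) where
  add x y := by rw [zpow_add, Units.val_mul]
  zero := by simp
  sum z := by
    have e1 : ∀ c : ℕ, ((u ^ ((c : ℤ) * z) : Aˣ) : A) = ((u ^ z : Aˣ) : A) ^ c := by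
      intro c; rw [mul_comm, zpow_mul, zpow_natCast, Units.val_pow_eq_pow_val]
    simp only [e1]
    split_ifs with h
    · obtain ⟨w, rfl⟩ := h
      have : u ^ (2 * 2 ^ s) = 1 := by rw [mul_comm, pow_mul, hu]; simp
      rw [zpow_mul, zpow_natCast, this]
      simp
    · rw [← pow_succ'] at h ⊢
      obtain ⟨t, ht, h⟩ := exists_pow_eq_neg_one hu h
      refine geom_sum_eq_zero ht ?_
      rw [← Units.val_pow_eq_pow_val, h]; simp

theorem two_pow_modExp (C₃ n : ℕ) : (2 : ZMod (modulus C₃ n)) ^ modExp C₃ n = -1 := by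
  have := ZMod.natCast_self (modulus C₃ n)
  rw [modulus] at this
  push_cast at this
  exact eq_neg_of_add_eq_zero_left this

namespace Sys

variable {K C₁ C₂ C₃ n d : ℕ} {I : Instance n d} {ρ : ℕ → ℤ} {M : ℕ → ℤ → ℤ}

theorem cast_mod (x : ℤ) : ((x % (modulus C₃ n : ℕ) : ℤ) : ZMod (modulus C₃ n)) = x :=
  ZMod.intCast_mod x _

theorem t48 (S : Sys K C₁ C₂ C₃ I ρ M) {y : ℕ} (hy : y < ord n) :
    M 48 y = 2 ^ (rootExp C₃ n * y) % (modulus C₃ n : ℕ) := by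
  rw [S.fillEq (a := 48) (e := get 24 (var 33 * z) % var 12) (by simp [prog]) S.r6 hy]
  simp only [eval_rules, Function.update_apply, reduceIte, Nat.reduceEqDiff, S.r33, S.r12]
  rw [← Nat.cast_mul, S.t24]
  have : rootExp C₃ n * y ≤ rootExp C₃ n * ord n := Nat.mul_le_mul_left _ hy.le
  have e : rootExp C₃ n * ord n = 2 * modExp C₃ n := by rw [ord, modExp]; ring
  omega

theorem exists_isChar (S : Sys K C₁ C₂ C₃ I ρ M) : ∃ e : ℤ → ZMod (modulus C₃ n),
    IsChar (ord n) e ∧ ∀ x : ℤ, ((M 48 (x % (ord n : ℕ)) : ℤ) : ZMod (modulus C₃ n)) = e x := by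
  have hk : 0 < base n := by positivity
  have h1 : ((2 : ZMod (modulus C₃ n)) ^ rootExp C₃ n) ^ base n = -1 := by
    rw [← pow_mul, mul_comm, two_pow_modExp]
  have h2 : ((2 : ZMod (modulus C₃ n)) ^ rootExp C₃ n) ^ ord n = 1 := by
    rw [ord, mul_comm, pow_mul, h1]; simp
  obtain ⟨u, hu⟩ : IsUnit ((2 : ZMod (modulus C₃ n)) ^ rootExp C₃ n) :=
    IsUnit.of_pow_eq_one h2 (by simp)
  rw [← hu] at h1 h2
  have h3 : u ^ 2 ^ dig n = -1 := by ext; push_cast; exact h1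
  have h4 : u ^ ord n = 1 := by ext; push_cast; exact h2
  refine ⟨_, isChar_of_pow h3, fun x => ?_⟩
  have hpos : (0 : ℤ) < (ord n : ℕ) := by positivity
  obtain ⟨y, hy⟩ := Int.eq_ofNat_of_zero_le (Int.emod_nonneg x hpos.ne')
  have hyl : y < ord n := by have := Int.emod_lt_of_pos x hpos; rw [hy] at this; exact_mod_cast this
  have e1 : u ^ x = u ^ y := by
    conv_lhs => rw [← Int.emod_add_mul_ediv x (ord n : ℕ), hy]
    rw [zpow_add, zpow_mul, zpow_natCast, zpow_natCast, h4, one_zpow, mul_one]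
  rw [hy, S.t48 hyl, cast_mod]
  simp only [e1]
  push_cast
  rw [hu, ← pow_mul]

theorem cast_digit (x t : ℕ) (B : ℕ) : ((x : ℤ) / (B : ℤ) ^ t) % (B : ℤ) = (digit B x t : ℕ) := by
  push_cast; rfl

theorem t46 (S : Sys K C₁ C₂ C₃ I ρ M) {x : ℕ} (hx : x < ord n ^ dig n) :
    M 46 x = offset (base n) (dig n) x := by
  rw [S.fillEq (a := 46) (e := fOffset) (by simp [prog]) S.r8 hx]
  simp only [fOffset, eval_rules, Function.update_apply, reduceIte, Nat.reduceEqDiff, S.r3, S.r5,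
    S.r6, Int.toNat_natCast]
  refine Finset.sum_congr rfl fun t ht => ?_
  have ht := Finset.mem_range.1 ht
  rw [S.t22 t (by omega), S.t23 t (by omega), cast_digit]
  congr 1
  refine if_congr ?_ rfl ?_
  · rw [sub_pos, Nat.cast_lt]
  · push_cast; rfl

theorem t45 (S : Sys K C₁ C₂ C₃ I ρ M) {x : ℕ} (hx : x < ord n ^ dig n) :
    M 45 x = if ∃ t < dig n, base n ≤ digit (ord n) x t then (-1 : ℤ) else
      (ofDig (base n) (dig n) (digit (ord n) x) : ℕ) := by
  rw [S.fillEq (a := 45) (e := fPosition) (by simp [prog]) S.r8 hx]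
  simp only [fPosition, eval_rules, Function.update_apply, reduceIte, Nat.reduceEqDiff, S.r3, S.r5,
    S.r6, Int.toNat_natCast]
  refine if_congr ?_ (by norm_num) ?_
  · have e1 : ∀ t ∈ Finset.range (dig n),
        (if 0 < (x : ℤ) / M 23 t % (ord n : ℕ) - (base n : ℕ) + 1 then (1 : ℤ) else 0) =
        if base n ≤ digit (ord n) x t then 1 else 0 := by
      intro t ht
      have ht := Finset.mem_range.1 ht
      rw [S.t23 t (by omega), cast_digit]
      refine if_congr ?_ rfl rfl
      generalize digit (ord n) x t = y
      omega
    rw [Finset.sum_congr rfl e1, Finset.sum_pos_iff_of_nonneg (by intros; split_ifs <;> simp)]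
    constructor
    · rintro ⟨t, ht, h⟩
      exact ⟨t, Finset.mem_range.1 ht, by by_contra h'; rw [if_neg h'] at h; omega⟩
    · rintro ⟨t, ht, h⟩
      exact ⟨t, Finset.mem_range.2 ht, by rw [if_pos h]; omega⟩
  · rw [ofDig, Nat.cast_sum]
    refine Finset.sum_congr rfl fun t ht => ?_
    have ht := Finset.mem_range.1 ht
    rw [S.t22 t (by omega), S.t23 t (by omega), cast_digit]
    push_cast; rfl

theorem t47 (S : Sys K C₁ C₂ C₃ I ρ M) {i : ℕ} (hi : i < n) :
    M 47 i = (embed (base n) (dig n) i : ℕ) := by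
  rw [S.fillEq (a := 47) (e := fEmbed) (by simp [prog]) S.r0 hi]
  simp only [fEmbed, eval_rules, Function.update_apply, reduceIte, Nat.reduceEqDiff, S.r3, S.r5,
    Int.toNat_natCast]
  rw [embed, ofDig, Nat.cast_sum]
  refine Finset.sum_congr rfl fun t ht => ?_
  have ht := Finset.mem_range.1 ht
  rw [S.t22 t (by omega), S.t23 t (by omega), cast_digit]
  push_cast; rfl

theorem le_base_pow (n : ℕ) : n ≤ base n ^ dig n := by
  rw [base, ← pow_mul]
  exact (Nat.lt_size_self n).le.trans (Nat.pow_le_pow_right (by norm_num) (le_root_sq _))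

theorem digit_embed {k s i t : ℕ} (hk : 0 < k) (ht : t < s) :
    digit (2 * k) (embed k s i) t = digit k i t :=
  digit_ofDig (fun t _ => (Nat.mod_lt _ hk).trans (by omega)) ht

theorem embed_lt {k s i : ℕ} (hk : 0 < k) : embed k s i < (2 * k) ^ s :=
  ofDig_lt fun t _ => (Nat.mod_lt _ hk).trans (by omega)

theorem ofDig_congr {B s : ℕ} {f g : ℕ → ℕ} (h : ∀ t < s, f t = g t) : ofDig B s f = ofDig B s g :=
  Finset.sum_congr rfl fun t ht => by rw [h t (Finset.mem_range.1 ht)]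

theorem position_embed (S : Sys K C₁ C₂ C₃ I ρ M) {j : ℕ} (hj : j < n) :
    M 45 (embed (base n) (dig n) j : ℕ) = j := by
  have hk : 0 < base n := by positivity
  rw [S.t45 (embed_lt hk), if_neg]
  · rw [ofDig_congr fun t ht => digit_embed hk ht, ofDig_digit,
      Nat.mod_eq_of_lt (hj.trans_le (le_base_pow n))]
  · rintro ⟨t, ht, h⟩
    rw [digit_embed hk ht] at h
    have : digit (base n) j t < base n := Nat.mod_lt _ hk
    omega

theorem position_of_ne (S : Sys K C₁ C₂ C₃ I ρ M) {x : ℕ} (hx : x < ord n ^ dig n)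
    (h : ∀ j < n, x ≠ embed (base n) (dig n) j) : M 45 x = -1 ∨ (n : ℤ) ≤ M 45 x := by
  rw [S.t45 hx]
  split_ifs with h'
  · exact Or.inl rfl
  · right
    push Not at h'
    by_contra h2
    push Not at h2
    have h3 : ofDig (base n) (dig n) (digit (ord n) x) < n := by exact_mod_cast h2
    apply h _ h3
    rw [embed, ofDig_congr fun t ht => digit_ofDig h' ht, ofDig_digit, Nat.mod_eq_of_lt hx]

end Sys

end RoPE.Alg

namespace RoPE.Alg

open RAM RAM.Fml

/-- The order of the group. -/
abbrev grp (n : ℕ) : ℕ := ord n ^ dig n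

/-- Address of the value at `x` after stage `τ` of the transform in block `p`. -/
def cell (n p τ x : ℕ) : ℕ := p * ((dig n + 1) * grp n) + (τ * grp n + x)

section cell

variable {n p τ x : ℕ}

theorem cell_div (hτ : τ < dig n + 1) (hx : x < grp n) :
    ((cell n p τ x : ℕ) : ℤ) / ((dig n + 1) * grp n : ℕ) = p := by
  rw [cell, Nat.cast_add, Nat.cast_mul]
  exact idx_div (idx_lt hτ hx)

theorem cell_eq : ((cell n p τ x : ℕ) : ℤ) =
    ((p * (dig n + 1) + τ : ℕ) : ℤ) * (grp n : ℕ) + x := by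
  rw [cell]; push_cast; ring

theorem cell_mod (hx : x < grp n) : ((cell n p τ x : ℕ) : ℤ) % (grp n : ℕ) = x := by
  rw [cell_eq, idx_mod hx]

theorem cell_div_mod (hτ : τ < dig n + 1) (hx : x < grp n) :
    ((cell n p τ x : ℕ) : ℤ) / (grp n : ℕ) % (dig n + 1 : ℕ) = τ := by
  rw [cell_eq, idx_div hx, Nat.cast_add, Nat.cast_mul, idx_mod hτ]

theorem cell_lt {m : ℕ} (hp : p < m) (hτ : τ < dig n + 1) (hx : x < grp n) :
    cell n p τ x < m * ((dig n + 1) * grp n) :=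
  idx_lt hp (idx_lt hτ hx)

end cell

theorem replaceDigit_eq {N τ x c : ℕ} : (replaceDigit N τ x c : ℤ) =
    x + ((c : ℤ) - digit N x τ) * (N : ℤ) ^ τ := by
  have h1 := Nat.mod_add_div x (N ^ τ)
  have h2 := Nat.mod_add_div (x / N ^ τ) N
  rw [Nat.div_div_eq_div_mul, ← pow_succ] at h2
  have h3 : (x : ℤ) = (x % N ^ τ : ℕ) + (N : ℤ) ^ τ *
      ((digit N x τ : ℕ) + N * (x / N ^ (τ + 1) : ℕ)) := by
    rw [digit]
    exact_mod_cast (by rw [h2, h1] : x = x % N ^ τ + N ^ τ *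
      (x / N ^ τ % N + N * (x / N ^ (τ + 1))))
  rw [replaceDigit]
  conv_rhs => rw [h3]
  push_cast
  ring

namespace Sys

variable {K C₁ C₂ C₃ n d : ℕ} {I : Instance n d} {ρ : ℕ → ℤ} {M : ℕ → ℤ → ℤ}

theorem fourier_zero (S : Sys K C₁ C₂ C₃ I ρ M) {a x m : ℕ} {σ : ℤ} {f : Fml} {b : ℕ → ℕ → ℤ}
    (hmem : Stmt.fill a x (fFourier σ f) ∈ prog K C₁ C₂ C₃)
    (hx : ρ x = (m * ((dig n + 1) * grp n) : ℕ))
    (hf : ∀ p < m, ∀ y < grp n, ∀ ρ' : ℕ → ℤ, ρ' 100 = cell n p 0 y → ρ' 101 = y →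
      (∀ x < 100, ρ' x = ρ x) → f.eval a M ρ' = b p y)
    {p y : ℕ} (hp : p < m) (hy : y < grp n) : M a (cell n p 0 y) = b p y := by
  rw [S.fillEq hmem hx (cell_lt hp (Nat.succ_pos _) hy)]
  simp only [fFourier, eval_rules, Function.update_apply, reduceIte, Nat.reduceEqDiff, S.r8, S.r7,
    cell_mod hy, cell_div_mod (Nat.succ_pos _) hy]
  rw [if_neg (by simp)]
  refine hf p hp y hy _ ?_ ?_ ?_
  · simp
  · simp
  · intro x hx
    rw [Function.update_of_ne (by omega), Function.update_of_ne (by omega),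
      Function.update_of_ne (by omega)]

theorem fourier_succ (S : Sys K C₁ C₂ C₃ I ρ M) {a x m : ℕ} {σ : ℤ} {f : Fml}
    (hmem : Stmt.fill a x (fFourier σ f) ∈ prog K C₁ C₂ C₃)
    (hx : ρ x = (m * ((dig n + 1) * grp n) : ℕ))
    {p τ y : ℕ} (hp : p < m) (hτ : τ < dig n) (hy : y < grp n) :
    M a (cell n p (τ + 1) y) = (∑ c ∈ Finset.range (ord n),
      M 48 ((σ * digit (ord n) y τ * c) % (ord n : ℕ)) *
        M a (cell n p τ (replaceDigit (ord n) τ y c))) % (modulus C₃ n : ℕ) := by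
  rw [S.fillEq hmem hx (cell_lt hp (Nat.succ_lt_succ hτ) hy)]
  simp only [fFourier, eval_rules, Function.update_apply, reduceIte, Nat.reduceEqDiff, S.r8, S.r7,
    cell_mod hy, cell_div_mod (Nat.succ_lt_succ hτ) hy, S.r6, S.r12, Int.toNat_natCast]
  rw [if_pos (by positivity)]
  congr 1
  refine Finset.sum_congr rfl fun c hc => ?_
  have hc := Finset.mem_range.1 hc
  rw [show ((τ + 1 : ℕ) : ℤ) - 1 = τ by omega, S.t23 τ (by omega), cast_digit]
  have h1 : ((cell n p (τ + 1) y : ℕ) : ℤ) - (grp n : ℕ) +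
      ((c : ℤ) - (digit (ord n) y τ : ℕ)) * (ord n : ℤ) ^ τ =
      (cell n p τ (replaceDigit (ord n) τ y c) : ℕ) := by
    rw [cell, cell]
    push_cast [replaceDigit_eq]
    ring
  have h2 : cell n p τ (replaceDigit (ord n) τ y c) < cell n p (τ + 1) y := by
    have h : replaceDigit (ord n) τ y c < grp n := replaceDigit_lt hτ hy hc
    rw [cell, cell, Nat.succ_mul τ]
    omega
  simp only [h1]
  rw [if_pos ⟨by positivity, by exact_mod_cast h2⟩]

/-- The last stage holds the Fourier transform of the input. -/
theorem fourier (S : Sys K C₁ C₂ C₃ I ρ M) {a x m : ℕ} {σ : ℤ} {f : Fml} {b : ℕ → ℕ → ℤ}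
    (hmem : Stmt.fill a x (fFourier σ f) ∈ prog K C₁ C₂ C₃)
    (hx : ρ x = (m * ((dig n + 1) * grp n) : ℕ))
    (hf : ∀ p < m, ∀ y < grp n, ∀ ρ' : ℕ → ℤ, ρ' 100 = cell n p 0 y → ρ' 101 = y →
      (∀ x < 100, ρ' x = ρ x) → f.eval a M ρ' = b p y)
    {e : ℤ → ZMod (modulus C₃ n)} (he : IsChar (ord n) e)
    (hroot : ∀ x : ℤ, ((M 48 (x % (ord n : ℕ)) : ℤ) : ZMod (modulus C₃ n)) = e x)
    {p y : ℕ} (hp : p < m) (hy : y < grp n) :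
    ((M a (cell n p (dig n) y) : ℤ) : ZMod (modulus C₃ n)) =
      ∑ w ∈ Finset.range (grp n), e (σ * pairing (ord n) (dig n) y w) * (b p w : ℤ) := by
  have hN : 0 < ord n := by positivity
  have := fourier_full (σ := σ) (s := dig n) he hN
    (D := fun τ y => ((M a (cell n p τ y) : ℤ) : ZMod (modulus C₃ n))) (fun τ hτ w hw => ?_) hy
  · rw [this]
    refine Finset.sum_congr rfl fun w hw => ?_
    rw [S.fourier_zero hmem hx hf hp (Finset.mem_range.1 hw)]
  · rw [S.fourier_succ hmem hx hp hτ hw, cast_mod]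
    push_cast
    refine Finset.sum_congr rfl fun c _ => ?_
    rw [← hroot]
    push_cast
    rfl

theorem r31 (S : Sys K C₁ C₂ C₃ I ρ M) : ρ 31 = ((d + 1) * (d + 1) : ℕ) := by
  rw [S.paramEq (x := 31) (e := (var 1 + 1) * (var 1 + 1)) (by simp [prog])]
  simp only [eval_rules, S.r1]; push_cast; rfl

theorem r34 (S : Sys K C₁ C₂ C₃ I ρ M) : ρ 34 = ((dig n + 1) * grp n : ℕ) := by
  rw [S.paramEq (x := 34) (e := var 7 * var 8) (by simp [prog])]
  simp only [eval_rules, S.r7, S.r8]; push_cast; rfl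

theorem r35 (S : Sys K C₁ C₂ C₃ I ρ M) {q c : ℕ} (hq : ρ 19 = q) (hc : ρ 25 = c) :
    ρ 35 = ((q + 1) * c * (d * d + 1) * ((dig n + 1) * grp n) : ℕ) := by
  rw [S.paramEq (x := 35) (e := var 26 * (var 14 + 1) * var 34) (by simp [prog])]
  simp only [eval_rules, S.r26 hq hc, S.r14, S.r34]; push_cast; rfl

theorem r36 (S : Sys K C₁ C₂ C₃ I ρ M) {q c : ℕ} (hq : ρ 19 = q) (hc : ρ 25 = c) :
    ρ 36 = ((q + 1) * c * ((d + 1) * (d + 1)) * ((dig n + 1) * grp n) : ℕ) := by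
  rw [S.paramEq (x := 36) (e := var 26 * var 31 * var 34) (by simp [prog])]
  simp only [eval_rules, S.r26 hq hc, S.r31, S.r34]; push_cast; rfl

theorem r38 (S : Sys K C₁ C₂ C₃ I ρ M) : ρ 38 = ((d * d + 1) * ((d + 1) * (d + 1)) : ℕ) := by
  rw [S.paramEq (x := 38) (e := (var 14 + 1) * var 31) (by simp [prog])]
  simp only [eval_rules, S.r14, S.r31]; push_cast; rfl

theorem r37 (S : Sys K C₁ C₂ C₃ I ρ M) {q c : ℕ} (hq : ρ 19 = q) (hc : ρ 25 = c) :
    ρ 37 = ((q + 1) * c * ((d * d + 1) * ((d + 1) * (d + 1))) * ((dig n + 1) * grp n) : ℕ) := by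
  rw [S.paramEq (x := 37) (e := var 26 * var 38 * var 34) (by simp [prog])]
  simp only [eval_rules, S.r26 hq hc, S.r38, S.r34]; push_cast; rfl

theorem cast_idx_div (i m : ℕ) : (i : ℤ) / (m : ℤ) = (i / m : ℕ) := by push_cast; rfl

theorem cast_idx_mod (i m : ℕ) : (i : ℤ) % (m : ℤ) = (i % m : ℕ) := by push_cast; rfl

/-- The input of the transform of the weights. -/
def weightInput (n d r F : ℕ) (M : ℕ → ℤ → ℤ) (p x : ℕ) : ℤ :=
  if 0 < M 46 x + n then if 0 < n - M 46 x then
    (M 43 (((d * d : ℕ) * r + (p / (d * d + 1) : ℕ)) * (2 * n - 1 : ℕ) + (M 46 x + n - 1)) *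
      M 42 ((p % (d * d + 1) : ℕ) * (2 * n - 1 : ℕ) + (M 46 x + n - 1))) % F else 0 else 0

/-- The input of the transform of the values. -/
def valueInput (n d r F : ℕ) (M : ℕ → ℤ → ℤ) (p x : ℕ) : ℤ :=
  if 0 < M 45 x + 1 then if 0 < n - M 45 x then
    (M 40 (((d * d : ℕ) * r + (p / ((d + 1) * (d + 1)) : ℕ)) * n + M 45 x) *
      M 44 ((p % ((d + 1) * (d + 1)) : ℕ) * n + M 45 x)) % F else 0 else 0

theorem weight_transform (S : Sys K C₁ C₂ C₃ I ρ M) {q c : ℕ} (hq : ρ 19 = q) (hc : ρ 25 = c)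
    {e : ℤ → ZMod (modulus C₃ n)} (he : IsChar (ord n) e)
    (hroot : ∀ x : ℤ, ((M 48 (x % (ord n : ℕ)) : ℤ) : ZMod (modulus C₃ n)) = e x)
    {p y : ℕ} (hp : p < (q + 1) * c * (d * d + 1)) (hy : y < grp n) :
    ((M 49 (cell n p (dig n) y) : ℤ) : ZMod (modulus C₃ n)) =
      ∑ w ∈ Finset.range (grp n), e (1 * pairing (ord n) (dig n) y w) *
        (weightInput n d ((q + 1) * c) (modulus C₃ n) M p w : ℤ) := by
  refine S.fourier (x := 35) (f := fWeightInput) (by simp [prog]) (S.r35 hq hc) ?_ he hroot hp hy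
  intro p hp w hw ρ' h100 h101 hρ
  simp only [fWeightInput, eval_rules, Function.update_apply, reduceIte, Nat.reduceEqDiff, h100,
    h101, hρ 34 (by omega), S.r34, cell_div (Nat.succ_pos _) hw, hρ 14 (by omega), S.r14,
    hρ 0 (by omega), S.r0, hρ 26 (by omega), S.r26 hq hc,
    hρ 21 (by omega), S.r21, hρ 12 (by omega), S.r12]
  rw [show ((d * d : ℕ) : ℤ) + 1 = (d * d + 1 : ℕ) by push_cast; rfl, cast_idx_div, cast_idx_mod]
  rfl

theorem value_transform (S : Sys K C₁ C₂ C₃ I ρ M) {q c : ℕ} (hq : ρ 19 = q) (hc : ρ 25 = c)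
    {e : ℤ → ZMod (modulus C₃ n)} (he : IsChar (ord n) e)
    (hroot : ∀ x : ℤ, ((M 48 (x % (ord n : ℕ)) : ℤ) : ZMod (modulus C₃ n)) = e x)
    {p y : ℕ} (hp : p < (q + 1) * c * ((d + 1) * (d + 1))) (hy : y < grp n) :
    ((M 50 (cell n p (dig n) y) : ℤ) : ZMod (modulus C₃ n)) =
      ∑ w ∈ Finset.range (grp n), e (1 * pairing (ord n) (dig n) y w) *
        (valueInput n d ((q + 1) * c) (modulus C₃ n) M p w : ℤ) := by
  refine S.fourier (x := 36) (f := fValueInput) (by simp [prog]) (S.r36 hq hc) ?_ he hroot hp hy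
  intro p hp w hw ρ' h100 h101 hρ
  simp only [fValueInput, eval_rules, Function.update_apply, reduceIte, Nat.reduceEqDiff, h100,
    h101, hρ 34 (by omega), S.r34, cell_div (Nat.succ_pos _) hw, hρ 14 (by omega), S.r14,
    hρ 0 (by omega), S.r0, hρ 26 (by omega), S.r26 hq hc, hρ 31 (by omega), S.r31,
    hρ 12 (by omega), S.r12, cast_idx_div, cast_idx_mod]
  rfl

theorem product_transform (S : Sys K C₁ C₂ C₃ I ρ M) {q c : ℕ} (hq : ρ 19 = q) (hc : ρ 25 = c)
    {e : ℤ → ZMod (modulus C₃ n)} (he : IsChar (ord n) e)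
    (hroot : ∀ x : ℤ, ((M 48 (x % (ord n : ℕ)) : ℤ) : ZMod (modulus C₃ n)) = e x)
    {p κ ν y : ℕ} (hp : p < (q + 1) * c) (hκ : κ < d * d + 1) (hν : ν < (d + 1) * (d + 1))
    (hy : y < grp n) :
    ((M 51 (cell n (p * ((d * d + 1) * ((d + 1) * (d + 1))) + (κ * ((d + 1) * (d + 1)) + ν))
        (dig n) y) : ℤ) : ZMod (modulus C₃ n)) =
      ∑ w ∈ Finset.range (grp n), e (-1 * pairing (ord n) (dig n) y w) *
        ((∑ a ∈ Finset.range (grp n), e (1 * pairing (ord n) (dig n) w a) *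
          (weightInput n d ((q + 1) * c) (modulus C₃ n) M (p * (d * d + 1) + κ) a : ℤ)) *
        ∑ a ∈ Finset.range (grp n), e (1 * pairing (ord n) (dig n) w a) *
          (valueInput n d ((q + 1) * c) (modulus C₃ n) M (p * ((d + 1) * (d + 1)) + ν) a : ℤ)) := by
  have hm : 0 < (d + 1) * (d + 1) := by positivity
  rw [S.fourier (x := 37) (σ := -1) (f := fProductInput) (b := fun p x =>
    (M 49 (cell n (p / ((d * d + 1) * ((d + 1) * (d + 1))) * (d * d + 1) +
        p % ((d * d + 1) * ((d + 1) * (d + 1))) / ((d + 1) * (d + 1))) (dig n) x) *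
      M 50 (cell n (p / ((d * d + 1) * ((d + 1) * (d + 1))) * ((d + 1) * (d + 1)) +
        p % ((d * d + 1) * ((d + 1) * (d + 1))) % ((d + 1) * (d + 1))) (dig n) x)) %
          (modulus C₃ n : ℕ)) (by simp [prog]) (S.r37 hq hc) ?_ he hroot
          (idx_lt hp (idx_lt hκ hν)) hy]
  · refine Finset.sum_congr rfl fun w hw => ?_
    have hw := Finset.mem_range.1 hw
    rw [cast_mod]
    have hlt := idx_lt hκ hν
    have e1 : (p * ((d * d + 1) * ((d + 1) * (d + 1))) + (κ * ((d + 1) * (d + 1)) + ν)) /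
        ((d * d + 1) * ((d + 1) * (d + 1))) = p := by
      rw [mul_comm p, Nat.mul_add_div (by positivity), Nat.div_eq_of_lt hlt, add_zero]
    have e2 : (p * ((d * d + 1) * ((d + 1) * (d + 1))) + (κ * ((d + 1) * (d + 1)) + ν)) %
        ((d * d + 1) * ((d + 1) * (d + 1))) = κ * ((d + 1) * (d + 1)) + ν := by
      rw [mul_comm p, Nat.mul_add_mod, Nat.mod_eq_of_lt hlt]
    have e3 : (κ * ((d + 1) * (d + 1)) + ν) / ((d + 1) * (d + 1)) = κ := by
      rw [mul_comm κ, Nat.mul_add_div hm, Nat.div_eq_of_lt hν, add_zero]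
    have e4 : (κ * ((d + 1) * (d + 1)) + ν) % ((d + 1) * (d + 1)) = ν := by
      rw [mul_comm κ, Nat.mul_add_mod, Nat.mod_eq_of_lt hν]
    rw [e1, e2, e3, e4, Int.cast_mul, S.weight_transform hq hc he hroot (idx_lt hp hκ) hw,
      S.value_transform hq hc he hroot (idx_lt hp hν) hw]
  · intro p hp w hw ρ' h100 h101 hρ
    simp only [fProductInput, eval_rules, Function.update_apply, reduceIte, Nat.reduceEqDiff, h100,
      h101, hρ 34 (by omega), S.r34, cell_div (Nat.succ_pos _) hw, hρ 14 (by omega), S.r14,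
      hρ 3 (by omega), S.r3, hρ 7 (by omega), S.r7, hρ 8 (by omega), S.r8, hρ 31 (by omega),
      S.r31, hρ 12 (by omega), S.r12, hρ 38 (by omega), S.r38, cast_idx_div, cast_idx_mod]
    simp only [cell_eq]
    push_cast
    rfl

end Sys

end RoPE.Alg

namespace RoPE.Alg

open RAM RAM.Fml

theorem sum_range_mul {A : Type*} [AddCommMonoid A] (f : ℕ → A) (m c : ℕ) :
    ∑ p ∈ Finset.range (m * c), f p =
      ∑ g ∈ Finset.range m, ∑ j ∈ Finset.range c, f (g * c + j) := by
  induction m with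
  | zero => simp
  | succ m ih => rw [Nat.succ_mul, Finset.sum_range_add, ih, Finset.sum_range_succ]

/-- The exponent at `(i, j)`, scaled. -/
def expArg (n d : ℕ) (M : ℕ → ℤ → ℤ) (i j : ℕ) : ℤ := ∑ e ∈ Finset.range (d * d), flag n d M e *
  (M 25 ((i : ℤ) * d + (e / d : ℕ)) * M 26 ((j : ℤ) * d + (e % d : ℕ)) *
    M 42 ((e : ℤ) * (2 * n - 1 : ℕ) + (i + (n - 1 - j) : ℕ)))

/-- The Taylor polynomial of the exponential function, scaled by `q! D ^ q`. -/
def taylor (q : ℕ) (D x : ℤ) : ℤ :=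
  ∑ g ∈ Finset.range (q + 1), ((q.factorial / g.factorial : ℕ) : ℤ) * D ^ (q - g) * x ^ g

namespace Sys

variable {K C₁ C₂ C₃ n d : ℕ} {I : Instance n d} {ρ : ℕ → ℤ} {M : ℕ → ℤ → ℤ}

theorem r28 (S : Sys K C₁ C₂ C₃ I ρ M) {q c : ℕ} (hq : ρ 19 = q) (hc : ρ 25 = c) :
    ρ 28 = ((d * d + 1) * ((q + 1) * c) * n : ℕ) := by
  rw [S.paramEq (x := 28) (e := var 27 * var 0) (by simp [prog])]
  simp only [eval_rules, S.r27 hq hc, S.r0]; push_cast; rfl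

theorem r30 (S : Sys K C₁ C₂ C₃ I ρ M) {q c : ℕ} (hq : ρ 19 = q) (hc : ρ 25 = c) :
    ρ 30 = ((d * d + 1) * ((q + 1) * c) * (2 * n - 1) : ℕ) := by
  rw [S.paramEq (x := 30) (e := var 27 * var 21) (by simp [prog])]
  simp only [eval_rules, S.r27 hq hc, S.r21]; push_cast; rfl

theorem r39 (S : Sys K C₁ C₂ C₃ I ρ M) :
    ρ 39 = ((d * d + 1) * ((d + 1) * (d + 1)) * n : ℕ) := by
  rw [S.paramEq (x := 39) (e := var 38 * var 0) (by simp [prog])]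
  simp only [eval_rules, S.r38, S.r0]; push_cast; rfl

theorem r40 (S : Sys K C₁ C₂ C₃ I ρ M) : ρ 40 = d * 2 ^ (3 * prec C₁ n) := by
  rw [S.paramEq (x := 40) (e := var 1 * var 13 * var 13 * var 13) (by simp [prog])]
  simp only [eval_rules, S.r1, S.r13]; ring

theorem t52 (S : Sys K C₁ C₂ C₃ I ρ M) {q : ℕ} (hq : ρ 19 = q) :
    ∀ g : ℕ, g < q + 1 → M 52 g = (d * 2 ^ (3 * prec C₁ n) : ℤ) ^ g :=
  S.powEq (a := 52) (c := var 40) (by simp [prog])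
    (fun z => by simp only [eval_rules, Function.update_apply, reduceIte, Nat.reduceEqDiff, S.r40])
    (S.r20 hq)

theorem dig_sq_le (S : Sys K C₁ C₂ C₃ I ρ M) (hC : 0 < C₃) :
    dig n * (dig n + 1) ≤ 2 * modExp C₃ n := by
  have h1 : dig n ≤ n.size := root_le _
  have h2 := S.lg_pos
  have h3 : n.size * n.size ≤ rootExp C₃ n := by
    rw [rootExp, mul_assoc]; exact Nat.le_mul_of_pos_left _ hC
  have h4 : rootExp C₃ n ≤ modExp C₃ n := Nat.le_mul_of_pos_left _ (by positivity)
  have h5 : dig n * (dig n + 1) ≤ n.size * (n.size + n.size) := Nat.mul_le_mul h1 (by omega)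
  have h6 : n.size * (n.size + n.size) = 2 * (n.size * n.size) := by ring
  omega

theorem r41 (S : Sys K C₁ C₂ C₃ I ρ M) (hC : 0 < C₃) :
    ρ 41 = 2 ^ (2 * modExp C₃ n - dig n * (dig n + 1)) := by
  rw [S.paramEq (x := 41) (e := get 24 (2 * var 10 - var 3 * var 7)) (by simp [prog])]
  have h := S.dig_sq_le hC
  simp only [eval_rules, S.r10, S.r3, S.r7]
  have e1 : 2 * ((modExp C₃ n : ℕ) : ℤ) - (dig n : ℕ) * (dig n + 1 : ℕ) =
      (2 * modExp C₃ n - dig n * (dig n + 1) : ℕ) := by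
    rw [Nat.cast_sub h]; push_cast; rfl
  rw [e1, S.t24 _ (by omega)]

theorem inv_mul (S : Sys K C₁ C₂ C₃ I ρ M) (hC : 0 < C₃) :
    (ord n : ZMod (modulus C₃ n)) ^ dig n * ((ρ 41 : ℤ) : ZMod (modulus C₃ n)) = 1 := by
  have h := S.dig_sq_le hC
  rw [S.r41 hC]
  have e1 : (ord n : ZMod (modulus C₃ n)) = 2 ^ (dig n + 1) := by
    rw [ord, base, pow_succ']; push_cast; rfl
  rw [e1]
  push_cast
  rw [← pow_mul, ← pow_add, mul_comm (dig n + 1), Nat.add_sub_cancel' h, mul_comm 2, pow_mul,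
    two_pow_modExp]
  norm_num

theorem conv (S : Sys K C₁ C₂ C₃ I ρ M) {q c : ℕ} (hq : ρ 19 = q) (hc : ρ 25 = c)
    {p κ ν i : ℕ} (hp : p < (q + 1) * c) (hκ : κ < d * d + 1) (hν : ν < (d + 1) * (d + 1))
    (hi : i < n) :
    ((M 51 (cell n (p * ((d * d + 1) * ((d + 1) * (d + 1))) + (κ * ((d + 1) * (d + 1)) + ν))
        (dig n) (embed (base n) (dig n) i)) : ℤ) : ZMod (modulus C₃ n)) =
      (ord n : ZMod (modulus C₃ n)) ^ dig n * ∑ j ∈ Finset.range n,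
        ((M 43 (((d * d * ((q + 1) * c) + p : ℕ) : ℤ) * (2 * n - 1 : ℕ) + (i + (n - 1 - j) : ℕ)) *
          M 42 ((κ : ℤ) * (2 * n - 1 : ℕ) + (i + (n - 1 - j) : ℕ)) *
          (M 40 (((d * d * ((q + 1) * c) + p : ℕ) : ℤ) * n + j) * M 44 ((ν : ℤ) * n + j)) : ℤ) :
            ZMod (modulus C₃ n)) := by
  obtain ⟨e, he, hroot⟩ := S.exists_isChar
  have hk : 0 < base n := by positivity
  have hm : 0 < (d + 1) * (d + 1) := by positivity
  have e1 : (p * (d * d + 1) + κ) / (d * d + 1) = p := by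
    rw [mul_comm p, Nat.mul_add_div (by positivity), Nat.div_eq_of_lt hκ, add_zero]
  have e2 : (p * (d * d + 1) + κ) % (d * d + 1) = κ := by
    rw [mul_comm p, Nat.mul_add_mod, Nat.mod_eq_of_lt hκ]
  have e3 : (p * ((d + 1) * (d + 1)) + ν) / ((d + 1) * (d + 1)) = p := by
    rw [mul_comm p, Nat.mul_add_div hm, Nat.div_eq_of_lt hν, add_zero]
  have e4 : (p * ((d + 1) * (d + 1)) + ν) % ((d + 1) * (d + 1)) = ν := by
    rw [mul_comm p, Nat.mul_add_mod, Nat.mod_eq_of_lt hν]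
  have e5 : ((d * d : ℕ) : ℤ) * ((q + 1) * c : ℕ) + p = (d * d * ((q + 1) * c) + p : ℕ) := by
    push_cast; rfl
  rw [S.product_transform hq hc he hroot hp hκ hν (embed_lt hk),
    toeplitz_convolution (V := fun j =>
      (((M 40 (((d * d * ((q + 1) * c) + p : ℕ) : ℤ) * n + j) * M 44 ((ν : ℤ) * n + j) : ℤ)) :
        ZMod (modulus C₃ n))) (W := fun t =>
      ((M 43 (((d * d * ((q + 1) * c) + p : ℕ) : ℤ) * (2 * n - 1 : ℕ) + (t + n - 1)) *
        M 42 ((κ : ℤ) * (2 * n - 1 : ℕ) + (t + n - 1)) : ℤ) : ZMod (modulus C₃ n)))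
      he hk (le_base_pow n) ?_ ?_ ?_ hi]
  · congr 1
    refine Finset.sum_congr rfl fun j hj => ?_
    have hj := Finset.mem_range.1 hj
    have e6 : (i : ℤ) - j + n - 1 = (i + (n - 1 - j) : ℕ) := by omega
    rw [e6, ← Int.cast_mul]
  · intro a ha h1 h2
    rw [weightInput, S.t46 ha, if_pos (by omega), if_pos (by omega), e1, e2, cast_mod, e5]
  · intro j hj
    rw [valueInput, S.position_embed hj, if_pos (by omega), if_pos (by omega), e3, e4, cast_mod, e5]
  · intro b hb h
    rw [valueInput]
    rcases S.position_of_ne hb h with h1 | h1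
    · rw [if_neg (by omega)]; simp
    · rw [if_pos (by omega), if_neg (by omega)]; simp

/-- The sum over all monomials, before the reduction. -/
def rawSum (n d q c : ℕ) (M : ℕ → ℤ → ℤ) (D : ℤ) (μ i : ℕ) : ℤ :=
  ∑ p ∈ Finset.range ((q + 1) * c), ((q.factorial / (p / c).factorial : ℕ) : ℤ) *
    (M 38 (d * d * ((q + 1) * c) + p : ℕ) *
      chooseAt M (p / c : ℕ) (M 37 (d * d * ((q + 1) * c) + p : ℕ))) * D ^ (q - p / c) *
    M 39 (((d * d * ((q + 1) * c) + p : ℕ) : ℤ) * n + i) *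
    M 51 (cell n (p * ((d * d + 1) * ((d + 1) * (d + 1))) + μ) (dig n)
      (embed (base n) (dig n) i))

theorem sumsEq (S : Sys K C₁ C₂ C₃ I ρ M) {q c : ℕ} (hq : ρ 19 = q) (hc : ρ 25 = c)
    {μ i : ℕ} (hμ : μ < (d * d + 1) * ((d + 1) * (d + 1))) (hi : i < n) :
    let w := rawSum n d q c M (d * 2 ^ (3 * prec C₁ n)) μ i * ρ 41 % (modulus C₃ n : ℕ)
    M 53 ((μ : ℤ) * n + i) = if 0 < 2 * w - (modulus C₃ n : ℕ) then w - (modulus C₃ n : ℕ) else w := by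
  intro w
  have hcpos := S.cnt_pos_left hq hc
  have h := S.fillEq (a := 53) (e := fSums) (by simp [prog]) S.r39 (idx_lt hμ hi)
  rw [Nat.cast_add, Nat.cast_mul] at h
  rw [h]
  simp only [fSums, fChoose, eval_rules, Function.update_apply, reduceIte, Nat.reduceEqDiff, S.r0,
    idx_div hi, idx_mod hi, S.r26 hq hc, S.r14, Int.toNat_natCast, hc, hq, S.r38, S.r7, S.r3,
    S.r8, S.r12, S.t47 hi]
  have hw : (∑ x ∈ Finset.range ((q + 1) * c),
      M 30 ↑q / M 30 ((x : ℤ) / c) * (M 38 (((d * d : ℕ) : ℤ) * ((q + 1) * c : ℕ) + x) *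
        (M 30 ((x : ℤ) / c) / (M 30 (M 37 (((d * d : ℕ) : ℤ) * ((q + 1) * c : ℕ) + x)) *
          M 30 ((x : ℤ) / c - M 37 (((d * d : ℕ) : ℤ) * ((q + 1) * c : ℕ) + x))))) *
        M 52 (q - (x : ℤ) / c) * M 39 ((((d * d : ℕ) : ℤ) * ((q + 1) * c : ℕ) + x) * n + i) *
        M 51 (((x * ((d * d + 1) * ((d + 1) * (d + 1)) : ℕ) + μ) * (dig n + 1 : ℕ) + dig n) *
          (ord n ^ dig n : ℕ) + (embed (base n) (dig n) i : ℕ))) =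
      rawSum n d q c M (d * 2 ^ (3 * prec C₁ n)) μ i := by
    refine Finset.sum_congr rfl fun x hx => ?_
    have hx := Finset.mem_range.1 hx
    have hg : x / c < q + 1 := (Nat.div_lt_iff_lt_mul hcpos).2 hx
    have hql := S.q_le hq
    have e1 : ((d * d : ℕ) : ℤ) * ((q + 1) * c : ℕ) + x = (d * d * ((q + 1) * c) + x : ℕ) := by
      push_cast; rfl
    have hg' : q - x / c < q + 1 := Nat.lt_succ_of_le (Nat.sub_le _ _)
    have hg'' : x / c < C₂ * n.size + 1 := hg.trans_le (Nat.succ_le_succ hql)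
    rw [cast_idx_div, e1, ← Nat.cast_sub (Nat.le_of_lt_succ hg), S.t30 q (by omega),
      S.t30 (x / c) hg'', S.t52 hq _ hg', cell_eq, chooseAt, S.t30 (x / c) hg'']
    push_cast
    rfl
  rw [hw]

theorem sum_features (S : Sys K C₁ C₂ C₃ I ρ M) {q c : ℕ} (hq : ρ 19 = q) (hc : ρ 25 = c)
    {i j : ℕ} (hi : i < n) (hj : j < n) {g : ℕ} (hg : g ≤ q) :
    ∑ l ∈ Finset.range c, ((M 38 (place q c (d * d) g l) *
      chooseAt M g (M 37 (place q c (d * d) g l)) : ℤ) : ZMod (modulus C₃ n)) *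
      ((M 39 ((place q c (d * d) g l : ℤ) * n + i) : ℤ) *
        (M 40 ((place q c (d * d) g l : ℤ) * n + j) : ℤ) *
        (M 43 ((place q c (d * d) g l : ℤ) * (2 * n - 1 : ℕ) + (i + (n - 1 - j) : ℕ)) : ℤ)) =
      ((expArg n d M i j : ℤ) : ZMod (modulus C₃ n)) ^ g := by
  have ht : i + (n - 1 - j) < 2 * n - 1 := by omega
  have m39 : Stmt.fill 39 28 (fFeature 0 (get 25 (var 102 * var 1 + (var 104 - 1) / var 1))) ∈
      prog K C₁ C₂ C₃ := by simp [prog]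
  have m40 : Stmt.fill 40 28 (fFeature 0 (get 26 (var 102 * var 1 + (var 104 - 1) % var 1))) ∈
      prog K C₁ C₂ C₃ := by simp [prog]
  have m43 : Stmt.fill 43 30 (fFeature 21 (get 42 ((var 104 - 1) * var 21 + var 102))) ∈
      prog K C₁ C₂ C₃ := by simp [prog]
  have f39 : ∀ (e i : ℕ) (ρ' : ℕ → ℤ), e < d * d → i < n → ρ' 102 = i → ρ' 104 = (e + 1 : ℕ) →
      (∀ x < 100, ρ' x = ρ x) →
      (get 25 (var 102 * var 1 + (var 104 - 1) / var 1)).eval 39 M ρ' =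
        M 25 ((i : ℤ) * d + (e / d : ℕ)) := by
    intro e i ρ' he hi h1 h2 h3
    simp only [eval_rules, h1, h2, h3 1 (by omega), S.r1]
    rw [show ((e + 1 : ℕ) : ℤ) - 1 = e by omega, cast_idx_div]
  have f40 : ∀ (e i : ℕ) (ρ' : ℕ → ℤ), e < d * d → i < n → ρ' 102 = i → ρ' 104 = (e + 1 : ℕ) →
      (∀ x < 100, ρ' x = ρ x) →
      (get 26 (var 102 * var 1 + (var 104 - 1) % var 1)).eval 40 M ρ' =
        M 26 ((i : ℤ) * d + (e % d : ℕ)) := by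
    intro e i ρ' he hi h1 h2 h3
    simp only [eval_rules, h1, h2, h3 1 (by omega), S.r1]
    rw [show ((e + 1 : ℕ) : ℤ) - 1 = e by omega, cast_idx_mod]
  have f43 : ∀ (e i : ℕ) (ρ' : ℕ → ℤ), e < d * d → i < 2 * n - 1 → ρ' 102 = i →
      ρ' 104 = (e + 1 : ℕ) → (∀ x < 100, ρ' x = ρ x) →
      (get 42 ((var 104 - 1) * var 21 + var 102)).eval 43 M ρ' =
        M 42 ((e : ℤ) * (2 * n - 1 : ℕ) + i) := by
    intro e i ρ' he hi h1 h2 h3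
    simp only [eval_rules, h1, h2, h3 21 (by omega), S.r21]
    rw [show ((e + 1 : ℕ) : ℤ) - 1 = e by omega]
  rw [S.sum_monomials hq hc (fun e => ((M 25 ((i : ℤ) * d + (e / d : ℕ)) *
    M 26 ((j : ℤ) * d + (e % d : ℕ)) *
    M 42 ((e : ℤ) * (2 * n - 1 : ℕ) + (i + (n - 1 - j) : ℕ)) : ℤ) : ZMod (modulus C₃ n)))
    (fun e g l => ((M 39 ((place q c e g l : ℤ) * n + i) : ℤ) : ZMod (modulus C₃ n)) *
        (M 40 ((place q c e g l : ℤ) * n + j) : ℤ) *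
        (M 43 ((place q c e g l : ℤ) * (2 * n - 1 : ℕ) + (i + (n - 1 - j) : ℕ)) : ℤ)) ?_ ?_ ?_ hg]
  · rw [expArg]; push_cast; rfl
  · intro e he g hg l hl
    rw [S.feature_copy hq hc m39 (S.r28 hq hc) S.r0 (by omega) he hg
      hl hi, S.feature_copy hq hc m40 (S.r28 hq hc) S.r0 (by omega)
      he hg hl hj, S.feature_copy hq hc m43 (S.r30 hq hc) S.r21
      (by omega) he hg hl ht]
  · intro e he g hg l hl
    rw [S.feature_mul hq hc m39 (S.r28 hq hc) S.r0 (by omega) f39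
      he hg hl hi, S.feature_mul hq hc m40 (S.r28 hq hc) S.r0
      (by omega) f40 he hg hl hj, S.feature_mul hq hc m43
      (S.r30 hq hc) S.r21 (by omega) f43 he hg hl ht, cast_mod, cast_mod, cast_mod]
    push_cast
    ring
  · rw [S.feature_one hq hc m39 (S.r28 hq hc) S.r0 (by omega) hi,
      S.feature_one hq hc m40 (S.r28 hq hc) S.r0 (by omega) hj,
      S.feature_one hq hc m43 (S.r30 hq hc) S.r21 (by omega) ht]
    simp

/-- The sums that the algorithm computes. -/
def exactSum (n d q : ℕ) (M : ℕ → ℤ → ℤ) (D : ℤ) (κ ν i : ℕ) : ℤ := ∑ j ∈ Finset.range n,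
  taylor q D (expArg n d M i j) * (M 42 ((κ : ℤ) * (2 * n - 1 : ℕ) + (i + (n - 1 - j) : ℕ)) *
    M 44 ((ν : ℤ) * n + j))

theorem rawSum_eq (S : Sys K C₁ C₂ C₃ I ρ M) {q c : ℕ} (hq : ρ 19 = q) (hc : ρ 25 = c)
    (hC : 0 < C₃) {κ ν i : ℕ} (hκ : κ < d * d + 1) (hν : ν < (d + 1) * (d + 1)) (hi : i < n)
    (D : ℤ) :
    ((rawSum n d q c M D (κ * ((d + 1) * (d + 1)) + ν) i * ρ 41 : ℤ) : ZMod (modulus C₃ n)) =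
      (exactSum n d q M D κ ν i : ℤ) := by
  have hcpos := S.cnt_pos_left hq hc
  rw [rawSum, sum_range_mul, exactSum]
  simp only [Int.cast_mul, Int.cast_sum, Int.cast_pow, Int.cast_natCast]
  rw [Finset.sum_mul]
  have e1 : ∀ g ∈ Finset.range (q + 1), ∀ l ∈ Finset.range c, (g * c + l) / c = g := by
    intro g _ l hl
    rw [mul_comm, Nat.mul_add_div hcpos, Nat.div_eq_of_lt (Finset.mem_range.1 hl), add_zero]
  have e2 : ∀ g ∈ Finset.range (q + 1), (∑ l ∈ Finset.range c,
      ((q.factorial / ((g * c + l) / c).factorial : ℕ) : ZMod (modulus C₃ n)) *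
      (((M 38 (d * d * ((q + 1) * c) + (g * c + l) : ℕ) : ℤ) : ZMod (modulus C₃ n)) *
        (chooseAt M ((g * c + l) / c : ℕ) (M 37 (d * d * ((q + 1) * c) + (g * c + l) : ℕ)) : ℤ)) *
          (D : ZMod (modulus C₃ n)) ^ (q - (g * c + l) / c) *
      (M 39 (((d * d * ((q + 1) * c) + (g * c + l) : ℕ) : ℤ) * n + i) : ℤ) *
      (M 51 (cell n ((g * c + l) * ((d * d + 1) * ((d + 1) * (d + 1))) +
        (κ * ((d + 1) * (d + 1)) + ν)) (dig n) (embed (base n) (dig n) i)) : ℤ)) * (ρ 41 : ℤ) =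
      ∑ j ∈ Finset.range n, ((q.factorial / g.factorial : ℕ) : ZMod (modulus C₃ n)) *
        (D : ZMod (modulus C₃ n)) ^ (q - g) * ((expArg n d M i j : ℤ) : ZMod (modulus C₃ n)) ^ g *
        ((M 42 ((κ : ℤ) * (2 * n - 1 : ℕ) + (i + (n - 1 - j) : ℕ)) : ℤ) *
          (M 44 ((ν : ℤ) * n + j) : ℤ)) := by
    intro g hg
    have hgq : g ≤ q := by simpa [Nat.lt_succ_iff] using hg
    have e3 : ∀ j ∈ Finset.range n, ((q.factorial / g.factorial : ℕ) : ZMod (modulus C₃ n)) *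
        (D : ZMod (modulus C₃ n)) ^ (q - g) * ((expArg n d M i j : ℤ) : ZMod (modulus C₃ n)) ^ g *
        ((M 42 ((κ : ℤ) * (2 * n - 1 : ℕ) + (i + (n - 1 - j) : ℕ)) : ℤ) *
          (M 44 ((ν : ℤ) * n + j) : ℤ)) = ∑ l ∈ Finset.range c, _ :=
      fun j hj => by
        rw [← S.sum_features hq hc hi (Finset.mem_range.1 hj) hgq, mul_assoc, Finset.sum_mul,
          Finset.mul_sum]
    rw [Finset.sum_congr rfl e3, Finset.sum_comm, Finset.sum_mul]
    refine Finset.sum_congr rfl fun l hl => ?_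
    rw [e1 g hg l hl, S.conv hq hc (idx_lt (Finset.mem_range.1 hg) (Finset.mem_range.1 hl)) hκ hν hi]
    have h := S.inv_mul hC
    have e4 : ∀ a b : ZMod (modulus C₃ n), a * ((ord n : ZMod (modulus C₃ n)) ^ dig n * b) *
        ((ρ 41 : ℤ) : ZMod (modulus C₃ n)) = a * b := by
      intro a b
      linear_combination (a * b) * h
    rw [e4, Finset.mul_sum]
    refine Finset.sum_congr rfl fun j _ => ?_
    simp only [place]
    push_cast
    ring
  rw [Finset.sum_congr rfl e2, Finset.sum_comm]
  refine Finset.sum_congr rfl fun j _ => ?_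
  rw [taylor, Int.cast_sum, Finset.sum_mul]
  refine Finset.sum_congr rfl fun g _ => ?_
  simp only [Int.cast_mul, Int.cast_pow, Int.cast_natCast]

theorem abs_sums_le (S : Sys K C₁ C₂ C₃ I ρ M) {q c : ℕ} (hq : ρ 19 = q) (hc : ρ 25 = c)
    {μ i : ℕ} (hμ : μ < (d * d + 1) * ((d + 1) * (d + 1))) (hi : i < n) :
    2 * |M 53 ((μ : ℤ) * n + i)| ≤ (modulus C₃ n : ℕ) := by
  have h := S.sumsEq hq hc hμ hi
  simp only at h
  have hF : (0 : ℤ) < (modulus C₃ n : ℕ) := by positivity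
  rw [h]
  set w := rawSum n d q c M (d * 2 ^ (3 * prec C₁ n)) μ i * ρ 41 % (modulus C₃ n : ℕ)
  have h1 : 0 ≤ w := Int.emod_nonneg _ hF.ne'
  have h2 : w < (modulus C₃ n : ℕ) := Int.emod_lt_of_pos _ hF
  split_ifs with h3
  · rw [abs_of_neg (by omega)]; omega
  · rw [abs_of_nonneg h1]; omega

/-- When the modulus is large, the sums are computed exactly. -/
theorem sums_eq (S : Sys K C₁ C₂ C₃ I ρ M) {q c : ℕ} (hq : ρ 19 = q) (hc : ρ 25 = c)
    (hC : 0 < C₃) {κ ν i : ℕ} (hκ : κ < d * d + 1) (hν : ν < (d + 1) * (d + 1)) (hi : i < n)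
    (hF : 2 * |exactSum n d q M (d * 2 ^ (3 * prec C₁ n)) κ ν i| < (modulus C₃ n : ℕ)) :
    M 53 (((κ * ((d + 1) * (d + 1)) + ν : ℕ) : ℤ) * n + i) =
      exactSum n d q M (d * 2 ^ (3 * prec C₁ n)) κ ν i := by
  have h := S.sumsEq hq hc (idx_lt hκ hν) hi
  have h1 := S.abs_sums_le hq hc (idx_lt hκ hν) hi
  have h2 : ((M 53 (((κ * ((d + 1) * (d + 1)) + ν : ℕ) : ℤ) * n + i) : ℤ) : ZMod (modulus C₃ n)) =
      (exactSum n d q M (d * 2 ^ (3 * prec C₁ n)) κ ν i : ℤ) := by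
    rw [← S.rawSum_eq hq hc hC hκ hν hi, h]
    split_ifs
    · rw [Int.cast_sub, cast_mod]; simp only [Int.cast_natCast, ZMod.natCast_self, sub_zero]
    · rw [cast_mod]
  rw [ZMod.intCast_eq_intCast_iff_dvd_sub] at h2
  have := Int.eq_zero_of_abs_lt_dvd h2 (by
    have := abs_sub (exactSum n d q M (d * 2 ^ (3 * prec C₁ n)) κ ν i)
      (M 53 (((κ * ((d + 1) * (d + 1)) + ν : ℕ) : ℤ) * n + i))
    omega)
  omega

end Sys

end RoPE.Alg

namespace RoPE.Alg

theorem exp_sub_sum_le {r : ℝ} (hr : 0 ≤ r) (n : ℕ) :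
    Real.exp r - ∑ m ∈ Finset.range n, r ^ m / m.factorial ≤ r ^ n / n.factorial * Real.exp r := by
  have hs : Summable fun m : ℕ => r ^ m / m.factorial := Real.summable_pow_div_factorial r
  have he : Real.exp r = ∑' m : ℕ, r ^ m / m.factorial := by
    rw [Real.exp_eq_exp_ℝ, NormedSpace.exp_eq_tsum_div]
  rw [he, ← hs.sum_add_tsum_nat_add n, add_sub_cancel_left, hs.sum_add_tsum_nat_add, ← tsum_mul_left]
  refine ((summable_nat_add_iff n).2 hs).tsum_le_tsum (fun m => ?_) (hs.mul_left _)
  rw [div_mul_div_comm, ← pow_add, add_comm m n]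
  have h1 : (n.factorial * m.factorial : ℝ) ≤ (n + m).factorial := by
    exact_mod_cast Nat.le_of_dvd (Nat.factorial_pos _) (Nat.factorial_mul_factorial_dvd_factorial_add n m)
  have h2 : (0 : ℝ) < n.factorial * m.factorial := by positivity
  gcongr

theorem abs_sum_sub_exp_le {x R : ℝ} (hx : |x| ≤ R) (n : ℕ) :
    |∑ m ∈ Finset.range n, x ^ m / m.factorial - Real.exp x| ≤
      R ^ n / n.factorial * Real.exp R := by
  have hs : Summable fun m : ℕ => x ^ m / m.factorial := Real.summable_pow_div_factorial x
  have hs' : Summable fun m : ℕ => |x| ^ m / m.factorial := Real.summable_pow_div_factorial |x|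
  have he : ∀ r, Real.exp r = ∑' m : ℕ, r ^ m / m.factorial := fun r => by
    rw [Real.exp_eq_exp_ℝ, NormedSpace.exp_eq_tsum_div]
  have e1 : ∀ m : ℕ, |x ^ (m + n) / ((m + n).factorial : ℝ)| = |x| ^ (m + n) / (m + n).factorial := by
    intro m; rw [abs_div, abs_pow, Nat.abs_cast]
  have h1 : |∑ m ∈ Finset.range n, x ^ m / m.factorial - Real.exp x| ≤
      Real.exp |x| - ∑ m ∈ Finset.range n, |x| ^ m / m.factorial := by
    rw [he, he, ← hs.sum_add_tsum_nat_add n, ← hs'.sum_add_tsum_nat_add n, sub_add_cancel_left,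
      add_sub_cancel_left, abs_neg]
    have h2 : Summable fun m : ℕ => |x ^ (m + n) / ((m + n).factorial : ℝ)| := by
      simp only [e1]; exact (summable_nat_add_iff n).2 hs'
    refine (norm_tsum_le_tsum_norm (f := fun m : ℕ => x ^ (m + n) / ((m + n).factorial : ℝ)) h2).trans
      (le_of_eq ?_)
    simp only [Real.norm_eq_abs, e1]
  have hR : 0 ≤ R := (abs_nonneg x).trans hx
  refine (h1.trans (exp_sub_sum_le (abs_nonneg x) n)).trans ?_
  gcongr

/-- Stability of weighted means. -/
theorem abs_mean_sub_mean_le {ι : Type*} {s : Finset ι} (hs : s.Nonempty) {a a' f f' : ι → ℝ}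
    {m η W ε : ℝ} (hm : 0 < m) (ha : ∀ j ∈ s, m ≤ a j) (hη : η ≤ m / 2)
    (haa : ∀ j ∈ s, |a' j - a j| ≤ η) (hW : ∀ j ∈ s, |f j| ≤ W)
    (hff : ∀ j ∈ s, |f' j - f j| ≤ ε) :
    |(∑ j ∈ s, a' j * f' j) / ∑ j ∈ s, a' j - (∑ j ∈ s, a j * f j) / ∑ j ∈ s, a j| ≤
      ε + 4 * W * η / m := by
  have hc : (0 : ℝ) < s.card := by exact_mod_cast hs.card_pos
  have ha' : ∀ j ∈ s, m / 2 ≤ a' j := fun j hj => by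
    have := ha j hj; have := (abs_le.1 (haa j hj)).1; linarith
  have hA : 0 < ∑ j ∈ s, a j := Finset.sum_pos (fun j hj => hm.trans_le (ha j hj)) hs
  have hA' : s.card * (m / 2) ≤ ∑ j ∈ s, a' j := by
    rw [← nsmul_eq_mul]; exact Finset.card_nsmul_le_sum s _ _ ha'
  have hA'0 : 0 < ∑ j ∈ s, a' j := lt_of_lt_of_le (by positivity) hA'
  obtain ⟨j₀, hj₀⟩ := hs
  have hη0 : 0 ≤ η := (abs_nonneg _).trans (haa j₀ hj₀)
  have hW0 : 0 ≤ W := (abs_nonneg _).trans (hW j₀ hj₀)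
  set r := (∑ j ∈ s, a j * f j) / ∑ j ∈ s, a j with hr
  have hrW : |r| ≤ W := by
    rw [hr, abs_div, abs_of_pos hA, div_le_iff₀ hA, Finset.mul_sum]
    refine (Finset.abs_sum_le_sum_abs _ _).trans (Finset.sum_le_sum fun j hj => ?_)
    rw [abs_mul, abs_of_pos (hm.trans_le (ha j hj)), mul_comm]
    exact mul_le_mul_of_nonneg_right (hW j hj) (hm.trans_le (ha j hj)).le
  have h0 : ∑ j ∈ s, a j * (f j - r) = 0 := by
    simp only [mul_sub, Finset.sum_sub_distrib, ← Finset.sum_mul]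
    rw [hr]; field_simp; simp
  have e1 : (∑ j ∈ s, a' j * f' j) / ∑ j ∈ s, a' j - r =
      (∑ j ∈ s, a' j * (f' j - f j)) / ∑ j ∈ s, a' j +
        (∑ j ∈ s, (a' j - a j) * (f j - r)) / ∑ j ∈ s, a' j := by
    have h2 : ∑ j ∈ s, (a' j - a j) * (f j - r) = ∑ j ∈ s, a' j * (f j - r) := by
      rw [← sub_zero (∑ j ∈ s, a' j * (f j - r)), ← h0, ← Finset.sum_sub_distrib]
      exact Finset.sum_congr rfl fun j _ => by ring
    rw [h2, ← add_div, ← Finset.sum_add_distrib]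
    have h3 : ∑ j ∈ s, (a' j * (f' j - f j) + a' j * (f j - r)) =
        ∑ j ∈ s, a' j * f' j - (∑ j ∈ s, a' j) * r := by
      rw [Finset.sum_mul, ← Finset.sum_sub_distrib]
      exact Finset.sum_congr rfl fun j _ => by ring
    rw [h3]; field_simp
  rw [e1]
  refine (abs_add_le _ _).trans (add_le_add ?_ ?_)
  · rw [abs_div, abs_of_pos hA'0, div_le_iff₀ hA'0, Finset.mul_sum]
    refine (Finset.abs_sum_le_sum_abs _ _).trans (Finset.sum_le_sum fun j hj => ?_)
    have : 0 < a' j := lt_of_lt_of_le (by positivity) (ha' j hj)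
    rw [abs_mul, abs_of_pos this, mul_comm]
    exact mul_le_mul_of_nonneg_right (hff j hj) this.le
  · rw [abs_div, abs_of_pos hA'0, div_le_iff₀ hA'0]
    have h4 : |∑ j ∈ s, (a' j - a j) * (f j - r)| ≤ s.card * (η * (2 * W)) := by
      refine (Finset.abs_sum_le_sum_abs _ _).trans ?_
      rw [← nsmul_eq_mul]
      refine Finset.sum_le_card_nsmul s _ _ fun j hj => ?_
      rw [abs_mul]
      refine mul_le_mul (haa j hj) ((abs_sub _ _).trans ?_) (abs_nonneg _) hη0
      linarith [hW j hj]
    refine h4.trans ?_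
    calc s.card * (η * (2 * W)) = 4 * W * η / m * (s.card * (m / 2)) := by field_simp; ring
      _ ≤ _ := by gcongr

section degree

variable {R P Q : ℕ}

theorem degree_filter (hP : 0 < P) : (Finset.range Q).filter
    (fun g => g.factorial < R ^ g * 2 ^ P) = Finset.range (degree R P Q) := by
  have h2 : 1 < 2 ^ P := Nat.one_lt_two_pow hP.ne'
  have step : ∀ g, (g + 1).factorial < R ^ (g + 1) * 2 ^ P → g.factorial < R ^ g * 2 ^ P := by
    intro g h
    rcases le_or_gt R (g + 1) with hR | hR
    · rw [Nat.factorial_succ, pow_succ, mul_comm (R ^ g) R, mul_assoc] at h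
      have := Nat.mul_le_mul_right (R ^ g * 2 ^ P) hR
      exact Nat.lt_of_mul_lt_mul_left (h.trans_le this)
    · have h1 : g.factorial ≤ R ^ g :=
        (Nat.factorial_le_pow g).trans (Nat.pow_le_pow_left (by omega) g)
      have h3 : 0 < R ^ g := by have : 0 < R := by omega
                                positivity
      nlinarith
  have down : ∀ g k, (g + k).factorial < R ^ (g + k) * 2 ^ P → g.factorial < R ^ g * 2 ^ P := by
    intro g k
    induction k with
    | zero => exact id
    | succ k ih => exact fun h => ih (step (g + k) h)
  have key : ∃ t, (Finset.range Q).filter (fun g => g.factorial < R ^ g * 2 ^ P) =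
      Finset.range t := by
    have hex : ∃ t, Q ≤ t ∨ R ^ t * 2 ^ P ≤ t.factorial := ⟨Q, Or.inl le_rfl⟩
    refine ⟨Nat.find hex, ?_⟩
    ext x
    simp only [Finset.mem_filter, Finset.mem_range]
    constructor
    · rintro ⟨h, h'⟩
      by_contra hx
      rcases Nat.find_spec hex with h1 | h1
      · omega
      · obtain ⟨k, hk⟩ := Nat.exists_eq_add_of_le (not_lt.1 hx)
        rw [hk] at h'
        exact absurd (down _ _ h') (by omega)
    · intro h
      have := Nat.find_min hex h
      push Not at this
      exact this
  obtain ⟨t, ht⟩ := key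
  rw [degree, ht, Finset.card_range]

theorem degree_spec (hP : 0 < P) (hQ : R ^ Q * 2 ^ P ≤ Q.factorial) :
    R ^ degree R P Q * 2 ^ P ≤ (degree R P Q).factorial := by
  rcases (degree_le R P Q).lt_or_eq with h | h
  · by_contra h'
    have : degree R P Q ∈ (Finset.range Q).filter (fun g => g.factorial < R ^ g * 2 ^ P) := by
      simp only [Finset.mem_filter, Finset.mem_range]; omega
    rw [degree_filter hP] at this
    simp at this
  · rw [h]; exact hQ

theorem degree_le_of (hP : 0 < P) {g : ℕ} (hg : R ^ g * 2 ^ P ≤ g.factorial) :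
    degree R P Q ≤ g := by
  by_contra h
  push Not at h
  have : g ∈ (Finset.range Q).filter (fun g => g.factorial < R ^ g * 2 ^ P) := by
    rw [degree_filter hP, Finset.mem_range]; exact h
  simp only [Finset.mem_filter, Finset.mem_range] at this
  omega

theorem pow_mul_le_factorial {R P g c : ℕ} (h : 3 * R * c ≤ g) (hc : 2 ^ P ≤ c ^ g) :
    R ^ g * 2 ^ P ≤ g.factorial := by
  have h1 : g ^ g ≤ 3 ^ g * g.factorial := by
    have := Real.pow_div_factorial_le_exp (g : ℝ) (by positivity) g
    have h3 : Real.exp g ≤ 3 ^ g := by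
      rw [← mul_one (g : ℝ), Real.exp_nat_mul]
      exact pow_le_pow_left₀ (by positivity) Real.exp_one_lt_three.le g
    rw [div_le_iff₀ (by positivity)] at this
    have : (g : ℝ) ^ g ≤ 3 ^ g * g.factorial :=
      this.trans (mul_le_mul_of_nonneg_right h3 (by positivity))
    exact_mod_cast this
  have h2 : 3 ^ g * (R ^ g * 2 ^ P) ≤ g ^ g := by
    calc 3 ^ g * (R ^ g * 2 ^ P) ≤ 3 ^ g * (R ^ g * c ^ g) := by gcongr
      _ = (3 * R * c) ^ g := by rw [mul_pow, mul_pow]; ring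
      _ ≤ g ^ g := Nat.pow_le_pow_left h g
  exact Nat.le_of_mul_le_mul_left (h2.trans h1) (by positivity)

end degree

end RoPE.Alg

namespace RoPE

section gradient

variable {n d : ℕ} (A₁ A₂ A₃ E : Matrix (Fin n) (Fin d) ℝ) (Y : Matrix (Fin d) (Fin d) ℝ)
  (W : ℤ → Matrix (Fin d) (Fin d) ℝ)

/-- The coefficients of the exponent of the attention weight at `(i, j)`. -/
noncomputable def coeff (i j : Fin n) : EuclideanSpace ℝ (Idx d) :=
  WithLp.toLp 2 fun q => A₁ i q.1.1 * A₂ j q.1.2 * W ((i : ℤ) - j) q.2.1 q.2.2 / d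

/-- The exponent of the attention weight at `(i, j)`. -/
noncomputable def expo (x : EuclideanSpace ℝ (Idx d)) (i j : Fin n) : ℝ := inner ℝ (coeff A₁ A₂ W i j) x

theorem attention_eq (x : EuclideanSpace ℝ (Idx d)) (i j : Fin n) :
    attention A₁ A₂ W x i j = Real.exp (expo A₁ A₂ W x i j) := by
  rw [attention, Matrix.of_apply, expo, PiLp.inner_apply]
  congr 1
  refine Finset.sum_congr rfl fun q _ => ?_
  simp only [rowKron, posMatrix, coeff, Matrix.of_apply, Matrix.kroneckerMap_apply,
    RCLike.inner_apply, conj_trivial]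
  ring

/-- Mean of `v` for the attention weights in row `i`. -/
noncomputable def mean (x : EuclideanSpace ℝ (Idx d)) (i : Fin n) (v : Fin n → ℝ) : ℝ :=
  (∑ j, Real.exp (expo A₁ A₂ W x i j) * v j) / ∑ j, Real.exp (expo A₁ A₂ W x i j)

theorem rowSum_pos (x : EuclideanSpace ℝ (Idx d)) (i : Fin n) :
    0 < ∑ j, Real.exp (expo A₁ A₂ W x i j) :=
  Finset.sum_pos (fun _ _ => Real.exp_pos _) ⟨i, Finset.mem_univ i⟩

theorem output_eq (x : EuclideanSpace ℝ (Idx d)) (i : Fin n) (c : Fin d) :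
    ((normalizer A₁ A₂ W x)⁻¹ * attention A₁ A₂ W x * A₃ * Y) i c =
      mean A₁ A₂ W x i fun j => (A₃ * Y) j c := by
  have h1 : (normalizer A₁ A₂ W x)⁻¹ =
      Matrix.diagonal fun i => (∑ j, Real.exp (expo A₁ A₂ W x i j))⁻¹ := by
    refine Matrix.inv_eq_left_inv ?_
    rw [normalizer, Matrix.diagonal_mul_diagonal, ← Matrix.diagonal_one]
    congr 1
    ext i
    have : (attention A₁ A₂ W x).mulVec 1 i = ∑ j, Real.exp (expo A₁ A₂ W x i j) := by
      simp [Matrix.mulVec, dotProduct, attention_eq]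
    rw [this]
    exact inv_mul_cancel₀ (rowSum_pos A₁ A₂ W x i).ne'
  rw [h1, Matrix.mul_assoc, Matrix.mul_assoc, Matrix.diagonal_mul, mean, div_eq_inv_mul]
  congr 1
  rw [Matrix.mul_apply]
  exact Finset.sum_congr rfl fun j _ => by rw [attention_eq]

theorem loss_eq (x : EuclideanSpace ℝ (Idx d)) : loss A₁ A₂ A₃ E Y W x =
    1 / 2 * ∑ i, ∑ c, (mean A₁ A₂ W x i (fun j => (A₃ * Y) j c) - E i c) ^ 2 := by
  rw [loss, frobenius, Real.sq_sqrt (by positivity)]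
  simp only [Matrix.sub_apply, output_eq]

theorem hasFDerivAt_mean (x : EuclideanSpace ℝ (Idx d)) (i : Fin n) (v : Fin n → ℝ) :
    HasFDerivAt (fun x => mean A₁ A₂ W x i v) (innerSL ℝ
      ((∑ j, Real.exp (expo A₁ A₂ W x i j))⁻¹ • ∑ j, (Real.exp (expo A₁ A₂ W x i j) *
        (v j - mean A₁ A₂ W x i v)) • coeff A₁ A₂ W i j)) x := by
  have h1 : ∀ j, HasFDerivAt (fun x => Real.exp (expo A₁ A₂ W x i j))
      (Real.exp (expo A₁ A₂ W x i j) • innerSL ℝ (coeff A₁ A₂ W i j)) x := fun j =>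
    ((innerSL ℝ (coeff A₁ A₂ W i j)).hasFDerivAt (x := x)).exp
  have h2 : HasFDerivAt (fun x => ∑ j, Real.exp (expo A₁ A₂ W x i j))
      (∑ j, Real.exp (expo A₁ A₂ W x i j) • innerSL ℝ (coeff A₁ A₂ W i j)) x :=
    HasFDerivAt.fun_sum fun j _ => h1 j
  have h3 : HasFDerivAt (fun x => ∑ j, Real.exp (expo A₁ A₂ W x i j) * v j)
      (∑ j, v j • Real.exp (expo A₁ A₂ W x i j) • innerSL ℝ (coeff A₁ A₂ W i j)) x :=
    HasFDerivAt.fun_sum fun j _ => (h1 j).mul_const (v j)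
  have hs := rowSum_pos A₁ A₂ W x i
  have h4 := h3.mul ((hasDerivAt_inv hs.ne').comp_hasFDerivAt x h2)
  refine h4.congr_fderiv ?_
  ext y
  simp only [Function.comp_apply, add_apply, smul_apply,
    sum_apply, innerSL_apply_apply, smul_eq_mul, inner_smul_left, sum_inner,
    conj_trivial]
  rw [mean]
  set s := ∑ j, Real.exp (expo A₁ A₂ W x i j)
  set N := ∑ j, Real.exp (expo A₁ A₂ W x i j) * v j
  have e1 : ∑ j, Real.exp (expo A₁ A₂ W x i j) * (v j - N / s) * inner ℝ (coeff A₁ A₂ W i j) y =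
      ∑ j, v j * (Real.exp (expo A₁ A₂ W x i j) * inner ℝ (coeff A₁ A₂ W i j) y) -
      N / s * ∑ j, Real.exp (expo A₁ A₂ W x i j) * inner ℝ (coeff A₁ A₂ W i j) y := by
    rw [Finset.mul_sum, ← Finset.sum_sub_distrib]
    exact Finset.sum_congr rfl fun j _ => by ring
  rw [e1]
  field_simp
  ring

/-- The gradient of the loss. -/
noncomputable def grad (x : EuclideanSpace ℝ (Idx d)) : EuclideanSpace ℝ (Idx d) :=
  ∑ i, ∑ c, (mean A₁ A₂ W x i (fun j => (A₃ * Y) j c) - E i c) •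
    ((∑ j, Real.exp (expo A₁ A₂ W x i j))⁻¹ • ∑ j, (Real.exp (expo A₁ A₂ W x i j) *
        ((A₃ * Y) j c - mean A₁ A₂ W x i (fun j => (A₃ * Y) j c))) • coeff A₁ A₂ W i j)

theorem hasGradientAt_loss (x : EuclideanSpace ℝ (Idx d)) :
    HasGradientAt (loss A₁ A₂ A₃ E Y W) (grad A₁ A₂ A₃ E Y W x) x := by
  rw [hasGradientAt_iff_hasFDerivAt]
  have h1 : loss A₁ A₂ A₃ E Y W = fun x =>
      1 / 2 * ∑ i, ∑ c, (mean A₁ A₂ W x i (fun j => (A₃ * Y) j c) - E i c) ^ 2 :=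
    funext fun x => loss_eq A₁ A₂ A₃ E Y W x
  rw [h1]
  have h2 := (HasFDerivAt.fun_sum (u := Finset.univ) fun i (_ : i ∈ Finset.univ) =>
    HasFDerivAt.fun_sum (u := Finset.univ) fun c (_ : c ∈ Finset.univ) =>
      ((hasFDerivAt_mean A₁ A₂ W x i fun j => (A₃ * Y) j c).sub_const (E i c)).pow 2).const_mul
        (1 / 2 : ℝ)
  refine h2.congr_fderiv ?_
  ext y
  simp only [smul_apply, sum_apply, innerSL_apply_apply,
    smul_eq_mul, InnerProductSpace.toDual_apply_apply, grad, sum_inner]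
  rw [Finset.mul_sum]
  refine Finset.sum_congr rfl fun i _ => ?_
  rw [Finset.mul_sum]
  refine Finset.sum_congr rfl fun c _ => ?_
  simp only [real_inner_smul_left]
  norm_num
  ring

theorem grad_apply (x : EuclideanSpace ℝ (Idx d)) (q : Idx d) :
    grad A₁ A₂ A₃ E Y W x q = ∑ i, ∑ c, A₁ i q.1.1 / d *
      (mean A₁ A₂ W x i (fun j => (A₃ * Y) j c) - E i c) *
      (mean A₁ A₂ W x i (fun j => W ((i : ℤ) - j) q.2.1 q.2.2 * (A₂ j q.1.2 * (A₃ * Y) j c)) -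
        mean A₁ A₂ W x i (fun j => (A₃ * Y) j c) *
          mean A₁ A₂ W x i (fun j => W ((i : ℤ) - j) q.2.1 q.2.2 * A₂ j q.1.2)) := by
  simp only [grad, WithLp.ofLp_sum, Finset.sum_apply, PiLp.smul_apply, smul_eq_mul, coeff]
  refine Finset.sum_congr rfl fun i _ => Finset.sum_congr rfl fun c _ => ?_
  rw [mul_comm (A₁ i q.1.1 / d), mul_assoc]
  congr 1
  generalize mean A₁ A₂ W x i (fun j => (A₃ * Y) j c) = O
  simp only [mean, div_eq_mul_inv]
  generalize (∑ j, Real.exp (expo A₁ A₂ W x i j))⁻¹ = t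
  have e1 : ∀ u v w : ℝ, u * (v * t - O * (w * t)) = t * (u * (v - O * w)) := fun u v w => by ring
  rw [e1]
  congr 1
  rw [Finset.mul_sum, ← Finset.sum_sub_distrib, Finset.mul_sum]
  exact Finset.sum_congr rfl fun j _ => by ring

end gradient

end RoPE

namespace RoPE

theorem layout_apply {ι : Type*} [Fintype ι] {addr : ι → ℤ} (h : Function.Injective addr)
    (f : ι → ℤ) (i : ι) : RAM.layout addr f (addr i) = f i := by
  classical
  simp [RAM.layout, h.eq_iff]

theorem injective_rowMajor (m k : ℕ) :
    Function.Injective fun q : Fin m × Fin k => ((q.1 : ℕ) : ℤ) * k + (q.2 : ℕ) := by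
  rintro ⟨i, j⟩ ⟨i', j'⟩ h
  simp only at h
  have h1 := congrArg (· / (k : ℤ)) h
  have h2 := congrArg (· % (k : ℤ)) h
  simp only [Alg.idx_div j.2, Alg.idx_div j'.2, Alg.idx_mod j.2, Alg.idx_mod j'.2] at h1 h2
  ext <;> simp <;> omega

theorem storeMatrix_apply {m k : ℕ} (f : ℚ → ℤ) (A : Matrix (Fin m) (Fin k) ℚ) (i : Fin m)
    (j : Fin k) : Instance.storeMatrix f A (((i : ℕ) : ℤ) * k + (j : ℕ)) = f (A i j) :=
  layout_apply (injective_rowMajor m k) (fun q => f (A q.1 q.2)) (i, j)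

theorem storeWeights_apply {n d : ℕ} (f : ℚ → ℤ) (I : Instance n d) (t : Fin (2 * n - 1))
    (k l : Fin d) : I.storeWeights f ((((t : ℕ) : ℤ) * d + (k : ℕ)) * d + (l : ℕ)) =
      f (I.W (((t : ℕ) : ℤ) - ((n : ℤ) - 1)) k l) := by
  refine layout_apply (addr := fun q : Fin (2 * n - 1) × Fin d × Fin d =>
    (((q.1 : ℕ) : ℤ) * d + (q.2.1 : ℕ)) * d + (q.2.2 : ℕ)) ?_
    (fun q => f (I.W (((q.1 : ℕ) : ℤ) - ((n : ℤ) - 1)) q.2.1 q.2.2)) (t, k, l)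
  rintro ⟨i, j, l⟩ ⟨i', j', l'⟩ h
  simp only at h
  have h1 := congrArg (· / (d : ℤ)) h
  have h2 := congrArg (· % (d : ℤ)) h
  have e : ∀ (i : Fin (2 * n - 1)) (j : Fin d), ((i : ℕ) : ℤ) * d + (j : ℕ) =
    (((i : ℕ) * d + (j : ℕ) : ℕ) : ℤ) := fun i j => by push_cast; rfl
  simp only [e, Alg.idx_div l.2, Alg.idx_div l'.2, Alg.idx_mod l.2, Alg.idx_mod l'.2] at h1 h2
  simp only [← e] at h1
  have h3 := injective_rowMajor (2 * n - 1) d (a₁ := (i, j)) (a₂ := (i', j')) h1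
  rw [Prod.mk.injEq] at h3
  obtain ⟨rfl, rfl⟩ := h3
  simp only [Prod.mk.injEq, true_and]
  ext; omega

namespace Alg

open RAM RAM.Fml

theorem abs_ediv_sub_le (a : ℤ) {b : ℤ} (hb : 0 < b) : |((a / b : ℤ) : ℝ) - a / b| ≤ 1 := by
  have hb' : (0 : ℝ) < b := by exact_mod_cast hb
  have h1 : (b : ℝ) * ((a / b : ℤ) : ℝ) + ((a % b : ℤ) : ℝ) = a := by
    exact_mod_cast Int.mul_ediv_add_emod a b
  have h2 : (0 : ℝ) ≤ ((a % b : ℤ) : ℝ) := by exact_mod_cast Int.emod_nonneg a hb.ne'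
  have h3 : ((a % b : ℤ) : ℝ) ≤ b := by exact_mod_cast (Int.emod_lt_of_pos a hb).le
  have e : ((a / b : ℤ) : ℝ) - a / b = -(((a % b : ℤ) : ℝ) / b) := by
    rw [← h1]; field_simp; ring
  rw [e, abs_neg, abs_of_nonneg (by positivity), div_le_one hb']
  exact h3

theorem abs_scaled_sub_le (P : ℕ) (r : ℚ) :
    |((2 ^ P * r.num / r.den : ℤ) : ℝ) / 2 ^ P - r| ≤ 1 / 2 ^ P := by
  have h := abs_ediv_sub_le (2 ^ P * r.num) (b := r.den) (by exact_mod_cast r.pos)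
  have e : (r : ℝ) = r.num / r.den := by exact_mod_cast (Rat.num_div_den r).symm
  have e2 : ((2 ^ P * r.num / r.den : ℤ) : ℝ) / 2 ^ P - r =
      (((2 ^ P * r.num / r.den : ℤ) : ℝ) - ((2 ^ P * r.num : ℤ) : ℝ) / ((r.den : ℤ) : ℝ)) / 2 ^ P := by
    rw [e]; push_cast; field_simp
  rw [e2, abs_div, abs_of_pos (by positivity : (0 : ℝ) < 2 ^ P)]
  gcongr

namespace Sys

variable {K C₁ C₂ C₃ n d : ℕ} {I : Instance n d} {ρ : ℕ → ℤ} {M : ℕ → ℤ → ℤ}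

theorem proj_approx (S : Sys K C₁ C₂ C₃ I ρ M) {c a x : ℕ}
    (h : Stmt.fill c 15 (fProj a x) ∈ prog K C₁ C₂ C₃) {A : Matrix (Fin n) (Fin d) ℚ}
    {X : Matrix (Fin d) (Fin d) ℚ} (h1 : M a = Instance.storeMatrix Rat.num A)
    (h2 : M (a + 8) = Instance.storeMatrix (fun r => (r.den : ℤ)) A)
    (h3 : M x = Instance.storeMatrix Rat.num X)
    (h4 : M (x + 8) = Instance.storeMatrix (fun r => (r.den : ℤ)) X) (i : Fin n) (k : Fin d) :
    |(M c (((i : ℕ) : ℤ) * d + (k : ℕ)) : ℝ) / 2 ^ prec C₁ n - toReal (A * X) i k| ≤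
      d / 2 ^ prec C₁ n := by
  rw [S.projEq h i.2 k.2, Finset.sum_range, h1, h2, h3, h4]
  simp only [storeMatrix_apply]
  have e : toReal (A * X) i k = ∑ j, (A i j : ℝ) * X j k := by
    simp [toReal, Matrix.mul_apply]
  rw [e]
  push_cast
  rw [Finset.sum_div, ← Finset.sum_sub_distrib]
  refine (Finset.abs_sum_le_sum_abs _ _).trans ?_
  have key : ∀ j ∈ Finset.univ, |((2 ^ prec C₁ n * (A i j).num * (X j k).num /
      ((A i j).den * (X j k).den) : ℤ) : ℝ) / 2 ^ prec C₁ n - (A i j : ℝ) * X j k| ≤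
      1 / 2 ^ prec C₁ n := by
    intro j _
    have hp : (0 : ℤ) < (A i j).den * (X j k).den := by
      exact_mod_cast Nat.mul_pos (A i j).pos (X j k).pos
    have h := abs_ediv_sub_le (2 ^ prec C₁ n * (A i j).num * (X j k).num) hp
    have eA : (A i j : ℝ) = (A i j).num / (A i j).den := by
      exact_mod_cast (Rat.num_div_den _).symm
    have eX : (X j k : ℝ) = (X j k).num / (X j k).den := by
      exact_mod_cast (Rat.num_div_den _).symm
    have d1 : ((A i j).den : ℝ) ≠ 0 := by exact_mod_cast (A i j).den_ne_zero
    have d2 : ((X j k).den : ℝ) ≠ 0 := by exact_mod_cast (X j k).den_ne_zero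
    have e2 : ((2 ^ prec C₁ n * (A i j).num * (X j k).num /
      ((A i j).den * (X j k).den) : ℤ) : ℝ) / 2 ^ prec C₁ n - (A i j : ℝ) * X j k =
      (((2 ^ prec C₁ n * (A i j).num * (X j k).num / ((A i j).den * (X j k).den) : ℤ) : ℝ) -
        ((2 ^ prec C₁ n * (A i j).num * (X j k).num : ℤ) : ℝ) /
          (((A i j).den * (X j k).den : ℤ) : ℝ)) / 2 ^ prec C₁ n := by
      rw [sub_div]
      congr 1
      rw [eA, eX]; push_cast; field_simp
    rw [e2, abs_div, abs_of_pos (by positivity : (0 : ℝ) < 2 ^ prec C₁ n)]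
    gcongr
  refine (Finset.sum_le_sum key).trans (le_of_eq ?_)
  simp [div_eq_mul_inv]

theorem query_approx (S : Sys K C₁ C₂ C₃ I ρ M) (i : Fin n) (k : Fin d) :
    |(M 25 (((i : ℕ) : ℤ) * d + (k : ℕ)) : ℝ) / 2 ^ prec C₁ n - toReal (I.A₁ * I.X₁) i k| ≤
      d / 2 ^ prec C₁ n :=
  S.proj_approx (c := 25) (a := 0) (x := 4) (by simp [prog]) (S.input 0 (by simp [inputBanks]))
    (S.input 8 (by simp [inputBanks])) (S.input 4 (by simp [inputBanks]))
    (S.input 12 (by simp [inputBanks])) i k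

theorem key_approx (S : Sys K C₁ C₂ C₃ I ρ M) (i : Fin n) (k : Fin d) :
    |(M 26 (((i : ℕ) : ℤ) * d + (k : ℕ)) : ℝ) / 2 ^ prec C₁ n - toReal (I.A₂ * I.X₂) i k| ≤
      d / 2 ^ prec C₁ n :=
  S.proj_approx (c := 26) (a := 1) (x := 5) (by simp [prog]) (S.input 1 (by simp [inputBanks]))
    (S.input 9 (by simp [inputBanks])) (S.input 5 (by simp [inputBanks]))
    (S.input 13 (by simp [inputBanks])) i k

theorem value_approx (S : Sys K C₁ C₂ C₃ I ρ M) (i : Fin n) (k : Fin d) :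
    |(M 27 (((i : ℕ) : ℤ) * d + (k : ℕ)) : ℝ) / 2 ^ prec C₁ n - toReal (I.A₃ * I.Y) i k| ≤
      d / 2 ^ prec C₁ n :=
  S.proj_approx (c := 27) (a := 2) (x := 6) (by simp [prog]) (S.input 2 (by simp [inputBanks]))
    (S.input 10 (by simp [inputBanks])) (S.input 6 (by simp [inputBanks]))
    (S.input 14 (by simp [inputBanks])) i k

theorem weight_addr (t k l : ℕ) : (t : ℤ) * (d * d : ℕ) + (k * d + l : ℕ) = ((t : ℤ) * d + k) * d + l := by
  push_cast; ring

theorem weight_num (S : Sys K C₁ C₂ C₃ I ρ M) (t : Fin (2 * n - 1)) (k l : Fin d) :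
    M 7 (((t : ℕ) : ℤ) * (d * d : ℕ) + ((k : ℕ) * d + (l : ℕ) : ℕ)) =
      (I.W (((t : ℕ) : ℤ) - ((n : ℤ) - 1)) k l).num := by
  rw [S.input 7 (by simp [inputBanks]), weight_addr]
  exact storeWeights_apply Rat.num I t k l

theorem weight_den (S : Sys K C₁ C₂ C₃ I ρ M) (t : Fin (2 * n - 1)) (k l : Fin d) :
    M 15 (((t : ℕ) : ℤ) * (d * d : ℕ) + ((k : ℕ) * d + (l : ℕ) : ℕ)) =
      ((I.W (((t : ℕ) : ℤ) - ((n : ℤ) - 1)) k l).den : ℤ) := by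
  rw [S.input 15 (by simp [inputBanks]), weight_addr]
  exact storeWeights_apply (fun r => (r.den : ℤ)) I t k l

theorem r29 (S : Sys K C₁ C₂ C₃ I ρ M) : ρ 29 = ((d * d + 1) * (2 * n - 1) : ℕ) := by
  rw [S.paramEq (x := 29) (e := (var 14 + 1) * var 21) (by simp [prog])]
  simp only [eval_rules, S.r14, S.r21]; push_cast; rfl

theorem r32 (S : Sys K C₁ C₂ C₃ I ρ M) : ρ 32 = ((d + 1) * (d + 1) * n : ℕ) := by
  rw [S.paramEq (x := 32) (e := var 31 * var 0) (by simp [prog])]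
  simp only [eval_rules, S.r31, S.r0]; push_cast; rfl

theorem t42_top (S : Sys K C₁ C₂ C₃ I ρ M) {t : ℕ} (ht : t < 2 * n - 1) :
    M 42 (((d * d : ℕ) : ℤ) * (2 * n - 1 : ℕ) + t) = 2 ^ prec C₁ n := by
  have h := S.fillEq (a := 42) (e := fWeightExt) (by simp [prog]) S.r29
    (idx_lt (Nat.lt_succ_self (d * d)) ht)
  rw [Nat.cast_add, Nat.cast_mul] at h
  rw [h]
  simp only [fWeightExt, eval_rules, Function.update_apply, reduceIte, Nat.reduceEqDiff, S.r21,
    idx_div ht, idx_mod ht, S.r14, S.r13]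
  simp

theorem t42 (S : Sys K C₁ C₂ C₃ I ρ M) (t : Fin (2 * n - 1)) (k l : Fin d) :
    M 42 ((((k : ℕ) * d + (l : ℕ) : ℕ) : ℤ) * (2 * n - 1 : ℕ) + (t : ℕ)) =
      2 ^ prec C₁ n * (I.W (((t : ℕ) : ℤ) - ((n : ℤ) - 1)) k l).num /
        (I.W (((t : ℕ) : ℤ) - ((n : ℤ) - 1)) k l).den := by
  have hlt := idx_lt k.2 l.2
  have h := S.fillEq (a := 42) (e := fWeightExt) (by simp [prog]) S.r29
    (idx_lt (Nat.lt_succ_of_lt hlt) t.2)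
  rw [Nat.cast_add, Nat.cast_mul] at h
  rw [h]
  simp only [fWeightExt, eval_rules, Function.update_apply, reduceIte, Nat.reduceEqDiff, S.r21,
    idx_div t.2, idx_mod t.2, S.r14, S.r13]
  have h' := S.fillEq (a := 41) (e := fWeight) (by simp [prog]) S.r22 (idx_lt t.2 hlt)
  rw [Nat.cast_add, Nat.cast_mul] at h'
  rw [if_pos (by rw [sub_pos]; exact_mod_cast hlt), h']
  simp only [fWeight, eval_rules, Function.update_apply, reduceIte, Nat.reduceEqDiff, S.r13]
  rw [S.weight_num, S.weight_den]

/-- The entries of `A₂` used in the sums, scaled, extended by `1`. -/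
def keyExt (P : ℕ) (d : ℕ) (M : ℕ → ℤ → ℤ) (j b : ℕ) : ℤ :=
  if b < d then 2 ^ P * M 1 ((j : ℤ) * d + b) / M 9 ((j : ℤ) * d + b) else 2 ^ P

/-- The entries of `A₃ Y` used in the sums, scaled, extended by `1`. -/
def valueExt (P : ℕ) (d : ℕ) (M : ℕ → ℤ → ℤ) (j c : ℕ) : ℤ :=
  if c < d then M 27 ((j : ℤ) * d + c) else 2 ^ P

theorem t44 (S : Sys K C₁ C₂ C₃ I ρ M) {b c j : ℕ} (hb : b < d + 1) (hc : c < d + 1) (hj : j < n) :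
    M 44 (((b * (d + 1) + c : ℕ) : ℤ) * n + j) =
      keyExt (prec C₁ n) d M j b * valueExt (prec C₁ n) d M j c := by
  have h := S.fillEq (a := 44) (e := fValueExt) (by simp [prog]) S.r32 (idx_lt (idx_lt hb hc) hj)
  rw [Nat.cast_add, Nat.cast_mul] at h
  rw [h]
  have e : (d : ℤ) + 1 = (d + 1 : ℕ) := by push_cast; rfl
  simp only [fValueExt, eval_rules, Function.update_apply, reduceIte, Nat.reduceEqDiff, S.r0,
    idx_div hj, idx_mod hj, S.r1, S.r13]
  rw [e, Nat.cast_add (b * (d + 1)), Nat.cast_mul b, idx_div hc, idx_mod hc, keyExt, valueExt]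
  congr 1
  · exact if_congr (by rw [sub_pos, Nat.cast_lt]) rfl rfl
  · exact if_congr (by rw [sub_pos, Nat.cast_lt]) rfl rfl

theorem weight_approx (S : Sys K C₁ C₂ C₃ I ρ M) (i j : Fin n) (k l : Fin d) :
    |(M 42 ((((k : ℕ) * d + (l : ℕ) : ℕ) : ℤ) * (2 * n - 1 : ℕ) +
        ((i : ℕ) + (n - 1 - (j : ℕ)) : ℕ)) : ℝ) / 2 ^ prec C₁ n -
      toReal (I.W (((i : ℕ) : ℤ) - (j : ℕ))) k l| ≤ 1 / 2 ^ prec C₁ n := by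
  have h := S.t42 ⟨(i : ℕ) + (n - 1 - (j : ℕ)), by omega⟩ k l
  have e : (((i : ℕ) + (n - 1 - (j : ℕ)) : ℕ) : ℤ) - ((n : ℤ) - 1) = ((i : ℕ) : ℤ) - (j : ℕ) := by
    omega
  simp only [e] at h
  rw [h]
  exact abs_scaled_sub_le _ _

theorem keyExt_approx (S : Sys K C₁ C₂ C₃ I ρ M) (j : Fin n) (b : Fin d) :
    |(keyExt (prec C₁ n) d M j b : ℝ) / 2 ^ prec C₁ n - toReal I.A₂ j b| ≤ 1 / 2 ^ prec C₁ n := by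
  rw [keyExt, if_pos b.2, S.input 1 (by simp [inputBanks]), S.input 9 (by simp [inputBanks])]
  simp only [Instance.input]
  rw [storeMatrix_apply, storeMatrix_apply]
  exact abs_scaled_sub_le _ _

theorem expo_point (I : Instance n d) (i j : Fin n) :
    expo (toReal I.A₁) (toReal I.A₂) (fun t => toReal (I.W t)) I.point i j =
      (∑ k, ∑ l, toReal (I.A₁ * I.X₁) i k * toReal (I.A₂ * I.X₂) j l *
        toReal (I.W (((i : ℕ) : ℤ) - (j : ℕ))) k l) / d := by
  have e : ∀ (A : Matrix (Fin n) (Fin d) ℚ) (X : Matrix (Fin d) (Fin d) ℚ) (i : Fin n) (k : Fin d),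
      toReal (A * X) i k = ∑ a, toReal A i a * toReal X a k := by
    intro A X i k; simp [toReal, Matrix.mul_apply]
  simp only [expo, PiLp.inner_apply, coeff, Instance.point, vect, RCLike.inner_apply, conj_trivial,
    e, Matrix.kroneckerMap_apply]
  rw [Fintype.sum_prod_type, Finset.sum_comm, Finset.sum_div, Fintype.sum_prod_type]
  refine Finset.sum_congr rfl fun k _ => ?_
  rw [Finset.sum_div]
  refine Finset.sum_congr rfl fun l _ => ?_
  rw [Fintype.sum_prod_type, Finset.sum_mul_sum, Finset.sum_mul, Finset.sum_div]
  refine Finset.sum_congr rfl fun a _ => ?_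
  rw [Finset.sum_mul, Finset.sum_div]
  exact Finset.sum_congr rfl fun b _ => by ring

end Sys

end Alg

end RoPE

namespace RoPE.Alg

open RAM RAM.Fml

/-- The computed sums. -/
def sumAt (n d : ℕ) (M : ℕ → ℤ → ℤ) (κ b c i : ℕ) : ℤ :=
  M 53 (((κ * ((d + 1) * (d + 1)) + (b * (d + 1) + c) : ℕ) : ℤ) * n + i)

/-- The contribution of the row `i` and the column `c` to the entry of the gradient at
`((a, b), κ)`. -/
def gradTerm (P n d : ℕ) (M : ℕ → ℤ → ℤ) (a b κ i c : ℕ) : ℤ :=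
  (2 ^ P * M 0 ((i : ℤ) * d + a) *
    (sumAt n d M (d * d) d c i * M 11 ((i : ℤ) * d + c) -
      M 3 ((i : ℤ) * d + c) * sumAt n d M (d * d) d d i) *
    (sumAt n d M κ b c i * sumAt n d M (d * d) d d i -
      sumAt n d M (d * d) d c i * sumAt n d M κ b d i)) /
  (M 8 ((i : ℤ) * d + a) * M 11 ((i : ℤ) * d + c) * sumAt n d M (d * d) d d i *
    sumAt n d M (d * d) d d i * sumAt n d M (d * d) d d i * d)

namespace Sys

variable {K C₁ C₂ C₃ n d : ℕ} {I : Instance n d} {ρ : ℕ → ℤ} {M : ℕ → ℤ → ℤ}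

theorem r42 (S : Sys K C₁ C₂ C₃ I ρ M) : ρ 42 = (d * d * (d * d) : ℕ) := by
  rw [S.paramEq (x := 42) (e := var 14 * var 14) (by simp [prog])]
  simp only [eval_rules, S.r14]; push_cast; rfl

theorem r43 (S : Sys K C₁ C₂ C₃ I ρ M) : ρ 43 = (n * (d * d * (d * d)) : ℕ) := by
  rw [S.paramEq (x := 43) (e := var 0 * var 42) (by simp [prog])]
  simp only [eval_rules, S.r0, S.r42]; push_cast; rfl

theorem gradientEq (S : Sys K C₁ C₂ C₃ I ρ M) {a b κ i : ℕ} (ha : a < d) (hb : b < d)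
    (hκ : κ < d * d) (hi : i < n) :
    M 54 ((i : ℤ) * (d * d * (d * d) : ℕ) + ((a * d + b) * (d * d) + κ : ℕ)) =
      (if i = 0 then 0 else
        M 54 (((i - 1 : ℕ) : ℤ) * (d * d * (d * d) : ℕ) + ((a * d + b) * (d * d) + κ : ℕ))) +
      ∑ c ∈ Finset.range d, gradTerm (prec C₁ n) n d M a b κ i c := by
  have hx : (a * d + b) * (d * d) + κ < d * d * (d * d) := idx_lt (idx_lt ha hb) hκ
  have h := S.fillEq (a := 54) (e := fGradient) (by simp [prog]) S.r43 (idx_lt hi hx)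
  rw [Nat.cast_add, Nat.cast_mul i] at h
  rw [h]
  have e1 : (((a * d + b) * (d * d) + κ : ℕ) : ℤ) / (d * (d * d : ℕ)) = a := by
    have : ((a * d + b) * (d * d) + κ : ℕ) = a * (d * (d * d)) + (b * (d * d) + κ) := by ring
    rw [this, Nat.cast_add, Nat.cast_mul a, ← Nat.cast_mul d, idx_div (idx_lt hb hκ)]
  have e2 : (((a * d + b) * (d * d) + κ : ℕ) : ℤ) / (d * d : ℕ) % d = b := by
    rw [Nat.cast_add, Nat.cast_mul (a * d + b), idx_div hκ, Nat.cast_add, Nat.cast_mul, idx_mod hb]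
  have e3 : (((a * d + b) * (d * d) + κ : ℕ) : ℤ) % (d * d : ℕ) = κ := by
    rw [Nat.cast_add, Nat.cast_mul (a * d + b), idx_mod hκ]
  simp only [fGradient, fSumAt, eval_rules, Function.update_apply, reduceIte, Nat.reduceEqDiff,
    S.r42, S.r0, S.r1, S.r13, S.r14, S.r31, idx_div hx, idx_mod hx, e1, e2, e3,
    Int.toNat_natCast]
  congr 1
  · by_cases h0 : i = 0
    · subst h0
      rw [if_pos rfl, if_neg]
      push_cast at hx ⊢
      zify at hx
      omega
    · obtain ⟨i, rfl⟩ := Nat.exists_eq_succ_of_ne_zero h0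
      have e4 : ((i.succ : ℕ) : ℤ) * (d * d * (d * d) : ℕ) + ((a * d + b) * (d * d) + κ : ℕ) -
          (d * d * (d * d) : ℕ) = ((i * (d * d * (d * d)) + ((a * d + b) * (d * d) + κ) : ℕ) : ℤ) := by
        push_cast; ring
      rw [if_neg h0, e4, if_pos, Nat.succ_sub_one]
      · push_cast; rfl
      · refine ⟨by positivity, ?_⟩
        rw [← e4]
        have : (0 : ℤ) < (d * d * (d * d) : ℕ) := by omega
        omega
  · refine Finset.sum_congr rfl fun c _ => ?_
    simp only [gradTerm, sumAt]
    push_cast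
    simp only [add_assoc]

theorem gradient_sum (S : Sys K C₁ C₂ C₃ I ρ M) {a b κ : ℕ} (ha : a < d) (hb : b < d)
    (hκ : κ < d * d) : ∀ i < n,
    M 54 ((i : ℤ) * (d * d * (d * d) : ℕ) + ((a * d + b) * (d * d) + κ : ℕ)) =
      ∑ i' ∈ Finset.range (i + 1), ∑ c ∈ Finset.range d,
        gradTerm (prec C₁ n) n d M a b κ i' c := by
  intro i
  induction i with
  | zero => intro hi; rw [S.gradientEq ha hb hκ hi]; simp
  | succ i ih =>
    intro hi
    rw [S.gradientEq ha hb hκ hi, if_neg (by omega), Nat.add_sub_cancel, ih (by omega),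
      Finset.sum_range_succ _ (i + 1)]

theorem output_num (S : Sys K C₁ C₂ C₃ I ρ M) {a b κ : ℕ} (ha : a < d) (hb : b < d)
    (hκ : κ < d * d) : M 16 ((a * d + b) * (d * d) + κ : ℕ) =
      ∑ i ∈ Finset.range n, ∑ c ∈ Finset.range d, gradTerm (prec C₁ n) n d M a b κ i c := by
  have hn := S.pos
  have hx : (a * d + b) * (d * d) + κ < d * d * (d * d) := idx_lt (idx_lt ha hb) hκ
  rw [S.fillEq (a := 16) (e := get 54 (var 43 - var 42 + z)) (by simp [prog]) S.r42 hx]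
  simp only [eval_rules, Function.update_apply, reduceIte, Nat.reduceEqDiff, S.r42, S.r43]
  have h := S.gradient_sum ha hb hκ (n - 1) (by omega)
  rw [Nat.sub_add_cancel hn] at h
  rw [← h]
  congr 1
  obtain ⟨m, rfl⟩ := Nat.exists_eq_succ_of_ne_zero hn.ne'
  push_cast
  ring

theorem output_den (S : Sys K C₁ C₂ C₃ I ρ M) {x : ℕ} (hx : x < d * d * (d * d)) :
    M 17 x = 2 ^ prec C₁ n := by
  rw [S.fillEq (a := 17) (e := var 13) (by simp [prog]) S.r42 hx]
  simp only [eval_rules, Function.update_apply, Nat.reduceEqDiff, reduceIte, S.r13]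

end Sys

end RoPE.Alg

namespace RoPE.Alg

open RAM RAM.Fml

/-- `X` bounds the size of an instance. -/
structure Bounded {n d : ℕ} (I : Instance n d) (X : ℝ) : Prop where
  two_le : 2 ≤ X
  n_le : (n : ℝ) ≤ X
  d_le : (d : ℝ) ≤ X
  A₁ : ∀ i k, |toReal I.A₁ i k| ≤ X
  A₂ : ∀ i k, |toReal I.A₂ i k| ≤ X
  E : ∀ i k, |toReal I.E i k| ≤ X
  query : ∀ i k, |toReal (I.A₁ * I.X₁) i k| ≤ X
  key : ∀ i k, |toReal (I.A₂ * I.X₂) i k| ≤ X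
  value : ∀ i k, |toReal (I.A₃ * I.Y) i k| ≤ X
  weight : ∀ t : ℤ, -(n : ℤ) < t → t < n → ∀ k l, |toReal (I.W t) k l| ≤ 1

theorem abs_mul_mul_sub_le {X δ a b c a' b' c' : ℝ} (hX : 1 ≤ X) (hδ : X * δ ≤ 1)
    (ha : |a| ≤ X) (hb : |b| ≤ X) (hc : |c| ≤ 1) (ha' : |a' - a| ≤ X * δ) (hb' : |b' - b| ≤ X * δ)
    (hc' : |c' - c| ≤ δ) : |a' * b' * c' - a * b * c| ≤ 7 * X ^ 2 * δ := by
  have hδ0 : 0 ≤ δ := (abs_nonneg _).trans hc'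
  have hδ1 : δ ≤ 1 := by nlinarith
  have e : a' * b' * c' - a * b * c = (a' - a) * (b' * c') + a * ((b' - b) * c') +
      a * b * (c' - c) := by ring
  have hb2 : |b'| ≤ 2 * X := by
    have := abs_add_le (b' - b) b; rw [sub_add_cancel] at this; linarith
  have hc2 : |c'| ≤ 2 := by
    have := abs_add_le (c' - c) c; rw [sub_add_cancel] at this; linarith
  rw [e]
  have h1 : |(a' - a) * (b' * c')| ≤ X * δ * (2 * X * 2) := by
    rw [abs_mul, abs_mul]; gcongr
  have h2 : |a * ((b' - b) * c')| ≤ X * (X * δ * 2) := by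
    rw [abs_mul, abs_mul]; gcongr
  have h3 : |a * b * (c' - c)| ≤ X * X * δ := by
    rw [abs_mul, abs_mul]; gcongr
  have h4 := abs_add_le ((a' - a) * (b' * c') + a * ((b' - b) * c')) (a * b * (c' - c))
  have h5 := abs_add_le ((a' - a) * (b' * c')) (a * ((b' - b) * c'))
  nlinarith

theorem abs_exp_sub_exp_le {a b R : ℝ} (ha : a ≤ R) (hb : b ≤ R) :
    |Real.exp a - Real.exp b| ≤ Real.exp R * |a - b| := by
  have key : ∀ a b : ℝ, a ≤ R → b ≤ a → Real.exp a - Real.exp b ≤ Real.exp R * (a - b) := by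
    intro a b ha hab
    have h1 := Real.add_one_le_exp (b - a)
    have h2 : Real.exp b = Real.exp a * Real.exp (b - a) := by rw [← Real.exp_add]; ring_nf
    have h3 : Real.exp a ≤ Real.exp R := Real.exp_le_exp.2 ha
    have h4 := Real.exp_pos a
    rw [h2]
    nlinarith
  rcases le_total b a with h | h
  · rw [abs_of_nonneg (sub_nonneg.2 (Real.exp_le_exp.2 h)), abs_of_nonneg (sub_nonneg.2 h)]
    exact key a b ha h
  · rw [abs_sub_comm, abs_sub_comm a, abs_of_nonneg (sub_nonneg.2 (Real.exp_le_exp.2 h)),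
      abs_of_nonneg (sub_nonneg.2 h)]
    exact key b a hb h

theorem cast_taylor (q : ℕ) {D : ℤ} (hD : D ≠ 0) (x : ℤ) : (taylor q D x : ℝ) =
    q.factorial * (D : ℝ) ^ q * ∑ g ∈ Finset.range (q + 1), ((x : ℝ) / D) ^ g / g.factorial := by
  have hD' : (D : ℝ) ≠ 0 := by exact_mod_cast hD
  rw [taylor, Int.cast_sum, Finset.mul_sum]
  refine Finset.sum_congr rfl fun g hg => ?_
  have hg : g ≤ q := by simpa [Nat.lt_succ_iff] using hg
  rw [Int.cast_mul, Int.cast_mul, Int.cast_natCast,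
    Nat.cast_div (Nat.factorial_dvd_factorial hg) (by positivity), Int.cast_pow, Int.cast_pow,
    ← Nat.sub_add_cancel hg, pow_add, Nat.add_sub_cancel, div_pow, Nat.sub_add_cancel hg]
  have : (g.factorial : ℝ) ≠ 0 := by positivity
  field_simp

theorem abs_mean_le {ι : Type*} {s : Finset ι} {a f : ι → ℝ} {W : ℝ}
    (ha : ∀ j ∈ s, 0 < a j) (hs : s.Nonempty) (hW : ∀ j ∈ s, |f j| ≤ W) :
    |(∑ j ∈ s, a j * f j) / ∑ j ∈ s, a j| ≤ W := by
  have hA : 0 < ∑ j ∈ s, a j := Finset.sum_pos ha hs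
  rw [abs_div, abs_of_pos hA, div_le_iff₀ hA, Finset.mul_sum]
  refine (Finset.abs_sum_le_sum_abs _ _).trans (Finset.sum_le_sum fun j hj => ?_)
  rw [abs_mul, abs_of_pos (ha j hj), mul_comm]
  exact mul_le_mul_of_nonneg_right (hW j hj) (ha j hj).le

theorem sum_range_sq {A : Type*} [AddCommMonoid A] (d : ℕ) (f : ℕ → A) :
    ∑ e ∈ Finset.range (d * d), f e = ∑ k : Fin d, ∑ l : Fin d, f ((k : ℕ) * d + (l : ℕ)) := by
  rw [sum_range_mul, Finset.sum_range]
  exact Finset.sum_congr rfl fun k _ => Finset.sum_range _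

namespace Sys

variable {K C₁ C₂ C₃ n d : ℕ} {I : Instance n d} {ρ : ℕ → ℤ} {M : ℕ → ℤ → ℤ}

theorem flag_mul (S : Sys K C₁ C₂ C₃ I ρ M) (i j : Fin n) (k l : Fin d) (x : ℤ) :
    (flag n d M ((k : ℕ) * d + (l : ℕ)) : ℤ) * (x *
      M 42 ((((k : ℕ) * d + (l : ℕ) : ℕ) : ℤ) * (2 * n - 1 : ℕ) +
        ((i : ℕ) + (n - 1 - (j : ℕ)) : ℕ))) =
    x * M 42 ((((k : ℕ) * d + (l : ℕ) : ℕ) : ℤ) * (2 * n - 1 : ℕ) +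
        ((i : ℕ) + (n - 1 - (j : ℕ)) : ℕ)) := by
  rw [flag]
  split_ifs with h
  · simp
  · push Not at h
    have ht : (i : ℕ) + (n - 1 - (j : ℕ)) < 2 * n - 1 := by omega
    have h1 := S.t42 ⟨(i : ℕ) + (n - 1 - (j : ℕ)), ht⟩ k l
    have h2 := S.weight_num ⟨(i : ℕ) + (n - 1 - (j : ℕ)), ht⟩ k l
    rw [h _ ht] at h2
    rw [h1, ← h2]
    simp

theorem cast_expArg (S : Sys K C₁ C₂ C₃ I ρ M) (i j : Fin n) : expArg n d M i j =
    ∑ k : Fin d, ∑ l : Fin d, M 25 (((i : ℕ) : ℤ) * d + (k : ℕ)) *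
      M 26 (((j : ℕ) : ℤ) * d + (l : ℕ)) *
      M 42 ((((k : ℕ) * d + (l : ℕ) : ℕ) : ℤ) * (2 * n - 1 : ℕ) +
        ((i : ℕ) + (n - 1 - (j : ℕ)) : ℕ)) := by
  rw [expArg, sum_range_sq]
  refine Finset.sum_congr rfl fun k _ => Finset.sum_congr rfl fun l _ => ?_
  have e1 : ((k : ℕ) * d + (l : ℕ)) / d = k := by
    rw [mul_comm, Nat.mul_add_div k.pos, Nat.div_eq_of_lt l.2, add_zero]
  have e2 : ((k : ℕ) * d + (l : ℕ)) % d = l := by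
    rw [mul_comm, Nat.mul_add_mod, Nat.mod_eq_of_lt l.2]
  rw [e1, e2, S.flag_mul]

theorem abs_t42_le (S : Sys K C₁ C₂ C₃ I ρ M) {X : ℝ} (hI : Bounded I X) (i j : Fin n)
    (k l : Fin d) : |M 42 ((((k : ℕ) * d + (l : ℕ) : ℕ) : ℤ) * (2 * n - 1 : ℕ) +
        ((i : ℕ) + (n - 1 - (j : ℕ)) : ℕ))| ≤ 2 ^ prec C₁ n := by
  have ht : (i : ℕ) + (n - 1 - (j : ℕ)) < 2 * n - 1 := by omega
  have h1 := S.t42 ⟨(i : ℕ) + (n - 1 - (j : ℕ)), ht⟩ k l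
  rw [h1]
  have h2 := hI.weight ((((i : ℕ) + (n - 1 - (j : ℕ)) : ℕ) : ℤ) - ((n : ℤ) - 1)) (by omega)
    (by omega) k l
  simp only at h1 ⊢
  set r := I.W ((((i : ℕ) + (n - 1 - (j : ℕ)) : ℕ) : ℤ) - ((n : ℤ) - 1)) k l with hr
  have h3 : |r| ≤ 1 := by
    rw [toReal, Matrix.map_apply, ← hr] at h2
    exact_mod_cast h2
  have hd : (0 : ℤ) < r.den := by exact_mod_cast r.pos
  rw [← Rat.num_div_den r, abs_div, Nat.abs_cast, div_le_one (by exact_mod_cast r.pos)] at h3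
  have h4 : |r.num| ≤ r.den := by exact_mod_cast h3
  obtain ⟨h5, h6⟩ := abs_le.1 h4
  rw [abs_le]
  constructor
  · rw [Int.le_ediv_iff_mul_le hd, neg_mul, ← mul_neg]
    exact mul_le_mul_of_nonneg_left h5 (by positivity)
  · refine Int.ediv_le_of_le_mul hd ?_
    exact mul_le_mul_of_nonneg_left h6 (by positivity)

theorem abs_expArg_le (S : Sys K C₁ C₂ C₃ I ρ M) {X : ℝ} (hI : Bounded I X) (hd : 0 < d)
    (hfl : ∑ e ∈ Finset.range (d * d), flag n d M e ≤ K * d) (i j : Fin n) :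
    |((expArg n d M i j : ℤ) : ℝ) / (d * 2 ^ (3 * prec C₁ n) : ℤ)| ≤ ((ρ 16).toNat : ℝ) - 1 := by
  obtain ⟨hU0, hU, -⟩ := S.maxEq (c := 28) (b := 25) (by simp [prog])
  obtain ⟨hV0, hV, -⟩ := S.maxEq (c := 29) (b := 26) (by simp [prog])
  have h16 := S.r16
  set U := M 28 ((n * d : ℕ) - 1)
  set V := M 29 ((n * d : ℕ) - 1)
  set Z : ℤ := 2 ^ prec C₁ n with hZ
  have hZ0 : 0 < Z := by positivity
  have h1 : |expArg n d M i j| ≤ (K * d : ℕ) * (U * V * Z) := by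
    rw [expArg]
    refine (Finset.abs_sum_le_sum_abs _ _).trans ?_
    have : ∀ e ∈ Finset.range (d * d), |(flag n d M e : ℤ) *
        (M 25 (((i : ℕ) : ℤ) * d + (e / d : ℕ)) * M 26 (((j : ℕ) : ℤ) * d + (e % d : ℕ)) *
          M 42 ((e : ℤ) * (2 * n - 1 : ℕ) + ((i : ℕ) + (n - 1 - (j : ℕ)) : ℕ)))| ≤
        (flag n d M e : ℤ) * (U * V * Z) := by
      intro e he
      have he := Finset.mem_range.1 he
      rw [abs_mul, Nat.abs_cast, abs_mul, abs_mul]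
      have hk : e / d < d := (Nat.div_lt_iff_lt_mul hd).2 he
      have hl : e % d < d := Nat.mod_lt _ hd
      have a1 := hU _ (idx_lt i.2 hk)
      have a2 := hV _ (idx_lt j.2 hl)
      have a3 := S.abs_t42_le hI i j ⟨e / d, hk⟩ ⟨e % d, hl⟩
      simp only [Nat.div_add_mod', ← hZ] at a3
      rw [Nat.cast_add, Nat.cast_mul] at a1 a2
      gcongr
    refine (Finset.sum_le_sum this).trans ?_
    rw [← Finset.sum_mul]
    refine mul_le_mul_of_nonneg_right ?_ (by positivity)
    exact_mod_cast hfl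
  have h2 : U * V ≤ (U / Z + 1) * (V / Z + 1) * Z * Z := by
    have a1 := Int.lt_ediv_add_one_mul_self U hZ0
    have a2 := Int.lt_ediv_add_one_mul_self V hZ0
    calc U * V ≤ ((U / Z + 1) * Z) * ((V / Z + 1) * Z) := by gcongr
      _ = _ := by ring
  have h3 : |expArg n d M i j| ≤ (ρ 16 - 1) * (d * 2 ^ (3 * prec C₁ n)) := by
    refine h1.trans ?_
    rw [h16, mul_comm 3, pow_mul, ← hZ]
    calc ((K * d : ℕ) : ℤ) * (U * V * Z) ≤ (K * d : ℕ) * ((U / Z + 1) * (V / Z + 1) * Z * Z * Z) := by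
          gcongr
      _ = _ := by push_cast; ring
  have hD : (0 : ℝ) < (d * 2 ^ (3 * prec C₁ n) : ℤ) := by
    have : (0 : ℤ) < d * 2 ^ (3 * prec C₁ n) := by positivity
    exact_mod_cast this
  rw [abs_div, abs_of_pos hD, div_le_iff₀ hD]
  have h4 : ((ρ 16).toNat : ℝ) = (ρ 16 : ℝ) := by exact_mod_cast S.r16_nat.symm
  rw [h4]
  exact_mod_cast h3

theorem expo_approx (S : Sys K C₁ C₂ C₃ I ρ M) {X : ℝ} (hI : Bounded I X) (hd : 0 < d)
    (hXZ : X ^ 2 ≤ 2 ^ prec C₁ n) (i j : Fin n) :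
    |((expArg n d M i j : ℤ) : ℝ) / (d * 2 ^ (3 * prec C₁ n) : ℤ) -
      expo (toReal I.A₁) (toReal I.A₂) (fun t => toReal (I.W t)) I.point i j| ≤
      7 * X ^ 3 * (1 / 2 ^ prec C₁ n) := by
  have hX := hI.two_le
  have hZ : (0 : ℝ) < 2 ^ prec C₁ n := by positivity
  have hd' : (0 : ℝ) < d := by exact_mod_cast hd
  have hdX := hI.d_le
  set δ : ℝ := 1 / 2 ^ prec C₁ n with hδ
  have hδ1 : X * δ ≤ 1 := by
    rw [hδ, mul_one_div, div_le_one hZ]; nlinarith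
  have hdδ : (d : ℝ) / 2 ^ prec C₁ n ≤ X * δ := by
    rw [hδ, mul_one_div]; gcongr
  rw [expo_point, S.cast_expArg]
  have e : ((∑ k : Fin d, ∑ l : Fin d, M 25 (((i : ℕ) : ℤ) * d + (k : ℕ)) *
      M 26 (((j : ℕ) : ℤ) * d + (l : ℕ)) *
      M 42 ((((k : ℕ) * d + (l : ℕ) : ℕ) : ℤ) * (2 * n - 1 : ℕ) +
        ((i : ℕ) + (n - 1 - (j : ℕ)) : ℕ)) : ℤ) : ℝ) / (d * 2 ^ (3 * prec C₁ n) : ℤ) =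
      (∑ k : Fin d, ∑ l : Fin d, (M 25 (((i : ℕ) : ℤ) * d + (k : ℕ)) : ℝ) / 2 ^ prec C₁ n *
        ((M 26 (((j : ℕ) : ℤ) * d + (l : ℕ)) : ℝ) / 2 ^ prec C₁ n) *
        ((M 42 ((((k : ℕ) * d + (l : ℕ) : ℕ) : ℤ) * (2 * n - 1 : ℕ) +
          ((i : ℕ) + (n - 1 - (j : ℕ)) : ℕ)) : ℝ) / 2 ^ prec C₁ n)) / d := by
    rw [mul_comm 3, pow_mul]
    simp only [Int.cast_sum, Int.cast_mul, Int.cast_pow, Int.cast_natCast, Int.cast_ofNat]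
    rw [mul_comm (d : ℝ), ← div_div, Finset.sum_div]
    congr 1
    refine Finset.sum_congr rfl fun k _ => ?_
    rw [Finset.sum_div]
    refine Finset.sum_congr rfl fun l _ => ?_
    field_simp
  rw [e, ← sub_div, abs_div, Nat.abs_cast, div_le_iff₀ hd', ← Finset.sum_sub_distrib]
  simp only [← Finset.sum_sub_distrib]
  refine (Finset.abs_sum_le_sum_abs _ _).trans ?_
  have h1 : ∀ k ∈ Finset.univ, |∑ l : Fin d,
      ((M 25 (((i : ℕ) : ℤ) * d + ((k : Fin d) : ℕ)) : ℝ) / 2 ^ prec C₁ n *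
        ((M 26 (((j : ℕ) : ℤ) * d + (l : ℕ)) : ℝ) / 2 ^ prec C₁ n) *
        ((M 42 ((((k : ℕ) * d + (l : ℕ) : ℕ) : ℤ) * (2 * n - 1 : ℕ) +
          ((i : ℕ) + (n - 1 - (j : ℕ)) : ℕ)) : ℝ) / 2 ^ prec C₁ n) -
      toReal (I.A₁ * I.X₁) i k * toReal (I.A₂ * I.X₂) j l *
        toReal (I.W (((i : ℕ) : ℤ) - (j : ℕ))) k l)| ≤ X * (7 * X ^ 2 * δ) := by
    intro k _
    refine (Finset.abs_sum_le_sum_abs _ _).trans ?_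
    refine (Finset.sum_le_card_nsmul _ _ (7 * X ^ 2 * δ) fun l _ => ?_).trans ?_
    · exact abs_mul_mul_sub_le (by linarith) hδ1 (hI.query i k) (hI.key j l)
        (hI.weight _ (by omega) (by omega) k l) ((S.query_approx i k).trans hdδ)
        ((S.key_approx j l).trans hdδ) (S.weight_approx i j k l)
    · rw [Finset.card_univ, Fintype.card_fin, nsmul_eq_mul]; gcongr
  refine (Finset.sum_le_card_nsmul _ _ _ h1).trans (le_of_eq ?_)
  rw [Finset.card_univ, Fintype.card_fin, nsmul_eq_mul]
  ring

end Sys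

end RoPE.Alg

namespace RoPE.Alg

open RAM RAM.Fml

theorem abs_gradTerm_sub_le {X ε a e o p r o' p' r' : ℝ} (hX : 2 ≤ X) (hε : ε ≤ 1) (ha : |a| ≤ X)
    (he : |e| ≤ X) (ho : |o| ≤ X ^ 2) (hp : |p| ≤ X ^ 2) (hr : |r| ≤ X ^ 2) (ho' : |o' - o| ≤ ε)
    (hp' : |p' - p| ≤ ε) (hr' : |r' - r| ≤ ε) :
    |a * (o' - e) * (p' - o' * r') - a * (o - e) * (p - o * r)| ≤ 14 * X ^ 5 * ε := by
  have hε0 : 0 ≤ ε := (abs_nonneg _).trans ho'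
  have hX2 : 1 ≤ X ^ 2 := by nlinarith
  have hXX : X ≤ X ^ 2 := by nlinarith
  have hr2 : |r'| ≤ 2 * X ^ 2 := by
    have := abs_add_le (r' - r) r; rw [sub_add_cancel] at this; linarith
  have hf : |o - e| ≤ 2 * X ^ 2 := by have := abs_sub o e; linarith
  have hg : |(p' - o' * r') - (p - o * r)| ≤ 4 * X ^ 2 * ε := by
    have e1 : (p' - o' * r') - (p - o * r) = (p' - p) - (o' - o) * r' - o * (r' - r) := by ring
    have h1 : |(o' - o) * r'| ≤ ε * (2 * X ^ 2) := by rw [abs_mul]; gcongr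
    have h2 : |o * (r' - r)| ≤ X ^ 2 * ε := by rw [abs_mul]; gcongr
    have h3 := abs_sub ((p' - p) - (o' - o) * r') (o * (r' - r))
    have h4 := abs_sub (p' - p) ((o' - o) * r')
    rw [e1]
    nlinarith
  have hq : |p' - o' * r'| ≤ 6 * X ^ 4 := by
    have h1 : |p - o * r| ≤ 2 * X ^ 4 := by
      have h2 : |o * r| ≤ X ^ 2 * X ^ 2 := by rw [abs_mul]; gcongr
      have h3 := abs_sub p (o * r)
      nlinarith
    have h2 := abs_add_le ((p' - o' * r') - (p - o * r)) (p - o * r)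
    rw [sub_add_cancel] at h2
    nlinarith
  have e2 : a * (o' - e) * (p' - o' * r') - a * (o - e) * (p - o * r) =
      a * ((o' - o) * (p' - o' * r') + (o - e) * ((p' - o' * r') - (p - o * r))) := by ring
  have h5 : |(o' - o) * (p' - o' * r')| ≤ ε * (6 * X ^ 4) := by rw [abs_mul]; gcongr
  have h6 : |(o - e) * ((p' - o' * r') - (p - o * r))| ≤ 2 * X ^ 2 * (4 * X ^ 2 * ε) := by
    rw [abs_mul]; gcongr
  rw [e2, abs_mul]
  calc |a| * _ ≤ X * (ε * (6 * X ^ 4) + 2 * X ^ 2 * (4 * X ^ 2 * ε)) := by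
        gcongr; exact (abs_add_le _ _).trans (add_le_add h5 h6)
    _ = 14 * X ^ 5 * ε := by ring

/-- The conditions under which the sums are computed with sufficient precision. -/
structure Precise (K C₁ C₂ C₃ : ℕ) {n d : ℕ} (I : Instance n d) (ρ : ℕ → ℤ) (M : ℕ → ℤ → ℤ)
    (q : ℕ) (X : ℝ) : Prop extends Sys K C₁ C₂ C₃ I ρ M where
  bounded : Bounded I X
  d_pos : 0 < d
  C_pos : 0 < C₃
  degree : ρ 19 = q
  flags : ∑ e ∈ Finset.range (d * d), flag n d M e ≤ K * d
  exp_le : Real.exp ((ρ 16).toNat : ℝ) ≤ X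
  degree_spec : (ρ 16).toNat ^ q * 2 ^ prec C₁ n ≤ q.factorial
  prec_ge : X ^ 30 ≤ 2 ^ prec C₁ n
  modulus_gt : ∀ κ < d * d + 1, ∀ ν < (d + 1) * (d + 1), ∀ i < n,
    2 * |Sys.exactSum n d q M (d * 2 ^ (3 * prec C₁ n)) κ ν i| < (modulus C₃ n : ℕ)

namespace Precise

variable {K C₁ C₂ C₃ n d : ℕ} {I : Instance n d} {ρ : ℕ → ℤ} {M : ℕ → ℤ → ℤ} {q : ℕ} {X : ℝ}

/-- The computed attention weights. -/
noncomputable def approxWeight (C₁ : ℕ) (M : ℕ → ℤ → ℤ) (q : ℕ) (i j : Fin n) : ℝ :=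
  ∑ g ∈ Finset.range (q + 1), (((expArg n d M i j : ℤ) : ℝ) /
    ((d * 2 ^ (3 * prec C₁ n) : ℤ) : ℝ)) ^ g / g.factorial

theorem pow_le (S : Precise K C₁ C₂ C₃ I ρ M q X) {k : ℕ} (hk : k ≤ 30) :
    X ^ k * (1 / 2 ^ prec C₁ n) ≤ 1 := by
  have h1 : (1 : ℝ) ≤ X := by have := S.bounded.two_le; linarith
  rw [mul_one_div, div_le_one (by positivity)]
  exact (pow_le_pow_right₀ h1 hk).trans S.prec_ge

theorem weight_bounds (S : Precise K C₁ C₂ C₃ I ρ M q X) (i j : Fin n) :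
    |approxWeight (d := d) C₁ M q i j -
      Real.exp (expo (toReal I.A₁) (toReal I.A₂) (fun t => toReal (I.W t)) I.point i j)| ≤
      8 * X ^ 4 * (1 / 2 ^ prec C₁ n) ∧
    1 / X ≤ Real.exp (expo (toReal I.A₁) (toReal I.A₂) (fun t => toReal (I.W t)) I.point i j) := by
  have hX := S.bounded.two_le
  have h1 := S.abs_expArg_le S.bounded S.d_pos S.flags i j
  have h2 := S.expo_approx S.bounded S.d_pos ((pow_le_pow_right₀ (by linarith)
    (by norm_num : 2 ≤ 30)).trans S.prec_ge) i j
  have hR := S.exp_le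
  have hspec := S.degree_spec
  have hsmall := S.pow_le (k := 6) (by norm_num)
  rw [approxWeight]
  set R := (ρ 16).toNat
  set x := ((expArg n d M i j : ℤ) : ℝ) / (d * 2 ^ (3 * prec C₁ n) : ℤ)
  set y := expo (toReal I.A₁) (toReal I.A₂) (fun t => toReal (I.W t)) I.point i j
  set δ : ℝ := 1 / 2 ^ prec C₁ n with hδ
  have hδ0 : 0 < δ := by positivity
  have hy : |y| ≤ R := by
    have h3 : |y| ≤ |x| + |x - y| := by
      have := abs_sub x (x - y); rwa [sub_sub_cancel] at this
    have h4 : 7 * X ^ 3 * δ ≤ 1 := by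
      refine le_trans ?_ hsmall
      gcongr
      nlinarith [pow_le_pow_left₀ (by norm_num) hX 3, pow_pos (by linarith : 0 < X) 3]
    linarith
  have hx : |x| ≤ R := by linarith
  refine ⟨?_, ?_⟩
  · have h3 := abs_sum_sub_exp_le hx (q + 1)
    have h4 : (R : ℝ) ^ (q + 1) / (q + 1).factorial ≤ R * δ := by
      have h5 : (R : ℝ) ^ q * 2 ^ prec C₁ n ≤ q.factorial := by exact_mod_cast hspec
      have h6 : (q.factorial : ℝ) ≤ (q + 1).factorial := by
        exact_mod_cast Nat.factorial_le (Nat.le_succ q)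
      rw [hδ, div_le_iff₀ (by positivity), mul_one_div, pow_succ, div_mul_eq_mul_div,
        le_div_iff₀ (by positivity)]
      calc (R : ℝ) ^ q * R * 2 ^ prec C₁ n = R * (R ^ q * 2 ^ prec C₁ n) := by ring
        _ ≤ R * (q + 1).factorial := by gcongr; exact h5.trans h6
    have h5 : (R : ℝ) ≤ X := by have := Real.add_one_le_exp (R : ℝ); linarith
    have h6 := abs_exp_sub_exp_le (le_of_abs_le hx) (le_of_abs_le hy)
    have h7 : (R : ℝ) ^ (q + 1) / (q + 1).factorial * Real.exp R ≤ X * δ * X := by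
      refine mul_le_mul (h4.trans (by gcongr)) hR (Real.exp_pos _).le (by positivity)
    have h8 : Real.exp R * |x - y| ≤ X * (7 * X ^ 3 * δ) :=
      mul_le_mul hR h2 (abs_nonneg _) (by linarith)
    have h9 := abs_add_le (∑ g ∈ Finset.range (q + 1), x ^ g / g.factorial - Real.exp x)
      (Real.exp x - Real.exp y)
    rw [sub_add_sub_cancel] at h9
    have h10 : X * δ * X ≤ X ^ 4 * δ := by
      have : X * X ≤ X ^ 4 := by nlinarith [sq_nonneg (X ^ 2 - 1), sq_nonneg X]
      nlinarith
    nlinarith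
  · have h3 : Real.exp (-(R : ℝ)) ≤ Real.exp y := Real.exp_le_exp.2 (neg_le_of_abs_le hy)
    refine le_trans ?_ h3
    rw [Real.exp_neg, one_div]
    exact inv_anti₀ (Real.exp_pos _) hR

theorem weight_pos (S : Precise K C₁ C₂ C₃ I ρ M q X) (i j : Fin n) :
    0 < approxWeight (d := d) C₁ M q i j := by
  obtain ⟨h1, h2⟩ := S.weight_bounds i j
  have hX := S.bounded.two_le
  have h3 := S.pow_le (k := 9) (by norm_num)
  have h4 : 8 * X ^ 4 * (1 / 2 ^ prec C₁ n) < 1 / X := by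
    rw [lt_div_iff₀ (by linarith)]
    refine lt_of_lt_of_le ?_ h3
    have : (0 : ℝ) < 1 / 2 ^ prec C₁ n := by positivity
    have h5 : 8 * X ^ 5 < X ^ 9 := by
      have : X ^ 9 = X ^ 4 * X ^ 5 := by ring
      rw [this]
      have : (2 : ℝ) ^ 4 ≤ X ^ 4 := pow_le_pow_left₀ (by norm_num) hX 4
      have : 0 < X ^ 5 := pow_pos (by linarith) 5
      nlinarith
    nlinarith
  have := (abs_le.1 h1).1
  linarith

theorem cast_sumAt (S : Precise K C₁ C₂ C₃ I ρ M q X) {κ b c : ℕ} (hκ : κ < d * d + 1)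
    (hb : b < d + 1) (hc : c < d + 1) (i : Fin n) : (sumAt n d M κ b c i : ℝ) =
      q.factorial * ((d * 2 ^ (3 * prec C₁ n) : ℤ) : ℝ) ^ q * (2 ^ prec C₁ n) ^ 3 *
      ∑ j : Fin n, approxWeight (d := d) C₁ M q i j *
        ((Sys.keyExt (prec C₁ n) d M j b : ℝ) / 2 ^ prec C₁ n *
          ((Sys.valueExt (prec C₁ n) d M j c : ℝ) / 2 ^ prec C₁ n) *
          ((M 42 ((κ : ℤ) * (2 * n - 1 : ℕ) + ((i : ℕ) + (n - 1 - (j : ℕ)) : ℕ)) : ℝ) /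
            2 ^ prec C₁ n)) := by
  obtain ⟨m, hm⟩ : ∃ m : ℕ, ρ 25 = m := ⟨_, S.r25 S.degree⟩
  have hν := idx_lt hb hc
  have hd := S.d_pos
  have hD : (d * 2 ^ (3 * prec C₁ n) : ℤ) ≠ 0 := by positivity
  rw [sumAt, S.sums_eq S.degree hm S.C_pos hκ hν i.2 (S.modulus_gt κ hκ _ hν i i.2), Sys.exactSum,
    Int.cast_sum, Finset.sum_range, Finset.mul_sum]
  refine Finset.sum_congr rfl fun j _ => ?_
  rw [Int.cast_mul, cast_taylor q hD, S.t44 hb hc j.2, approxWeight]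
  generalize ((d * 2 ^ (3 * prec C₁ n) : ℤ) : ℝ) = D
  simp only [Int.cast_mul]
  field_simp

/-- The factors of the terms that are summed. -/
theorem abs_ratio_sub_mean_le (S : Precise K C₁ C₂ C₃ I ρ M q X) {κ b c : ℕ} (hκ : κ < d * d + 1)
    (hb : b < d + 1) (hc : c < d + 1) (i : Fin n) {w x v : Fin n → ℝ} (hw : ∀ j, |w j| ≤ 1)
    (hx : ∀ j, |x j| ≤ X) (hv : ∀ j, |v j| ≤ X)
    (hw' : ∀ j : Fin n, |(M 42 ((κ : ℤ) * (2 * n - 1 : ℕ) +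
      ((i : ℕ) + (n - 1 - (j : ℕ)) : ℕ)) : ℝ) / 2 ^ prec C₁ n - w j| ≤ 1 / 2 ^ prec C₁ n)
    (hx' : ∀ j : Fin n, |(Sys.keyExt (prec C₁ n) d M j b : ℝ) / 2 ^ prec C₁ n - x j| ≤
      X * (1 / 2 ^ prec C₁ n))
    (hv' : ∀ j : Fin n, |(Sys.valueExt (prec C₁ n) d M j c : ℝ) / 2 ^ prec C₁ n - v j| ≤
      X * (1 / 2 ^ prec C₁ n)) :
    |(sumAt n d M κ b c i : ℝ) / sumAt n d M (d * d) d d i -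
      mean (toReal I.A₁) (toReal I.A₂) (fun t => toReal (I.W t)) I.point i
        (fun j => x j * v j * w j)| ≤ X ^ 13 * (1 / 2 ^ prec C₁ n) ∧
    |mean (toReal I.A₁) (toReal I.A₂) (fun t => toReal (I.W t)) I.point i
        (fun j => x j * v j * w j)| ≤ X ^ 2 := by
  have hX := S.bounded.two_le
  have hne : (Finset.univ : Finset (Fin n)).Nonempty := ⟨i, Finset.mem_univ i⟩
  have hW : ∀ j ∈ Finset.univ, |x j * v j * w j| ≤ X ^ 2 := by
    intro j _
    rw [abs_mul, abs_mul, sq]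
    calc |x j| * |v j| * |w j| ≤ X * X * 1 := by
          refine mul_le_mul (mul_le_mul (hx j) (hv j) (abs_nonneg _) (by linarith)) (hw j)
            (abs_nonneg _) (by positivity)
      _ = X * X := mul_one _
  refine ⟨?_, abs_mean_le (fun _ _ => Real.exp_pos _) hne hW⟩
  have hd := S.d_pos
  rw [S.cast_sumAt hκ hb hc i, S.cast_sumAt (Nat.lt_succ_self _) (Nat.lt_succ_self _)
    (Nat.lt_succ_self _) i, mul_div_mul_left]
  swap
  · have : (0 : ℤ) < d * 2 ^ (3 * prec C₁ n) := by positivity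
    have : (0 : ℝ) < (d * 2 ^ (3 * prec C₁ n) : ℤ) := by exact_mod_cast this
    positivity
  have e1 : ∀ j : Fin n, approxWeight (d := d) C₁ M q i j *
        ((Sys.keyExt (prec C₁ n) d M j d : ℝ) / 2 ^ prec C₁ n *
          ((Sys.valueExt (prec C₁ n) d M j d : ℝ) / 2 ^ prec C₁ n) *
          ((M 42 (((d * d : ℕ) : ℤ) * (2 * n - 1 : ℕ) + ((i : ℕ) + (n - 1 - (j : ℕ)) : ℕ)) : ℝ) /
            2 ^ prec C₁ n)) = approxWeight (d := d) C₁ M q i j := by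
    intro j
    rw [Sys.keyExt, Sys.valueExt, if_neg (lt_irrefl d), if_neg (lt_irrefl d),
      S.t42_top (by omega)]
    push_cast
    field_simp
  rw [Finset.sum_congr rfl fun j _ => e1 j, mean]
  set δ : ℝ := 1 / 2 ^ prec C₁ n with hδ
  have hδ0 : 0 < δ := by positivity
  have h9 := S.pow_le (k := 9) (by norm_num)
  have hXδ : X * δ ≤ 1 := by have := S.pow_le (k := 1) (by norm_num); rwa [pow_one] at this
  have p4 : (2 : ℝ) ^ 4 ≤ X ^ 4 := pow_le_pow_left₀ (by norm_num) hX 4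
  have p5 : 0 < X ^ 5 := pow_pos (by linarith) 5
  have key := abs_mean_sub_mean_le hne (m := 1 / X) (η := 8 * X ^ 4 * δ) (W := X ^ 2)
    (ε := 7 * X ^ 2 * δ) (by positivity) (fun j _ => (S.weight_bounds i j).2) (by
      rw [div_div, le_div_iff₀ (by linarith)]
      refine le_trans ?_ h9
      have : 8 * X ^ 4 * δ * (X * 2) = 16 * X ^ 5 * δ := by ring
      rw [this]
      have : X ^ 9 = X ^ 4 * X ^ 5 := by ring
      rw [this]
      gcongr
      linarith) (fun j _ => (S.weight_bounds i j).1) hW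
    (fun j _ => abs_mul_mul_sub_le (by linarith) hXδ (hx j) (hv j) (hw j) (hx' j) (hv' j) (hw' j))
  refine key.trans ?_
  have e2 : 7 * X ^ 2 * δ + 4 * X ^ 2 * (8 * X ^ 4 * δ) / (1 / X) =
      (7 * X ^ 2 + 32 * X ^ 7) * δ := by field_simp; ring
  rw [e2]
  refine mul_le_mul_of_nonneg_right ?_ hδ0.le
  have p2 : X ^ 2 ≤ X ^ 7 := pow_le_pow_right₀ (by linarith) (by norm_num)
  have p6 : (2 : ℝ) ^ 6 ≤ X ^ 6 := pow_le_pow_left₀ (by norm_num) hX 6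
  have p7 : 0 < X ^ 7 := pow_pos (by linarith) 7
  have : X ^ 13 = X ^ 6 * X ^ 7 := by ring
  rw [this]
  nlinarith

theorem valueExt_approx (S : Precise K C₁ C₂ C₃ I ρ M q X) (j : Fin n) (c : Fin d) :
    |(Sys.valueExt (prec C₁ n) d M j c : ℝ) / 2 ^ prec C₁ n - toReal (I.A₃ * I.Y) j c| ≤
      X * (1 / 2 ^ prec C₁ n) := by
  rw [Sys.valueExt, if_pos c.2]
  refine (S.value_approx j c).trans ?_
  rw [mul_one_div]
  gcongr
  exact S.bounded.d_le

theorem keyExt_approx' (S : Precise K C₁ C₂ C₃ I ρ M q X) (j : Fin n) (b : Fin d) :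
    |(Sys.keyExt (prec C₁ n) d M j b : ℝ) / 2 ^ prec C₁ n - toReal I.A₂ j b| ≤
      X * (1 / 2 ^ prec C₁ n) := by
  refine (S.keyExt_approx j b).trans ?_
  have := S.bounded.two_le
  have : (0 : ℝ) < 1 / 2 ^ prec C₁ n := by positivity
  nlinarith

theorem sum_pos (S : Precise K C₁ C₂ C₃ I ρ M q X) (i : Fin n) :
    0 < sumAt n d M (d * d) d d i := by
  have h := S.cast_sumAt (Nat.lt_succ_self (d * d)) (Nat.lt_succ_self d) (Nat.lt_succ_self d) i
  have hd := S.d_pos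
  have h1 : (0 : ℤ) < d * 2 ^ (3 * prec C₁ n) := by positivity
  have h2 : (0 : ℝ) < (d * 2 ^ (3 * prec C₁ n) : ℤ) := by exact_mod_cast h1
  have h3 : (0 : ℝ) < sumAt n d M (d * d) d d i := by
    rw [h]
    refine mul_pos (by positivity) (Finset.sum_pos (fun j _ => ?_) ⟨i, Finset.mem_univ i⟩)
    refine mul_pos (S.weight_pos i j) ?_
    rw [Sys.keyExt, Sys.valueExt, if_neg (lt_irrefl d), if_neg (lt_irrefl d),
      S.t42_top (by omega)]
    push_cast
    positivity
  exact_mod_cast h3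

theorem gradTerm_approx (S : Precise K C₁ C₂ C₃ I ρ M q X) (a b k l c : Fin d) (i : Fin n) :
    |(gradTerm (prec C₁ n) n d M a b ((k : ℕ) * d + (l : ℕ)) i c : ℝ) / 2 ^ prec C₁ n -
      toReal I.A₁ i a / d *
      (mean (toReal I.A₁) (toReal I.A₂) (fun t => toReal (I.W t)) I.point i
        (fun j => (toReal I.A₃ * toReal I.Y) j c) - toReal I.E i c) *
      (mean (toReal I.A₁) (toReal I.A₂) (fun t => toReal (I.W t)) I.point i
        (fun j => toReal (I.W (((i : ℕ) : ℤ) - (j : ℕ))) k l *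
          (toReal I.A₂ j b * (toReal I.A₃ * toReal I.Y) j c)) -
        mean (toReal I.A₁) (toReal I.A₂) (fun t => toReal (I.W t)) I.point i
          (fun j => (toReal I.A₃ * toReal I.Y) j c) *
        mean (toReal I.A₁) (toReal I.A₂) (fun t => toReal (I.W t)) I.point i
          (fun j => toReal (I.W (((i : ℕ) : ℤ) - (j : ℕ))) k l * toReal I.A₂ j b))| ≤
      X ^ 23 * (1 / 2 ^ prec C₁ n) := by
  have hX := S.bounded.two_le
  have hd : (0 : ℝ) < d := by exact_mod_cast S.d_pos
  set δ : ℝ := 1 / 2 ^ prec C₁ n with hδ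
  have hδ0 : 0 < δ := by positivity
  have hXδ : 0 ≤ X * δ := by positivity
  have hAY : toReal I.A₃ * toReal I.Y = toReal (I.A₃ * I.Y) := by
    ext i j; simp [toReal, Matrix.mul_apply]
  rw [hAY]
  have one42 : ∀ j : Fin n, |(M 42 (((d * d : ℕ) : ℤ) * (2 * n - 1 : ℕ) +
      ((i : ℕ) + (n - 1 - (j : ℕ)) : ℕ)) : ℝ) / 2 ^ prec C₁ n - 1| ≤ δ := by
    intro j
    rw [S.t42_top (by omega)]
    push_cast
    rw [div_self (by positivity), sub_self, abs_zero]
    exact hδ0.le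
  have oneKey : ∀ j : Fin n, |(Sys.keyExt (prec C₁ n) d M j d : ℝ) / 2 ^ prec C₁ n - 1| ≤ X * δ := by
    intro j
    rw [Sys.keyExt, if_neg (lt_irrefl d)]
    push_cast
    rw [div_self (by positivity), sub_self, abs_zero]
    exact hXδ
  have oneVal : ∀ j : Fin n,
      |(Sys.valueExt (prec C₁ n) d M j d : ℝ) / 2 ^ prec C₁ n - 1| ≤ X * δ := by
    intro j
    rw [Sys.valueExt, if_neg (lt_irrefl d)]
    push_cast
    rw [div_self (by positivity), sub_self, abs_zero]
    exact hXδ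
  have hone : ∀ _ : Fin n, |(1 : ℝ)| ≤ X := fun _ => by rw [abs_one]; linarith
  have hkl : (k : ℕ) * d + (l : ℕ) < d * d + 1 := Nat.lt_succ_of_lt (idx_lt k.2 l.2)
  have hwt : ∀ j : Fin n, |toReal (I.W (((i : ℕ) : ℤ) - (j : ℕ))) k l| ≤ 1 := fun j =>
    S.bounded.weight _ (by omega) (by omega) k l
  obtain ⟨o1, o2⟩ := S.abs_ratio_sub_mean_le (Nat.lt_succ_self (d * d)) (Nat.lt_succ_self d)
    (Nat.lt_succ_of_lt c.2) i (w := fun _ => 1) (x := fun _ => 1)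
    (v := fun j => toReal (I.A₃ * I.Y) j c) (fun _ => by simp) hone
    (fun j => S.bounded.value j c) one42 oneKey (fun j => S.valueExt_approx j c)
  obtain ⟨p1, p2⟩ := S.abs_ratio_sub_mean_le hkl (Nat.lt_succ_of_lt b.2)
    (Nat.lt_succ_of_lt c.2) i (w := fun j => toReal (I.W (((i : ℕ) : ℤ) - (j : ℕ))) k l)
    (x := fun j => toReal I.A₂ j b)
    (v := fun j => toReal (I.A₃ * I.Y) j c) hwt (fun j => S.bounded.A₂ j b)
    (fun j => S.bounded.value j c) (fun j => S.weight_approx i j k l)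
    (fun j => S.keyExt_approx' j b) (fun j => S.valueExt_approx j c)
  obtain ⟨r1, r2⟩ := S.abs_ratio_sub_mean_le hkl (Nat.lt_succ_of_lt b.2)
    (Nat.lt_succ_self d) i (w := fun j => toReal (I.W (((i : ℕ) : ℤ) - (j : ℕ))) k l)
    (x := fun j => toReal I.A₂ j b) (v := fun _ => 1) hwt (fun j => S.bounded.A₂ j b) hone
    (fun j => S.weight_approx i j k l) (fun j => S.keyExt_approx' j b) oneVal
  simp only [one_mul, mul_one] at o1 o2 r1 r2
  have e1 : (fun j : Fin n => toReal (I.W (((i : ℕ) : ℤ) - (j : ℕ))) k l *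
      (toReal I.A₂ j b * toReal (I.A₃ * I.Y) j c)) = fun j : Fin n => toReal I.A₂ j b *
        toReal (I.A₃ * I.Y) j c * toReal (I.W (((i : ℕ) : ℤ) - (j : ℕ))) k l := by
    funext j; ring
  have e2 : (fun j : Fin n => toReal (I.W (((i : ℕ) : ℤ) - (j : ℕ))) k l * toReal I.A₂ j b) =
      fun j : Fin n => toReal I.A₂ j b * toReal (I.W (((i : ℕ) : ℤ) - (j : ℕ))) k l := by
    funext j; ring
  rw [e1, e2]
  set o := mean (toReal I.A₁) (toReal I.A₂) (fun t => toReal (I.W t)) I.point i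
    (fun j => toReal (I.A₃ * I.Y) j c)
  set p := mean (toReal I.A₁) (toReal I.A₂) (fun t => toReal (I.W t)) I.point i
    (fun j : Fin n => toReal I.A₂ j b * toReal (I.A₃ * I.Y) j c *
      toReal (I.W (((i : ℕ) : ℤ) - (j : ℕ))) k l)
  set r := mean (toReal I.A₁) (toReal I.A₂) (fun t => toReal (I.W t)) I.point i
    (fun j : Fin n => toReal I.A₂ j b * toReal (I.W (((i : ℕ) : ℤ) - (j : ℕ))) k l)
  have ha : |toReal I.A₁ i a / d| ≤ X := by
    rw [abs_div, Nat.abs_cast]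
    exact (div_le_self (abs_nonneg _) (by exact_mod_cast S.d_pos)).trans (S.bounded.A₁ i a)
  have main := abs_gradTerm_sub_le hX (S.pow_le (by norm_num : 13 ≤ 30)) ha (S.bounded.E i c) o2 p2
    r2 o1 p1 r1
  have hs := S.sum_pos i
  have hs' : (0 : ℝ) < sumAt n d M (d * d) d d i := by exact_mod_cast hs
  have b0 : M 0 (((i : ℕ) : ℤ) * d + (a : ℕ)) = (I.A₁ i a).num := by
    rw [S.input 0 (by simp [inputBanks])]; exact storeMatrix_apply Rat.num I.A₁ i a
  have b8 : M 8 (((i : ℕ) : ℤ) * d + (a : ℕ)) = (I.A₁ i a).den := by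
    rw [S.input 8 (by simp [inputBanks])]
    exact storeMatrix_apply (fun r => (r.den : ℤ)) I.A₁ i a
  have b3 : M 3 (((i : ℕ) : ℤ) * d + (c : ℕ)) = (I.E i c).num := by
    rw [S.input 3 (by simp [inputBanks])]; exact storeMatrix_apply Rat.num I.E i c
  have b11 : M 11 (((i : ℕ) : ℤ) * d + (c : ℕ)) = (I.E i c).den := by
    rw [S.input 11 (by simp [inputBanks])]
    exact storeMatrix_apply (fun r => (r.den : ℤ)) I.E i c
  have eA : toReal I.A₁ i a = (I.A₁ i a).num / (I.A₁ i a).den := by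
    rw [toReal, Matrix.map_apply]; exact_mod_cast (Rat.num_div_den _).symm
  have eE : toReal I.E i c = (I.E i c).num / (I.E i c).den := by
    rw [toReal, Matrix.map_apply]; exact_mod_cast (Rat.num_div_den _).symm
  have dA : (0 : ℝ) < (I.A₁ i a).den := by exact_mod_cast (I.A₁ i a).pos
  have dE : (0 : ℝ) < (I.E i c).den := by exact_mod_cast (I.E i c).pos
  have hfl : |(gradTerm (prec C₁ n) n d M a b ((k : ℕ) * d + (l : ℕ)) i c : ℝ) / 2 ^ prec C₁ n -
      toReal I.A₁ i a / d * ((sumAt n d M (d * d) d c i : ℝ) / sumAt n d M (d * d) d d i -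
        toReal I.E i c) * ((sumAt n d M ((k : ℕ) * d + (l : ℕ)) b c i : ℝ) /
          sumAt n d M (d * d) d d i - (sumAt n d M (d * d) d c i : ℝ) /
          sumAt n d M (d * d) d d i * ((sumAt n d M ((k : ℕ) * d + (l : ℕ)) b d i : ℝ) /
          sumAt n d M (d * d) d d i))| ≤ δ := by
    rw [gradTerm, b0, b8, b3, b11]
    have hden : (0 : ℤ) < ((I.A₁ i a).den : ℤ) * ((I.E i c).den : ℤ) * sumAt n d M (d * d) d d i *
        sumAt n d M (d * d) d d i * sumAt n d M (d * d) d d i * (d : ℤ) := by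
      have h1 : (0 : ℤ) < (I.A₁ i a).den := by exact_mod_cast (I.A₁ i a).pos
      have h2 : (0 : ℤ) < (I.E i c).den := by exact_mod_cast (I.E i c).pos
      have h3 : (0 : ℤ) < d := by exact_mod_cast S.d_pos
      positivity
    have h := abs_ediv_sub_le (2 ^ prec C₁ n * (I.A₁ i a).num *
      (sumAt n d M (d * d) d c i * (I.E i c).den - (I.E i c).num * sumAt n d M (d * d) d d i) *
      (sumAt n d M ((k : ℕ) * d + (l : ℕ)) b c i * sumAt n d M (d * d) d d i -
        sumAt n d M (d * d) d c i * sumAt n d M ((k : ℕ) * d + (l : ℕ)) b d i)) hden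
    rw [hδ, le_div_iff₀ (by positivity),
      ← abs_of_pos (by positivity : (0 : ℝ) < 2 ^ prec C₁ n), ← abs_mul, abs_of_pos
      (by positivity : (0 : ℝ) < 2 ^ prec C₁ n), sub_mul, div_mul_cancel₀ _ (by positivity)]
    refine le_of_eq_of_le ?_ h
    congr 2
    rw [eA, eE]
    push_cast
    field_simp
  refine ((abs_sub_le _ _ _).trans (add_le_add hfl main)).trans ?_
  have p5 : (2 : ℝ) ^ 5 ≤ X ^ 5 := pow_le_pow_left₀ (by norm_num) hX 5
  have p18 : 1 ≤ X ^ 18 := one_le_pow₀ (by linarith)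
  have e3 : δ + 14 * X ^ 5 * (X ^ 13 * δ) = (1 + 14 * X ^ 18) * δ := by ring
  have e4 : X ^ 23 = X ^ 5 * X ^ 18 := by ring
  rw [e3, e4]
  refine mul_le_mul_of_nonneg_right ?_ hδ0.le
  nlinarith

/-- The algorithm computes the gradient up to an error of `X ^ 25 * 2 ^ (-prec)`. -/
theorem output_approx (S : Precise K C₁ C₂ C₃ I ρ M q X) (x : Idx d) :
    0 < M 17 (outAddr x) ∧ |(M 16 (outAddr x) : ℝ) / (M 17 (outAddr x) : ℝ) -
      grad (toReal I.A₁) (toReal I.A₂) (toReal I.A₃) (toReal I.E) (toReal I.Y)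
        (fun t => toReal (I.W t)) I.point x| ≤ X ^ 25 * (1 / 2 ^ prec C₁ n) := by
  obtain ⟨⟨a, b⟩, k, l⟩ := x
  have hκ : (k : ℕ) * d + (l : ℕ) < d * d := idx_lt k.2 l.2
  have e : outAddr ((a, b), (k, l)) =
      (((a : ℕ) * d + (b : ℕ)) * (d * d) + ((k : ℕ) * d + (l : ℕ)) : ℕ) := by
    rw [outAddr]; push_cast; ring
  rw [e, S.output_den (idx_lt (idx_lt a.2 b.2) hκ), S.output_num a.2 b.2 hκ, grad_apply]
  refine ⟨by positivity, ?_⟩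
  have hX := S.bounded.two_le
  push_cast
  rw [Finset.sum_div, Finset.sum_range, ← Finset.sum_sub_distrib]
  refine (Finset.abs_sum_le_sum_abs _ _).trans ?_
  refine (Finset.sum_le_card_nsmul _ _ (X * (X ^ 23 * (1 / 2 ^ prec C₁ n))) fun i _ => ?_).trans ?_
  · rw [Finset.sum_div, Finset.sum_range, ← Finset.sum_sub_distrib]
    refine (Finset.abs_sum_le_sum_abs _ _).trans ?_
    refine (Finset.sum_le_card_nsmul _ _ (X ^ 23 * (1 / 2 ^ prec C₁ n)) fun c _ => ?_).trans ?_
    · exact S.gradTerm_approx a b k l c i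
    · rw [Finset.card_univ, Fintype.card_fin, nsmul_eq_mul]
      gcongr
      exact S.bounded.d_le
  · rw [Finset.card_univ, Fintype.card_fin, nsmul_eq_mul]
    calc (n : ℝ) * (X * (X ^ 23 * (1 / 2 ^ prec C₁ n)))
        ≤ X * (X * (X ^ 23 * (1 / 2 ^ prec C₁ n))) := by gcongr; exact S.bounded.n_le
      _ = _ := by ring

end Precise

end RoPE.Alg

namespace RAM

namespace Fml

/-- The value is bounded by the maximum of earlier cells plus a quantity independent of them;
register `12` holds a positive modulus. -/
def addl (Dr Db : List ℕ) : List ℕ → Fml → Bool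
  | _, self _ => true
  | L, op .add e f => (addl Dr Db L e && wf Dr Db L f) || (wf Dr Db L e && addl Dr Db L f)
  | L, op .mod e (var 12) => decide (12 ∈ Dr) || wf Dr Db L (op .mod e (var 12))
  | L, pos _ p q => addl Dr Db L p && addl Dr Db L q
  | L, bind v e f => decide (100 < v) && wf Dr Db L e && addl Dr Db (v :: L) f
  | L, e => wf Dr Db L e

/-- The value is at most a multiple of the maximum of earlier cells. -/
def lin (Dr Db : List ℕ) : List ℕ → Fml → Bool
  | _, self _ => true
  | L, op .add e f => lin Dr Db L e && lin Dr Db L f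
  | L, op .mul e f => (lin Dr Db L e && wf Dr Db L f) || (wf Dr Db L e && lin Dr Db L f)
  | L, pos _ p q => lin Dr Db L p && lin Dr Db L q
  | L, bind v e f => decide (100 < v) && wf Dr Db L e && lin Dr Db (v :: L) f
  | L, e => wf Dr Db L e

/-- Formulas that do not refer to the table being filled. -/
theorem abs_eval_le_of_wf {a : ℕ} {M : ℕ → ℤ → ℤ} {Dr Db : List ℕ} {e : Fml} {L : List ℕ}
    (hw : wf Dr Db L e = true) (h100 : 100 ∉ L) {m : ℕ} (hm : 1 ≤ m)
    (hM : ∀ b ∈ Db, ∀ z, |M b z| ≤ 2 ^ m) {ρ : ℕ → ℤ}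
    (hρ : ∀ x, x ∈ Dr ∨ x ∈ L → |ρ x| ≤ 2 ^ m) : |e.eval a M ρ| ≤ 2 ^ (e.weight * m) := by
  rw [eval_congr (M' := fun b => if b ∈ Db then M b else 0) (ρ' := ρ) hw
    (fun b hb => by simp [hb]) (fun h => absurd h h100) fun _ _ => rfl]
  refine abs_eval_le hw hm (fun b z => ?_) hρ
  split_ifs with h
  · exact hM b h z
  · simp

theorem abs_update_le {Dr L : List ℕ} {m m' : ℕ} (h : m ≤ m') {ρ : ℕ → ℤ}
    (hρ : ∀ x, x ∈ Dr ∨ x ∈ L → |ρ x| ≤ 2 ^ m) {v : ℕ} {y : ℤ} (hy : |y| ≤ 2 ^ m') (x : ℕ)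
    (hx : x ∈ Dr ∨ x ∈ v :: L) : |Function.update ρ v y x| ≤ 2 ^ m' := by
  by_cases hxv : x = v
  · subst hxv; simpa using hy
  · rw [Function.update_of_ne hxv]
    exact (hρ x (hx.imp_right fun h' => (List.mem_cons.1 h').resolve_left hxv)).trans
      (pow_le_pow_right₀ (by norm_num) h)

theorem abs_eval_le_of_addl {a : ℕ} {M : ℕ → ℤ → ℤ} {Dr Db : List ℕ} {e : Fml}
    {L : List ℕ} (hw : addl Dr Db L e = true) (h100 : 100 ∉ L) (hL : ∀ x ∈ L, 100 < x) {m : ℕ} (hm : 1 ≤ m)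
    (hM : ∀ b ∈ Db, ∀ z, |M b z| ≤ 2 ^ m) {ρ : ℕ → ℤ}
    (hρ : ∀ x, x ∈ Dr ∨ x ∈ L → |ρ x| ≤ 2 ^ m) {s : ℤ} (hs0 : 0 ≤ s) (h12 : 0 < ρ 12)
    (hs : ∀ z, 0 ≤ z → z < ρ 100 → |M a z| ≤ s) : |e.eval a M ρ| ≤ s + 2 ^ (e.weight * m) := by
  have mono : ∀ {i j : ℕ}, i ≤ j → (2 : ℤ) ^ i ≤ 2 ^ j := fun h =>
    pow_le_pow_right₀ (by norm_num) h
  have wfc : ∀ {e : Fml}, wf Dr Db L e = true → |e.eval a M ρ| ≤ s + 2 ^ (e.weight * m) :=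
    fun h => (abs_eval_le_of_wf h h100 hm hM hρ).trans (by linarith)
  fun_induction addl Dr Db L e generalizing m ρ with
  | case1 L i =>
    simp only [eval]
    split_ifs with h
    · have := hs _ h.1 h.2
      have : (0 : ℤ) ≤ 2 ^ ((self i).weight * m) := by positivity
      linarith
    · simp; positivity
  | case2 L e f he hf =>
    simp only [Bool.or_eq_true, Bool.and_eq_true] at hw
    have h := two_pow_add_le (Nat.mul_pos e.weight_pos hm) (Nat.mul_pos f.weight_pos hm)
    rw [← add_mul] at h
    have tri : |(op .add e f).eval a M ρ| ≤ |e.eval a M ρ| + |f.eval a M ρ| := abs_add_le _ _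
    simp only [weight]
    rcases hw with hw | hw
    · have h1 := he hw.1 h100 hL hm hM hρ h12 hs wfc
      have h2 := abs_eval_le_of_wf (a := a) hw.2 h100 hm hM hρ
      linarith
    · have h1 := hf hw.2 h100 hL hm hM hρ h12 hs wfc
      have h2 := abs_eval_le_of_wf (a := a) hw.1 h100 hm hM hρ
      linarith
  | case3 L e =>
    simp only [Bool.or_eq_true, decide_eq_true_eq] at hw
    rcases hw with hw | hw
    · have h1 := hρ 12 (Or.inl hw)
      have h2 : |e.eval a M ρ % ρ 12| ≤ 2 ^ m := by
        rw [abs_of_nonneg (Int.emod_nonneg _ h12.ne')]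
        rw [abs_of_pos h12] at h1
        exact (Int.emod_lt_of_pos _ h12).le.trans h1
      have h3 : (2 : ℤ) ^ m ≤ 2 ^ ((op .mod e (var 12)).weight * m) :=
        mono (Nat.le_mul_of_pos_left m (weight_pos _))
      show |e.eval a M ρ % ρ 12| ≤ _
      linarith
    · exact wfc hw
  | case4 L c p q hp hq =>
    simp only [Bool.and_eq_true] at hw
    simp only [eval, weight]
    split_ifs
    · refine (hp hw.1 h100 hL hm hM hρ h12 hs wfc).trans ?_
      gcongr
      · norm_num
      · omega
    · refine (hq hw.2 h100 hL hm hM hρ h12 hs wfc).trans ?_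
      gcongr
      · norm_num
      · omega
  | case5 L v e f hf =>
    simp only [Bool.and_eq_true, decide_eq_true_eq] at hw
    simp only [eval, weight]
    have hv := abs_eval_le_of_wf (a := a) hw.1.2 h100 hm hM hρ
    have hle : m ≤ e.weight * m := Nat.le_mul_of_pos_left m e.weight_pos
    have h1 : 100 ∉ v :: L := by simp [h100]; omega
    have hM' : ∀ b ∈ Db, ∀ z, |M b z| ≤ 2 ^ (e.weight * m) :=
      fun b hb z => (hM b hb z).trans (mono hle)
    have := hf hw.2 h1 (by simpa [hw.1.1] using hL) (hm.trans hle) hM'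
      (abs_update_le hle hρ hv) (by rwa [Function.update_of_ne (by omega)])
      (by rwa [Function.update_of_ne (by omega)])
      (fun h => (abs_eval_le_of_wf h h1 (hm.trans hle) hM' (abs_update_le hle hρ hv)).trans
        (by linarith))
    rw [← mul_assoc, mul_comm f.weight] at this
    exact this
  | case6 L e h1 h2 h3 h4 h5 => exact wfc hw

theorem abs_eval_le_of_lin {a : ℕ} {M : ℕ → ℤ → ℤ} {Dr Db : List ℕ}
    {e : Fml} {L : List ℕ} (hw : lin Dr Db L e = true) (h100 : 100 ∉ L) {m : ℕ} (hm : 1 ≤ m)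
    (hM : ∀ b ∈ Db, ∀ z, |M b z| ≤ 2 ^ m) {ρ : ℕ → ℤ}
    (hρ : ∀ x, x ∈ Dr ∨ x ∈ L → |ρ x| ≤ 2 ^ m) {s : ℤ} (hs0 : 1 ≤ s)
    (hs : ∀ z, 0 ≤ z → z < ρ 100 → |M a z| ≤ s) : |e.eval a M ρ| ≤ 2 ^ (e.weight * m) * s := by
  have mono : ∀ {i j : ℕ}, i ≤ j → (2 : ℤ) ^ i ≤ 2 ^ j := fun h =>
    pow_le_pow_right₀ (by norm_num) h
  have wfc : ∀ {e : Fml}, wf Dr Db L e = true → |e.eval a M ρ| ≤ 2 ^ (e.weight * m) * s :=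
    fun h => (abs_eval_le_of_wf h h100 hm hM hρ).trans (le_mul_of_one_le_right (by positivity) hs0)
  fun_induction lin Dr Db L e generalizing m ρ with
  | case1 L i =>
    simp only [eval]
    split_ifs with h
    · exact (hs _ h.1 h.2).trans (le_mul_of_one_le_left (by linarith) (one_le_pow₀ (by norm_num)))
    · simp; positivity
  | case2 L e f he hf =>
    simp only [Bool.and_eq_true] at hw
    have h := two_pow_add_le (Nat.mul_pos e.weight_pos hm) (Nat.mul_pos f.weight_pos hm)
    rw [← add_mul] at h
    have tri : |(op .add e f).eval a M ρ| ≤ |e.eval a M ρ| + |f.eval a M ρ| := abs_add_le _ _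
    have h1 := he hw.1 h100 hm hM hρ hs wfc
    have h2 := hf hw.2 h100 hm hM hρ hs wfc
    simp only [weight]
    nlinarith
  | case3 L e f he hf =>
    simp only [Bool.or_eq_true, Bool.and_eq_true] at hw
    have e1 : |(op .mul e f).eval a M ρ| = |e.eval a M ρ| * |f.eval a M ρ| := abs_mul _ _
    rw [e1]
    simp only [weight, add_mul, pow_add]
    rcases hw with hw | hw
    · have h1 := he hw.1 h100 hm hM hρ hs wfc
      have h2 := abs_eval_le_of_wf (a := a) hw.2 h100 hm hM hρ
      rw [mul_right_comm]
      exact mul_le_mul h1 h2 (abs_nonneg _) (by positivity)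
    · have h1 := hf hw.2 h100 hm hM hρ hs wfc
      have h2 := abs_eval_le_of_wf (a := a) hw.1 h100 hm hM hρ
      rw [mul_assoc]
      exact mul_le_mul h2 h1 (abs_nonneg _) (by positivity)
  | case4 L c p q hp hq =>
    simp only [Bool.and_eq_true] at hw
    simp only [eval, weight]
    split_ifs
    · refine (hp hw.1 h100 hm hM hρ hs wfc).trans ?_
      gcongr
      · norm_num
      · omega
    · refine (hq hw.2 h100 hm hM hρ hs wfc).trans ?_
      gcongr
      · norm_num
      · omega
  | case5 L v e f hf =>
    simp only [Bool.and_eq_true, decide_eq_true_eq] at hw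
    simp only [eval, weight]
    have hv := abs_eval_le_of_wf (a := a) hw.1.2 h100 hm hM hρ
    have hle : m ≤ e.weight * m := Nat.le_mul_of_pos_left m e.weight_pos
    have h1 : 100 ∉ v :: L := by simp [h100]; omega
    have hM' : ∀ b ∈ Db, ∀ z, |M b z| ≤ 2 ^ (e.weight * m) :=
      fun b hb z => (hM b hb z).trans (mono hle)
    have := hf hw.2 h1 (hm.trans hle) hM'
      (abs_update_le hle hρ hv) (by rwa [Function.update_of_ne (by omega)])
      (fun h => (abs_eval_le_of_wf h h1 (hm.trans hle) hM' (abs_update_le hle hρ hv)).trans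
        (le_mul_of_one_le_right (by positivity) hs0))
    rw [← mul_assoc, mul_comm f.weight] at this
    exact this
  | case6 L e h1 h2 h3 h4 h5 => exact wfc hw

end Fml

namespace Fml

/-- The ranges of all sums are given by registers in `S`. -/
def sums (S : List ℕ) : Fml → Bool
  | const _ => true
  | var _ => true
  | get _ i => sums S i
  | self i => sums S i
  | op _ e f => sums S e && sums S f
  | pos c p q => sums S c && sums S p && sums S q
  | sum x _ e => decide (x ∈ S) && sums S e
  | bind _ e f => sums S e && sums S f

theorem exists_steps_le (S : List ℕ) (e : Fml) (h : sums S e = true) :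
    ∃ C : ℕ, ∀ (ρ : ℕ → ℤ) (τ : ℕ), 1 ≤ τ → (∀ x ∈ S, (ρ x).toNat ≤ τ) →
      e.steps ρ ≤ C * τ ^ C := by
  have key : ∀ {A B C τ : ℕ}, 1 ≤ τ → A ≤ B → B ≤ C → A * τ ^ B ≤ C * τ ^ C :=
    fun h1 h2 h3 => Nat.mul_le_mul (h2.trans h3) (Nat.pow_le_pow_right h1 h3)
  have mono : ∀ {A C τ : ℕ}, 1 ≤ τ → A ≤ C → A * τ ^ A ≤ A * τ ^ C :=
    fun h1 h2 => Nat.mul_le_mul_left _ (Nat.pow_le_pow_right h1 h2)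
  have one : ∀ {C τ : ℕ}, 1 ≤ τ → 1 ≤ τ ^ C := fun h => Nat.one_le_pow _ _ h
  induction e with
  | const z => exact ⟨1, fun ρ τ h1 _ => by simp [steps]; omega⟩
  | var z => exact ⟨1, fun ρ τ h1 _ => by simp [steps]; omega⟩
  | get b i ih =>
    obtain ⟨C, hC⟩ := ih h
    refine ⟨C + 1, fun ρ τ h1 hS => ?_⟩
    have h2 := hC ρ τ h1 hS
    have h3 := mono h1 (Nat.le_add_right C 1)
    have h4 := one (C := C + 1) h1
    simp only [steps]; rw [add_mul]; omega
  | self i ih =>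
    obtain ⟨C, hC⟩ := ih h
    refine ⟨C + 3, fun ρ τ h1 hS => ?_⟩
    have h2 := hC ρ τ h1 hS
    have h3 := mono h1 (Nat.le_add_right C 3)
    have h4 := one (C := C + 3) h1
    simp only [steps]; rw [add_mul]; omega
  | op o e f he hf =>
    simp only [sums, Bool.and_eq_true] at h
    obtain ⟨C, hC⟩ := he h.1
    obtain ⟨C', hC'⟩ := hf h.2
    refine ⟨C + C' + 1, fun ρ τ h1 hS => ?_⟩
    have h2 := hC ρ τ h1 hS
    have h2' := hC' ρ τ h1 hS
    have h3 := mono (A := C) (C := C + C' + 1) h1 (by omega)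
    have h3' := mono (A := C') (C := C + C' + 1) h1 (by omega)
    have h4 := one (C := C + C' + 1) h1
    simp only [steps]; rw [add_mul, add_mul]; omega
  | pos c p q hc hp hq =>
    simp only [sums, Bool.and_eq_true] at h
    obtain ⟨C, hC⟩ := hc h.1.1
    obtain ⟨C', hC'⟩ := hp h.1.2
    obtain ⟨D, hD⟩ := hq h.2
    refine ⟨C + C' + D + 1, fun ρ τ h1 hS => ?_⟩
    have h2 := hC ρ τ h1 hS
    have h2' := hC' ρ τ h1 hS
    have h2'' := hD ρ τ h1 hS
    have h3 := mono (A := C) (C := C + C' + D + 1) h1 (by omega)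
    have h3' := mono (A := C') (C := C + C' + D + 1) h1 (by omega)
    have h3'' := mono (A := D) (C := C + C' + D + 1) h1 (by omega)
    have h4 := one (C := C + C' + D + 1) h1
    simp only [steps]; rw [add_mul, add_mul, add_mul]; omega
  | sum x v e he =>
    simp only [sums, Bool.and_eq_true, decide_eq_true_eq] at h
    obtain ⟨C, hC⟩ := he h.2
    refine ⟨C + 6, fun ρ τ h1 hS => ?_⟩
    have h2 := hC ρ τ h1 hS
    have h3 := hS x h.1
    have h5 := Nat.mul_le_mul h3 (Nat.add_le_add_right h2 3)
    have h6 : τ * (C * τ ^ C + 3) + 3 ≤ (C + 6) * τ ^ (C + 1) := by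
      have := one (C := C) h1
      rw [pow_succ]
      nlinarith [Nat.mul_le_mul this h1]
    simp only [steps]
    exact (Nat.add_le_add_right h5 3).trans (h6.trans
      (Nat.mul_le_mul_left _ (Nat.pow_le_pow_right h1 (by omega))))
  | bind v e f he hf =>
    simp only [sums, Bool.and_eq_true] at h
    obtain ⟨C, hC⟩ := he h.1
    obtain ⟨C', hC'⟩ := hf h.2
    refine ⟨C + C' + 1, fun ρ τ h1 hS => ?_⟩
    have h2 := hC ρ τ h1 hS
    have h2' := hC' ρ τ h1 hS
    have h3 := mono (A := C) (C := C + C' + 1) h1 (by omega)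
    have h3' := mono (A := C') (C := C + C' + 1) h1 (by omega)
    have h4 := one (C := C + C' + 1) h1
    simp only [steps]; rw [add_mul, add_mul]; omega

end Fml

namespace Stmt

/-- The statements fit the growth estimates: tables whose entries may grow multiplicatively have
a length in `S`. -/
def tame (S : List ℕ) : List ℕ → List ℕ → List Stmt → Bool
  | _, _, [] => true
  | Dr, Db, param x e :: l => e.wf Dr Db [] && tame S (x :: Dr) Db l
  | Dr, Db, fill a x e :: l => decide (x ∈ Dr) &&
      (e.addl (100 :: Dr) Db [] || (e.lin (100 :: Dr) Db [] && decide (x ∈ S))) &&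
      tame S Dr (a :: Db) l

/-- Product of the growth rates. -/
def growth (l : List Stmt) : ℕ := (l.map fun st => st.fml.weight + 1).prod

theorem growth_pos (l : List Stmt) : 1 ≤ growth l := by
  refine List.one_le_prod ?_
  simp

theorem fill_abs_le {Dr Db S : List ℕ} {a x : ℕ} {e : Fml} (hx : x ∈ Dr)
    (he : (e.addl (100 :: Dr) Db [] || (e.lin (100 :: Dr) Db [] && decide (x ∈ S))) = true)
    {ρ : ℕ → ℤ} {M : ℕ → ℤ → ℤ} {m τ : ℕ} (hm : 1 ≤ m) (hτ : 1 ≤ τ)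
    (hS : ∀ x ∈ S, (ρ x).toNat ≤ τ) (h12 : 0 < ρ 12) (hh : (fill a x e).Holds ρ M)
    (hρ : ∀ x ∈ Dr, |ρ x| ≤ 2 ^ m) (hM : ∀ b ∈ Db, ∀ z, |M b z| ≤ 2 ^ m) (z : ℤ) :
    |M a z| ≤ 2 ^ (m * (e.weight + 1) * τ) := by
  rcases lt_or_ge z 0 with h0 | h0
  · rw [hh.2 z (Or.inl h0)]; simp
  rcases le_or_gt (ρ x) z with h1 | h1
  · rw [hh.2 z (Or.inr h1)]; simp
  obtain ⟨z, rfl⟩ := Int.eq_ofNat_of_zero_le h0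
  have hρz : ∀ y : ℕ, (y : ℤ) < ρ x → ∀ x, x ∈ 100 :: Dr ∨ x ∈ ([] : List ℕ) →
      |Function.update ρ 100 (y : ℤ) x| ≤ 2 ^ m := by
    intro y hy w hw
    have hy' : |(y : ℤ)| ≤ 2 ^ m := by
      rw [abs_of_nonneg (by omega)]
      exact hy.le.trans ((le_abs_self _).trans (hρ x hx))
    refine Fml.abs_update_le (Dr := Dr) (L := []) le_rfl (fun x hx => hρ x (by simpa using hx)) hy'
      w ?_
    simpa [or_comm] using hw
  have h12' : ∀ y : ℤ, 0 < Function.update ρ 100 y 12 := fun y => by simpa using h12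
  have w1 : 1 ≤ e.weight * m := Nat.mul_pos e.weight_pos hm
  rw [Bool.or_eq_true, Bool.and_eq_true, decide_eq_true_eq] at he
  rcases he with he | ⟨he, hxS⟩
  · have key : ∀ y : ℕ, (y : ℤ) < ρ x → |M a y| ≤ (y + 1) * 2 ^ (e.weight * m) := by
      intro y
      induction y using Nat.strong_induction_on with
      | _ y ih =>
        intro hy
        rw [hh.1 y hy]
        have := Fml.abs_eval_le_of_addl (a := a) (s := y * 2 ^ (e.weight * m)) he (by simp)
          (by simp) hm hM (hρz y hy) (by positivity) (h12' y) (by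
            intro t ht0 ht
            rw [Function.update_self] at ht
            obtain ⟨t, rfl⟩ := Int.eq_ofNat_of_zero_le ht0
            refine (ih t (by exact_mod_cast ht) (ht.trans hy)).trans ?_
            gcongr
            omega)
        linarith
    refine (key z h1).trans ?_
    have h2 : (z : ℤ) + 1 ≤ 2 ^ m := by
      have := (le_abs_self _).trans (hρ x hx)
      omega
    calc ((z : ℤ) + 1) * 2 ^ (e.weight * m) ≤ 2 ^ m * 2 ^ (e.weight * m) := by gcongr
      _ = 2 ^ (m * (e.weight + 1)) := by rw [← pow_add]; ring_nf
      _ ≤ _ := pow_le_pow_right₀ (by norm_num) (Nat.le_mul_of_pos_right _ hτ)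
  · have key : ∀ y : ℕ, (y : ℤ) < ρ x → |M a y| ≤ 2 ^ (e.weight * m * (y + 1)) := by
      intro y
      induction y using Nat.strong_induction_on with
      | _ y ih =>
        intro hy
        rw [hh.1 y hy]
        have := Fml.abs_eval_le_of_lin (a := a) (s := 2 ^ (e.weight * m * y)) he (by simp) hm hM
          (hρz y hy) (one_le_pow₀ (by norm_num)) (by
            intro t ht0 ht
            rw [Function.update_self] at ht
            obtain ⟨t, rfl⟩ := Int.eq_ofNat_of_zero_le ht0
            refine (ih t (by exact_mod_cast ht) (ht.trans hy)).trans ?_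
            refine pow_le_pow_right₀ (by norm_num) (Nat.mul_le_mul_left _ ?_)
            exact_mod_cast ht)
        rw [← pow_add] at this
        refine this.trans (le_of_eq ?_)
        congr 1
        ring
    refine (key z h1).trans (pow_le_pow_right₀ (by norm_num) ?_)
    have h2 := hS x hxS
    refine Nat.mul_le_mul ?_ (by omega)
    rw [mul_comm]
    exact Nat.mul_le_mul_left _ (by omega)

/-- All values occurring in a tame program. -/
theorem abs_le_of_tame {S : List ℕ} {ρ : ℕ → ℤ} {M : ℕ → ℤ → ℤ} {τ : ℕ} (hτ : 1 ≤ τ)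
    (hS : ∀ x ∈ S, (ρ x).toNat ≤ τ) (h12 : 0 < ρ 12) (l : List Stmt) :
    ∀ {Dr Db : List ℕ} {m : ℕ}, tame S Dr Db l = true → 1 ≤ m → (∀ st ∈ l, st.Holds ρ M) →
      (∀ x ∈ Dr, |ρ x| ≤ 2 ^ m) → (∀ b ∈ Db, ∀ z, |M b z| ≤ 2 ^ m) →
      (∀ x, (x ∈ Dr ∨ ∃ st ∈ l, x ∈ st.regs) → |ρ x| ≤ 2 ^ (m * growth l * τ ^ l.length)) ∧
      ∀ b, (b ∈ Db ∨ ∃ st ∈ l, b ∈ st.banks) → ∀ z,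
        |M b z| ≤ 2 ^ (m * growth l * τ ^ l.length) := by
  induction l with
  | nil =>
    intro Dr Db m _ _ _ hρ hM
    simpa [growth] using ⟨hρ, hM⟩
  | cons st l ih =>
    intro Dr Db m ht hm hh hρ hM
    have hle : m ≤ m * (st.fml.weight + 1) * τ := by
      rw [mul_assoc]
      exact Nat.le_mul_of_pos_right _ (Nat.mul_pos (by omega) hτ)
    have mono : (2 : ℤ) ^ m ≤ 2 ^ (m * (st.fml.weight + 1) * τ) :=
      pow_le_pow_right₀ (by norm_num) hle
    have e1 : m * (st.fml.weight + 1) * τ * growth l * τ ^ l.length =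
        m * growth (st :: l) * τ ^ (st :: l).length := by
      simp only [growth, List.map_cons, List.prod_cons, List.length_cons]; ring
    cases st with
    | param x e =>
      rw [tame, Bool.and_eq_true] at ht
      have hx : |ρ x| ≤ 2 ^ (m * (e.weight + 1) * τ) := by
        have : ρ x = e.eval 0 M ρ := hh (param x e) List.mem_cons_self
        rw [this]
        refine (Fml.abs_eval_le_of_wf ht.1 (by simp) hm hM (by simpa using hρ)).trans
          (pow_le_pow_right₀ (by norm_num) ?_)
        rw [mul_comm]
        exact (Nat.mul_le_mul_left m (Nat.le_succ _)).trans (Nat.le_mul_of_pos_right _ hτ)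
      have := ih ht.2 (hm.trans hle) (fun st hst => hh st (List.mem_cons_of_mem _ hst)) (by
        intro y hy
        rcases List.mem_cons.1 hy with rfl | hy
        · exact hx
        · exact (hρ y hy).trans mono) (fun b hb z => (hM b hb z).trans mono)
      rw [e1] at this
      refine ⟨fun y hy => this.1 y ?_, fun b hb => this.2 b ?_⟩
      · simp only [List.mem_cons, exists_eq_or_imp, regs, List.not_mem_nil, or_false] at hy ⊢
        tauto
      · simp only [List.mem_cons, exists_eq_or_imp, banks, List.not_mem_nil, false_or] at hb ⊢
        exact hb
    | fill a x e =>
      rw [tame, Bool.and_eq_true, Bool.and_eq_true, decide_eq_true_eq] at ht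
      have hx := fill_abs_le ht.1.1 ht.1.2 hm hτ hS h12 (hh (fill a x e) List.mem_cons_self) hρ hM
      have := ih ht.2 (hm.trans hle) (fun st hst => hh st (List.mem_cons_of_mem _ hst))
        (fun y hy => (hρ y hy).trans mono) (by
        intro b hb z
        rcases List.mem_cons.1 hb with rfl | hb
        · exact hx z
        · exact (hM b hb z).trans mono)
      rw [e1] at this
      refine ⟨fun y hy => this.1 y ?_, fun b hb => this.2 b ?_⟩
      · simp only [List.mem_cons, exists_eq_or_imp, regs, List.not_mem_nil, false_or] at hy ⊢
        exact hy
      · simp only [List.mem_cons, exists_eq_or_imp, banks, List.not_mem_nil, or_false] at hb ⊢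
        tauto

/-- All sums and all tables have ranges in `S` and in `T`. -/
def short (S T : List ℕ) : Stmt → Bool
  | param _ e => e.sums S
  | fill _ x e => e.sums S && decide (x ∈ T)

theorem exists_costList_le (S T : List ℕ) (l : List Stmt) (h : l.all (short S T) = true) :
    ∃ C : ℕ, ∀ (ρ : ℕ → ℤ) (n m τ : ℕ), 1 ≤ n → 1 ≤ m → 1 ≤ τ → (∀ x ∈ S, (ρ x).toNat ≤ τ) →
      (∀ x ∈ T, (ρ x).toNat ≤ n * τ) → costList ρ m l ≤ C * (n * τ ^ C * m ^ 2) := by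
  induction l with
  | nil =>
    refine ⟨1, fun ρ n m τ hn hm hτ _ _ => ?_⟩
    have : 0 < n * τ ^ 1 * m ^ 2 := by positivity
    simp only [costList]; omega
  | cons st l ih =>
    rw [List.all_cons, Bool.and_eq_true] at h
    obtain ⟨C, hC⟩ := ih h.2
    have hst : ∃ A : ℕ, ∀ (ρ : ℕ → ℤ) (n τ : ℕ), 1 ≤ n → 1 ≤ τ → (∀ x ∈ S, (ρ x).toNat ≤ τ) →
        (∀ x ∈ T, (ρ x).toNat ≤ n * τ) → st.steps ρ ≤ A * (n * τ ^ A) := by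
      cases st with
      | param x e =>
        obtain ⟨A, hA⟩ := e.exists_steps_le S h.1
        refine ⟨A + 1, fun ρ n τ hn hτ hS _ => ?_⟩
        have h1 := hA ρ τ hτ hS
        have h2 : A * τ ^ A ≤ A * (n * τ ^ (A + 1)) :=
          Nat.mul_le_mul_left _ ((Nat.pow_le_pow_right hτ (by omega)).trans
            (Nat.le_mul_of_pos_left _ hn))
        have h3 : 0 < n * τ ^ (A + 1) := by positivity
        simp only [steps]; rw [add_mul]; omega
      | fill a x e =>
        simp only [short, Bool.and_eq_true, decide_eq_true_eq] at h
        obtain ⟨A, hA⟩ := e.exists_steps_le S h.1.1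
        refine ⟨A + 5, fun ρ n τ hn hτ hS hT => ?_⟩
        have h1 := hA ρ τ hτ hS
        have h2 := Nat.mul_le_mul (hT x h.1.2) (Nat.add_le_add_right h1 3)
        have h4 : 1 ≤ τ ^ A := Nat.one_le_pow _ _ hτ
        have h5 : n * τ * (A * τ ^ A + 3) + 2 ≤ (A + 5) * (n * τ ^ (A + 1)) := by
          have h6 : 1 ≤ n * τ := Nat.mul_pos hn hτ
          have h7 : n * τ ≤ n * τ * τ ^ A := Nat.le_mul_of_pos_right _ h4
          have h8 : n * τ ^ (A + 1) = n * τ * τ ^ A := by ring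
          rw [h8]; nlinarith
        simp only [steps]
        refine (Nat.add_le_add_right h2 2).trans (h5.trans ?_)
        gcongr
        omega
    obtain ⟨A, hA⟩ := hst
    refine ⟨100 * A * (st.fml.weight + 2) ^ 2 + A + C, fun ρ n m τ hn hm hτ hS hT => ?_⟩
    have h1 := hC ρ n m τ hn hm hτ hS hT
    have h2 := hA ρ n τ hn hτ hS hT
    set W := 100 * A * (st.fml.weight + 2) ^ 2
    simp only [costList]
    have h3 : n * τ ^ C * m ^ 2 ≤ n * τ ^ (W + A + C) * m ^ 2 := by
      gcongr
      omega
    have h4 : n * τ ^ A * m ^ 2 ≤ n * τ ^ (W + A + C) * m ^ 2 := by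
      gcongr
      omega
    calc st.steps ρ * (100 * ((st.fml.weight + 2) * m) ^ 2) + costList ρ m l
        ≤ A * (n * τ ^ A) * (100 * ((st.fml.weight + 2) * m) ^ 2) + C * (n * τ ^ C * m ^ 2) := by
          gcongr
      _ = W * (n * τ ^ A * m ^ 2) + C * (n * τ ^ C * m ^ 2) := by simp only [W]; ring
      _ ≤ W * (n * τ ^ (W + A + C) * m ^ 2) + C * (n * τ ^ (W + A + C) * m ^ 2) := by gcongr
      _ ≤ (W + A + C) * (n * τ ^ (W + A + C) * m ^ 2) := by
          rw [← add_mul]; gcongr; omega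

end Stmt

end RAM

namespace RoPE.Alg

open RAM

/-- Registers with small contents. -/
def smallRegs : List ℕ := [1, 2, 3, 4, 6, 7, 11, 17, 18, 20, 24, 26, 27]

/-- Registers that hold the length of a table. -/
def tableRegs : List ℕ :=
  [0, 4, 7, 11, 15, 18, 22, 14, 24, 27, 28, 29, 30, 32, 8, 6, 35, 36, 37, 20, 39, 43, 42]

theorem prog_tame (K C₁ C₂ C₃ : ℕ) :
    Stmt.tame smallRegs [0, 1] inputBanks (prog K C₁ C₂ C₃) = true := by
  rfl

theorem prog_short (K C₁ C₂ C₃ : ℕ) :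
    (prog K C₁ C₂ C₃).all (Stmt.short smallRegs tableRegs) = true := by
  rfl

end RoPE.Alg

namespace RoPE.Alg

open RAM RAM.Fml

theorem degree_mono {R R' : ℕ} (h : R ≤ R') (P Q : ℕ) : degree R P Q ≤ degree R' P Q := by
  refine Finset.card_le_card fun g hg => ?_
  simp only [Finset.mem_filter] at hg ⊢
  exact ⟨hg.1, hg.2.trans_le (by gcongr)⟩

theorem choose_add_le {a b q Q : ℕ} (h : a ≤ b) (hq : q ≤ Q) :
    (a + q).choose q ≤ (b + Q).choose Q := by
  calc (a + q).choose q ≤ (b + q).choose q := Nat.choose_le_choose _ (by omega)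
    _ = (b + q).choose b := (Nat.choose_symm_add).symm
    _ ≤ (b + Q).choose b := Nat.choose_le_choose _ (by omega)
    _ = (b + Q).choose Q := Nat.choose_symm_add

/-- Bound for the radius of the disc on which the exponential is approximated. -/
noncomputable def radiusBound (K : ℕ) (B : ℝ) : ℕ := K * (⌈|B|⌉₊ + 2) * (⌈|B|⌉₊ + 2) + 1

/-- Bound for the degree of the Taylor polynomial. -/
noncomputable def degreeBound (K C₁ C₂ : ℕ) (B : ℝ) (n : ℕ) : ℕ :=
  degree (radiusBound K B) (prec C₁ n) (C₂ * n.size)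

/-- Product of the parameters of subpolynomial size. -/
def spread (K C₂ C₃ d Q n : ℕ) : ℕ :=
  (d + 1) * (n.size + 1) * ord n * (2 * modExp C₃ n + 1) * (C₂ * n.size + 1) * (Q + 1) *
    (K * d + Q).choose Q

theorem group_le {n : ℕ} (hn : 0 < n) : ord n ^ dig n ≤ n * ord n ^ 3 := by
  have h1 := root_sq_le (Nat.size_pos.2 hn)
  have h2 : 2 ^ (n.size - 1) ≤ n := by
    by_contra h
    push Not at h
    have := Nat.size_le.2 h
    have := Nat.size_pos.2 hn
    omega
  have e : ∀ k, ord n ^ k = 2 ^ ((dig n + 1) * k) := fun k => by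
    rw [pow_mul, pow_succ']
  rw [e, e]
  calc 2 ^ ((dig n + 1) * dig n) ≤ 2 ^ (n.size - 1 + (dig n + 1) * 3) := by
        refine Nat.pow_le_pow_right (by norm_num) ?_
        have := Nat.size_pos.2 hn
        change dig n * dig n + 2 ≤ n.size + 2 * dig n at h1
        have : (dig n + 1) * dig n = dig n * dig n + dig n := by ring
        omega
    _ = 2 ^ (n.size - 1) * 2 ^ ((dig n + 1) * 3) := pow_add _ _ _
    _ ≤ _ := Nat.mul_le_mul_right _ h2

namespace Sys

variable {K C₁ C₂ C₃ n d : ℕ} {I : Instance n d} {ρ : ℕ → ℤ} {M : ℕ → ℤ → ℤ}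

theorem sum_flag_le (S : Sys K C₁ C₂ C₃ I ρ M) {T : Finset (Fin d × Fin d)}
    (h : ∀ t : ℤ, -(n : ℤ) < t → t < n → ∀ k l, I.W t k l ≠ 0 → (k, l) ∈ T) :
    ∑ e ∈ Finset.range (d * d), flag n d M e ≤ T.card := by
  rw [sum_range_sq, ← Fintype.sum_prod_type']
  calc _ ≤ ∑ x : Fin d × Fin d, if x ∈ T then 1 else 0 := by
        refine Finset.sum_le_sum fun x _ => ?_
        rw [flag]
        split_ifs with h1 h2 h2
        · exact le_rfl
        · obtain ⟨t, ht, h3⟩ := h1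
          refine absurd (h ((t : ℤ) - ((n : ℤ) - 1)) (by omega) (by omega) x.1 x.2 ?_) h2
          have := S.weight_num ⟨t, ht⟩ x.1 x.2
          simp only at this
          rw [this] at h3
          exact fun h0 => h3 (by rw [h0]; rfl)
        · omega
        · exact le_rfl
    _ = T.card := by simp

theorem max_le (S : Sys K C₁ C₂ C₃ I ρ M) {c b : ℕ} {A : Matrix (Fin n) (Fin d) ℚ}
    (h : Stmt.fill c 15 (fMax b) ∈ prog K C₁ C₂ C₃)
    (ha : ∀ (i : Fin n) (k : Fin d), |(M b (((i : ℕ) : ℤ) * d + (k : ℕ)) : ℝ) / 2 ^ prec C₁ n -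
      toReal A i k| ≤ d / 2 ^ prec C₁ n) {B : ℝ} (hB : MaxNormLE A B) (hd : d ≤ 2 ^ prec C₁ n) :
    M c ((n * d : ℕ) - 1) / 2 ^ prec C₁ n ≤ (⌈|B|⌉₊ + 1 : ℕ) := by
  refine Int.ediv_le_of_le_mul (by positivity) ?_
  refine (S.maxEq h).2.2 _ (by positivity) fun z hz => ?_
  have hd0 : 0 < d := Nat.pos_of_ne_zero (by rintro rfl; simp at hz)
  have hi : z / d < n := Nat.div_lt_of_lt_mul (by rwa [mul_comm])
  have h1 := ha ⟨z / d, hi⟩ ⟨z % d, Nat.mod_lt _ hd0⟩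
  have h2 := hB ⟨z / d, hi⟩ ⟨z % d, Nat.mod_lt _ hd0⟩
  have e : ((z / d : ℕ) : ℤ) * d + (z % d : ℕ) = z := by exact_mod_cast Nat.div_add_mod' z d
  simp only [e] at h1
  have hP : (0 : ℝ) < 2 ^ prec C₁ n := by positivity
  have h3 : (d : ℝ) / 2 ^ prec C₁ n ≤ 1 := by
    rw [div_le_one hP]; exact_mod_cast hd
  have h4 := abs_sub_abs_le_abs_sub ((M b (z : ℤ) : ℝ) / 2 ^ prec C₁ n)
    (toReal A ⟨z / d, hi⟩ ⟨z % d, Nat.mod_lt _ hd0⟩)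
  have h5 : |(M b (z : ℤ) : ℝ)| / 2 ^ prec C₁ n ≤ ⌈|B|⌉₊ + 1 := by
    rw [abs_div, abs_of_pos hP] at h4
    have := Nat.le_ceil |B|
    have := le_abs_self B
    linarith
  rw [div_le_iff₀ hP] at h5
  exact_mod_cast h5

theorem radius_le (S : Sys K C₁ C₂ C₃ I ρ M) {B : ℝ} (hq : MaxNormLE (I.A₁ * I.X₁) B)
    (hk : MaxNormLE (I.A₂ * I.X₂) B) (hd : d ≤ 2 ^ prec C₁ n) :
    (ρ 16).toNat ≤ radiusBound K B := by
  have h1 := S.max_le (c := 28) (b := 25) (by simp [prog]) S.query_approx hq hd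
  have h2 := S.max_le (c := 29) (b := 26) (by simp [prog]) S.key_approx hk hd
  have h1' := (S.maxEq (c := 28) (b := 25) (by simp [prog])).1
  have h2' := (S.maxEq (c := 29) (b := 26) (by simp [prog])).1
  have e := S.r16
  have h3 : ρ 16 ≤ (radiusBound K B : ℕ) := by
    rw [e, radiusBound]
    push_cast at h1 h2 ⊢
    have h5 : 0 ≤ M 29 ((n : ℤ) * d - 1) / 2 ^ prec C₁ n :=
      Int.ediv_nonneg (by exact_mod_cast h2') (by positivity)
    have h6 : M 28 ((n : ℤ) * d - 1) / 2 ^ prec C₁ n + 1 ≤ ⌈|B|⌉₊ + 2 := by linarith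
    have h7 : M 29 ((n : ℤ) * d - 1) / 2 ^ prec C₁ n + 1 ≤ ⌈|B|⌉₊ + 2 := by linarith
    exact add_le_add_left (mul_le_mul (mul_le_mul_of_nonneg_left h6 (by positivity)) h7
      (by linarith) (by positivity)) 1
  omega

theorem degree_le_degreeBound (S : Sys K C₁ C₂ C₃ I ρ M) {q : ℕ} (hq : ρ 19 = q) {B : ℝ}
    (hR : (ρ 16).toNat ≤ radiusBound K B) : q ≤ degreeBound K C₁ C₂ B n := by
  have h := S.r19
  rw [hq] at h
  have : q = degree (ρ 16).toNat (prec C₁ n) (C₂ * n.size) := by exact_mod_cast h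
  rw [this]
  exact degree_mono hR _ _

/-- The number of steps of the algorithm is governed by the subpolynomial parameters. -/
theorem regs_le (S : Sys K C₁ C₂ C₃ I ρ M) {q Q : ℕ} (hq : ρ 19 = q) (hqQ : q ≤ Q)
    (hfl : ∑ e ∈ Finset.range (d * d), flag n d M e ≤ K * d) :
    (∀ x ∈ smallRegs, (ρ x).toNat ≤ spread K C₂ C₃ d Q n ^ 12) ∧
      ∀ x ∈ tableRegs, (ρ x).toNat ≤ n * spread K C₂ C₃ d Q n ^ 12 := by
  have hc := S.r25 hq
  set c := (∑ e ∈ Finset.range (d * d), flag n d M e + q).choose q with hcdef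
  have hc1 : c ≤ (K * d + Q).choose Q := choose_add_le hfl hqQ
  have hn := S.pos
  set σ := spread K C₂ C₃ d Q n with hσ
  have p1 : 0 < ord n := by positivity
  have p2 : 0 < (K * d + Q).choose Q := Nat.choose_pos (by omega)
  have le_of_dvd : ∀ {a : ℕ}, a ∣ σ → a ≤ σ ^ 1 := fun h => by
    rw [pow_one]; exact Nat.le_of_dvd (by rw [hσ, spread]; positivity) h
  have hd : d + 1 ≤ σ ^ 1 := le_of_dvd (by
    simp only [hσ, spread, mul_assoc]; exact Dvd.intro _ rfl)
  have hl : n.size + 1 ≤ σ ^ 1 := le_of_dvd (by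
    rw [hσ, spread]; simp only [mul_assoc]; exact Dvd.dvd.mul_left (Dvd.intro _ rfl) _)
  have ho : ord n ≤ σ ^ 1 := le_of_dvd (by
    rw [hσ, spread]
    exact ((((Dvd.intro_left _ rfl).mul_right _).mul_right _).mul_right _).mul_right _)
  have he : 2 * modExp C₃ n + 1 ≤ σ ^ 1 := le_of_dvd (by
    rw [hσ, spread]
    exact (((Dvd.intro_left _ rfl).mul_right _).mul_right _).mul_right _)
  have h17 : C₂ * n.size + 1 ≤ σ ^ 1 := le_of_dvd (by
    rw [hσ, spread]
    exact ((Dvd.intro_left _ rfl).mul_right _).mul_right _)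
  have hQ : Q + 1 ≤ σ ^ 1 := le_of_dvd (by
    rw [hσ, spread]
    exact (Dvd.intro_left _ rfl).mul_right _)
  have hch : c ≤ σ ^ 1 := hc1.trans (le_of_dvd (by
    rw [hσ, spread]
    exact Dvd.intro_left _ rfl))
  have hs : dig n + 1 ≤ σ ^ 1 := (Nat.succ_le_succ (root_le n.size)).trans hl
  have hqq : q + 1 ≤ σ ^ 1 := (Nat.succ_le_succ hqQ).trans hQ
  have h2σ : 2 ≤ σ ^ 1 := (show 2 ≤ ord n by
    have : 1 ≤ base n := Nat.one_le_two_pow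
    simp only [ord]; omega).trans ho
  have hσ1 : 1 ≤ σ := by rw [pow_one] at h2σ; omega
  have up : ∀ {a i : ℕ}, a ≤ σ ^ i → i ≤ 12 → a ≤ σ ^ 12 := fun h hi =>
    h.trans (Nat.pow_le_pow_right hσ1 hi)
  have upn : ∀ {a i : ℕ}, a ≤ n * σ ^ i → i ≤ 12 → a ≤ n * σ ^ 12 := fun h hi =>
    h.trans (Nat.mul_le_mul_left _ (Nat.pow_le_pow_right hσ1 hi))
  have mm : ∀ {a b i j : ℕ}, a ≤ σ ^ i → b ≤ σ ^ j → a * b ≤ σ ^ (i + j) := fun h h' => by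
    rw [pow_add]; exact Nat.mul_le_mul h h'
  have mn : ∀ {a b i j : ℕ}, a ≤ σ ^ i → b ≤ n * σ ^ j → a * b ≤ n * σ ^ (i + j) := fun h h' => by
    rw [pow_add, mul_left_comm]; exact Nat.mul_le_mul h h'
  have small : ∀ {a i : ℕ}, a ≤ σ ^ i → a ≤ n * σ ^ i := fun h =>
    h.trans (Nat.le_mul_of_pos_left _ hn)
  have hd0 : d ≤ σ ^ 1 := by omega
  have hdd : d * d + 1 ≤ σ ^ 2 := (show d * d + 1 ≤ (d + 1) * (d + 1) by nlinarith).trans (mm hd hd)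
  have h31 := mm hd hd
  have h26 := mm hqq hch
  have h27 := mm hdd h26
  have h38 := mm hdd h31
  have h42 := mm (mm hd0 hd0) (mm hd0 hd0)
  have hn0 : n ≤ n * σ ^ 0 := by simp
  have hnn : 2 * n - 1 ≤ n * σ ^ 1 := (show 2 * n - 1 ≤ n * 2 by omega).trans
    (Nat.mul_le_mul_left _ h2σ)
  have hG : ord n ^ dig n ≤ n * σ ^ 3 := (group_le hn).trans (Nat.mul_le_mul_left _
    (Nat.pow_le_pow_left (by simpa using ho) 3))
  have h34 := mn hs hG
  have cast : ∀ {x : ℤ} {a b : ℕ}, x = (a : ℕ) → a ≤ b → x.toNat ≤ b := fun h h' => by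
    rw [h, Int.toNat_natCast]; exact h'
  have e25 : ρ 25 = (c : ℕ) := hc
  constructor
  · simp only [smallRegs, List.forall_mem_cons, List.not_mem_nil, false_implies, implies_true,
      and_true]
    exact ⟨cast S.r1 (up hd0 (by norm_num)), cast S.r2 (up (by omega) (by norm_num : 1 ≤ 12)),
      cast S.r3 (up (by omega) (by norm_num : 1 ≤ 12)), cast S.r4 (up hl (by norm_num)),
      cast S.r6 (up ho (by norm_num)), cast S.r7 (up hs (by norm_num)),
      cast S.r11 (up he (by norm_num)), cast S.r17 (up (by omega) (by norm_num : 1 ≤ 12)),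
      cast S.r18 (up h17 (by norm_num)), cast (S.r20 hq) (up hqq (by norm_num)),
      cast (S.r24 hq) (up (mm hdd hqq) (by norm_num)),
      cast (S.r26 hq e25) (up h26 (by norm_num)), cast (S.r27 hq e25) (up h27 (by norm_num))⟩
  · simp only [tableRegs, List.forall_mem_cons, List.not_mem_nil, false_implies, implies_true,
      and_true]
    exact ⟨cast S.r0 (upn hn0 (by norm_num)), cast S.r4 (upn (small hl) (by norm_num)),
      cast S.r7 (upn (small hs) (by norm_num)), cast S.r11 (upn (small he) (by norm_num)),
      cast S.r15 (upn (by rw [mul_comm]; exact mn hd0 hn0) (by norm_num)),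
      cast S.r18 (upn (small h17) (by norm_num)),
      cast S.r22 (upn (by rw [mul_comm]; exact mn (mm hd0 hd0) hnn) (by norm_num)),
      cast S.r14 (upn (small (mm hd0 hd0)) (by norm_num)),
      cast (S.r24 hq) (upn (small (mm hdd hqq)) (by norm_num)),
      cast (S.r27 hq e25) (upn (small h27) (by norm_num)),
      cast (S.r28 hq e25) (upn (mn h27 hn0) (by norm_num)),
      cast S.r29 (upn (mn hdd hnn) (by norm_num)),
      cast (S.r30 hq e25) (upn (mn h27 hnn) (by norm_num)),
      cast S.r32 (upn (mn h31 hn0) (by norm_num)), cast S.r8 (upn hG (by norm_num)),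
      cast S.r6 (upn (small ho) (by norm_num)),
      cast (S.r35 hq e25) (upn (mn (mm h26 hdd) h34) (by norm_num)),
      cast (S.r36 hq e25) (upn (mn (mm h26 h31) h34) (by norm_num)),
      cast (S.r37 hq e25) (upn (mn (mm h26 h38) h34) (by norm_num)),
      cast (S.r20 hq) (upn (small hqq) (by norm_num)), cast S.r39 (upn (mn h38 hn0) (by norm_num)),
      cast S.r43 (upn (by rw [mul_comm]; exact mn h42 hn0) (by norm_num)),
      cast S.r42 (upn (small h42) (by norm_num))⟩

end Sys

end RoPE.Alg

namespace RoPE.Alg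

open RAM RAM.Fml

theorem abs_taylor_le (q : ℕ) {D : ℤ} (hD : 0 < D) (x : ℤ) :
    |(taylor q D x : ℝ)| ≤ q.factorial * (D : ℝ) ^ q * Real.exp |(x : ℝ) / D| := by
  have hD' : (0 : ℝ) < D := by exact_mod_cast hD
  rw [cast_taylor q hD.ne', abs_mul, abs_of_nonneg (by positivity)]
  gcongr
  refine le_trans ?_ (Real.sum_le_exp_of_nonneg (abs_nonneg _) (q + 1))
  refine (Finset.abs_sum_le_sum_abs _ _).trans (Finset.sum_le_sum fun g _ => ?_)
  rw [abs_div, abs_pow, Nat.abs_cast]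

theorem abs_le_of_div_sub_le {Z X a x e : ℝ} (hZ : 0 < Z) (h : |a / Z - x| ≤ e) (hx : |x| ≤ X) :
    |a| ≤ Z * (X + e) := by
  have h1 := abs_sub_abs_le_abs_sub (a / Z) x
  rw [abs_div, abs_of_pos hZ] at h1
  have h2 : |a| / Z ≤ X + e := by linarith
  rwa [div_le_iff₀' hZ] at h2

namespace Sys

variable {K C₁ C₂ C₃ n d : ℕ} {I : Instance n d} {ρ : ℕ → ℤ} {M : ℕ → ℤ → ℤ}

theorem abs_exactSum_le (S : Sys K C₁ C₂ C₃ I ρ M) {X : ℝ} (hI : Bounded I X) (hd : 0 < d)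
    (hfl : ∑ e ∈ Finset.range (d * d), flag n d M e ≤ K * d)
    (hexp : Real.exp ((ρ 16).toNat : ℝ) ≤ X) (hX2 : X ^ 2 ≤ 2 ^ prec C₁ n) (q : ℕ) {κ ν i : ℕ}
    (hκ : κ < d * d + 1) (hν : ν < (d + 1) * (d + 1)) (hi : i < n) :
    |(exactSum n d q M (d * 2 ^ (3 * prec C₁ n)) κ ν i : ℝ)| ≤
      q.factorial * (2 ^ prec C₁ n) ^ (4 * q + 7) := by
  have hX := hI.two_le
  set Z : ℝ := 2 ^ prec C₁ n with hZ
  have hZ0 : 0 < Z := by positivity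
  have hXZ : X ≤ Z := by nlinarith
  have h2XZ : 2 * X ≤ Z := by nlinarith
  have hdX := hI.d_le
  have hdiv : ∀ {y : ℝ}, y ≤ X → y / Z ≤ X := fun h => by
    rw [div_le_iff₀ hZ0]; nlinarith
  have h42 : ∀ j : Fin n, |(M 42 ((κ : ℤ) * (2 * n - 1 : ℕ) +
      (i + (n - 1 - (j : ℕ)) : ℕ)) : ℝ)| ≤ Z := by
    intro j
    rcases Nat.lt_succ_iff_lt_or_eq.1 hκ with h | rfl
    · have hk : κ / d < d := (Nat.div_lt_iff_lt_mul hd).2 h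
      have := S.abs_t42_le hI ⟨i, hi⟩ j ⟨κ / d, hk⟩ ⟨κ % d, Nat.mod_lt _ hd⟩
      simp only [Nat.div_add_mod'] at this
      rw [hZ]
      exact_mod_cast this
    · rw [S.t42_top (by omega)]
      rw [hZ]; push_cast; rw [abs_of_pos (by positivity)]
  have hkey : ∀ (j : Fin n) (b : ℕ), |(keyExt (prec C₁ n) d M j b : ℝ)| ≤ Z * Z := by
    intro j b
    by_cases hb : b < d
    · refine (abs_le_of_div_sub_le hZ0 (S.keyExt_approx j ⟨b, hb⟩) (hI.A₂ j ⟨b, hb⟩)).trans ?_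
      have := hdiv (y := 1) (by linarith)
      gcongr
      linarith
    · rw [keyExt, if_neg hb]
      push_cast
      rw [← hZ, abs_of_pos hZ0]
      nlinarith
  have hval : ∀ (j : Fin n) (c : ℕ), |(valueExt (prec C₁ n) d M j c : ℝ)| ≤ Z * Z := by
    intro j c
    by_cases hc : c < d
    · rw [valueExt, if_pos hc]
      refine (abs_le_of_div_sub_le hZ0 (S.value_approx j ⟨c, hc⟩) (hI.value j ⟨c, hc⟩)).trans ?_
      have := hdiv hdX
      gcongr
      linarith
    · rw [valueExt, if_neg hc]
      push_cast
      rw [← hZ, abs_of_pos hZ0]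
      nlinarith
  have h44 : ∀ j : Fin n, |(M 44 ((ν : ℤ) * n + (j : ℕ)) : ℝ)| ≤ Z ^ 4 := by
    intro j
    have h := S.t44 (b := ν / (d + 1)) (c := ν % (d + 1))
      ((Nat.div_lt_iff_lt_mul (by omega)).2 hν) (Nat.mod_lt _ (by omega)) j.2
    rw [Nat.div_add_mod'] at h
    rw [h, Int.cast_mul, abs_mul]
    calc _ ≤ (Z * Z) * (Z * Z) := mul_le_mul (hkey j _) (hval j _) (abs_nonneg _) (by positivity)
      _ = Z ^ 4 := by ring
  have hD : (0 : ℤ) < d * 2 ^ (3 * prec C₁ n) := by positivity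
  have hDZ : ((d * 2 ^ (3 * prec C₁ n) : ℤ) : ℝ) ≤ Z ^ 4 := by
    have e : ((d * 2 ^ (3 * prec C₁ n) : ℤ) : ℝ) = d * Z ^ 3 := by
      rw [hZ, mul_comm 3, pow_mul]; push_cast; ring
    rw [e]
    calc (d : ℝ) * Z ^ 3 ≤ Z * Z ^ 3 := by gcongr; linarith
      _ = Z ^ 4 := by ring
  have hD0 : (0 : ℝ) < (d * 2 ^ (3 * prec C₁ n) : ℤ) := by exact_mod_cast hD
  have htay : ∀ j : Fin n, |(taylor q (d * 2 ^ (3 * prec C₁ n)) (expArg n d M i j) : ℝ)| ≤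
      q.factorial * Z ^ (4 * q) * Z := by
    intro j
    refine (abs_taylor_le q hD _).trans ?_
    have h1 := S.abs_expArg_le hI hd hfl ⟨i, hi⟩ j
    have h2 : Real.exp |((expArg n d M i j : ℤ) : ℝ) / (d * 2 ^ (3 * prec C₁ n) : ℤ)| ≤ Z :=
      (Real.exp_le_exp.2 (h1.trans (by linarith))).trans (hexp.trans hXZ)
    rw [pow_mul Z]
    gcongr
  rw [exactSum, Finset.sum_range, Int.cast_sum]
  refine (Finset.abs_sum_le_sum_abs _ _).trans ?_
  refine (Finset.sum_le_card_nsmul _ _ (q.factorial * Z ^ (4 * q) * Z * (Z * Z ^ 4))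
    fun j _ => ?_).trans ?_
  · rw [Int.cast_mul, Int.cast_mul, abs_mul, abs_mul]
    have a1 := htay j
    have a2 := h42 j
    have a3 := h44 j
    gcongr
  · rw [Finset.card_univ, Fintype.card_fin, nsmul_eq_mul]
    calc (n : ℝ) * _ ≤ Z * (q.factorial * Z ^ (4 * q) * Z * (Z * Z ^ 4)) := by
          gcongr; exact hI.n_le.trans hXZ
      _ = _ := by rw [pow_add]; ring

theorem exactSum_lt_modulus (S : Sys K C₁ C₂ C₃ I ρ M) {X : ℝ} (hI : Bounded I X) (hd : 0 < d)
    (hfl : ∑ e ∈ Finset.range (d * d), flag n d M e ≤ K * d)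
    (hexp : Real.exp ((ρ 16).toNat : ℝ) ≤ X) (hX2 : X ^ 2 ≤ 2 ^ prec C₁ n) {q : ℕ}
    (hq : q ≤ C₂ * n.size) (hC : C₂ * C₂ + C₁ * (4 * C₂ + 7) + 1 ≤ C₃) {κ ν i : ℕ}
    (hκ : κ < d * d + 1) (hν : ν < (d + 1) * (d + 1)) (hi : i < n) :
    2 * |exactSum n d q M (d * 2 ^ (3 * prec C₁ n)) κ ν i| < (modulus C₃ n : ℕ) := by
  have h1 := S.abs_exactSum_le hI hd hfl hexp hX2 q hκ hν hi
  have h2 : |exactSum n d q M (d * 2 ^ (3 * prec C₁ n)) κ ν i| ≤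
      (q.factorial * (2 ^ prec C₁ n) ^ (4 * q + 7) : ℕ) := by exact_mod_cast h1
  have hl := S.lg_pos
  have h3 : 2 * (q.factorial * (2 ^ prec C₁ n) ^ (4 * q + 7)) ≤ 2 ^ modExp C₃ n := by
    calc 2 * (q.factorial * (2 ^ prec C₁ n) ^ (4 * q + 7))
        ≤ 2 * ((2 ^ q) ^ q * (2 ^ prec C₁ n) ^ (4 * q + 7)) := by
          gcongr
          exact (Nat.factorial_le_pow q).trans (Nat.pow_le_pow_left Nat.lt_two_pow_self.le q)
      _ = 2 ^ (q * q + prec C₁ n * (4 * q + 7) + 1) := by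
          rw [← pow_mul, ← pow_mul, pow_succ, pow_add]; ring
      _ ≤ 2 ^ modExp C₃ n := by
          refine Nat.pow_le_pow_right (by norm_num) ?_
          calc q * q + prec C₁ n * (4 * q + 7) + 1
              ≤ (C₂ * n.size) * (C₂ * n.size) + (C₁ * n.size) * (4 * (C₂ * n.size) + 7 * n.size) +
                n.size * n.size := by
                gcongr
                · omega
                · nlinarith
            _ = (C₂ * C₂ + C₁ * (4 * C₂ + 7) + 1) * n.size * n.size := by ring
            _ ≤ C₃ * n.size * n.size := by gcongr
            _ ≤ base n * (C₃ * n.size * n.size) :=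
                Nat.le_mul_of_pos_left _ Nat.one_le_two_pow
  have h4 : ((2 * (q.factorial * (2 ^ prec C₁ n) ^ (4 * q + 7)) : ℕ) : ℤ) ≤
      (2 ^ modExp C₃ n : ℕ) := by exact_mod_cast h3
  have h5 : ((modulus C₃ n : ℕ) : ℤ) = (2 ^ modExp C₃ n : ℕ) + 1 := by
    simp only [modulus]; push_cast; ring
  rw [h5]
  rw [Nat.cast_mul 2] at h4
  generalize ((q.factorial * (2 ^ prec C₁ n) ^ (4 * q + 7) : ℕ) : ℤ) = u at *
  generalize ((2 ^ modExp C₃ n : ℕ) : ℤ) = v at *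
  push_cast at h4
  linarith

end Sys

end RoPE.Alg

namespace RoPE.Alg

open RAM RAM.Fml

theorem abs_layout_le {ι : Type*} [Fintype ι] {addr : ι → ℤ} {f : ι → ℤ} {u : ℤ} (hu : 0 ≤ u)
    (h : ∀ i, |layout addr f (addr i)| ≤ u) (y : ℤ) : |layout addr f y| ≤ u := by
  by_cases hy : ∃ i, addr i = y
  · obtain ⟨i, rfl⟩ := hy; exact h i
  · push Not at hy
    simp [layout, hy, hu]

theorem abs_num_le {r : ℚ} {b : ℕ} (h : r.num.natAbs.size ≤ b) : |r.num| ≤ 2 ^ b := by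
  rw [Int.abs_eq_natAbs]
  exact_mod_cast (Nat.size_le.1 h).le

theorem abs_den_le {r : ℚ} {b : ℕ} (h : r.den.size ≤ b) : |(r.den : ℤ)| ≤ 2 ^ b := by
  rw [Nat.abs_cast]
  exact_mod_cast (Nat.size_le.1 h).le

theorem abs_entry_le {m k b : ℕ} {A : Matrix (Fin m) (Fin k) ℚ} (h : BitsLE A b) (i : Fin m)
    (j : Fin k) : |toReal A i j| ≤ 2 ^ b := by
  have h1 : |(A i j)| ≤ 2 ^ b := by
    rw [← Rat.num_div_den (A i j), abs_div, Nat.abs_cast]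
    have h2 : (|(A i j).num| : ℚ) ≤ 2 ^ b := by exact_mod_cast abs_num_le (h i j).1
    have h3 : (1 : ℚ) ≤ (A i j).den := by exact_mod_cast (A i j).pos
    exact (div_le_self (abs_nonneg _) h3).trans h2
  rw [toReal, Matrix.map_apply]
  exact_mod_cast h1

theorem abs_storeMatrix_num_le {m k b : ℕ} {A : Matrix (Fin m) (Fin k) ℚ} (h : BitsLE A b)
    (y : ℤ) : |Instance.storeMatrix Rat.num A y| ≤ 2 ^ b :=
  abs_layout_le (by positivity) (fun q => by
    refine (congrArg abs (storeMatrix_apply Rat.num A q.1 q.2)).trans_le ?_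
    exact abs_num_le (h q.1 q.2).1) y

theorem abs_storeMatrix_den_le {m k b : ℕ} {A : Matrix (Fin m) (Fin k) ℚ} (h : BitsLE A b)
    (y : ℤ) : |Instance.storeMatrix (fun r => (r.den : ℤ)) A y| ≤ 2 ^ b :=
  abs_layout_le (by positivity) (fun q => by
    refine (congrArg abs (storeMatrix_apply (fun r => (r.den : ℤ)) A q.1 q.2)).trans_le ?_
    exact abs_den_le (h q.1 q.2).2) y

theorem abs_storeWeights_le {n d : ℕ} {I : Instance n d} {f : ℚ → ℤ} {u : ℤ} (hu : 0 ≤ u)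
    (h : ∀ t : ℤ, -(n : ℤ) < t → t < n → ∀ k l, |f (I.W t k l)| ≤ u) (y : ℤ) :
    |I.storeWeights f y| ≤ u :=
  abs_layout_le hu (fun q => by
    refine (congrArg abs (storeWeights_apply f I q.1 q.2.1 q.2.2)).trans_le ?_
    exact h _ (by omega) (by omega) _ _) y

theorem abs_input_le {n d : ℕ} {I : Instance n d} {B : ℝ} {K b : ℕ} (hI : I.Admissible B K b)
    (a : ℕ) (y : ℤ) : |I.input.mem a y| ≤ 2 ^ b := by
  simp only [Instance.input]
  split
  · exact abs_storeMatrix_num_le hI.bits_A₁ y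
  · exact abs_storeMatrix_num_le hI.bits_A₂ y
  · exact abs_storeMatrix_num_le hI.bits_A₃ y
  · exact abs_storeMatrix_num_le hI.bits_E y
  · exact abs_storeMatrix_num_le hI.bits_X₁ y
  · exact abs_storeMatrix_num_le hI.bits_X₂ y
  · exact abs_storeMatrix_num_le hI.bits_Y y
  · exact abs_storeWeights_le (by positivity)
      (fun t h1 h2 k l => abs_num_le (hI.bits_W t h1 h2 k l).1) y
  · exact abs_storeMatrix_den_le hI.bits_A₁ y
  · exact abs_storeMatrix_den_le hI.bits_A₂ y
  · exact abs_storeMatrix_den_le hI.bits_A₃ y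
  · exact abs_storeMatrix_den_le hI.bits_E y
  · exact abs_storeMatrix_den_le hI.bits_X₁ y
  · exact abs_storeMatrix_den_le hI.bits_X₂ y
  · exact abs_storeMatrix_den_le hI.bits_Y y
  · exact abs_storeWeights_le (by positivity)
      (fun t h1 h2 k l => abs_den_le (hI.bits_W t h1 h2 k l).2) y
  · simp

theorem input_mem_eq_zero {n d : ℕ} (I : Instance n d) {a : ℕ} (h : a ∉ inputBanks) :
    I.input.mem a = 0 := by
  simp only [Instance.input]
  split
  all_goals first
    | (simp [inputBanks] at h; done)
    | rfl

theorem input_reg_eq_zero {n d : ℕ} (I : Instance n d) {x : ℕ} (h : x ∉ [0, 1]) :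
    I.input.reg x = 0 := by
  simp only [Instance.input]
  split
  all_goals first
    | (simp at h; done)
    | rfl

theorem spread_pos (K C₂ C₃ d Q n : ℕ) : 1 ≤ spread K C₂ C₃ d Q n := by
  have : 0 < (K * d + Q).choose Q := Nat.choose_pos (by omega)
  have : 0 < ord n := by positivity
  exact Nat.succ_le_of_lt (by unfold spread; positivity)

/-- The algorithm halts, within a time governed by the subpolynomial parameters. -/
theorem exists_run {K C₁ C₂ C₃ : ℕ} (hC : C₁ ≤ C₃) : ∃ A : ℕ, ∀ {n d : ℕ} (I : Instance n d)
    {B : ℝ} {b : ℕ}, 0 < n → I.Admissible B K b → d ≤ 2 ^ prec C₁ n →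
    ∃ (ρ : ℕ → ℤ) (c : ℕ) (s : State), Sys K C₁ C₂ C₃ I ρ s.mem ∧
      Runs (Stmt.compList (prog K C₁ C₂ C₃)) I.input c s ∧
      c ≤ n * (A * (spread K C₂ C₃ d (degreeBound K C₁ C₂ B n) n ^ A * (n.size + d + b) ^ 2)) := by
  obtain ⟨A, hA⟩ := Stmt.exists_costList_le _ _ _ (prog_short K C₁ C₂ C₃)
  set g := Stmt.growth (prog K C₁ C₂ C₃) with hg
  set len := (prog K C₁ C₂ C₃).length with hlen
  refine ⟨A * g ^ 2 + 12 * A + 24 * len, fun {n d} I {B b} hn hI hd => ?_⟩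
  obtain ⟨ρ, M, hρ, hM, hh, hrun⟩ := Stmt.run_list _ (prog_wf K C₁ C₂ C₃) (by simp) I.input.reg
    I.input.mem fun b hb => input_mem_eq_zero I hb
  have S : Sys K C₁ C₂ C₃ I ρ M := {
    holds := hh
    input := fun b hb => hM b (Or.inl hb)
    pos := hn
    le := hC
    r0 := hρ 0 (by simp)
    r1 := hρ 1 (by simp) }
  obtain ⟨T, hT, hTW⟩ := hI.support
  obtain ⟨h1, h2⟩ := S.regs_le S.r19 (S.degree_le_degreeBound S.r19
    (S.radius_le hI.query hI.key hd)) ((S.sum_flag_le hTW).trans hT)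
  set σ := spread K C₂ C₃ d (degreeBound K C₁ C₂ B n) n with hσ
  have hσ1 : 1 ≤ σ := spread_pos _ _ _ _ _ _
  have hτ1 : 1 ≤ σ ^ 12 := Nat.one_le_pow _ _ hσ1
  set m := n.size + d + b with hm
  have hm1 : 1 ≤ m := by have := S.lg_pos; omega
  have pow_le : ∀ {i : ℕ}, i ≤ m → (2 : ℤ) ^ i ≤ 2 ^ m := fun h => pow_le_pow_right₀ (by norm_num) h
  have hr : ∀ x ∈ [0, 1], |ρ x| ≤ 2 ^ m := by
    simp only [List.forall_mem_cons, List.not_mem_nil, false_implies, implies_true, and_true]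
    constructor
    · rw [S.r0, Nat.abs_cast]
      refine le_trans ?_ (pow_le (i := n.size) (by omega))
      exact_mod_cast (Nat.lt_size_self n).le
    · rw [S.r1, Nat.abs_cast]
      refine le_trans ?_ (pow_le (i := d) (by omega))
      exact_mod_cast Nat.lt_two_pow_self.le
  have hb : ∀ a ∈ inputBanks, ∀ y, |M a y| ≤ 2 ^ m := fun a ha y => by
    rw [S.input a ha]
    exact (abs_input_le hI a y).trans (pow_le (by omega))
  have h12 : 0 < ρ 12 := by rw [S.r12]; positivity
  obtain ⟨hρb, hMb⟩ := Stmt.abs_le_of_tame hτ1 h1 h12 _ (prog_tame K C₁ C₂ C₃) hm1 hh hr hb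
  rw [← hg, ← hlen] at hρb hMb
  have hm2 : 1 ≤ m * g * (σ ^ 12) ^ len :=
    Nat.mul_pos (Nat.mul_pos hm1 (Stmt.growth_pos _)) (Nat.pow_pos hτ1)
  obtain ⟨c, s, hs1, hs2, hs3⟩ := hrun _ hm2 (fun x => by
      by_cases hx : x ∈ [0, 1] ∨ ∃ st ∈ prog K C₁ C₂ C₃, x ∈ st.regs
      · exact hρb x hx
      · push Not at hx
        rw [hρ x (Or.inr hx.2), input_reg_eq_zero I hx.1]
        simp) (fun a y => by
      by_cases ha : a ∈ inputBanks ∨ ∃ st ∈ prog K C₁ C₂ C₃, a ∈ st.banks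
      · exact hMb a ha y
      · push Not at ha
        rw [hM a (Or.inr ha.2), input_mem_eq_zero I ha.1]
        simp) I.input rfl fun _ _ => rfl
  refine ⟨ρ, c, s, by rw [hs2]; exact S, hs1, hs3.trans ?_⟩
  refine (hA ρ n _ _ hn hm2 hτ1 h1 h2).trans ?_
  clear_value g len σ
  calc A * (n * (σ ^ 12) ^ A * (m * g * (σ ^ 12) ^ len) ^ 2)
      = n * (A * g ^ 2 * (σ ^ (12 * A + 24 * len) * m ^ 2)) := by
        rw [pow_add, ← pow_mul, ← pow_mul, mul_pow, mul_pow, ← pow_mul]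
        ring
    _ ≤ _ := by
        gcongr
        · omega
        · omega

theorem Sys.precise {K C C₁ C₂ C₃ n d b p : ℕ} {I : Instance n d} {ρ : ℕ → ℤ} {M : ℕ → ℤ → ℤ} {B : ℝ}
    (S : Sys K C₁ C₂ C₃ I ρ M) (hI : I.Admissible B K b) (hd0 : 0 < d) (hd : d ≤ C * n.size)
    (hb : b ≤ C * n.size) (hB : B ≤ C * n.size) (hR : radiusBound K B ≤ C * n.size)
    (hC₁ : C₁ = 30 * (2 * C + 1) + p) (hC₂ : 6 * C + C₁ ≤ C₂)
    (hC₃ : C₂ * C₂ + C₁ * (4 * C₂ + 7) + 1 ≤ C₃) :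
    ∃ q, Precise K C₁ C₂ C₃ I ρ M q (2 ^ ((2 * C + 1) * n.size)) := by
  have hl := S.lg_pos
  set u := (2 * C + 1) * n.size with hu
  have huC : 2 * (C * n.size) + n.size = u := by rw [hu]; ring
  have pow_le : ∀ {i : ℕ}, i ≤ u → (2 : ℝ) ^ i ≤ 2 ^ u := fun h => pow_le_pow_right₀ (by norm_num) h
  have nat_le : ∀ {i : ℕ}, i ≤ u → (i : ℝ) ≤ 2 ^ u := fun h =>
    le_trans (by exact_mod_cast Nat.lt_two_pow_self.le) (pow_le h)
  have hprec : 30 * u ≤ prec C₁ n := by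
    have : prec C₁ n = 30 * u + p * n.size := by simp only [prec, hu, hC₁]; ring
    omega
  have hdp : d ≤ 2 ^ prec C₁ n := by
    refine Nat.lt_two_pow_self.le.trans (Nat.pow_le_pow_right (by norm_num) ?_)
    omega
  have hrad := S.radius_le hI.query hI.key hdp
  have hentry : ∀ {A : Matrix (Fin n) (Fin d) ℚ}, BitsLE A b → ∀ i k, |toReal A i k| ≤ 2 ^ u :=
    fun h i k => (abs_entry_le h i k).trans (pow_le (by omega))
  have hB' : B ≤ 2 ^ u := hB.trans (by exact_mod_cast nat_le (i := C * n.size) (by omega))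
  have hbd : Bounded I (2 ^ u) := {
    two_le := by simpa using pow_le (i := 1) (by omega)
    n_le := le_trans (by exact_mod_cast (Nat.lt_size_self n).le) (pow_le (i := n.size) (by omega))
    d_le := nat_le (by omega)
    A₁ := hentry hI.bits_A₁
    A₂ := hentry hI.bits_A₂
    E := hentry hI.bits_E
    query := fun i k => (hI.query i k).trans hB'
    key := fun i k => (hI.key i k).trans hB'
    value := fun i k => (hI.value i k).trans hB'
    weight := hI.weight }
  obtain ⟨T, hT, hTW⟩ := hI.support
  have hfl := (S.sum_flag_le hTW).trans hT
  have hexp : Real.exp ((ρ 16).toNat : ℝ) ≤ 2 ^ u := by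
    rw [← mul_one ((ρ 16).toNat : ℝ), Real.exp_nat_mul]
    calc Real.exp 1 ^ (ρ 16).toNat ≤ (2 ^ 2) ^ (ρ 16).toNat := by
          gcongr
          have := Real.exp_one_lt_three
          linarith
      _ = 2 ^ (2 * (ρ 16).toNat) := by rw [pow_mul]
      _ ≤ 2 ^ u := pow_le (by omega)
  have hX : ((2 : ℝ) ^ u) ^ 30 ≤ 2 ^ prec C₁ n := by
    rw [← pow_mul]
    exact pow_le_pow_right₀ (by norm_num) (by omega)
  have hP : 0 < prec C₁ n := by omega
  refine ⟨degree (ρ 16).toNat (prec C₁ n) (C₂ * n.size), { S with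
    bounded := hbd
    d_pos := hd0
    C_pos := by omega
    degree := S.r19
    flags := hfl
    exp_le := hexp
    degree_spec := degree_spec hP (pow_mul_le_factorial (c := 2) ?_ ?_)
    prec_ge := hX
    modulus_gt := fun κ hκ ν hν i hi => S.exactSum_lt_modulus hbd hd0 hfl hexp (le_trans
      (pow_le_pow_right₀ (one_le_pow₀ (by norm_num)) (by norm_num)) hX) (degree_le _ _ _) hC₃
      hκ hν hi }⟩
  · calc 3 * (ρ 16).toNat * 2 ≤ 3 * (C * n.size) * 2 := by gcongr; exact hrad.trans hR
      _ = 6 * C * n.size := by ring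
      _ ≤ C₂ * n.size := by gcongr; omega
  · refine Nat.pow_le_pow_right (by norm_num) ?_
    simp only [prec]
    gcongr
    omega

/-- The output of the algorithm. -/
theorem Sys.outputs {K C C₁ C₂ C₃ n d b p : ℕ} {I : Instance n d} {ρ : ℕ → ℤ} {s : State} {B : ℝ}
    (S : Sys K C₁ C₂ C₃ I ρ s.mem) (hI : I.Admissible B K b) (hd : d ≤ C * n.size)
    (hb : b ≤ C * n.size) (hB : B ≤ C * n.size) (hR : radiusBound K B ≤ C * n.size)
    (hC₁ : C₁ = 30 * (2 * C + 1) + p) (hC₂ : 6 * C + C₁ ≤ C₂)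
    (hC₃ : C₂ * C₂ + C₁ * (4 * C₂ + 7) + 1 ≤ C₃) :
    Outputs s (grad (toReal I.A₁) (toReal I.A₂) (toReal I.A₃) (toReal I.E) (toReal I.Y)
      (fun t => toReal (I.W t)) I.point) (1 / (n : ℝ) ^ p) := by
  intro x
  obtain ⟨q, P⟩ := S.precise hI x.1.1.pos hd hb hB hR hC₁ hC₂ hC₃
  obtain ⟨h1, h2⟩ := P.output_approx x
  refine ⟨h1, h2.trans ?_⟩
  have hn : (0 : ℝ) < n := by exact_mod_cast S.pos
  rw [mul_one_div, ← pow_mul]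
  calc (2 : ℝ) ^ ((2 * C + 1) * n.size * 25) / 2 ^ prec C₁ n ≤ 1 / (2 ^ n.size) ^ p := by
        rw [div_le_div_iff₀ (by positivity) (by positivity), one_mul, ← pow_mul, ← pow_add]
        refine pow_le_pow_right₀ (by norm_num) ?_
        simp only [prec, hC₁]
        nlinarith [Nat.zero_le (C * n.size)]
    _ ≤ 1 / (n : ℝ) ^ p := by
        gcongr
        exact_mod_cast (Nat.lt_size_self n).le

end RoPE.Alg

/-- Growth slower than every positive power. -/
def Subpolynomial (f : ℕ → ℕ) : Prop :=
  ∀ ε : ℝ, 0 < ε → ∀ᶠ n : ℕ in atTop, (f n : ℝ) ≤ (n : ℝ) ^ ε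

namespace Subpolynomial

variable {f g : ℕ → ℕ}

theorem mul (hf : Subpolynomial f) (hg : Subpolynomial g) : Subpolynomial fun n => f n * g n := by
  intro ε hε
  filter_upwards [hf (ε / 2) (by positivity), hg (ε / 2) (by positivity), eventually_gt_atTop 0]
    with n h1 h2 hn
  have hn' : (0 : ℝ) < n := by exact_mod_cast hn
  calc ((f n * g n : ℕ) : ℝ) = f n * g n := by push_cast; rfl
    _ ≤ (n : ℝ) ^ (ε / 2) * (n : ℝ) ^ (ε / 2) := by gcongr
    _ = (n : ℝ) ^ ε := by rw [← Real.rpow_add hn']; ring_nf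

theorem of_isLittleO_rpow (h : ∀ ε : ℝ, 0 < ε →
    (fun n => (f n : ℝ)) =o[atTop] fun n : ℕ => (n : ℝ) ^ ε) : Subpolynomial f := by
  intro ε hε
  filter_upwards [(h ε hε).bound zero_lt_one] with n hn
  rw [one_mul, Real.norm_of_nonneg (by positivity), Real.norm_of_nonneg (by positivity)] at hn
  exact hn

theorem of_isBigO_log (h : (fun n => (f n : ℝ)) =O[atTop] fun n : ℕ => Real.log n) :
    Subpolynomial f :=
  of_isLittleO_rpow fun _ hε => h.trans_isLittleO
    ((isLittleO_log_rpow_atTop hε).comp_tendsto tendsto_natCast_atTop_atTop)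

theorem const (c : ℕ) : Subpolynomial fun _ => c := by
  refine of_isBigO_log ?_
  refine (isLittleO_const_left.2 (Or.inr ?_)).isBigO
  exact tendsto_norm_atTop_atTop.comp (Real.tendsto_log_atTop.comp tendsto_natCast_atTop_atTop)

theorem add (hf : Subpolynomial f) (hg : Subpolynomial g) : Subpolynomial fun n => f n + g n := by
  intro ε hε
  filter_upwards [hf (ε / 2) (by positivity), hg (ε / 2) (by positivity),
    const 2 (ε / 2) (by positivity), eventually_gt_atTop 0] with n h1 h2 h3 hn
  have hn' : (0 : ℝ) < n := by exact_mod_cast hn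
  calc ((f n + g n : ℕ) : ℝ) = f n + g n := by push_cast; rfl
    _ ≤ 2 * (n : ℝ) ^ (ε / 2) := by linarith
    _ ≤ (n : ℝ) ^ (ε / 2) * (n : ℝ) ^ (ε / 2) := by gcongr; exact_mod_cast h3
    _ = (n : ℝ) ^ ε := by rw [← Real.rpow_add hn']; ring_nf

theorem pow (hf : Subpolynomial f) (k : ℕ) : Subpolynomial fun n => f n ^ k := by
  induction k with
  | zero => simpa using const 1
  | succ k ih => simpa only [pow_succ] using ih.mul hf

theorem rpow_le {n : ℕ} (hn : 0 < n) {c δ : ℝ} {k : ℕ} (hc : 1 ≤ c) (hk : (k : ℝ) ≤ δ * Real.log n) :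
    c ^ k ≤ (n : ℝ) ^ (Real.log c * δ) := by
  have hn' : (0 : ℝ) < n := by exact_mod_cast hn
  rw [Real.rpow_def_of_pos hn', ← Real.exp_log (show 0 < c ^ k by positivity), Real.log_pow]
  refine Real.exp_le_exp.2 ?_
  have := Real.log_nonneg hc
  nlinarith

theorem bound_of_isLittleO {g : ℕ → ℕ}
    (h : (fun n => (g n : ℝ)) =o[atTop] fun n : ℕ => Real.log n) {δ : ℝ} (hδ : 0 < δ) :
    ∀ᶠ n : ℕ in atTop, (g n : ℝ) ≤ δ * Real.log n := by
  filter_upwards [h.bound hδ, eventually_gt_atTop 0] with n hn h0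
  rwa [Real.norm_of_nonneg (by positivity), Real.norm_of_nonneg
    (Real.log_nonneg (by exact_mod_cast h0))] at hn

theorem const_pow {g : ℕ → ℕ} (h : (fun n => (g n : ℝ)) =o[atTop] fun n : ℕ => Real.log n) (c : ℕ)
    (hc : 1 ≤ c) : Subpolynomial fun n => c ^ g n := by
  intro ε hε
  have hc' : (1 : ℝ) ≤ c := by exact_mod_cast hc
  have hl := Real.log_nonneg hc'
  filter_upwards [bound_of_isLittleO h (δ := ε / (Real.log c + 1)) (by positivity),
    eventually_gt_atTop 0] with n hn h0
  push_cast
  refine (rpow_le h0 hc' hn).trans (Real.rpow_le_rpow_of_exponent_le (by exact_mod_cast h0) ?_)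
  rw [mul_div_assoc', div_le_iff₀ (by positivity)]
  nlinarith

theorem choose_le {x : ℝ} (hx : 0 < x) (a b : ℕ) :
    (a.choose b : ℝ) ≤ (1 + x) ^ a * (1 / x) ^ b := by
  rcases lt_or_ge a b with h | h
  · rw [Nat.choose_eq_zero_of_lt h]; simp; positivity
  · have h1 : x ^ b * a.choose b ≤ (1 + x) ^ a := by
      rw [add_comm 1 x, add_pow]
      have := Finset.single_le_sum (f := fun m => x ^ m * 1 ^ (a - m) * (a.choose m : ℝ))
        (fun m _ => by positivity) (Finset.mem_range.2 (Nat.lt_succ_of_le h))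
      simpa using this
    rw [one_div, inv_pow, ← div_eq_mul_inv, le_div_iff₀ (by positivity), mul_comm]
    exact h1

theorem choose {u : ℕ → ℕ} (hf : (fun n => (f n : ℝ)) =O[atTop] fun n : ℕ => Real.log n)
    (hu : (fun n => (u n : ℝ)) =o[atTop] fun n : ℕ => Real.log n) :
    Subpolynomial fun n => (f n).choose (u n) := by
  intro ε hε
  obtain ⟨c, hc0, hc⟩ := hf.exists_pos
  obtain ⟨x, hx0, hx1, hxc⟩ : ∃ x : ℝ, 0 < x ∧ x ≤ 1 ∧ x * c ≤ ε / 2 := by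
    refine ⟨min 1 (ε / 2 / c), by positivity, min_le_left _ _, ?_⟩
    calc min 1 (ε / 2 / c) * c ≤ ε / 2 / c * c := by gcongr; exact min_le_right _ _
      _ = ε / 2 := by field_simp
  have hx2 : 1 ≤ 1 / x := by rw [le_div_iff₀ hx0]; linarith
  have hl := Real.log_nonneg hx2
  filter_upwards [hc.bound, bound_of_isLittleO hu (δ := ε / 2 / (Real.log (1 / x) + 1))
    (by positivity), eventually_gt_atTop 0] with n h1 h2 h0
  have hn1 : (1 : ℝ) ≤ n := by exact_mod_cast h0
  rw [Real.norm_of_nonneg (by positivity), Real.norm_of_nonneg (Real.log_nonneg hn1)] at h1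
  refine (choose_le hx0 (f n) (u n)).trans ?_
  calc (1 + x) ^ f n * (1 / x) ^ u n ≤ (n : ℝ) ^ (ε / 2) * (n : ℝ) ^ (ε / 2) := by
        gcongr
        · refine (rpow_le h0 (by linarith) h1).trans
            (Real.rpow_le_rpow_of_exponent_le hn1 ?_)
          have := Real.log_le_sub_one_of_pos (show 0 < 1 + x by linarith)
          nlinarith
        · refine (rpow_le h0 hx2 h2).trans (Real.rpow_le_rpow_of_exponent_le hn1 ?_)
          rw [mul_div_assoc', div_le_iff₀ (by positivity)]
          nlinarith
    _ = (n : ℝ) ^ ε := by rw [← Real.rpow_add (by linarith)]; ring_nf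

/-- `n` times a subpolynomial factor is almost linear. -/
theorem almostLinear (hf : Subpolynomial f) : RAM.AlmostLinear fun n => n * f n := by
  refine ⟨fun n => Real.log (f n + 1) / Real.log n, ?_, ?_⟩
  · refine squeeze_zero' (g := fun n => Real.log (f n + 1) / Real.log n) ?_ ?_ ?_
    · filter_upwards [eventually_gt_atTop 0] with n hn
      have : (1 : ℝ) ≤ n := by exact_mod_cast hn
      exact div_nonneg (Real.log_nonneg (by linarith [(f n).cast_nonneg (α := ℝ)]))
        (Real.log_nonneg this)
    · exact Eventually.of_forall fun n => le_rfl
    · rw [Metric.tendsto_atTop']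
      intro ε hε
      obtain ⟨N, hN⟩ := eventually_atTop.1 ((hf.add (const 1)) (ε / 2) (by positivity))
      refine ⟨max N 1, fun n hn => ?_⟩
      have h1 := hN n (by omega)
      have hn1 : (1 : ℝ) < n := by
        have : 1 < n := by omega
        exact_mod_cast this
      have hlog := Real.log_pos hn1
      push_cast at h1
      have h2 : Real.log (f n + 1) ≤ ε / 2 * Real.log n := by
        have := Real.log_le_log (by positivity) h1
        rwa [Real.log_rpow (by linarith)] at this
      have h3 : 0 ≤ Real.log ((f n : ℝ) + 1) :=
        Real.log_nonneg (by linarith [(f n).cast_nonneg (α := ℝ)])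
      rw [Real.dist_eq, sub_zero, abs_of_nonneg (div_nonneg h3 hlog.le), div_lt_iff₀ hlog]
      nlinarith
  · refine IsBigO.of_bound 1 ?_
    filter_upwards [eventually_gt_atTop 1] with n hn
    have hn1 : (1 : ℝ) < n := by exact_mod_cast hn
    have hn0 : (0 : ℝ) < n := by linarith
    have hlog := Real.log_pos hn1
    have hf0 : (0 : ℝ) < f n + 1 := by positivity
    rw [one_mul, Real.norm_of_nonneg (by positivity), Real.norm_of_nonneg (by positivity),
      Real.rpow_add hn0, Real.rpow_one, Real.rpow_def_of_pos hn0,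
      mul_div_cancel₀ _ hlog.ne', Real.exp_log hf0]
    push_cast
    gcongr
    linarith

end Subpolynomial

namespace RoPE.Alg

theorem log_le_size (n : ℕ) : Real.log n ≤ n.size := by
  rcases Nat.eq_zero_or_pos n with rfl | hn
  · simp
  have h1 : (n : ℝ) ≤ 2 ^ n.size := by exact_mod_cast (Nat.lt_size_self n).le
  have h2 := Real.log_le_log (by exact_mod_cast hn) h1
  rw [Real.log_pow] at h2
  have := Real.log_two_lt_d9
  have h3 : (0 : ℝ) ≤ n.size := by positivity
  nlinarith

theorem size_le_log {n : ℕ} (hn : 2 ≤ n) : (n.size : ℝ) ≤ 3 * Real.log n := by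
  have hs := Nat.size_pos.2 (show 0 < n by omega)
  have h1 : 2 ^ (n.size - 1) ≤ n := by
    by_contra h
    push Not at h
    have := Nat.size_le.2 h
    omega
  have h2 : ((2 : ℝ) ^ (n.size - 1)) ≤ n := by exact_mod_cast h1
  have h3 := Real.log_le_log (by positivity) h2
  rw [Real.log_pow, Nat.cast_sub hs, Nat.cast_one] at h3
  have h4 := Real.log_two_gt_d9
  have h5 : Real.log 2 ≤ Real.log n := Real.log_le_log (by norm_num) (by exact_mod_cast hn)
  have h6 : (0 : ℝ) ≤ (n.size : ℝ) - 1 := by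
    have : (1 : ℝ) ≤ n.size := by exact_mod_cast hs
    linarith
  nlinarith

theorem isBigO_size : (fun n : ℕ => (n.size : ℝ)) =O[atTop] fun n : ℕ => Real.log n := by
  refine IsBigO.of_bound 3 ?_
  filter_upwards [eventually_ge_atTop 2] with n hn
  rw [Real.norm_of_nonneg (by positivity), Real.norm_of_nonneg
    (Real.log_nonneg (by exact_mod_cast (by omega : 1 ≤ n)))]
  exact size_le_log hn

theorem tendsto_log : Tendsto (fun n : ℕ => Real.log n) atTop atTop :=
  Real.tendsto_log_atTop.comp tendsto_natCast_atTop_atTop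

theorem isLittleO_dig : (fun n : ℕ => (dig n : ℝ)) =o[atTop] fun n : ℕ => Real.log n := by
  refine isLittleO_iff.2 fun c hc => ?_
  filter_upwards [eventually_ge_atTop 2, tendsto_log.eventually_ge_atTop (16 / c ^ 2 + 2 / c)]
    with n hn hlog
  have h1 := root_sq_le (Nat.size_pos.2 (show 0 < n by omega))
  have h2 := size_le_log hn
  have h3 : (dig n : ℝ) * dig n + 2 ≤ n.size + 2 * dig n := by exact_mod_cast h1
  have hl : 0 ≤ Real.log n := le_trans (by positivity) hlog
  rw [Real.norm_of_nonneg (by positivity), Real.norm_of_nonneg hl]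
  by_contra h
  push Not at h
  set x := (dig n : ℝ)
  set l := Real.log n
  have h4 : 16 ≤ c ^ 2 * l := by
    have : 16 / c ^ 2 ≤ l := le_trans (by linarith [show (0:ℝ) ≤ 2 / c by positivity]) hlog
    rw [div_le_iff₀ (by positivity)] at this
    linarith
  have h5 : 2 ≤ c * l := by
    have : 2 / c ≤ l := le_trans (by linarith [show (0:ℝ) ≤ 16 / c ^ 2 by positivity]) hlog
    rw [div_le_iff₀ hc] at this
    linarith
  have h6 : (c * l) ^ 2 ≤ x ^ 2 := by gcongr
  have h7 : 16 * l ≤ (c * l) ^ 2 := by nlinarith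
  nlinarith [sq_nonneg (x - 4)]

theorem isLittleO_radiusBound (K : ℕ) {B : ℕ → ℝ} (hB : B =o[atTop] fun n : ℕ => √(Real.log n)) :
    (fun n => (radiusBound K (B n) : ℝ)) =o[atTop] fun n : ℕ => Real.log n := by
  have hsqrt : Tendsto (fun n : ℕ => ‖√(Real.log n)‖) atTop atTop :=
    tendsto_norm_atTop_atTop.comp (Real.tendsto_sqrt_atTop.comp tendsto_log)
  have h3 : (fun _ : ℕ => (3 : ℝ)) =o[atTop] fun n : ℕ => √(Real.log n) :=
    isLittleO_const_left.2 (Or.inr hsqrt)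
  have h1 : (fun n => (⌈|B n|⌉₊ + 2 : ℝ)) =o[atTop] fun n : ℕ => √(Real.log n) := by
    refine IsBigO.trans_isLittleO (IsBigO.of_bound 1 (Eventually.of_forall fun n => ?_))
      ((hB.norm_left).add h3)
    rw [one_mul, Real.norm_of_nonneg (by positivity), Real.norm_of_nonneg (by positivity),
      Real.norm_eq_abs]
    linarith [(Nat.ceil_lt_add_one (abs_nonneg (B n))).le]
  have h2 : (fun n => (⌈|B n|⌉₊ + 2 : ℝ) * (⌈|B n|⌉₊ + 2 : ℝ)) =o[atTop]
      fun n : ℕ => Real.log n := by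
    refine (h1.mul h1).congr' EventuallyEq.rfl ?_
    filter_upwards [tendsto_log.eventually_ge_atTop 0] with n hn
    exact Real.mul_self_sqrt hn
  have h4 : (fun _ : ℕ => (1 : ℝ)) =o[atTop] fun n : ℕ => Real.log n :=
    isLittleO_const_left.2 (Or.inr (tendsto_norm_atTop_atTop.comp tendsto_log))
  refine ((h2.const_mul_left (K : ℝ)).add h4).congr_left fun n => ?_
  rw [radiusBound]; push_cast; ring

theorem isLittleO_degreeBound (K C₂ : ℕ) {C₁ : ℕ} (hC₁ : 0 < C₁) {B : ℕ → ℝ}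
    (hB : B =o[atTop] fun n : ℕ => √(Real.log n)) :
    (fun n => (degreeBound K C₁ C₂ (B n) n : ℝ)) =o[atTop] fun n : ℕ => Real.log n := by
  refine isLittleO_iff.2 fun ε hε => ?_
  obtain ⟨j, hj⟩ := exists_nat_ge (3 * C₁ / (ε / 2))
  have hR := Subpolynomial.bound_of_isLittleO (isLittleO_radiusBound K hB)
    (δ := ε / 2 / (3 * 2 ^ j)) (by positivity)
  filter_upwards [eventually_ge_atTop 2, hR, tendsto_log.eventually_ge_atTop (2 / ε)]
    with n hn hRn hlog
  have hl : 0 ≤ Real.log n := le_trans (by positivity) hlog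
  rw [Real.norm_of_nonneg (by positivity), Real.norm_of_nonneg hl]
  set g := ⌈ε / 2 * Real.log n⌉₊ with hg
  have hg1 : ε / 2 * Real.log n ≤ g := Nat.le_ceil _
  have hs := Nat.size_pos.2 (show 0 < n by omega)
  have h1 : degreeBound K C₁ C₂ (B n) n ≤ g := by
    refine degree_le_of (Nat.mul_pos hC₁ hs) (pow_mul_le_factorial (c := 2 ^ j) ?_ ?_)
    · have : (radiusBound K (B n) : ℝ) * (3 * 2 ^ j) ≤ g := by
        rw [div_mul_eq_mul_div, le_div_iff₀ (by positivity)] at hRn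
        linarith
      have h' : radiusBound K (B n) * (3 * 2 ^ j) ≤ g := by exact_mod_cast this
      calc 3 * radiusBound K (B n) * 2 ^ j = radiusBound K (B n) * (3 * 2 ^ j) := by ring
        _ ≤ g := h'
    · rw [← pow_mul]
      refine Nat.pow_le_pow_right (by norm_num) ?_
      have h2 := size_le_log hn
      rw [div_le_iff₀ (by positivity)] at hj
      have h3 : (C₁ : ℝ) * n.size ≤ j * g := by
        calc (C₁ : ℝ) * n.size ≤ C₁ * (3 * Real.log n) := by gcongr
          _ = 3 * C₁ * Real.log n := by ring
          _ ≤ j * (ε / 2) * Real.log n := by gcongr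
          _ = j * (ε / 2 * Real.log n) := by ring
          _ ≤ j * g := by gcongr
      exact_mod_cast h3
  have h2 : (g : ℝ) ≤ ε / 2 * Real.log n + 1 := (Nat.ceil_lt_add_one (by positivity)).le
  have h3 : 1 ≤ ε / 2 * Real.log n := by
    rw [div_le_iff₀ hε] at hlog
    linarith
  have h4 : (degreeBound K C₁ C₂ (B n) n : ℝ) ≤ g := by exact_mod_cast h1
  linarith

theorem exists_le_mul_size {f : ℕ → ℝ} (h : f =O[atTop] fun n : ℕ => Real.log n) :
    ∃ C : ℕ, ∀ n : ℕ, 0 < n → f n ≤ C * n.size := by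
  obtain ⟨c, hc0, hc⟩ := h.exists_pos
  obtain ⟨N, hN⟩ := eventually_atTop.1 hc.bound
  refine ⟨⌈c + ∑ k ∈ Finset.range N, |f k|⌉₊, fun n hn => ?_⟩
  have hs : (1 : ℝ) ≤ n.size := by exact_mod_cast Nat.size_pos.2 hn
  have hsum : 0 ≤ ∑ k ∈ Finset.range N, |f k| := Finset.sum_nonneg fun _ _ => abs_nonneg _
  refine le_trans ?_ (mul_le_mul_of_nonneg_right (Nat.le_ceil _) (by positivity))
  rcases lt_or_ge n N with h1 | h1
  · have := Finset.single_le_sum (f := fun k => |f k|) (fun k _ => abs_nonneg _)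
      (Finset.mem_range.2 h1)
    have h2 := le_abs_self (f n)
    nlinarith
  · have h2 := hN n h1
    rw [Real.norm_eq_abs, Real.norm_of_nonneg
      (Real.log_nonneg (by exact_mod_cast hn))] at h2
    have h3 := log_le_size n
    have h4 := le_abs_self (f n)
    nlinarith

theorem subpolynomial_spread {K C₁ C₂ C₃ : ℕ} (hC₁ : 0 < C₁) {d : ℕ → ℕ} {B : ℕ → ℝ}
    (hd : (fun n => (d n : ℝ)) =O[atTop] fun n : ℕ => Real.log n)
    (hB : B =o[atTop] fun n : ℕ => √(Real.log n)) :
    Subpolynomial fun n => spread K C₂ C₃ (d n) (degreeBound K C₁ C₂ (B n) n) n := by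
  have hQ := isLittleO_degreeBound K C₂ hC₁ hB
  have s1 : Subpolynomial fun n => n.size := .of_isBigO_log isBigO_size
  have s2 : Subpolynomial fun n => base n := .const_pow isLittleO_dig 2 (by norm_num)
  have one := Subpolynomial.const 1
  have two := Subpolynomial.const 2
  have s3 : Subpolynomial fun n => modExp C₃ n := s2.mul (((Subpolynomial.const C₃).mul s1).mul s1)
  have hM : (fun n => ((K * d n + degreeBound K C₁ C₂ (B n) n : ℕ) : ℝ)) =O[atTop]
      fun n : ℕ => Real.log n := by
    refine ((hd.const_mul_left (K : ℝ)).add hQ.isBigO).congr_left fun n => ?_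
    push_cast; rfl
  exact (((((((Subpolynomial.of_isBigO_log hd).add one).mul (s1.add one)).mul (two.mul s2)).mul
    ((two.mul s3).add one)).mul (((Subpolynomial.const C₂).mul s1).add one)).mul
    ((Subpolynomial.of_isBigO_log hQ.isBigO).add one)).mul (Subpolynomial.choose hM hQ)

end RoPE.Alg

theorem theorem6p6 (d b : ℕ → ℕ) (B : ℕ → ℝ) (K p : ℕ)
    (hd : (fun n => (d n : ℝ)) =O[atTop] fun n : ℕ => Real.log n)
    (hb : (fun n => (b n : ℝ)) =O[atTop] fun n : ℕ => Real.log n)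
    (hB : B =o[atTop] fun n : ℕ => √(Real.log n)) :
    ∃ (P : RAM.Program) (T : ℕ → ℕ), RAM.AlmostLinear T ∧
      ∀ n : ℕ, 0 < n → ∀ I : RoPE.Instance n (d n), I.Admissible (B n) K (b n) →
        ∃ (c : ℕ) (s : RAM.State), RAM.Runs P I.input c s ∧ c ≤ T n ∧
          ∃ g : EuclideanSpace ℝ (RoPE.Idx (d n)),
            HasGradientAt I.lossFn g I.point ∧ RoPE.Outputs s g (1 / (n : ℝ) ^ p) := by
  open RoPE RoPE.Alg in
  have hBlog : B =O[atTop] fun n : ℕ => Real.log n := by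
    refine hB.isBigO.trans (IsBigO.of_bound 1 ?_)
    filter_upwards [tendsto_log.eventually_ge_atTop 1] with n hn
    rw [one_mul, Real.norm_of_nonneg (Real.sqrt_nonneg _), Real.norm_of_nonneg (by linarith)]
    exact Real.sqrt_le_left (by linarith) |>.mpr (by nlinarith)
  obtain ⟨Cd, hCd⟩ := exists_le_mul_size hd
  obtain ⟨Cb, hCb⟩ := exists_le_mul_size hb
  obtain ⟨CB, hCB⟩ := exists_le_mul_size hBlog
  obtain ⟨CR, hCR⟩ := exists_le_mul_size (isLittleO_radiusBound K hB).isBigO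
  obtain ⟨C, hC1, hC2, hC3, hC4⟩ : ∃ C : ℕ, Cd ≤ C ∧ Cb ≤ C ∧ CB ≤ C ∧ CR ≤ C :=
    ⟨Cd + Cb + CB + CR, by omega, by omega, by omega, by omega⟩
  obtain ⟨C₁, hC₁⟩ : ∃ C₁ : ℕ, C₁ = 30 * (2 * C + 1) + p := ⟨_, rfl⟩
  obtain ⟨C₂, hC₂⟩ : ∃ C₂ : ℕ, 6 * C + C₁ ≤ C₂ := ⟨_, le_rfl⟩
  obtain ⟨C₃, hC₃⟩ : ∃ C₃ : ℕ, C₂ * C₂ + C₁ * (4 * C₂ + 7) + 1 ≤ C₃ := ⟨_, le_rfl⟩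
  have hC₁₃ : C₁ ≤ C₃ := by nlinarith
  obtain ⟨A, hA⟩ := exists_run (K := K) (C₂ := C₂) hC₁₃
  have nat_le : ∀ {x A n : ℕ}, A ≤ C → (x : ℝ) ≤ A * n.size → x ≤ C * n.size := fun h h' =>
    (show _ ≤ _ by exact_mod_cast h').trans (Nat.mul_le_mul_right _ h)
  refine ⟨RAM.Stmt.compList (prog K C₁ C₂ C₃), fun n => n * (A *
    (spread K C₂ C₃ (d n) (degreeBound K C₁ C₂ (B n) n) n ^ A * (n.size + d n + b n) ^ 2)),
    Subpolynomial.almostLinear ((Subpolynomial.const A).mul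
      (((subpolynomial_spread (by omega) hd hB).pow A).mul
        ((((Subpolynomial.of_isBigO_log isBigO_size).add (.of_isBigO_log hd)).add
          (.of_isBigO_log hb)).pow 2))), fun n hn I hI => ?_⟩
  have hdn := nat_le hC1 (hCd n hn)
  have hs := Nat.size_pos.2 hn
  obtain ⟨ρ, c, s, S, hrun, hcost⟩ := hA I hn hI (by
    refine Nat.lt_two_pow_self.le.trans (Nat.pow_le_pow_right (by norm_num) (hdn.trans ?_))
    exact Nat.mul_le_mul_right _ (by omega))
  refine ⟨c, s, hrun, hcost, _, hasGradientAt_loss _ _ _ _ _ _ _,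
    S.outputs hI hdn (nat_le hC2 (hCb n hn)) ((hCB n hn).trans ?_) (nat_le hC4 (hCR n hn))
    hC₁ hC₂ hC₃⟩
  have : (CB : ℝ) ≤ C := by exact_mod_cast hC3
  gcongr
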